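/- Let $B$ be a closed smooth manifold (compact, Hausdorff, without boundary) and, for $i=1,2$, let $\pi_i:E_i\to B$ be a smooth fibre bundle with compact Hausdorff total space whose fibre is a smooth $n$-manifold $M_i$ with non-empty boundary, $n\ge 1$. Write $\partial E_i$ for the boundary of $E_i$, which is the union of the boundaries of the fibres $\pi_i^{-1}(b)$. Let $\{h_i(b)\}_{b\in B}$ be a smoothly varying family of Riemannian metrics on the fibres $\pi_i^{-1}(b)$, all of positive Ricci curvature, that is, a positive definite symmetric form on the vertical tangent bundle $\ker d\pi_i$ whose coefficients are smooth on $E_i$ up to the boundary. Let $\phi:\partial E_1\to\partial E_2$ be a diffeomorphism with $\pi_2\circ\phi=\pi_1$ on $\partial E_1$ such that for every $b\in B$ its restriction $\phi_b:\partial\pi_1^{-1}(b)\to\partial\pi_2^{-1}(b)$ is an isometry of the metrics induced by $h_1(b)$ and $h_2(b)$. For a point $x$ of the boundary of a fibre $\pi_i^{-1}(b)$ and a unit vector $u$ tangent to this boundary at $x$, let $k_i(u)=h_i(b)(\nabla_u\nu,u)$ be the normal curvature with respect to the outward unit normal $\nu$, where $\nabla$ is the Levi-Civita connection of $h_i(b)$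 (so round balls in Euclidean space have positive normal curvatures). Suppose that $$k_1(u)>-k_2(d\phi_b(u))$$ for all $b\in B$, all $x\in\partial\pi_1^{-1}(b)$ and all unit vectors $u\in T_x\,\partial\pi_1^{-1}(b)$. Let $W=E_1\cup_\phi E_2$ be the adjunction space, obtained from $E_1\sqcup E_2$ by identifying $x$ with $\phi(x)$ for $x\in\partial E_1$, let $X\subset W$ be the image of $\partial E_1$, and let $\pi:W\to B$ be the map induced by $\pi_1,\pi_2$. Call a smooth structure on $W$ (without boundary, inducing the quotient topology) compatible if the inclusions $E_i\to W$ are smooth with everywhere invertible differential and $\pi$ is a smooth submersion. Then: 1. $W$ has a compatible smooth structure. 2. For every compatible smooth structure on $W$ and every open set $N\supset X$, the fibrewise metric $h=\{h_1(b)\cup_{\phi_b}h_2(b)\}_{b\in B}$ can be smoothed within fibrewise positive Ricci curvature by a change inside $N$: there is a smoothly varying family of smooth Riemannian metrics $g=\{g(b)\}_{b\in B}$ on the fibres of $\pi:W\to B$, all of positive Ricci curvature, such that at every point of $W\setminus N$ it agrees with the metric coming from $h_1$ or $h_2$. -/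

import Mathlib

open scoped Manifold ContDiff Topology

noncomputable section

namespace FibreGluing

/-! ### Smooth fibre bundles, fibred charts, vertical vectors

The base `B` is a manifold modelled on `ℝ^k`.  The total space `P` is a manifold modelled on
`ℝ^k × H`, where `J` models the fibres: `J = 𝓡∂ n` for fibres of dimension `n` with boundary,
`J = 𝓡 n` for fibres of dimension `n` without boundary. -/

section Bundles

variable (k : ℕ) {n : ℕ} {H : Type*} [TopologicalSpace H]
  (J : ModelWithCorners ℝ (EuclideanSpace ℝ (Fin n)) H)
  {B : Type*} [TopologicalSpace B] [ChartedSpace (EuclideanSpace ℝ (Fin k)) B]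
  {P : Type*} [TopologicalSpace P] [ChartedSpace (ModelProd (EuclideanSpace ℝ (Fin k)) H) P]

/-- `π : P → B` is a smooth fibre bundle with fibre the manifold `M`: it is smooth and smoothly
locally trivial. -/
structure IsSmoothFibreBundle (π : P → B) (M : Type*) [TopologicalSpace M]
    [ChartedSpace H M] : Prop where
  smooth : ContMDiff ((𝓡 k).prod J) (𝓡 k) ∞ π
  locally_trivial : ∀ b : B, ∃ e : Bundle.Trivialization M π, b ∈ e.baseSet ∧
    ContMDiffOn ((𝓡 k).prod J) ((𝓡 k).prod J) ∞ e e.source ∧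
    ContMDiffOn ((𝓡 k).prod J) ((𝓡 k).prod J) ∞ e.toOpenPartialHomeomorph.symm e.target

/-- A fibred chart of `π : P → B`: smooth charts of `P` and of `B` in which `π` is the projection
`(y, z) ↦ y`.  For fixed `y`, the coordinate `z` is then a chart of the fibre over `y`. -/
structure FibredChart (π : P → B) where
  total : OpenPartialHomeomorph P (ModelProd (EuclideanSpace ℝ (Fin k)) H)
  base : OpenPartialHomeomorph B (EuclideanSpace ℝ (Fin k))
  total_mem : total ∈ IsManifold.maximalAtlas ((𝓡 k).prod J) ∞ P
  base_mem : base ∈ IsManifold.maximalAtlas (𝓡 k) ∞ B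
  proj_mem : ∀ x ∈ total.source, π x ∈ base.source
  fst_eq : ∀ x ∈ total.source, (total x).1 = base (π x)

/-- The vertical tangent space at `x`, that is, the tangent space at `x` of the fibre through
`x`: the kernel of the differential of `π`. -/
def Vert (π : P → B) (x : P) : Submodule ℝ (TangentSpace ((𝓡 k).prod J) x) :=
  LinearMap.ker (mfderiv ((𝓡 k).prod J) (𝓡 k) π x).toLinearMap

/-- A family of bilinear forms on the tangent spaces of the fibres of `π`. -/
abbrev FibreForm (π : P → B) : Type _ := ∀ x : P, LinearMap.BilinForm ℝ (Vert k J π x)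

end Bundles

/-! ### Riemannian geometry of the fibres in coordinates -/

section Coordinates

variable {n : ℕ} {H : Type*} [TopologicalSpace H]
  (J : ModelWithCorners ℝ (EuclideanSpace ℝ (Fin n)) H)

/-- The `i`-th partial derivative at `z`, within the model domain (a half-space or `ℝⁿ`). -/
def partialDeriv (i : Fin n) (f : EuclideanSpace ℝ (Fin n) → ℝ) (z : EuclideanSpace ℝ (Fin n)) :
    ℝ :=
  fderivWithin ℝ f (Set.range J) z (EuclideanSpace.single i 1)

variable (G : EuclideanSpace ℝ (Fin n) → Matrix (Fin n) (Fin n) ℝ)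

/-- The Christoffel symbols `Γˡᵢⱼ` of the metric with coefficient matrix `G`. -/
def christoffel (l i j : Fin n) (z : EuclideanSpace ℝ (Fin n)) : ℝ :=
  (1 / 2) * ∑ m, (G z)⁻¹ l m *
    (partialDeriv J i (fun w => G w j m) z + partialDeriv J j (fun w => G w i m) z
      - partialDeriv J m (fun w => G w i j) z)

/-- The components `Ricᵢⱼ` of the Ricci tensor of the metric with coefficient matrix `G`. -/
def ricciMatrix (i j : Fin n) (z : EuclideanSpace ℝ (Fin n)) : ℝ :=
  ∑ l, (partialDeriv J l (christoffel J G l i j) z - partialDeriv J i (christoffel J G l l j) z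
    + ∑ m, (christoffel J G l l m z * christoffel J G m i j z
      - christoffel J G l i m z * christoffel J G m l j z))

/-- The outward unit normal `- grad z₀ / |grad z₀|` of the half-space `{z₀ ≥ 0}`. -/
def outwardNormal [NeZero n] (z : EuclideanSpace ℝ (Fin n)) (l : Fin n) : ℝ :=
  -(G z)⁻¹ l 0 / √((G z)⁻¹ 0 0)

/-- The second fundamental form `⟨∇ₐ ν, a⟩ = -⟨∇ₐ a, ν⟩` of the boundary `{z₀ = 0}` of the
half-space with respect to the outward unit normal `ν`, for a vector `a` tangent to the boundary
(in `∇ₐ a` the vector `a` is extended with constant coefficients).  With this sign the boundary of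
a round ball in Euclidean space has positive normal curvatures. -/
def boundaryForm [NeZero n] (z a : EuclideanSpace ℝ (Fin n)) : ℝ :=
  -∑ l, ∑ m, G z l m * (∑ i, ∑ j, christoffel J G l i j z * a i * a j) * outwardNormal G z m

end Coordinates

/-! ### Fibrewise metrics and their curvatures -/

section Metrics

variable {k n : ℕ} {H : Type*} [TopologicalSpace H]
  {J : ModelWithCorners ℝ (EuclideanSpace ℝ (Fin n)) H}
  {B : Type*} [TopologicalSpace B] [ChartedSpace (EuclideanSpace ℝ (Fin k)) B]
  {P : Type*} [TopologicalSpace P] [ChartedSpace (ModelProd (EuclideanSpace ℝ (Fin k)) H) P]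
  {π : P → B}

/-- The chart of `P` underlying a fibred chart, with values in `ℝ^k × ℝ^n`. -/
abbrev FibredChart.ext (c : FibredChart k J π) :
    PartialEquiv P (EuclideanSpace ℝ (Fin k) × EuclideanSpace ℝ (Fin n)) :=
  c.total.extend ((𝓡 k).prod J)

/-- The components of a vertical tangent vector in a fibred chart. -/
def FibredChart.coord (c : FibredChart k J π) (x : P) (u : Vert k J π x) :
    EuclideanSpace ℝ (Fin n) :=
  (NormedSpace.fromTangentSpace _
    (mfderiv ((𝓡 k).prod J) 𝓘(ℝ, EuclideanSpace ℝ (Fin k) × EuclideanSpace ℝ (Fin n))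
      c.ext x u.1)).2

/-- The coordinate vector field `∂/∂zᵢ` of a fibred chart, at the point with coordinates `p`. -/
def FibredChart.frame (c : FibredChart k J π)
    (p : EuclideanSpace ℝ (Fin k) × EuclideanSpace ℝ (Fin n)) (i : Fin n) :
    TangentSpace ((𝓡 k).prod J) (c.ext.symm p) :=
  mfderivWithin 𝓘(ℝ, EuclideanSpace ℝ (Fin k) × EuclideanSpace ℝ (Fin n)) ((𝓡 k).prod J)
    c.ext.symm (Set.range ((𝓡 k).prod J)) p
    ((NormedSpace.fromTangentSpace p).symm (0, EuclideanSpace.single i 1))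

open Classical in
/-- A vertical vector, regarded as an element of the vertical space (`0` if not vertical). -/
def toVert (x : P) (u : TangentSpace ((𝓡 k).prod J) x) : Vert k J π x :=
  if hu : u ∈ Vert k J π x then ⟨u, hu⟩ else 0

/-- The coefficients `h(∂/∂zᵢ, ∂/∂zⱼ)` of a fibrewise bilinear form in a fibred chart, as functions
of `(y, z)`.  (The vectors `∂/∂zᵢ` are vertical at every point of the chart.) -/
def FibredChart.coeff (c : FibredChart k J π) (h : FibreForm k J π)
    (p : EuclideanSpace ℝ (Fin k) × EuclideanSpace ℝ (Fin n)) : Matrix (Fin n) (Fin n) ℝ :=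
  fun i j => h (c.ext.symm p) (toVert _ (c.frame p i)) (toVert _ (c.frame p j))

/-- A smoothly varying family of Riemannian metrics on the fibres of `π`: symmetric and positive
definite, with coefficients in fibred charts that are jointly smooth in base and fibre
coordinates (up to the boundary). -/
structure IsFibreMetric (h : FibreForm k J π) : Prop where
  symm : ∀ (x : P) (u v : Vert k J π x), h x u v = h x v u
  pos : ∀ (x : P) (u : Vert k J π x), u ≠ 0 → 0 < h x u u
  smooth : ∀ (c : FibredChart k J π) (i j : Fin n),
    ContDiffOn ℝ ∞ (fun p => c.coeff h p i j) c.ext.target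

/-- The Ricci curvature `Ric(u, u)`, at `x`, of the metric on the fibre through `x`, computed in a
fibred chart around `x`: the base coordinate is frozen. -/
def FibredChart.ricci (c : FibredChart k J π) (h : FibreForm k J π) (x : P) (u : Vert k J π x) : ℝ :=
  ∑ i, ∑ j, ricciMatrix J (fun z => c.coeff h ((c.ext x).1, z)) i j (c.ext x).2
    * c.coord x u i * c.coord x u j

/-- All fibres have positive Ricci curvature. -/
def RicciPositive (h : FibreForm k J π) : Prop :=
  ∀ (c : FibredChart k J π), ∀ x ∈ c.total.source, ∀ u : Vert k J π x, u ≠ 0 → 0 < c.ricci h x u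

end Metrics

/-! ### The boundary bundles and the gluing map -/

section Boundary

variable {k n : ℕ} [NeZero n]
  {B : Type*} [TopologicalSpace B] [ChartedSpace (EuclideanSpace ℝ (Fin k)) B]

section One

variable {P : Type*} [TopologicalSpace P]
  [ChartedSpace (ModelProd (EuclideanSpace ℝ (Fin k)) (EuclideanHalfSpace n)) P]

variable (k n P) in
/-- The boundary of the total space, that is, the union of the boundaries of the fibres. -/
abbrev Bdry : Set P := ((𝓡 k).prod (𝓡∂ n)).boundary P

/-- A tangent vector at a boundary point `x` is tangent to the boundary: in the preferred chart at
`x`, with values in `ℝ^k × {z₀ ≥ 0}`, its `z₀`-component vanishes. -/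
def IsBoundaryVector (x : P) (u : TangentSpace ((𝓡 k).prod (𝓡∂ n)) x) : Prop :=
  (NormedSpace.fromTangentSpace _
    (mfderiv ((𝓡 k).prod (𝓡∂ n)) 𝓘(ℝ, EuclideanSpace ℝ (Fin k) × EuclideanSpace ℝ (Fin n))
      (extChartAt ((𝓡 k).prod (𝓡∂ n)) x) x u)).2 0 = 0

/-- The normal curvature, with respect to the outward normal, of the boundary of the fibre through
the boundary point `x`, in the direction of a vector `u` tangent to the boundary of that fibre. -/
def FibredChart.normalCurvature {π : P → B} (c : FibredChart k (𝓡∂ n) π) (h : FibreForm k (𝓡∂ n) π)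
    (x : P) (u : Vert k (𝓡∂ n) π x) : ℝ :=
  boundaryForm (𝓡∂ n) (fun z => c.coeff h ((c.ext x).1, z)) (c.ext x).2 (c.coord x u)

end One

variable {E₁ E₂ : Type*} [TopologicalSpace E₁] [TopologicalSpace E₂]
  [ChartedSpace (ModelProd (EuclideanSpace ℝ (Fin k)) (EuclideanHalfSpace n)) E₁]
  [ChartedSpace (ModelProd (EuclideanSpace ℝ (Fin k)) (EuclideanHalfSpace n)) E₂]

/-- `F : E₁ → E₂` is smooth near `x` and extends `f : ∂E₁ → ∂E₂` near `x`. -/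
def IsLocalExtension (f : Bdry k n E₁ → Bdry k n E₂) (x : Bdry k n E₁) (F : E₁ → E₂) : Prop :=
  ContMDiffAt ((𝓡 k).prod (𝓡∂ n)) ((𝓡 k).prod (𝓡∂ n)) ∞ F x ∧
    ∀ᶠ y in 𝓝 (x : E₁), ∀ hy : y ∈ Bdry k n E₁, F y = f ⟨y, hy⟩

/-- A smooth map between boundaries. -/
def SmoothBdryMap (f : Bdry k n E₁ → Bdry k n E₂) : Prop :=
  ∀ x, ∃ F : E₁ → E₂, IsLocalExtension f x F

/-- `u'` is the image of `u`, a vector tangent to `∂E₁` at `x`, under the differential of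
`f : ∂E₁ → ∂E₂`. -/
def IsBdryPush (f : Bdry k n E₁ → Bdry k n E₂) (x : Bdry k n E₁)
    (u : TangentSpace ((𝓡 k).prod (𝓡∂ n)) (x : E₁))
    (u' : TangentSpace ((𝓡 k).prod (𝓡∂ n)) (f x : E₂)) : Prop :=
  ∃ F : E₁ → E₂, IsLocalExtension f x F ∧
    tangentMap ((𝓡 k).prod (𝓡∂ n)) ((𝓡 k).prod (𝓡∂ n)) F ⟨x, u⟩ = ⟨f x, u'⟩

/-- A diffeomorphism `∂E₁ → ∂E₂` over `B`, that is, a smoothly varying family of diffeomorphisms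
between the boundaries of the fibres. -/
structure FibrewiseBdryDiffeo (π₁ : E₁ → B) (π₂ : E₂ → B) where
  toEquiv : Bdry k n E₁ ≃ Bdry k n E₂
  proj_eq : ∀ x, π₂ (toEquiv x) = π₁ x
  smooth : SmoothBdryMap toEquiv
  smooth_symm : SmoothBdryMap toEquiv.symm

variable {π₁ : E₁ → B} {π₂ : E₂ → B}

/-- Every `φ_b` is an isometry between the boundaries of the fibres over `b`. -/
def IsFibrewiseIsometry (φ : FibrewiseBdryDiffeo (k := k) (n := n) π₁ π₂)
    (h₁ : FibreForm k (𝓡∂ n) π₁) (h₂ : FibreForm k (𝓡∂ n) π₂) : Prop :=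
  ∀ (x : Bdry k n E₁) (u v : Vert k (𝓡∂ n) π₁ (x : E₁))
    (u' v' : Vert k (𝓡∂ n) π₂ (φ.toEquiv x : E₂)),
    IsBoundaryVector (x : E₁) u.1 → IsBoundaryVector (x : E₁) v.1 →
    IsBdryPush φ.toEquiv x u.1 u'.1 → IsBdryPush φ.toEquiv x v.1 v'.1 →
    h₂ _ u' v' = h₁ _ u v

/-- At every boundary point of every fibre, the normal curvatures of the first metric are greater
than the negatives of the corresponding normal curvatures of the second one, both with respect to
the outward normals. -/
def NormalCurvatureCondition (φ : FibrewiseBdryDiffeo (k := k) (n := n) π₁ π₂)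
    (h₁ : FibreForm k (𝓡∂ n) π₁) (h₂ : FibreForm k (𝓡∂ n) π₂) : Prop :=
  ∀ (x : Bdry k n E₁) (u : Vert k (𝓡∂ n) π₁ (x : E₁))
    (u' : Vert k (𝓡∂ n) π₂ (φ.toEquiv x : E₂)),
    IsBoundaryVector (x : E₁) u.1 → h₁ _ u u = 1 → IsBdryPush φ.toEquiv x u.1 u'.1 →
    ∀ (c₁ : FibredChart k (𝓡∂ n) π₁) (c₂ : FibredChart k (𝓡∂ n) π₂),
      (x : E₁) ∈ c₁.total.source → (φ.toEquiv x : E₂) ∈ c₂.total.source →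
      -c₂.normalCurvature h₂ (φ.toEquiv x) u' < c₁.normalCurvature h₁ x u

/-! ### The glued bundle -/

/-- The identification `x ∼ φ x` for `x ∈ ∂E₁`. -/
inductive GlueRel (φ : FibrewiseBdryDiffeo (k := k) (n := n) π₁ π₂) : E₁ ⊕ E₂ → E₁ ⊕ E₂ → Prop
  | glue (x : Bdry k n E₁) : GlueRel φ (Sum.inl (x : E₁)) (Sum.inr (φ.toEquiv x : E₂))

/-- The adjunction space `E₁ ∪_φ E₂`. -/
def Glued (φ : FibrewiseBdryDiffeo (k := k) (n := n) π₁ π₂) : Type _ := Quot (GlueRel φ)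

/-- The quotient topology. -/
instance (φ : FibrewiseBdryDiffeo (k := k) (n := n) π₁ π₂) : TopologicalSpace (Glued φ) :=
  inferInstanceAs (TopologicalSpace (Quot (GlueRel φ)))

variable (φ : FibrewiseBdryDiffeo (k := k) (n := n) π₁ π₂)

/-- The inclusion of `E₁`. -/
def incl₁ (x : E₁) : Glued φ := Quot.mk _ (Sum.inl x)

/-- The inclusion of `E₂`. -/
def incl₂ (x : E₂) : Glued φ := Quot.mk _ (Sum.inr x)

/-- The projection `E₁ ∪_φ E₂ → B`. -/
def gluedProj : Glued φ → B :=
  Quot.lift (Sum.elim π₁ π₂) (by rintro _ _ ⟨x⟩; exact (φ.proj_eq x).symm)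

/-- The glued boundaries, as a subset of `E₁ ∪_φ E₂`. -/
def seam : Set (Glued φ) := incl₁ φ '' Bdry k n E₁

/-- A manifold structure on `E₁ ∪_φ E₂` is compatible with the gluing if the inclusions of `E₁` and
`E₂` are smooth with invertible differentials (so that, by compactness, they are diffeomorphisms
onto smooth domains with common boundary), and if the projection to `B` is a smooth submersion (so
that, by compactness, it is a smooth fibre bundle).  These are the structures obtained from
fibrewise collars. -/
structure IsCompatible
    [ChartedSpace (ModelProd (EuclideanSpace ℝ (Fin k)) (EuclideanSpace ℝ (Fin n))) (Glued φ)] :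
    Prop where
  smooth₁ : ContMDiff ((𝓡 k).prod (𝓡∂ n)) ((𝓡 k).prod (𝓡 n)) ∞ (incl₁ φ)
  smooth₂ : ContMDiff ((𝓡 k).prod (𝓡∂ n)) ((𝓡 k).prod (𝓡 n)) ∞ (incl₂ φ)
  bijective₁ : ∀ x, Function.Bijective
    (mfderiv ((𝓡 k).prod (𝓡∂ n)) ((𝓡 k).prod (𝓡 n)) (incl₁ φ) x)
  bijective₂ : ∀ x, Function.Bijective
    (mfderiv ((𝓡 k).prod (𝓡∂ n)) ((𝓡 k).prod (𝓡 n)) (incl₂ φ) x)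
  smooth_proj : ContMDiff ((𝓡 k).prod (𝓡 n)) (𝓡 k) ∞ (gluedProj φ)
  fibred : ∀ w, ∃ c : FibredChart k (𝓡 n) (gluedProj φ), w ∈ c.total.source

/-- The fibrewise form `g` on `E₁ ∪_φ E₂` agrees with `h₁` on `E₁` and with `h₂` on `E₂` at all
points outside `N`. -/
def AgreesOutside
    [ChartedSpace (ModelProd (EuclideanSpace ℝ (Fin k)) (EuclideanSpace ℝ (Fin n))) (Glued φ)]
    (g : FibreForm k (𝓡 n) (gluedProj φ)) (h₁ : FibreForm k (𝓡∂ n) π₁) (h₂ : FibreForm k (𝓡∂ n) π₂)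
    (N : Set (Glued φ)) : Prop :=
  (∀ x : E₁, incl₁ φ x ∉ N → ∀ (u v : Vert k (𝓡∂ n) π₁ x)
    (u' v' : Vert k (𝓡 n) (gluedProj φ) (incl₁ φ x)),
    u'.1 = mfderiv ((𝓡 k).prod (𝓡∂ n)) ((𝓡 k).prod (𝓡 n)) (incl₁ φ) x u.1 →
    v'.1 = mfderiv ((𝓡 k).prod (𝓡∂ n)) ((𝓡 k).prod (𝓡 n)) (incl₁ φ) x v.1 →
    g _ u' v' = h₁ x u v) ∧
  (∀ x : E₂, incl₂ φ x ∉ N → ∀ (u v : Vert k (𝓡∂ n) π₂ x)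
    (u' v' : Vert k (𝓡 n) (gluedProj φ) (incl₂ φ x)),
    u'.1 = mfderiv ((𝓡 k).prod (𝓡∂ n)) ((𝓡 k).prod (𝓡 n)) (incl₂ φ) x u.1 →
    v'.1 = mfderiv ((𝓡 k).prod (𝓡∂ n)) ((𝓡 k).prod (𝓡 n)) (incl₂ φ) x v.1 →
    g _ u' v' = h₂ x u v)

end Boundary

end FibreGluing

end

open FibreGluing

set_option linter.unusedSectionVars false

noncomputable section

namespace FibreGluing

open Set Filter
open Function (Bijective Injective comp_apply)
open Finset (sum_congr mul_sum sum_mul sum_comm sum_add_distrib sum_sub_distrib sum_neg_distrib)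
open Metric (ball closedBall isOpen_ball ball_subset_ball mem_ball_self mem_ball ball_mem_nhds
  closedBall_subset_ball isClosed_closedBall)
open IsManifold (maximalAtlas)
open ContinuousLinearMap (inl inr)

variable {k n : ℕ} [NeZero n] {F : Type*} [NormedAddCommGroup F] [NormedSpace ℝ F]

local notation:max "𝔼" n:max => EuclideanSpace ℝ (Fin n)
local notation:max "𝕄" n:max => Matrix (Fin n) (Fin n) ℝ
local notation:max "ℍ" n:max => EuclideanHalfSpace n
local notation:max "𝕍" => EuclideanSpace ℝ (Fin k) × EuclideanSpace ℝ (Fin n)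
local notation:max "𝔽" => (F × EuclideanSpace ℝ (Fin n)) × ℝ × ℝ
local notation:max "𝔐" => ModelProd (EuclideanSpace ℝ (Fin k)) (EuclideanSpace ℝ (Fin n))
local notation:max "𝔐₊" => ModelProd (EuclideanSpace ℝ (Fin k)) (EuclideanHalfSpace n)
local notation:max "𝓟" J:max => ModelWithCorners.prod (𝓡 k) J
local notation:max "𝓗" => ModelWithCorners.prod (𝓡 k) (𝓡∂ n)
local notation:max "𝓕" => ModelWithCorners.prod (𝓡 k) (𝓡 n)
local notation:max "ℛ" => range (ModelWithCorners.prod (𝓡 k) (𝓡∂ n))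
local notation:max "ℛ₀" => range (𝓡∂ n)
local notation "HChart" => FibredChart k (𝓡∂ n)
local notation "FChart" => FibredChart k (𝓡 n)
local notation "HForm" => FibreForm k (𝓡∂ n)
local notation "FForm" => FibreForm k (𝓡 n)
local notation:max "𝔅" X:max => Bdry k n X
local notation:max "𝒮" c:max => PartialEquiv.source (PartialHomeomorph.toPartialEquiv (OpenPartialHomeomorph.toPartialHomeomorph (FibredChart.total c)))
local notation "𝒟" => fderivWithin ℝ
local notation "SmoothOn" => ContDiffOn ℝ ∞
local notation "SmoothWithinAt" => ContDiffWithinAt ℝ ∞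
local notation:max "δ₀" => (Pi.single 0 1 : Fin n → ℝ)
local notation:max "𝐞" i:max => EuclideanSpace.single i (1 : ℝ)
local notation:max "proj₀" => (EuclideanSpace.proj 0 : EuclideanSpace ℝ (Fin n) →L[ℝ] ℝ)
local notation "OPHomeo" => OpenPartialHomeomorph
local notation "SmoothH" => ContMDiff (ModelWithCorners.prod (𝓡 k) (𝓡∂ n)) (ModelWithCorners.prod (𝓡 k) (𝓡∂ n)) ∞

/-- The height as a linear functional on the model space. -/
def heightL (k n : ℕ) [NeZero n] : (𝔼 k × 𝔼 n) →L[ℝ] ℝ :=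
  (EuclideanSpace.proj 0 : 𝔼 n →L[ℝ] ℝ).comp (ContinuousLinearMap.snd ℝ _ _)

/-- The coordinate vector `∂/∂z₀`. -/
def e₀ (k n : ℕ) [NeZero n] : 𝔼 k × 𝔼 n := (0, EuclideanSpace.single 0 1)

/-- The projection `z₀ ↦ 0`. -/
def flatL (k n : ℕ) [NeZero n] : (𝔼 k × 𝔼 n) →L[ℝ] (𝔼 k × 𝔼 n) :=
  ContinuousLinearMap.id ℝ _ - (heightL k n).smulRight (e₀ k n)

/-- The reflection `z₀ ↦ -z₀`. -/
def reflL (k n : ℕ) [NeZero n] : (𝔼 k × 𝔼 n) →L[ℝ] (𝔼 k × 𝔼 n) :=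
  ContinuousLinearMap.id ℝ _ - (2 : ℝ) • (heightL k n).smulRight (e₀ k n)

/-- The reflection `z₀ ↦ -z₀` of the fibre coordinates. -/
def refl₀ (n : ℕ) [NeZero n] : 𝔼 n →L[ℝ] 𝔼 n := (ContinuousLinearMap.snd ℝ (𝔼 0) (𝔼 n)).comp
    ((reflL 0 n).comp (ContinuousLinearMap.inr ℝ _ _))

local notation:max "𝐡" => heightL k n
local notation:max "𝐮" => e₀ k n
local notation:max "𝐟" => flatL k n
local notation:max "𝐫" => reflL k n
local notation:max "𝐬" => refl₀ n

variable {H H' : Type*} [TopologicalSpace H] [TopologicalSpace H'] {J : ModelWithCorners ℝ (𝔼 n) H}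
  {J' : ModelWithCorners ℝ (𝔼 n) H'}

local notation "JChart" => FibredChart k J
local notation "JForm" => FibreForm k J
local notation "SmoothAt" => ContMDiffAt (ModelWithCorners.prod (𝓡 k) J) (ModelWithCorners.prod (𝓡 k) J') ∞
local notation "SmoothFun" => ContMDiff (ModelWithCorners.prod (𝓡 k) J) 𝓘(ℝ) ∞
local notation:max "ℛJ" => range (ModelWithCorners.prod (𝓡 k) J)

variable {B : Type*} [TopologicalSpace B] [ChartedSpace (𝔼 k) B] [IsManifold (𝓡 k) ∞ B] {P : Type*}
  [TopologicalSpace P] [ChartedSpace (ModelProd (𝔼 k) H) P] [IsManifold ((𝓡 k).prod J) ∞ P]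
  {P' : Type*} [TopologicalSpace P'] [ChartedSpace (ModelProd (𝔼 k) H') P']
  [IsManifold ((𝓡 k).prod J') ∞ P'] {π : P → B} {π' : P' → B} {X : Type*} [TopologicalSpace X]
  [ChartedSpace (ModelProd (𝔼 k) (𝔼 n)) X] [IsManifold ((𝓡 k).prod (𝓡 n)) ∞ X] {ϖ : X → B}
  {E : Type*} [TopologicalSpace E] [ChartedSpace (ModelProd (𝔼 k) (ℍ n)) E]
  [IsManifold ((𝓡 k).prod (𝓡∂ n)) ∞ E] {πE : E → B} {E1 E2 : Type*} [TopologicalSpace E1]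
  [TopologicalSpace E2] [T2Space E1] [CompactSpace E1] [T2Space E2] [CompactSpace E2]
  [ChartedSpace (ModelProd (𝔼 k) (ℍ n)) E1] [ChartedSpace (ModelProd (𝔼 k) (ℍ n)) E2]
  [IsManifold ((𝓡 k).prod (𝓡∂ n)) ∞ E1] [IsManifold ((𝓡 k).prod (𝓡∂ n)) ∞ E2] {π₁ : E1 → B}
  {π₂ : E2 → B} {φ : FibrewiseBdryDiffeo (k := k) (n := n) π₁ π₂}

local notation "ι₁" => incl₁ φ
local notation "ι₂" => incl₂ φ

abbrev SmoothMat (G : F → 𝕄 n) (S : Set F) : Prop := ∀ i j, SmoothOn (fun q => G q i j) S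

abbrev NonDeg {V : Type*} (G : V → 𝕄 n) (S : Set V) : Prop := ∀ q ∈ S, (G q).det ≠ 0

section Charts

variable {E H M E' H' M' : Type*} [NormedAddCommGroup E] [NormedSpace ℝ E] [TopologicalSpace H]
  [NormedAddCommGroup E'] [NormedSpace ℝ E'] [TopologicalSpace H'] {I : ModelWithCorners ℝ E H}
  {I' : ModelWithCorners ℝ E' H'} [TopologicalSpace M] [ChartedSpace H M] [TopologicalSpace M']
  [ChartedSpace H' M']

/-- The differential of an extended chart, with values in the model vector space. -/
def dChart (I : ModelWithCorners ℝ E H) (e : OPHomeo M H) (x : M) : TangentSpace I x →L[ℝ] E :=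
  mfderiv I 𝓘(ℝ, E) (e.extend I) x

variable {e : OpenPartialHomeomorph M H} {e' : OpenPartialHomeomorph M' H'}

lemma mdiff_extend [IsManifold I ∞ M] (he : e ∈ maximalAtlas I ∞ M) {x : M} (hx : x ∈ e.source) :
  MDifferentiableAt I 𝓘(ℝ, E) (e.extend I) x :=
  (e.contMDiffAt_extend he hx).mdifferentiableAt (by simp)

lemma smooth_extend_symm [IsManifold I ∞ M] (he : e ∈ maximalAtlas I ∞ M) {p : E}
  (hp : p ∈ (e.extend I).target) : ContMDiffWithinAt 𝓘(ℝ, E) I ∞ (e.extend I).symm (range I) p := by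
  have h := contMDiffOn_extend_symm he p (by aesop)
  refine h.mono_of_mem_nhdsWithin ?_; rw [← e.extend_target', ← (e.extend I).right_inv hp]
  exact e.extend_target_mem_nhdsWithin (by simp_all)

lemma dChart_bijective [IsManifold I ∞ M] (he : e ∈ maximalAtlas I ∞ M) {x : M}
  (hx : x ∈ e.source) : Bijective (dChart I e x) := by
  have hd : e.MDifferentiable I I :=
    ⟨(contMDiffOn_of_mem_maximalAtlas he).mdifferentiableOn (by simp),
      (contMDiffOn_symm_of_mem_maximalAtlas he).mdifferentiableOn (by simp)⟩
  have h1 := hd.mfderiv_bijective hx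
  have h2 : dChart I e x = mfderiv I I e x := by
    have h3 := (I.hasMFDerivAt (x := e x)).comp x (hd.mdifferentiableAt hx).hasMFDerivAt
    have h4 := h3.mfderiv; exact h4
  aesop

lemma dChart_mfderiv [IsManifold I ∞ M] [IsManifold I' ∞ M'] (he : e ∈ maximalAtlas I ∞ M)
  (he' : e' ∈ maximalAtlas I' ∞ M') {F : M → M'} {x : M} (hF : MDifferentiableAt I I' F x)
  (hx : x ∈ e.source) (hx' : F x ∈ e'.source) (u : TangentSpace I x) : dChart I' e' (F x)
  (mfderiv I I' F x u) = 𝒟 (e'.extend I' ∘ F ∘ (e.extend I).symm) (range I) (e.extend I x)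
  (dChart I e x u) := by
  have hxe : (e.extend I).symm (e.extend I x) = x := e.extend_left_inv hx
  have hmem : e.extend I x ∈ (e.extend I).target := (e.extend I).map_source (by simp_all)
  have h1 : MDifferentiableAt I 𝓘(ℝ, E') (e'.extend I' ∘ F) x := (mdiff_extend he' hx').comp x hF
  have hs : MDifferentiableWithinAt 𝓘(ℝ, E) I (e.extend I).symm (range I) (e.extend I x) :=
    (smooth_extend_symm he hmem).mdifferentiableWithinAt (by simp)
  have hg : MDifferentiableWithinAt 𝓘(ℝ, E) 𝓘(ℝ, E')
      (e'.extend I' ∘ F ∘ (e.extend I).symm) (range I) (e.extend I x) :=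
    MDifferentiableAt.comp_mdifferentiableWithinAt_of_eq (g := e'.extend I' ∘ F)
      (f := (e.extend I).symm) (e.extend I x) h1 hs hxe
  have hcomp : mfderiv I 𝓘(ℝ, E') ((e'.extend I' ∘ F ∘ (e.extend I).symm) ∘ e.extend I) x =
      (mfderivWithin 𝓘(ℝ, E) 𝓘(ℝ, E') (e'.extend I' ∘ F ∘ (e.extend I).symm) (range I)
        (e.extend I x)).comp (mfderiv I 𝓘(ℝ, E) (e.extend I) x) := by
    have := mfderivWithin_comp (s := univ) x hg ((mdiff_extend he hx).mdifferentiableWithinAt)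
      (by intro y _; simp) (uniqueMDiffWithinAt_univ I)
    aesop
  have hev : (e'.extend I' ∘ F ∘ (e.extend I).symm) ∘ e.extend I =ᶠ[𝓝 x] e'.extend I' ∘ F := by
    filter_upwards [e.open_source.mem_nhds hx] with y hy
    simp_all
  have hl := mfderiv_comp x (mdiff_extend he' hx') hF
  have := hev.mfderiv_eq (I := I) (I' := 𝓘(ℝ, E')); rw [hcomp, hl] at this
  have h2 := congrArg (fun L => L u) this
  rw [mfderivWithin_eq_fderivWithin] at h2
  tauto

lemma dChart_mfderivWithin_symm [IsManifold I ∞ M] (he : e ∈ maximalAtlas I ∞ M) {p : E}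
  (hp : p ∈ (e.extend I).target) (v : E) : dChart I e ((e.extend I).symm p)
  (mfderivWithin 𝓘(ℝ, E) I (e.extend I).symm (range I) p ((NormedSpace.fromTangentSpace p).symm v))
  = v := by
  have hx : (e.extend I).symm p ∈ e.source := by simp_all
  have hs : MDifferentiableWithinAt 𝓘(ℝ, E) I (e.extend I).symm (range I) p :=
    (smooth_extend_symm he hp).mdifferentiableWithinAt (by simp)
  have hu : UniqueMDiffWithinAt 𝓘(ℝ, E) (range I) p := by
    rw [uniqueMDiffWithinAt_iff_uniqueDiffWithinAt]
    exact I.uniqueDiffOn p (e.extend_target_subset_range hp)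
  have h1 := mfderiv_comp_mfderivWithin p (mdiff_extend he hx) hs hu
  have hn : (e.extend I).target ∈ 𝓝[range I] p := by
    have := e.extend_target_mem_nhdsWithin (I := I) hx; simp_all
  have hev : e.extend I ∘ (e.extend I).symm =ᶠ[𝓝[range I] p] id := by
    filter_upwards [hn] with q hq
    simp_all
  have h2 := hev.mfderivWithin_eq (I := 𝓘(ℝ, E)) (I' := 𝓘(ℝ, E)) ((e.extend I).right_inv hp)
  rw [h1, mfderivWithin_id hu] at h2
  exact congrArg (fun L => L ((NormedSpace.fromTangentSpace p).symm v)) h2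

end Charts

/-- The fibred charts cover. -/
abbrev HasCharts (k n : ℕ) [NeZero n] {B : Type*} [TopologicalSpace B] [ChartedSpace (𝔼 k) B]
  {E : Type*} [TopologicalSpace E] [ChartedSpace (ModelProd (𝔼 k) (ℍ n)) E] (π : E → B) : Prop :=
  ∀ x, ∃ c : FibredChart k (𝓡∂ n) π, x ∈ 𝒮 c

/-- The bilinear form on `ℝⁿ` with matrix `M`. -/
def bil {n : ℕ} (M : 𝕄 n) (a b : 𝔼 n) : ℝ := ∑ i, ∑ j, M i j * a i * b j

lemma bil_add_left {n : ℕ} (M : 𝕄 n) (a a' b : 𝔼 n) : bil M (a + a') b =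
  bil M a b + bil M a' b := by
  simp only [bil, ← sum_add_distrib, PiLp.add_apply]
  grind

lemma bil_smul_left {n : ℕ} (M : 𝕄 n) (r : ℝ) (a b : 𝔼 n) : bil M (r • a) b = r * bil M a b := by
  simp only [bil, mul_sum, PiLp.smul_apply, smul_eq_mul]
  grind

lemma bil_swap {n : ℕ} (M : 𝕄 n) (a b : 𝔼 n) : bil M a b = bil M.transpose b a := by
  simp only [bil]; rw [sum_comm]
  exact sum_congr rfl fun i _ => sum_congr rfl fun j _ => by
    simp only [Matrix.transpose_apply]; ring

lemma bil_add_right {n : ℕ} (M : 𝕄 n) (a b b' : 𝔼 n) : bil M a (b + b') =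
  bil M a b + bil M a b' := by
  rw [bil_swap, bil_add_left, ← bil_swap, ← bil_swap]

lemma bil_smul_right {n : ℕ} (M : 𝕄 n) (r : ℝ) (a b : 𝔼 n) : bil M a (r • b) = r * bil M a b := by
  rw [bil_swap, bil_smul_left, ← bil_swap]

lemma bil_single {n : ℕ} (M : 𝕄 n) (i j : Fin n) : bil M (𝐞 i) (𝐞 j) = M i j := by
  simp [bil, PiLp.single_apply]

lemma bil_symm {n : ℕ} {M : 𝕄 n} (hM : ∀ i j, M i j = M j i) (a b : 𝔼 n) : bil M a b =
  bil M b a := by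
  rw [bil_swap]; congr 1; ext i j; exact hM j i

lemma eq_bil_of_basis {n : ℕ} (f : 𝔼 n →ₗ[ℝ] 𝔼 n →ₗ[ℝ] ℝ) (a b : 𝔼 n) : f a b = bil
  (fun i j => f (𝐞 i) (𝐞 j)) a b := by
  have ha : ∀ c : 𝔼 n, c = ∑ i, c i • 𝐞 i := by
    intro c; have := (EuclideanSpace.basisFun (Fin n) ℝ).sum_repr c; simp_all
  conv_lhs => rw [ha a, ha b]
  simp only [map_sum, map_smul, LinearMap.sum_apply, LinearMap.smul_apply, smul_eq_mul, bil,
    mul_sum]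
  rw [sum_comm]
  grind

namespace FibredChart

lemma ext_apply_fst (c : JChart π) (x : P) : (c.ext x).1 = (c.total x).1 := rfl

lemma mem_source (c : JChart π) {p : 𝕍} (hp : p ∈ c.ext.target) : c.ext.symm p ∈ 𝒮 c := by simp_all

lemma ext_mem (c : JChart π) {x : P} (hx : x ∈ 𝒮 c) :
    c.ext x ∈ c.ext.target := c.ext.map_source (by simp_all)

lemma symm_ext (c : JChart π) {x : P} (hx : x ∈ 𝒮 c) :
    c.ext.symm (c.ext x) = x := c.total.extend_left_inv hx

lemma target_mem_nhdsWithin (c : JChart π) {p : 𝕍} (hp : p ∈ c.ext.target) :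
  c.ext.target ∈ 𝓝[ℛJ] p := by
  have := c.total.extend_target_mem_nhdsWithin (I := 𝓟 J) (c.mem_source hp)
  rwa [c.ext.right_inv hp] at this

/-- The components of vertical vectors, as a linear map. -/
def coordₗ (c : JChart π) (x : P) : Vert k J π x →ₗ[ℝ] 𝔼 n := (LinearMap.snd ℝ (𝔼 k) (𝔼 n)).comp
    ((dChart (𝓟 J) c.total x).toLinearMap.comp (Vert k J π x).subtype)

lemma contMDiffAt_proj (c : JChart π) {x : P} (hx : x ∈ 𝒮 c) : ContMDiffAt (𝓟 J) (𝓡 k) ∞ π x := by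
  have h1 : ContMDiffAt (𝓟 J) (𝓡 k) ∞ (fun y => c.base.symm (c.ext y).1) x := by
    have h2 := c.total.contMDiffAt_extend c.total_mem hx
    have h3 : ContMDiffAt (𝓡 k) (𝓡 k) ∞ c.base.symm (c.ext x).1 := by
      apply contMDiffAt_symm_of_mem_maximalAtlas c.base_mem; rw [c.ext_apply_fst, c.fst_eq x hx]
      exact c.base.map_source (c.proj_mem x hx)
    exact h3.comp x (contDiff_fst.contMDiff.contMDiffAt.comp x h2)
  refine h1.congr_of_eventuallyEq ?_; filter_upwards [c.total.open_source.mem_nhds hx] with y hy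
  rw [c.ext_apply_fst, c.fst_eq y hy, c.base.left_inv (c.proj_mem y hy)]

lemma mem_vert_iff (c : JChart π) {x : P} (hx : x ∈ 𝒮 c) (u : TangentSpace (𝓟 J) x) :
  u ∈ Vert k J π x ↔ (dChart (𝓟 J) c.total x u).1 = 0 := by
  have hπ := (c.contMDiffAt_proj hx).mdifferentiableAt (by simp)
  have hb := c.proj_mem x hx; have h1 := mfderiv_comp x (mdiff_extend c.base_mem hb) hπ
  have hfst : MDifferentiableAt 𝓘(ℝ, 𝕍) 𝓘(ℝ, 𝔼 k) Prod.fst (c.ext x) :=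
    mdifferentiableAt_iff_differentiableAt.2 differentiableAt_fst
  have h2 := mfderiv_comp x hfst (mdiff_extend c.total_mem hx)
  have hev : c.base.extend (𝓡 k) ∘ π =ᶠ[𝓝 x] Prod.fst ∘ c.total.extend (𝓟 J) := by
    filter_upwards [c.total.open_source.mem_nhds hx] with y hy
    exact (c.fst_eq y hy).symm
  have h3 := hev.mfderiv_eq (I := 𝓟 J) (I' := 𝓘(ℝ, 𝔼 k)); rw [h1, h2] at h3
  have h4 := congrArg (fun L => L u) h3
  have h5 : dChart (𝓡 k) c.base (π x) (mfderiv (𝓟 J) (𝓡 k) π x u) =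
      (dChart (𝓟 J) c.total x u).1 := by
    refine Eq.trans h4 ?_; rw [mfderiv_eq_fderiv]
    have : fderiv ℝ (Prod.fst : 𝕍 → _) (c.ext x) = ContinuousLinearMap.fst ℝ _ _ := fderiv_fst
    aesop
  rw [← h5]; change mfderiv (𝓟 J) (𝓡 k) π x u = 0 ↔ _
  constructor
  · simp_all
  · intro h; exact (dChart_bijective c.base_mem hb).1 (by rw [h, map_zero])

lemma dChart_vert (c : JChart π) {x : P} (hx : x ∈ 𝒮 c) (u : Vert k J π x) : dChart
  (𝓟 J) c.total x u.1 = (0, c.coord x u) :=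
  Prod.ext ((c.mem_vert_iff hx u.1).1 u.2) rfl

lemma coord_injective (c : JChart π) {x : P} (hx : x ∈ 𝒮 c) : Injective (c.coord x) := by
  intro u v huv; apply Subtype.ext; apply (dChart_bijective c.total_mem hx).1
  rw [c.dChart_vert hx, c.dChart_vert hx, huv]

lemma exists_coord (c : JChart π) {x : P} (hx : x ∈ 𝒮 c) (a : 𝔼 n) : ∃ u : Vert k J π x,
  c.coord x u = a := by
  obtain ⟨u, hu⟩ := (dChart_bijective c.total_mem hx).2 (0, a)
  exact ⟨⟨u, (c.mem_vert_iff hx u).2 (by rw [hu])⟩, congrArg Prod.snd hu⟩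

lemma coord_toVert_frame (c : JChart π) {p : 𝕍} (hp : p ∈ c.ext.target) (i : Fin n) : c.coord
  (c.ext.symm p) (toVert _ (c.frame p i)) = 𝐞 i := by
  have h := dChart_mfderivWithin_symm c.total_mem hp ((0 : 𝔼 k), 𝐞 i)
  have hv : c.frame p i ∈ Vert k J π (c.ext.symm p) :=
    (c.mem_vert_iff (c.mem_source hp) _).2 (congrArg Prod.fst h)
  rw [toVert, dif_pos hv]; exact congrArg Prod.snd h

/-- The linear isomorphism between vertical vectors and their components. -/
def coordEquiv (c : JChart π) {x : P} (hx : x ∈ 𝒮 c) : Vert k J π x ≃ₗ[ℝ] 𝔼 n :=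
  LinearEquiv.ofBijective (c.coordₗ x) ⟨c.coord_injective hx, c.exists_coord hx⟩

lemma form_eq_bil_symm (c : JChart π) (h : JForm π) {p : 𝕍} (hp : p ∈ c.ext.target)
  (u v : Vert k J π (c.ext.symm p)) : h _ u v = bil (c.coeff h p) (c.coord _ u) (c.coord _ v) := by
  have hx := c.mem_source hp
  let φ := (c.coordEquiv hx).symm
  have key := eq_bil_of_basis ((h (c.ext.symm p)).compl₁₂ φ.toLinearMap φ.toLinearMap)
    (c.coord _ u) (c.coord _ v)
  have hφ : ∀ w, φ (c.coord _ w) = w := fun w => (c.coordEquiv hx).symm_apply_apply w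
  have hf : ∀ i, φ (𝐞 i) = toVert _ (c.frame p i) := by
    intro i; rw [← c.coord_toVert_frame hp i, hφ]
  aesop

lemma form_eq_bil (c : JChart π) (h : JForm π) {x : P} (hx : x ∈ 𝒮 c) (u v : Vert k J π x) :
  h x u v = bil (c.coeff h (c.ext x)) (c.coord x u) (c.coord x v) := by
  obtain ⟨p, hp, rfl⟩ : ∃ p ∈ c.ext.target, c.ext.symm p = x :=
    ⟨c.ext x, c.ext_mem hx, c.symm_ext hx⟩
  rw [c.form_eq_bil_symm h hp, c.ext.right_inv hp]

lemma coeff_eq_of_form (c : JChart π) (h : JForm π) {x : P} (hx : x ∈ 𝒮 c) (M : 𝕄 n)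
  (hM : ∀ u v : Vert k J π x, h x u v = bil M (c.coord x u) (c.coord x v)) : c.coeff h (c.ext x) =
  M := by
  ext i j; obtain ⟨u, hu⟩ := c.exists_coord hx (𝐞 i); obtain ⟨v, hv⟩ := c.exists_coord hx (𝐞 j)
  have h1 := hM u v; rw [c.form_eq_bil h hx, hu, hv, bil_single, bil_single] at h1; exact h1

end FibredChart

/-- The form on the vertical space at `x` with matrix `M` in a fibred chart. -/
def FibredChart.toForm (c : JChart π) (x : P) (M : 𝕄 n) : LinearMap.BilinForm ℝ (Vert k J π x) :=
  LinearMap.mk₂ ℝ (fun u v => bil M (c.coordₗ x u) (c.coordₗ x v))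
    (fun u v w => by rw [map_add, bil_add_left]) (fun r u v => by rw [map_smul, bil_smul_left]; rfl)
    (fun u v w => by rw [map_add, bil_add_right])
    (fun r u v => by rw [map_smul, bil_smul_right]; rfl)

lemma FibredChart.toForm_apply (c : JChart π) (x : P) (M : 𝕄 n)
    (u v : Vert k J π x) : c.toForm x M u v = bil M (c.coord x u) (c.coord x v) := rfl

section Curvature

variable {E : Type*} [NormedAddCommGroup E] [NormedSpace ℝ E]

/-- Christoffel symbols of the first kind. -/
def koszul (D : E →L[ℝ] E →L[ℝ] E →L[ℝ] ℝ) (u v w : E) : ℝ :=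
  (1 / 2) * (D u v w + D v u w - D w u v)

/-- The curvature tensor of a connection with Christoffel symbols `γ`. -/
def curvature (s : Set E) (γ : E → E →L[ℝ] E →L[ℝ] E) (z x u v : E) : E :=
  𝒟 γ s z x u v - 𝒟 γ s z u x v + γ z x (γ z u v) - γ z u (γ z x v)

variable {s s' : Set E} {Φ : E → E}

lemma smoothOn_fderiv {G : Type*} [NormedAddCommGroup G] [NormedSpace ℝ G] {s : Set F} {f : F → G}
  (hs : UniqueDiffOn ℝ s) (hf : SmoothOn f s) : SmoothOn (𝒟 f s) s :=
  hf.fderivWithin hs (by simp)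

lemma hasFDerivWithin {G : Type*} [NormedAddCommGroup G] [NormedSpace ℝ G] {s : Set F} {f : F → G}
  (hf : SmoothOn f s) {z : F} (hz : z ∈ s) : HasFDerivWithinAt f (𝒟 f s z) s z :=
  ((hf z hz).differentiableWithinAt (by simp)).hasFDerivWithinAt

lemma two_le_smooth : minSmoothness ℝ 2 ≤ (∞ : WithTop ℕ∞) := by
  rw [minSmoothness_of_isRCLikeNormedField]
  tauto

lemma fderivWithin_fderivWithin_symm {f : E → F} (hs : UniqueDiffOn ℝ s)
  (hcl : s ⊆ closure (interior s)) (hf : SmoothOn f s) {z : E} (hz : z ∈ s) (u v : E) : 𝒟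
  (𝒟 f s) s z u v = 𝒟 (𝒟 f s) s z v u :=
  (hf z hz).isSymmSndFDerivWithinAt (two_le_smooth) hs (hcl hz) hz u v

lemma christoffel_transform {g g' : E → E →L[ℝ] E →L[ℝ] ℝ} {γ γ' : E → E →L[ℝ] E →L[ℝ] E}
  (hs : UniqueDiffOn ℝ s) (hcl : s ⊆ closure (interior s)) (hΦ : SmoothOn Φ s)
  (hmaps : MapsTo Φ s s') (hg : ∀ z ∈ s, ∀ u v, g z u v = g' (Φ z) (𝒟 Φ s z u) (𝒟 Φ s z v))
  (hgd : DifferentiableOn ℝ g s) (hg' : DifferentiableOn ℝ g' s')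
  (hsymm : ∀ w ∈ s', ∀ u v, g' w u v = g' w v u) (hnd : ∀ w ∈ s', ∀ u, (∀ v, g' w u v = 0) → u = 0)
  (hγ : ∀ z ∈ s, ∀ u v w, g z (γ z u v) w = koszul (𝒟 g s z) u v w)
  (hγ' : ∀ z ∈ s', ∀ u v w, g' z (γ' z u v) w = koszul (𝒟 g' s' z) u v w)
  (hA : ∀ z ∈ s, Function.Surjective (𝒟 Φ s z)) {z : E} (hz : z ∈ s) (u v : E) : 𝒟 Φ s z (γ z u v) =
  𝒟 (𝒟 Φ s) s z u v + γ' (Φ z) (𝒟 Φ s z u) (𝒟 Φ s z v) := by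
  set A := 𝒟 Φ s with hAdef
  set Bz := 𝒟 A s z with hBdef
  have hBs : ∀ x y, Bz x y = Bz y x := fun x y => fderivWithin_fderivWithin_symm hs hcl hΦ hz x y
  have hAd : HasFDerivWithinAt A Bz s z := hasFDerivWithin (smoothOn_fderiv hs hΦ) hz
  have hΦd : HasFDerivWithinAt Φ (A z) s z := hasFDerivWithin hΦ hz; have hw : Φ z ∈ s' := hmaps hz
  set D' := 𝒟 g' s' (Φ z) with hD'
  have hD : ∀ x y w, 𝒟 g s z x y w =
      D' (A z x) (A z y) (A z w) + g' (Φ z) (Bz x y) (A z w) + g' (Φ z) (A z y) (Bz x w) := by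
    intro x y w; have h0 : HasFDerivWithinAt g' D' s' (Φ z) := (hg' _ hw).hasFDerivWithinAt
    have h1 := HasFDerivWithinAt.comp (G := E →L[ℝ] E →L[ℝ] ℝ) z h0 hΦd hmaps
    have h2 := (h1.clm_apply (hAd.clm_apply (hasFDerivWithinAt_const y z s))).clm_apply
      (hAd.clm_apply (hasFDerivWithinAt_const w z s))
    have h3 := (((hgd z hz).hasFDerivWithinAt).clm_apply
      (hasFDerivWithinAt_const y z s)).clm_apply (hasFDerivWithinAt_const w z s)
    have h4 := (hs z hz).eq (h3.congr (fun q hq => (hg q hq y w).symm) (hg z hz y w).symm) h2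
    have h5 := congrArg (fun L => L x) h4
    simp at h5; rw [h5]; ring
  suffices h : ∀ w, g' (Φ z) (A z (γ z u v) - (Bz u v + γ' (Φ z) (A z u) (A z v))) w = 0 from
    sub_eq_zero.1 (hnd _ hw _ h)
  intro w'; obtain ⟨w, rfl⟩ := hA z hz w'; have e1 := hγ z hz u v w
  have e2 := hγ' _ hw (A z u) (A z v) (A z w); rw [hg z hz] at e1
  simp only [map_sub, map_add, sub_apply, add_apply, e1, e2]; simp only [koszul, hD]
  grind

lemma curvature_transform {γ γ' : E → E →L[ℝ] E →L[ℝ] E} (hs : UniqueDiffOn ℝ s)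
  (hcl : s ⊆ closure (interior s)) (hΦ : SmoothOn Φ s) (hmaps : MapsTo Φ s s')
  (hγ : DifferentiableOn ℝ γ s) (hγ' : DifferentiableOn ℝ γ' s') (h : ∀ z ∈ s, ∀ u v,
  𝒟 Φ s z (γ z u v) = 𝒟 (𝒟 Φ s) s z u v + γ' (Φ z) (𝒟 Φ s z u) (𝒟 Φ s z v)) {z : E} (hz : z ∈ s)
  (x u v : E) : 𝒟 Φ s z (curvature s γ z x u v) = curvature s' γ' (Φ z) (𝒟 Φ s z x) (𝒟 Φ s z u)
  (𝒟 Φ s z v) := by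
  set A := 𝒟 Φ s with hAdef
  set Bf := 𝒟 A s with hBdef
  have hAs : SmoothOn A s := smoothOn_fderiv hs hΦ
  have hBs : ∀ x y, Bf z x y = Bf z y x := fun x y => fderivWithin_fderivWithin_symm hs hcl hΦ hz x y
  have hCs : ∀ x y, 𝒟 Bf s z x y = 𝒟 Bf s z y x :=
    fun x y => fderivWithin_fderivWithin_symm hs hcl hAs hz x y
  have hAd : HasFDerivWithinAt A (Bf z) s z := hasFDerivWithin hAs hz
  have hBd : HasFDerivWithinAt Bf (𝒟 Bf s z) s z := hasFDerivWithin (smoothOn_fderiv hs hAs) hz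
  have hΦd : HasFDerivWithinAt Φ (A z) s z := hasFDerivWithin hΦ hz; have hw : Φ z ∈ s' := hmaps hz
  set D' := 𝒟 γ' s' (Φ z) with hD'
  set D := 𝒟 γ s z with hD
  have key : ∀ x u v, Bf z x (γ z u v) + A z (D x u v) = 𝒟 Bf s z x u v +
      (D' (A z x) (A z u) (A z v) + γ' (Φ z) (Bf z x u) (A z v) + γ' (Φ z) (A z u) (Bf z x v)) := by
    intro x u v; have h0 : HasFDerivWithinAt γ' D' s' (Φ z) := (hγ' _ hw).hasFDerivWithinAt
    have h1 := HasFDerivWithinAt.comp (G := E →L[ℝ] E →L[ℝ] E) z h0 hΦd hmaps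
    have h2 := (h1.clm_apply (hAd.clm_apply (hasFDerivWithinAt_const u z s))).clm_apply
      (hAd.clm_apply (hasFDerivWithinAt_const v z s))
    have h2' := ((hBd.clm_apply (hasFDerivWithinAt_const u z s)).clm_apply
      (hasFDerivWithinAt_const v z s)).add h2
    have h3 := hAd.clm_apply ((((hγ z hz).hasFDerivWithinAt).clm_apply
      (hasFDerivWithinAt_const u z s)).clm_apply (hasFDerivWithinAt_const v z s))
    have h4 := (hs z hz).eq (h3.congr (fun q hq => (h q hq u v).symm) (h z hz u v).symm) h2'
    have h5 := congrArg (fun L => L x) h4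
    simp at h5; rw [add_comm] at h5; rw [hD, h5]; abel
  have hB : ∀ u v, Bf z u v = A z (γ z u v) - γ' (Φ z) (A z u) (A z v) := by
    intro u v; rw [h z hz u v]; abel
  have k1 := key x u v; have k2 := key u x v; rw [hCs u x, hBs u x] at k2
  have k3 : A z (D x u v) = 𝒟 Bf s z x u v + (D' (A z x) (A z u) (A z v) +
      γ' (Φ z) (Bf z x u) (A z v) + γ' (Φ z) (A z u) (Bf z x v)) - Bf z x (γ z u v) := by
    rw [← k1]; abel
  have k4 : A z (D u x v) = 𝒟 Bf s z x u v + (D' (A z u) (A z x) (A z v) +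
      γ' (Φ z) (Bf z x u) (A z v) + γ' (Φ z) (A z x) (Bf z u v)) - Bf z u (γ z x v) := by
    rw [← k2]; abel
  simp only [curvature, map_sub, map_add]
  rw [← hD, k3, k4, hB x v, hB u v, hB x (γ z u v), hB u (γ z x v)]; rw [← hD']
  have e1 : A z (γ z u v) = Bf z u v + γ' (Φ z) (A z u) (A z v) := h z hz u v; simp only [map_sub]
  abel

end Curvature

section Index

/-- Partial derivatives within a set. -/
def pd (s : Set (𝔼 n)) (i : Fin n) (f : 𝔼 n → ℝ) (z : 𝔼 n) : ℝ := 𝒟 f s z (𝐞 i)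

/-- Christoffel symbols of a metric on a set. -/
def chr (s : Set (𝔼 n)) (G : 𝔼 n → 𝕄 n) (l i j : Fin n) (z : 𝔼 n) : ℝ :=
  (1 / 2) * ∑ m, (G z)⁻¹ l m *
    (pd s i (fun w => G w j m) z + pd s j (fun w => G w i m) z - pd s m (fun w => G w i j) z)

/-- The Ricci tensor of a metric on a set. -/
def ric (s : Set (𝔼 n)) (G : 𝔼 n → 𝕄 n) (z : 𝔼 n) : 𝕄 n :=
  fun i j => ∑ l, (pd s l (chr s G l i j) z - pd s i (chr s G l l j) z
    + ∑ m, (chr s G l l m z * chr s G m i j z - chr s G l i m z * chr s G m l j z))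

lemma pd_congr_set {s t : Set (𝔼 n)} {i : Fin n} {f g : 𝔼 n → ℝ} {z : 𝔼 n} (hst : s =ᶠ[𝓝 z] t)
  (hfg : f =ᶠ[𝓝[s] z] g) (hz : f z = g z) : pd s i f z = pd t i g z := by
  rw [pd, pd, hfg.fderivWithin_eq hz, fderivWithin_congr_set hst]

lemma chr_congr {s t : Set (𝔼 n)} {G G' : 𝔼 n → 𝕄 n} {z : 𝔼 n} (hst : s =ᶠ[𝓝 z] t)
  (hfg : G =ᶠ[𝓝[s] z] G') (hz : G z = G' z) (l i j : Fin n) : chr s G l i j z =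
  chr t G' l i j z := by
  have h : ∀ a b c, pd s c (fun w => G w a b) z = pd t c (fun w => G' w a b) z := fun a b c =>
    pd_congr_set hst (hfg.mono fun w hw => by simp_all) (by rw [hz])
  simp only [chr, h, hz]

lemma ric_congr {s t : Set (𝔼 n)} {G G' : 𝔼 n → 𝕄 n} {z : 𝔼 n} (hst : s =ᶠ[𝓝 z] t)
  (hfg : G =ᶠ[𝓝[s] z] G') (hzs : z ∈ s) : ric s G z = ric t G' z := by
  have hz : G z = G' z := hfg.eq_of_nhdsWithin hzs
  have h1 : ∀ l i j, chr s G l i j z = chr t G' l i j z := chr_congr hst hfg hz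
  have h2 : ∀ l i j, chr s G l i j =ᶠ[𝓝[s] z] chr t G' l i j := by
    intro l i j
    have h3 : ∀ᶠ w in 𝓝 z, G =ᶠ[𝓝[s] w] G' ∨ w ∉ s := by
      have h5 : ∀ᶠ w in 𝓝 z, w ∈ s → G w = G' w := eventually_nhdsWithin_iff.1 hfg
      filter_upwards [eventually_eventually_nhds.2 h5] with w hw
      exact Or.inl (eventually_nhdsWithin_iff.2 hw)
    have h4 := eventually_eventually_nhds.2 hst
    filter_upwards [self_mem_nhdsWithin, nhdsWithin_le_nhds h3, nhdsWithin_le_nhds h4]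
      with w hws hw3 hw4
    rcases hw3 with hw3 | hw3
    · exact chr_congr hw4 hw3 (hw3.eq_of_nhdsWithin hws) l i j
    simp_all
  ext i j; simp only [ric, h1]; refine sum_congr rfl fun l _ => ?_
  rw [pd_congr_set hst (h2 l i j) (h1 l i j), pd_congr_set hst (h2 l l j) (h1 l l j)]

section Smooth

variable {s : Set F}

lemma contDiffOn_det {M : F → 𝕄 n} {m : WithTop ℕ∞} (hM : ∀ i j,
  ContDiffOn ℝ m (fun z => M z i j) s) : ContDiffOn ℝ m (fun z => (M z).det) s := by
  simp only [Matrix.det_apply]; fun_prop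

lemma contDiffOn_inv {M : F → 𝕄 n} {m : WithTop ℕ∞} (hM : ∀ i j,
  ContDiffOn ℝ m (fun z => M z i j) s) (hdet : NonDeg M s) (i j : Fin n) : ContDiffOn ℝ m
  (fun z => (M z)⁻¹ i j) s := by
  have h : ∀ z, (M z)⁻¹ i j = ((M z).det)⁻¹ * (M z).adjugate i j := by
    intro z; rw [Matrix.inv_def, Ring.inverse_eq_inv']; rfl
  simp only [h]; refine ((contDiffOn_det hM).inv hdet).mul ?_; simp only [Matrix.adjugate_apply]
  refine contDiffOn_det fun a b => ?_
  by_cases ha : a = j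
  · subst ha; simp only [Matrix.updateRow_self]; exact contDiffOn_const
  simp_all

end Smooth

variable {s s' : Set (𝔼 n)} {G G' : 𝔼 n → 𝕄 n}

lemma contDiffOn_pd {f : 𝔼 n → ℝ} (hs : UniqueDiffOn ℝ s) (hf : SmoothOn f s) (i : Fin n) : SmoothOn
  (pd s i f) s :=
  (smoothOn_fderiv hs hf).clm_apply contDiffOn_const

lemma contDiffOn_chr (hs : UniqueDiffOn ℝ s) (hG : SmoothMat G s) (hdet : NonDeg G s)
  (l i j : Fin n) : SmoothOn (chr s G l i j) s := by
  refine contDiffOn_const.mul (ContDiffOn.sum fun m _ => (contDiffOn_inv hG hdet l m).mul ?_)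
  exact ((contDiffOn_pd hs (hG j m) i).add (contDiffOn_pd hs (hG i m) j)).sub
    (contDiffOn_pd hs (hG i j) m)

lemma hasFDerivWithinAt_sum_smul {V F ι : Type*} [NormedAddCommGroup V] [NormedSpace ℝ V]
  [NormedAddCommGroup F] [NormedSpace ℝ F] [Fintype ι] {s : Set V} {z : V} {c : ι → V → ℝ}
  {c' : ι → V →L[ℝ] ℝ} (T : ι → F) (h : ∀ i, HasFDerivWithinAt (c i) (c' i) s z) : HasFDerivWithinAt
  (fun z => ∑ i, c i z • T i) (∑ i, (c' i).smulRight (T i)) s z :=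
  HasFDerivWithinAt.fun_sum fun i _ => (h i).smul_const (T i)

/-- The continuous bilinear form with given matrix. -/
def matL (M : 𝕄 n) : 𝔼 n →L[ℝ] 𝔼 n →L[ℝ] ℝ := ∑ i : Fin n × Fin n, M i.1 i.2 •
    (EuclideanSpace.proj i.1 : 𝔼 n →L[ℝ] ℝ).smulRight (EuclideanSpace.proj i.2 : 𝔼 n →L[ℝ] ℝ)

lemma matL_apply (M : 𝕄 n) (u v : 𝔼 n) : matL M u v = bil M u v := by
  simp [matL, bil, mul_assoc, Fintype.sum_prod_type]

/-- The bilinear maps `(u, v) ↦ uᵢ vⱼ eₗ`. -/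
def basisTensor (i : Fin n × Fin n × Fin n) : 𝔼 n →L[ℝ] 𝔼 n →L[ℝ] 𝔼 n :=
  (EuclideanSpace.proj i.1 : 𝔼 n →L[ℝ] ℝ).smulRight
    ((EuclideanSpace.proj i.2.1 : 𝔼 n →L[ℝ] ℝ).smulRight
      (𝐞 i.2.2))

/-- The Christoffel symbols as a bilinear map. -/
def chrL (s : Set (𝔼 n)) (G : 𝔼 n → 𝕄 n) (z : 𝔼 n) : 𝔼 n →L[ℝ] 𝔼 n →L[ℝ] 𝔼 n :=
  ∑ i : Fin n × Fin n × Fin n, chr s G i.2.2 i.1 i.2.1 z • basisTensor i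

lemma sum_tensor_apply (X : Fin n → Fin n → Fin n → ℝ) (u v : 𝔼 n) (l : Fin n) :
  ((∑ i : Fin n × Fin n × Fin n, X i.2.2 i.1 i.2.1 • basisTensor i) u v) l = bil
  (Matrix.of fun i j => X l i j) u v := by
  simp [bil, basisTensor, Pi.single_apply, mul_assoc, Fintype.sum_prod_type]

lemma chrL_apply (z u v : 𝔼 n) (l : Fin n) : (chrL s G z u v) l = bil
  (Matrix.of fun i j => chr s G l i j z) u v :=
  sum_tensor_apply (fun l i j => chr s G l i j z) u v l

lemma fderivWithin_matL (hs : UniqueDiffOn ℝ s) (hG : SmoothMat G s) {z : 𝔼 n} (hz : z ∈ s)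
  (x u v : 𝔼 n) : 𝒟 (fun z => matL (G z)) s z x u v = bil (Matrix.of fun i j => 𝒟 (fun z => G z i j)
  s z x) u v := by
  have h := hasFDerivWithinAt_sum_smul (F := 𝔼 n →L[ℝ] 𝔼 n →L[ℝ] ℝ)
    (fun i : Fin n × Fin n => (EuclideanSpace.proj i.1 : 𝔼 n →L[ℝ] ℝ).smulRight
      (EuclideanSpace.proj i.2 : 𝔼 n →L[ℝ] ℝ))
    (fun i => hasFDerivWithin (hG i.1 i.2) hz)
  have h' : HasFDerivWithinAt (fun z => matL (G z)) _ s z := h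
  rw [h'.fderivWithin (hs z hz)]; simp [bil, mul_assoc, Fintype.sum_prod_type]

lemma differentiableOn_matL (hG : SmoothMat G s) : DifferentiableOn ℝ (fun z => matL (G z)) s := by
  intro z hz
  exact (hasFDerivWithinAt_sum_smul (F := 𝔼 n →L[ℝ] 𝔼 n →L[ℝ] ℝ)
    (fun i : Fin n × Fin n => (EuclideanSpace.proj i.1 : 𝔼 n →L[ℝ] ℝ).smulRight
      (EuclideanSpace.proj i.2 : 𝔼 n →L[ℝ] ℝ))
    (fun i => hasFDerivWithin (hG i.1 i.2) hz)).differentiableWithinAt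

lemma differentiableOn_chrL (hs : UniqueDiffOn ℝ s) (hG : SmoothMat G s) (hdet : NonDeg G s) :
  DifferentiableOn ℝ (chrL s G) s := by
  intro z hz
  exact (hasFDerivWithinAt_sum_smul (F := 𝔼 n →L[ℝ] 𝔼 n →L[ℝ] 𝔼 n)
    basisTensor (fun i => hasFDerivWithin
      (contDiffOn_chr hs hG hdet i.2.2 i.1 i.2.1) hz)).differentiableWithinAt

lemma fderivWithin_chrL (hs : UniqueDiffOn ℝ s) (hG : SmoothMat G s) (hdet : NonDeg G s) {z : 𝔼 n}
  (hz : z ∈ s) (x u v : 𝔼 n) (l : Fin n) : (𝒟 (chrL s G) s z x u v) l = bil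
  (Matrix.of fun i j => 𝒟 (chr s G l i j) s z x) u v := by
  have h := hasFDerivWithinAt_sum_smul (F := 𝔼 n →L[ℝ] 𝔼 n →L[ℝ] 𝔼 n)
    basisTensor (fun i => hasFDerivWithin (contDiffOn_chr hs hG hdet i.2.2 i.1 i.2.1) hz)
  have h' : HasFDerivWithinAt (chrL s G) _ s z := h; rw [h'.fderivWithin (hs z hz)]
  rw [← sum_tensor_apply (fun l i j => 𝒟 (chr s G l i j) s z x) u v l]
  simp

lemma vec_expand (c : 𝔼 n) : c = ∑ i, c i • 𝐞 i := by
  have := (EuclideanSpace.basisFun (Fin n) ℝ).sum_repr c; simp_all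

lemma clm_expand (L : 𝔼 n →L[ℝ] F) (x : 𝔼 n) : L x = ∑ i, x i • L (𝐞 i) := by
  conv_lhs => rw [vec_expand x]
  simp

lemma clm_expand₃ (D : 𝔼 n →L[ℝ] 𝔼 n →L[ℝ] 𝔼 n →L[ℝ] ℝ) (u v w : 𝔼 n) : D u v w = ∑ i, ∑ j, ∑ m,
  u i * v j * w m * D (𝐞 i) (𝐞 j) (𝐞 m) := by
  rw [clm_expand (F := 𝔼 n →L[ℝ] 𝔼 n →L[ℝ] ℝ) D u]; simp only [sum_apply, smul_apply]
  refine sum_congr rfl fun i _ => ?_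
  rw [clm_expand (F := 𝔼 n →L[ℝ] ℝ) (D (𝐞 i)) v]; simp only [sum_apply, smul_apply, Finset.smul_sum]
  refine sum_congr rfl fun j _ => ?_
  rw [clm_expand (D (𝐞 i) (𝐞 j)) w]; simp only [smul_eq_mul, mul_sum]
  grind

lemma koszul_expand (D : 𝔼 n →L[ℝ] 𝔼 n →L[ℝ] 𝔼 n →L[ℝ] ℝ) (u v w : 𝔼 n) : koszul D u v w = ∑ i, ∑ j,
  ∑ m, u i * v j * w m * koszul D (𝐞 i) (𝐞 j) (𝐞 m) := by
  have h2 : D v u w = ∑ i, ∑ j, ∑ m, u i * v j * w m * D (𝐞 j) (𝐞 i) (𝐞 m) := by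
    rw [clm_expand₃, sum_comm]
    exact sum_congr rfl fun i _ => sum_congr rfl fun j _ => sum_congr rfl fun m _ => by ring
  have h3 : D w u v = ∑ i, ∑ j, ∑ m, u i * v j * w m * D (𝐞 m) (𝐞 i) (𝐞 j) := by
    rw [clm_expand₃, sum_comm]; refine sum_congr rfl fun i _ => ?_
    rw [sum_comm]; exact sum_congr rfl fun j _ => sum_congr rfl fun m _ => by ring
  simp only [koszul]; rw [h2, h3, clm_expand₃ D u v w]
  simp only [← sum_add_distrib, ← sum_sub_distrib, mul_sum]
  exact sum_congr rfl fun i _ => sum_congr rfl fun j _ => sum_congr rfl fun m _ => by ring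

lemma bil_chrL_eq_koszul (hs : UniqueDiffOn ℝ s) (hG : SmoothMat G s) (hdet : NonDeg G s)
  (hsymm : ∀ z ∈ s, ∀ i j, G z i j = G z j i) {z : 𝔼 n} (hz : z ∈ s) (u v w : 𝔼 n) : matL (G z)
  (chrL s G z u v) w = koszul (𝒟 (fun z => matL (G z)) s z) u v w := by
  rw [koszul_expand]
  have hk : ∀ i j m, koszul (𝒟 (fun z => matL (G z)) s z) (𝐞 i)
      (𝐞 j) (𝐞 m) = ∑ l, G z l m * chr s G l i j z := by
    intro i j m; simp only [koszul, fderivWithin_matL hs hG hz, bil_single, chr, Matrix.of_apply]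
    have hx : ∀ X : Fin n → ℝ, ∑ l, G z l m * ((1 / 2) * ∑ m', (G z)⁻¹ l m' * X m') =
        (1 / 2) * X m := by
      intro X; have h1 : G z * (G z)⁻¹ = 1 := Matrix.mul_nonsing_inv _ (hdet z hz).isUnit
      have h2 : ∀ m', ∑ l, G z l m * (G z)⁻¹ l m' = if m = m' then 1 else 0 := by
        intro m'; have := congrFun (congrFun h1 m) m'
        rw [Matrix.mul_apply, Matrix.one_apply] at this; simp_all
      calc _ = (1 / 2) * ∑ m', (∑ l, G z l m * (G z)⁻¹ l m') * X m' := by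
            simp only [mul_sum, sum_mul]; rw [sum_comm]
            grind
        _ = _ := by simp [h2]
    rw [hx]; rfl
  simp only [hk]; rw [matL_apply]; simp only [bil, chrL_apply, Matrix.of_apply]; rw [sum_comm]
  simp only [mul_sum, sum_mul]
  have : ∀ m : Fin n, ∑ l, ∑ i, ∑ j, G z l m * (chr s G l i j z * u i * v j) * w m =
      ∑ i, ∑ j, ∑ l, u i * v j * w m * (G z l m * chr s G l i j z) := by
    intro m; rw [sum_comm]; refine sum_congr rfl fun i _ => ?_
    rw [sum_comm]
    grind
  simp only [this]; rw [sum_comm]; refine sum_congr rfl fun i _ => ?_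
  rw [sum_comm]

lemma bil_single_left (M : 𝕄 n) (l : Fin n) (v : 𝔼 n) : bil M (𝐞 l) v = ∑ j, M l j * v j := by
  rw [bil, Finset.sum_eq_single l (by simp_all) (by simp)]
  simp

lemma bil_ric_eq_sum_curvature (hs : UniqueDiffOn ℝ s) (hG : SmoothMat G s) (hdet : NonDeg G s)
  {z : 𝔼 n} (hz : z ∈ s) (u v : 𝔼 n) : bil (ric s G z) u v = ∑ l,
  (curvature s (chrL s G) z (𝐞 l) u v) l := by
  have h1 : ∀ l, (curvature s (chrL s G) z (𝐞 l) u v) l =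
      ∑ i, ∑ j, (pd s l (chr s G l i j) z - pd s i (chr s G l l j) z
    + ∑ m, (chr s G l l m z * chr s G m i j z - chr s G l i m z * chr s G m l j z)) * u i * v j := by
    intro l
    have e1 : (𝒟 (chrL s G) s z (𝐞 l) u v) l =
        ∑ i, ∑ j, pd s l (chr s G l i j) z * u i * v j := fderivWithin_chrL hs hG hdet hz _ u v l
    have e2 : (𝒟 (chrL s G) s z u (𝐞 l) v) l = ∑ i, ∑ j, pd s i (chr s G l l j) z * u i * v j := by
      rw [fderivWithin_chrL hs hG hdet hz, bil_single_left, sum_comm]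
      refine sum_congr rfl fun j _ => ?_
      rw [Matrix.of_apply, clm_expand (𝒟 (chr s G l l j) s z) u]
      simp only [pd, sum_mul, smul_eq_mul]; exact sum_congr rfl fun i _ => by ring
    have e3 : (chrL s G z (𝐞 l) (chrL s G z u v)) l =
        ∑ i, ∑ j, (∑ m, chr s G l l m z * chr s G m i j z) * u i * v j := by
      rw [chrL_apply, bil_single_left]
      simp only [chrL_apply, bil, Matrix.of_apply, mul_sum, sum_mul]; rw [sum_comm]
      refine sum_congr rfl fun i _ => ?_
      rw [sum_comm]; exact sum_congr rfl fun j _ => sum_congr rfl fun m _ => by ring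
    have e4 : (chrL s G z u (chrL s G z (𝐞 l) v)) l =
        ∑ i, ∑ j, (∑ m, chr s G l i m z * chr s G m l j z) * u i * v j := by
      have : ∀ m, (chrL s G z (𝐞 l) v) m = ∑ j, chr s G m l j z * v j := by
        intro m; rw [chrL_apply, bil_single_left]; rfl
      rw [chrL_apply]; simp only [bil, Matrix.of_apply, this, mul_sum, sum_mul]
      refine sum_congr rfl fun i _ => ?_
      rw [sum_comm]; exact sum_congr rfl fun j _ => sum_congr rfl fun m _ => by ring
    simp only [curvature, PiLp.add_apply, PiLp.sub_apply, e1, e2, e3, e4]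
    simp only [← sum_add_distrib, ← sum_sub_distrib]
    refine sum_congr rfl fun i _ => sum_congr rfl fun j _ => ?_
    rw [sum_sub_distrib]; ring
  simp only [h1, bil, ric, sum_mul]; symm; rw [sum_comm]; refine sum_congr rfl fun i _ => ?_
  rw [sum_comm]

lemma eq_zero_of_bil {M : 𝕄 n} (hM : M.det ≠ 0) {u : 𝔼 n} (h : ∀ v, bil M u v = 0) : u = 0 := by
  have h1 : Matrix.vecMul u.ofLp M = 0 := by
    ext j; have := h (𝐞 j); rw [bil_swap, bil_single_left] at this
    rw [Matrix.vecMul, dotProduct, Pi.zero_apply, ← this]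
    exact sum_congr rfl fun i _ => by rw [Matrix.transpose_apply]; ring
  have h2 := Matrix.eq_zero_of_vecMul_eq_zero hM h1; simp_all

lemma sum_coord_eq_trace (T : 𝔼 n →ₗ[ℝ] 𝔼 n) : ∑ l, T (𝐞 l) l = LinearMap.trace ℝ _ T := by
  rw [LinearMap.trace_eq_sum_inner T (EuclideanSpace.basisFun (Fin n) ℝ)]
  simp [EuclideanSpace.inner_single_left]

section Transform

variable {Φ : 𝔼 n → 𝔼 n}

lemma chrL_transform (hs : UniqueDiffOn ℝ s) (hcl : s ⊆ closure (interior s))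
  (hs' : UniqueDiffOn ℝ s') (hΦ : SmoothOn Φ s) (hmaps : MapsTo Φ s s') (hG : SmoothMat G s)
  (hG' : SmoothMat G' s') (hdet : NonDeg G s) (hdet' : NonDeg G' s')
  (hsymm : ∀ z ∈ s, ∀ i j, G z i j = G z j i) (hsymm' : ∀ z ∈ s', ∀ i j, G' z i j = G' z j i)
  (hA : ∀ z ∈ s, Function.Surjective (𝒟 Φ s z)) (h : ∀ z ∈ s, ∀ u v, bil (G z) u v =
  bil (G' (Φ z)) (𝒟 Φ s z u) (𝒟 Φ s z v)) {z : 𝔼 n} (hz : z ∈ s) (u v : 𝔼 n) : 𝒟 Φ s z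
  (chrL s G z u v) = 𝒟 (𝒟 Φ s) s z u v + chrL s' G' (Φ z) (𝒟 Φ s z u) (𝒟 Φ s z v) :=
  christoffel_transform hs hcl hΦ hmaps (g := fun z => matL (G z)) (g' := fun z => matL (G' z))
    (fun z hz u v => by simp only [matL_apply]; exact h z hz u v)
    (differentiableOn_matL hG) (differentiableOn_matL hG')
    (fun w hw u v => by simp only [matL_apply]; exact bil_symm (hsymm' w hw) u v)
    (fun w hw u hu => eq_zero_of_bil (hdet' w hw) fun v => by rw [← matL_apply]; exact hu v)
    (fun z hz => bil_chrL_eq_koszul hs hG hdet hsymm hz)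
    (fun z hz => bil_chrL_eq_koszul hs' hG' hdet' hsymm' hz) hA hz u v

lemma ric_transform (hs : UniqueDiffOn ℝ s) (hcl : s ⊆ closure (interior s))
  (hs' : UniqueDiffOn ℝ s') (hΦ : SmoothOn Φ s) (hmaps : MapsTo Φ s s') (hG : SmoothMat G s)
  (hG' : SmoothMat G' s') (hdet : NonDeg G s) (hdet' : NonDeg G' s')
  (hsymm : ∀ z ∈ s, ∀ i j, G z i j = G z j i) (hsymm' : ∀ z ∈ s', ∀ i j, G' z i j = G' z j i)
  (hA : ∀ z ∈ s, Bijective (𝒟 Φ s z)) (h : ∀ z ∈ s, ∀ u v, bil (G z) u v =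
  bil (G' (Φ z)) (𝒟 Φ s z u) (𝒟 Φ s z v)) {z : 𝔼 n} (hz : z ∈ s) (u v : 𝔼 n) : bil (ric s G z) u v =
  bil (ric s' G' (Φ z)) (𝒟 Φ s z u) (𝒟 Φ s z v) := by
  have hw := hmaps hz; set A := 𝒟 Φ s z with hAdef
  rw [bil_ric_eq_sum_curvature hs hG hdet hz, bil_ric_eq_sum_curvature hs' hG' hdet' hw]
  have key := fun x => curvature_transform hs hcl hΦ hmaps (differentiableOn_chrL hs hG hdet)
    (differentiableOn_chrL hs' hG' hdet')
    (fun z hz u v => chrL_transform hs hcl hs' hΦ hmaps hG hG' hdet hdet' hsymm hsymm'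
      (fun z hz => (hA z hz).2) h hz u v) hz x u v
  have lin : ∀ (s : Set (𝔼 n)) (γ : 𝔼 n → 𝔼 n →L[ℝ] 𝔼 n →L[ℝ] 𝔼 n) (z u v : 𝔼 n),
      ∃ T : 𝔼 n →ₗ[ℝ] 𝔼 n, ∀ x, T x = curvature s γ z x u v := by
    intro s γ z u v
    refine ⟨{ toFun := fun x => curvature s γ z x u v, map_add' := ?_, map_smul' := ?_ },
      fun _ => rfl⟩
    · intro x y; simp only [curvature, map_add, add_apply]; abel
    · intro r x; simp only [curvature, map_smul, smul_apply, RingHom.id_apply, smul_sub, smul_add]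
  obtain ⟨T, hT⟩ := lin s (chrL s G) z u v
  obtain ⟨T', hT'⟩ := lin s' (chrL s' G') (Φ z) (A u) (A v); simp only [← hT, ← hT'] at key ⊢
  rw [sum_coord_eq_trace, sum_coord_eq_trace]
  let e : 𝔼 n ≃ₗ[ℝ] 𝔼 n := LinearEquiv.ofBijective A.toLinearMap (hA z hz)
  have h3 : T' = e.conj T := by
    ext1 x
    rw [LinearEquiv.conj_apply_apply]; obtain ⟨y, rfl⟩ := e.surjective x
    rw [LinearEquiv.symm_apply_apply]; exact (hT' (e y)).trans (key y).symm
  rw [h3, LinearMap.trace_conj']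

end Transform

end Index

section Algebra

open Matrix

lemma bil_eq_dotProduct (M : 𝕄 n) (a b : 𝔼 n) : bil M a b = a.ofLp ⬝ᵥ (M *ᵥ b.ofLp) := by
  simp only [bil, dotProduct, mulVec, mul_sum]
  grind

lemma posDef_of_bil {G : 𝕄 n} (hs : ∀ i j, G i j = G j i) (hp : ∀ a : 𝔼 n, a ≠ 0 → 0 < bil G a a) :
  G.PosDef := by
  refine Matrix.PosDef.of_dotProduct_mulVec_pos ?_ ?_
  · ext i j; simp [hs i j]
  · intro x hx; have := hp (WithLp.toLp 2 x) (by simp_all)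
    rw [bil_eq_dotProduct] at this; assumption

lemma det_ne_zero_of_bil {G : 𝕄 n} (hs : ∀ i j, G i j = G j i) (hp : ∀ a : 𝔼 n, a ≠ 0 → 0 <
  bil G a a) : G.det ≠ 0 :=
  (posDef_of_bil hs hp).det_pos.ne'

lemma inv_zero_zero_pos {G : 𝕄 n} (hG : G.PosDef) : 0 < G⁻¹ 0 0 := hG.inv.diag_pos

open scoped MatrixOrder in
lemma trace_neg_of_tangential {G J : 𝕄 n} (hn : ∃ i : Fin n, i ≠ 0) (hG : G.PosDef)
  (hJ : ∀ a : Fin n → ℝ, a ≠ 0 → a 0 = 0 → a ⬝ᵥ (J *ᵥ a) < 0) : (G⁻¹ * J).trace -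
  ((G⁻¹ *ᵥ Pi.single 0 1) ⬝ᵥ (J *ᵥ (G⁻¹ *ᵥ Pi.single 0 1))) / G⁻¹ 0 0 < 0 := by
  have hGs : G.transpose = G := by simpa using hG.isHermitian.eq
  have hIs : G⁻¹.transpose = G⁻¹ := by rw [transpose_nonsing_inv, hGs]
  have hdet : IsUnit G.det := hG.det_pos.ne'.isUnit; have hN0 := inv_zero_zero_pos hG
  set N : Fin n → ℝ := G⁻¹ *ᵥ Pi.single 0 1 with hN
  have hN00 : N 0 = G⁻¹ 0 0 := by simp [hN]
  set N0 := G⁻¹ 0 0 with hN0d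
  set P : 𝕄 n := G⁻¹ - N0⁻¹ • vecMulVec N N with hP
  have hGN : G *ᵥ N = Pi.single 0 1 := by rw [hN, mulVec_mulVec, mul_nonsing_inv _ hdet, one_mulVec]
  have hNG : N ᵥ* G = Pi.single 0 1 := by rw [← mulVec_transpose, hGs, hGN]
  have hPG : P * G = 1 - N0⁻¹ • vecMulVec N (Pi.single 0 1) := by
    rw [hP, sub_mul, nonsing_inv_mul _ hdet, smul_mul_assoc, vecMulVec_mul, hNG]
  have hPe : P *ᵥ Pi.single 0 1 = 0 := by
    rw [hP, sub_mulVec, ← hN, smul_mulVec, vecMulVec_mulVec]; ext i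
    simp only [Pi.sub_apply, Pi.smul_apply, dotProduct_single, mul_one, hN00]; simp; field_simp
    simp
  have hPs : P.transpose = P := by simp_all
  have heP : δ₀ ᵥ* P = 0 := by rw [← mulVec_transpose, hPs, hPe]
  have hPGP : P * G * P = P := by
    rw [hPG, sub_mul, one_mul, smul_mul_assoc, vecMulVec_mul, heP]; simp
  obtain ⟨L, hL⟩ := CStarAlgebra.nonneg_iff_eq_star_mul_self.mp hG.posSemidef.nonneg
  rw [star_eq_conjTranspose, conjTranspose_eq_transpose_of_trivial] at hL; set C := L * P with hC
  have hCC : C.transpose * C = P := by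
    rw [hC, transpose_mul, hPs, Matrix.mul_assoc, ← Matrix.mul_assoc L.transpose, ← hL,
      ← Matrix.mul_assoc, hPGP]
  have hC0 : ∀ i, C i 0 = 0 := by
    intro i; have : C *ᵥ Pi.single 0 1 = 0 := by rw [hC, ← mulVec_mulVec, hPe, mulVec_zero]
    simpa using congrFun this i
  have htr : (G⁻¹ * J).trace - (N ⬝ᵥ (J *ᵥ N)) / N0 = (P * J).trace := by
    rw [hP, sub_mul, trace_sub, smul_mul_assoc, trace_smul, vecMulVec_mul, trace_vecMulVec]
    rw [dotProduct_comm N (N ᵥ* J), ← dotProduct_mulVec, smul_eq_mul, div_eq_inv_mul]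
  have htr2 : (P * J).trace = ∑ i, C i ⬝ᵥ (J *ᵥ C i) := by
    rw [← hCC, Matrix.mul_assoc, trace_mul_comm, Matrix.trace]; refine sum_congr rfl fun i _ => ?_
    simp only [diag_apply, Matrix.mul_apply, transpose_apply, dotProduct, mulVec, mul_sum, sum_mul]
    rw [sum_comm]; exact sum_congr rfl fun y _ => sum_congr rfl fun x _ => by ring
  rw [htr, htr2]
  have hle : ∀ i, C i ⬝ᵥ (J *ᵥ C i) ≤ 0 := by
    intro i
    by_cases h : C i = 0
    · rw [h]; simp
    · exact (hJ _ h (hC0 i)).le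
  refine Finset.sum_neg' (fun i _ => hle i) ?_
  by_contra hcon
  push Not at hcon
  have hCz : C = 0 := by
    ext i j; by_contra hij; have hCi : C i ≠ 0 := fun h => hij (by rw [h]; rfl)
    exact absurd (hJ _ hCi (hC0 i)) (not_lt.2 (hcon i (Finset.mem_univ i)))
  have hPz : P = 0 := by rw [← hCC, hCz]; simp
  rw [hPz, zero_mul] at hPG; obtain ⟨i, hi⟩ := hn; have := congrFun (congrFun hPG i) i
  simp [vecMulVec, hi] at this

lemma second_order_term_pos {G J : 𝕄 n} (hn : ∃ i : Fin n, i ≠ 0) (hG : G.PosDef)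
  (hJs : ∀ i j, J i j = J j i) (hJ : ∀ a : Fin n → ℝ, a ≠ 0 → a 0 = 0 → a ⬝ᵥ (J *ᵥ a) < 0)
  {v : Fin n → ℝ} (hv : v ≠ 0) : 0 < 2 * v 0 * ((G⁻¹ *ᵥ Pi.single 0 1) ⬝ᵥ (J *ᵥ v)) - G⁻¹ 0 0 *
  (v ⬝ᵥ (J *ᵥ v)) - v 0 ^ 2 * (G⁻¹ * J).trace := by
  have htr := trace_neg_of_tangential hn hG hJ; have hN0 := inv_zero_zero_pos hG
  set N : Fin n → ℝ := G⁻¹ *ᵥ Pi.single 0 1 with hN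
  have hN00 : N 0 = G⁻¹ 0 0 := by simp [hN]
  set N0 := G⁻¹ 0 0 with hN0d
  set T := (G⁻¹ * J).trace; set w : Fin n → ℝ := v - (v 0 / N0) • N with hw
  have hw0 : w 0 = 0 := by simp [hw, hN00]; field_simp; simp
  have hsym : ∀ a b : Fin n → ℝ, a ⬝ᵥ (J *ᵥ b) = b ⬝ᵥ (J *ᵥ a) := by
    intro a b; have : J.transpose = J := by aesop
    rw [dotProduct_mulVec, dotProduct_comm, ← mulVec_transpose, this]
  have hww : w ⬝ᵥ (J *ᵥ w) = v ⬝ᵥ (J *ᵥ v) - 2 * (v 0 / N0) * (N ⬝ᵥ (J *ᵥ v)) +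
      (v 0 / N0) ^ 2 * (N ⬝ᵥ (J *ᵥ N)) := by
    simp only [hw, mulVec_sub, mulVec_smul, dotProduct_sub, sub_dotProduct, smul_dotProduct,
      dotProduct_smul, smul_eq_mul]
    rw [hsym v N]; ring
  have hmain : 2 * v 0 * (N ⬝ᵥ (J *ᵥ v)) - N0 * (v ⬝ᵥ (J *ᵥ v)) - v 0 ^ 2 * T =
      -(N0 * (w ⬝ᵥ (J *ᵥ w))) - v 0 ^ 2 * (T - (N ⬝ᵥ (J *ᵥ N)) / N0) := by
    rw [hww]; field_simp; ring
  rw [hmain]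
  by_cases hwz : w = 0
  · have hv0 : v 0 ≠ 0 := by intro h; simp_all
    have : 0 < v 0 ^ 2 := by positivity
    rw [hwz]; simp only [mulVec_zero, dotProduct_zero, mul_zero, neg_zero, zero_sub]; nlinarith
  · have h1 := hJ w hwz hw0; have h2 : 0 ≤ v 0 ^ 2 := sq_nonneg _; nlinarith

end Algebra

section Ramp

open MeasureTheory

/-- A smooth even bump supported in `[-1, 1]`. -/
def bump (s : ℝ) : ℝ := expNegInvGlue (1 - s ^ 2)

lemma contDiff_bump : ContDiff ℝ ∞ bump :=
  expNegInvGlue.contDiff.comp (contDiff_const.sub (contDiff_id.pow 2))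

lemma bump_nonneg (s : ℝ) : 0 ≤ bump s := expNegInvGlue.nonneg _

lemma bump_pos {s : ℝ} (h : s ∈ Ioo (-1 : ℝ) 1) : 0 < bump s :=
  expNegInvGlue.pos_of_pos (by nlinarith [h.1, h.2])

lemma bump_eq_zero {s : ℝ} (h : s ∉ Ioo (-1 : ℝ) 1) : bump s = 0 := by
  refine expNegInvGlue.zero_of_nonpos ?_; by_contra hs
  push Not at hs
  exact h ⟨by nlinarith, by nlinarith⟩

lemma bump_neg (s : ℝ) : bump (-s) = bump s := by simp [bump]

lemma integrable_bump (a b : ℝ) : IntervalIntegrable bump volume a b :=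
  contDiff_bump.continuous.intervalIntegrable a b

lemma integral_bump_pos : 0 < ∫ s in (-1 : ℝ)..1, bump s :=
  intervalIntegral.intervalIntegral_pos_of_pos_on (integrable_bump _ _)
    (fun _ h => bump_pos h) (by simp)

/-- A smooth step from `0` to `1` on `[-1, 1]`. -/
def step (s : ℝ) : ℝ := (∫ x in (-1 : ℝ)..1, bump x)⁻¹ * ∫ x in (-1 : ℝ)..s, bump x

/-- The normalised bump. -/
def stepDeriv (s : ℝ) : ℝ := (∫ x in (-1 : ℝ)..1, bump x)⁻¹ * bump s

/-- A smooth convex function that is `0` for `s ≤ -1` and `s` for `s ≥ 1`. -/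
def ramp (s : ℝ) : ℝ := ∫ x in (-1 : ℝ)..s, step x

lemma hasDerivAt_step (s : ℝ) : HasDerivAt step (stepDeriv s) s :=
  (intervalIntegral.integral_hasDerivAt_right (integrable_bump _ _)
    (contDiff_bump.continuous.stronglyMeasurableAtFilter _ _)
    contDiff_bump.continuous.continuousAt).const_mul _

lemma contDiff_infty_of_hasDerivAt {f f' : ℝ → ℝ} (h : ∀ s, HasDerivAt f (f' s) s)
  (hf' : ContDiff ℝ ∞ f') : ContDiff ℝ ∞ f := by
  rw [contDiff_infty_iff_deriv]; refine ⟨fun s => (h s).differentiableAt, ?_⟩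
  rwa [show deriv f = f' from funext fun s => (h s).deriv]

lemma contDiff_stepDeriv : ContDiff ℝ ∞ stepDeriv := contDiff_const.mul contDiff_bump

lemma contDiff_step : ContDiff ℝ ∞ step :=
  contDiff_infty_of_hasDerivAt hasDerivAt_step contDiff_stepDeriv

lemma hasDerivAt_ramp (s : ℝ) : HasDerivAt ramp (step s) s :=
  intervalIntegral.integral_hasDerivAt_right (contDiff_step.continuous.intervalIntegrable _ _)
    (contDiff_step.continuous.stronglyMeasurableAtFilter _ _)
    contDiff_step.continuous.continuousAt

lemma contDiff_ramp : ContDiff ℝ ∞ ramp :=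
  contDiff_infty_of_hasDerivAt hasDerivAt_ramp contDiff_step

lemma stepDeriv_nonneg (s : ℝ) : 0 ≤ stepDeriv s :=
  mul_nonneg (inv_nonneg.2 integral_bump_pos.le) (bump_nonneg s)

lemma stepDeriv_pos {s : ℝ} (h : s ∈ Ioo (-1 : ℝ) 1) : 0 < stepDeriv s :=
  mul_pos (inv_pos.2 integral_bump_pos) (bump_pos h)

lemma stepDeriv_eq_zero {s : ℝ} (h : s ∉ Ioo (-1 : ℝ) 1) : stepDeriv s = 0 := by
  rw [stepDeriv, bump_eq_zero h, mul_zero]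

lemma monotone_step : Monotone step :=
  monotone_of_hasDerivAt_nonneg hasDerivAt_step stepDeriv_nonneg

lemma step_of_le {s : ℝ} (h : s ≤ -1) : step s = 0 := by
  have h1 : ∫ x in (-1 : ℝ)..s, bump x = 0 := by
    rw [intervalIntegral.integral_congr (g := fun _ => 0)]
    · simp
    · intro x hx; rw [uIcc_of_ge h] at hx; exact bump_eq_zero fun h' => by grind
  rw [step, h1, mul_zero]

lemma step_of_ge {s : ℝ} (h : 1 ≤ s) : step s = 1 := by
  have h1 : ∫ x in (1 : ℝ)..s, bump x = 0 := by
    rw [intervalIntegral.integral_congr (g := fun _ => 0)]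
    · simp
    · intro x hx; rw [uIcc_of_le h] at hx; exact bump_eq_zero fun h' => by grind
  have h2 := intervalIntegral.integral_add_adjacent_intervals (integrable_bump (-1) 1)
    (integrable_bump 1 s)
  rw [step, ← h2, h1, add_zero, inv_mul_cancel₀ integral_bump_pos.ne']

lemma step_nonneg (s : ℝ) : 0 ≤ step s := by
  rcases le_total s (-1) with h | h
  · rw [step_of_le h]
  · rw [← step_of_le le_rfl]; exact monotone_step h

lemma step_le_one (s : ℝ) : step s ≤ 1 := by
  rcases le_total s 1 with h | h
  · rw [← step_of_ge le_rfl]; exact monotone_step h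
  · rw [step_of_ge h]

lemma step_neg (s : ℝ) : step (-s) = 1 - step s := by
  have h1 : ∫ x in (-1 : ℝ)..-s, bump x = ∫ x in s..1, bump x := by
    rw [← intervalIntegral.integral_comp_neg]; simp only [bump_neg]
  rw [step, h1, step, eq_sub_iff_add_eq, ← mul_add, add_comm,
    intervalIntegral.integral_add_adjacent_intervals (integrable_bump _ _)
    (integrable_bump _ _), inv_mul_cancel₀ integral_bump_pos.ne']

lemma ramp_of_le {s : ℝ} (h : s ≤ -1) : ramp s = 0 := by
  rw [ramp, intervalIntegral.integral_congr (g := fun _ => 0)]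
  · simp
  · intro x hx; rw [uIcc_of_ge h] at hx; exact step_of_le hx.2

lemma ramp_of_ge {s : ℝ} (h : 1 ≤ s) : ramp s = s := by
  have hi : ∀ a b, IntervalIntegrable step volume a b := fun a b =>
    contDiff_step.continuous.intervalIntegrable _ _
  have h1 : ∫ x in (1 : ℝ)..s, step x = s - 1 := by
    rw [intervalIntegral.integral_congr (g := fun _ => 1)]
    · simp
    · intro x hx; rw [uIcc_of_le h] at hx; exact step_of_ge hx.1
  have h2 : ∫ x in (-1 : ℝ)..1, step x = 1 := by
    have h3 : ∫ x in (-1 : ℝ)..1, step (-x) = ∫ x in (-1 : ℝ)..1, step x := by simp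
    simp only [step_neg] at h3; rw [intervalIntegral.integral_sub (by simp) (hi _ _)] at h3
    simp at h3; linarith
  rw [ramp, ← intervalIntegral.integral_add_adjacent_intervals (hi _ 1) (hi _ _), h1, h2]; ring

lemma monotone_ramp : Monotone ramp := monotone_of_hasDerivAt_nonneg hasDerivAt_ramp step_nonneg

lemma ramp_nonneg (s : ℝ) : 0 ≤ ramp s := by
  rcases le_total s (-1) with h | h
  · rw [ramp_of_le h]
  · rw [← ramp_of_le le_rfl]; exact monotone_ramp h

lemma le_ramp (s : ℝ) : s ≤ ramp s := by
  have hm : Monotone fun s => s - ramp s :=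
    monotone_of_hasDerivAt_nonneg (fun s => (hasDerivAt_id s).sub (hasDerivAt_ramp s))
      fun s => sub_nonneg.2 (step_le_one s)
  have h1 := hm (le_max_left s 1); simp only [ramp_of_ge (le_max_right s 1), sub_self] at h1
  linarith

lemma ramp_le (s : ℝ) : ramp s ≤ max s 1 := by
  rw [← ramp_of_ge (le_max_right s 1)]; exact monotone_ramp (le_max_left _ _)

/-- The rescaled ramp. -/
def rampε (ε t : ℝ) : ℝ := ε * ramp (t / ε)

lemma contDiff_rampε (ε : ℝ) : ContDiff ℝ ∞ (rampε ε) :=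
  contDiff_const.mul (contDiff_ramp.comp (contDiff_id.div_const ε))

lemma hasDerivAt_rampε {ε : ℝ} (hε : ε ≠ 0) (t : ℝ) : HasDerivAt (rampε ε) (step (t / ε)) t := by
  have := ((hasDerivAt_ramp (t / ε)).comp t ((hasDerivAt_id t).div_const ε)).const_mul ε
  refine this.congr_deriv ?_
  grind

lemma hasDerivAt_step_div (ε t : ℝ) : HasDerivAt (fun t => step (t / ε))
  (stepDeriv (t / ε) / ε) t := by
  have := (hasDerivAt_step (t / ε)).comp t ((hasDerivAt_id t).div_const ε)
  aesop

lemma rampε_nonneg {ε : ℝ} (hε : 0 ≤ ε) (t : ℝ) : 0 ≤ rampε ε t := mul_nonneg hε (ramp_nonneg _)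

lemma le_rampε {ε : ℝ} (hε : 0 < ε) (t : ℝ) : t ≤ rampε ε t := by
  have := mul_le_mul_of_nonneg_left (le_ramp (t / ε)) hε.le; rwa [mul_div_cancel₀ _ hε.ne'] at this

lemma rampε_le {ε : ℝ} (hε : 0 < ε) (t : ℝ) : rampε ε t ≤ max t ε := by
  have := mul_le_mul_of_nonneg_left (ramp_le (t / ε)) hε.le
  rwa [mul_max_of_nonneg _ _ hε.le, mul_div_cancel₀ _ hε.ne', mul_one] at this

lemma rampε_of_le {ε t : ℝ} (hε : 0 < ε) (h : t ≤ -ε) : rampε ε t = 0 := by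
  rw [rampε, ramp_of_le, mul_zero]; rw [div_le_iff₀ hε]; linarith

lemma rampε_of_ge {ε t : ℝ} (hε : 0 < ε) (h : ε ≤ t) : rampε ε t = t := by
  rw [rampε, ramp_of_ge, mul_div_cancel₀ _ hε.ne']; rw [le_div_iff₀ hε]; linarith

end Ramp

section Fold

/-- The folded graph `z ↦ (y, z; z₀ - f(z₀), f(z₀))`. -/
def foldMap (f : ℝ → ℝ) (y : F) (z : 𝔼 n) : 𝔽 := ((y, z), z 0 - f (z 0), f (z 0))

/-- The quadrant `{σ ≤ 0 ≤ τ}`. -/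
def quadrant (n : ℕ) (F : Type*) : Set ((F × 𝔼 n) × ℝ × ℝ) :=
  {q | q.2.1 ≤ 0 ∧ 0 ≤ q.2.2}

/-- The velocity of the fold map in the `i`-th direction when `f' = 0`. -/
def foldVec (F : Type*) [NormedAddCommGroup F] (i : Fin n) : (F × 𝔼 n) × ℝ × ℝ :=
  ((0, EuclideanSpace.single i 1), (Pi.single 0 1 : Fin n → ℝ) i, 0)

/-- The change of velocity of the fold map in direction `z₀`. -/
def jumpVec (n : ℕ) (F : Type*) [NormedAddCommGroup F] : (F × 𝔼 n) × ℝ × ℝ := ((0, 0), -1, 1)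

lemma uniqueDiffOn_quadrant : UniqueDiffOn ℝ (quadrant n F) := by
  have h : quadrant n F = univ ×ˢ (Iic 0 ×ˢ Ici 0) := by ext q; simp [quadrant]
  rw [h]; exact uniqueDiffOn_univ.prod ((uniqueDiffOn_Iic 0).prod (uniqueDiffOn_Ici 0))

lemma proj_zero_single (i : Fin n) : proj₀ (𝐞 i) = δ₀ i := by
  change (𝐞 i).ofLp 0 = _; simp [Pi.single_apply, eq_comm]

lemma exists_hasFDerivAt_foldMap {f : ℝ → ℝ} {f' : ℝ} {y : F} {z : 𝔼 n}
  (hf : HasDerivAt f f' (z 0)) : ∃ L : 𝔼 n →L[ℝ] 𝔽, HasFDerivAt (foldMap f y) L z ∧ ∀ i, L (𝐞 i) =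
  foldVec F i + (f' * δ₀ i) • jumpVec n F := by
  have h0 : HasFDerivAt (fun z : 𝔼 n => z 0) proj₀ z := (proj₀).hasFDerivAt
  have h1 := hf.hasFDerivAt.comp z h0
  refine ⟨_, ((hasFDerivAt_const y z).prodMk (hasFDerivAt_id z)).prodMk ((h0.sub h1).prodMk h1), ?_⟩
  intro i
  simp only [foldVec, jumpVec, ContinuousLinearMap.prod_apply, zero_apply,
    ContinuousLinearMap.id_apply, sub_apply, ContinuousLinearMap.comp_apply,
    proj_zero_single, ContinuousLinearMap.toSpanSingleton_apply, smul_eq_mul, Prod.mk_add_mk, Prod.smul_mk, smul_zero, add_zero, zero_add, mul_neg, mul_one]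
  refine Prod.ext rfl (Prod.ext ?_ ?_) <;> simp <;> ring

variable {S : Set ((F × 𝔼 n) × ℝ × ℝ)}

lemma hasFDerivWithinAt_comp_foldMap {s : Set (𝔼 n)} {f : ℝ → ℝ} {f' : ℝ} {y : F} {z : 𝔼 n}
  (hz : z ∈ s) (hf : HasDerivAt f f' (z 0)) (hmaps : MapsTo (foldMap f y) s S) {g : 𝔽 → ℝ}
  (hg : SmoothOn g S) : ∃ L : 𝔼 n →L[ℝ] ℝ, HasFDerivWithinAt (g ∘ foldMap f y) L s z ∧ ∀ i, L
  (𝐞 i) = 𝒟 g S (foldMap f y z) (foldVec F i) + f' * (δ₀ i * 𝒟 g S (foldMap f y z)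
  (jumpVec n F)) := by
  obtain ⟨L, hL, hLi⟩ := exists_hasFDerivAt_foldMap (y := y) hf
  have hg' := hasFDerivWithin hg (hmaps hz)
  refine ⟨_, hg'.comp z hL.hasFDerivWithinAt hmaps, fun i => ?_⟩
  rw [ContinuousLinearMap.comp_apply, hLi, map_add, map_smul, smul_eq_mul, mul_assoc]

variable (S) (G : (F × 𝔼 n) × ℝ × ℝ → 𝕄 n)

/-- The jump of the normal derivative of the metric. -/
def jump (q : 𝔽) : 𝕄 n := fun i j => 𝒟 (fun q => G q i j) S q (jumpVec n F)

/-- Christoffel symbols of the folded metric when `f' = 0`. -/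
def foldChr (l i j : Fin n) (q : 𝔽) : ℝ :=
  (1 / 2) * ∑ m, (G q)⁻¹ l m * (𝒟 (fun q => G q j m) S q (foldVec F i) +
    𝒟 (fun q => G q i m) S q (foldVec F j) -
    𝒟 (fun q => G q i j) S q (foldVec F m))

/-- The coefficient of `f'` in the Christoffel symbols of the folded metric. -/
def jumpChr (l i j : Fin n) (q : 𝔽) : ℝ := (1 / 2) * ∑ m, (G q)⁻¹ l m * (δ₀ i * jump S G q j m +
    δ₀ j * jump S G q i m - δ₀ m * jump S G q i j)

/-- Christoffel symbols of the folded metric when `f' = a`. -/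
def foldChrAt (l i j : Fin n) (q : 𝔽) (a : ℝ) : ℝ := foldChr S G l i j q + a * jumpChr S G l i j q

/-- The part without `f''` of the derivatives of the Christoffel symbols. -/
def foldChrDeriv (r l i j : Fin n) (q : 𝔽) (a : ℝ) : ℝ := (𝒟 (foldChr S G l i j) S q (foldVec F r) +
    a * (δ₀ r * 𝒟 (foldChr S G l i j) S q (jumpVec n F))) +
  a * (𝒟 (jumpChr S G l i j) S q (foldVec F r) +
    a * (δ₀ r * 𝒟 (jumpChr S G l i j) S q (jumpVec n F)))

/-- The part without `f''` of the Ricci tensor of the folded metric. -/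
def foldRic (q : 𝔽) (a : ℝ) : 𝕄 n :=
  fun i j => ∑ l, (foldChrDeriv S G l l i j q a - foldChrDeriv S G i l l j q a
    + ∑ m, (foldChrAt S G l l m q a * foldChrAt S G m i j q a -
      foldChrAt S G l i m q a * foldChrAt S G m l j q a))

/-- The coefficient of `f''` in the Ricci tensor of the folded metric. -/
def jumpRic (q : 𝔽) : 𝕄 n := fun i j => ∑ l, (δ₀ l * jumpChr S G l i j q -
    δ₀ i * jumpChr S G l l j q)

variable {S G}

lemma contDiffOn_jump (hS : UniqueDiffOn ℝ S) (hG : SmoothMat G S) (i j : Fin n) : SmoothOn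
  (fun q => jump S G q i j) S :=
  (smoothOn_fderiv hS (hG i j)).clm_apply contDiffOn_const

lemma contDiffOn_foldChr (hS : UniqueDiffOn ℝ S) (hG : SmoothMat G S) (hdet : NonDeg G S)
  (l i j : Fin n) : SmoothOn (foldChr S G l i j) S := by
  have h : ∀ i j (w : 𝔽), SmoothOn (fun q => 𝒟 (fun q => G q i j) S q w) S := fun i j w =>
    (smoothOn_fderiv hS (hG i j)).clm_apply contDiffOn_const
  exact contDiffOn_const.mul (ContDiffOn.sum fun m _ => (contDiffOn_inv hG hdet l m).mul
    (((h _ _ _).add (h _ _ _)).sub (h _ _ _)))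

lemma contDiffOn_jumpChr (hS : UniqueDiffOn ℝ S) (hG : SmoothMat G S) (hdet : NonDeg G S)
  (l i j : Fin n) : SmoothOn (jumpChr S G l i j) S := by
  have h := contDiffOn_jump hS hG
  exact contDiffOn_const.mul (ContDiffOn.sum fun m _ => (contDiffOn_inv hG hdet l m).mul
    (((contDiffOn_const.mul (h _ _)).add (contDiffOn_const.mul (h _ _))).sub
      (contDiffOn_const.mul (h _ _))))

lemma continuousOn_foldRic (hS : UniqueDiffOn ℝ S) (hG : SmoothMat G S) (hdet : NonDeg G S)
  (i j : Fin n) : ContinuousOn (fun x : 𝔽 × ℝ => foldRic S G x.1 x.2 i j) (S ×ˢ univ) := by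
  have hfst : MapsTo (Prod.fst : 𝔽 × ℝ → _) (S ×ˢ univ) S := fun x hx => hx.1
  have c1 : ∀ l i j, ContinuousOn (fun x : 𝔽 × ℝ =>
      foldChrAt S G l i j x.1 x.2) (S ×ˢ univ) := fun l i j =>
    ((contDiffOn_foldChr hS hG hdet l i j).continuousOn.comp continuousOn_fst hfst).add
      (continuousOn_snd.mul
        ((contDiffOn_jumpChr hS hG hdet l i j).continuousOn.comp continuousOn_fst hfst))
  have c3 : ∀ (g : 𝔽 → ℝ) (w : 𝔽), SmoothOn g S → ContinuousOn (fun x : 𝔽 × ℝ =>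
        𝒟 g S x.1 w) (S ×ˢ univ) := fun g w hg =>
    ((smoothOn_fderiv hS hg).clm_apply
      (contDiffOn_const (c := w))).continuousOn.comp continuousOn_fst hfst
  have c2 : ∀ r l i j, ContinuousOn (fun x : 𝔽 × ℝ =>
      foldChrDeriv S G r l i j x.1 x.2) (S ×ˢ univ) := fun r l i j =>
    have d1 := c3 _ (foldVec F r) (contDiffOn_foldChr hS hG hdet l i j)
    have d2 := c3 _ (jumpVec n F) (contDiffOn_foldChr hS hG hdet l i j)
    have d3 := c3 _ (foldVec F r) (contDiffOn_jumpChr hS hG hdet l i j)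
    have d4 := c3 _ (jumpVec n F) (contDiffOn_jumpChr hS hG hdet l i j)
    (d1.add (continuousOn_snd.mul (continuousOn_const.mul d2))).add
      (continuousOn_snd.mul (d3.add (continuousOn_snd.mul (continuousOn_const.mul d4))))
  refine continuousOn_finsetSum _ fun l _ => ((c2 _ _ _ _).sub (c2 _ _ _ _)).add ?_
  exact continuousOn_finsetSum _ fun m _ => ((c1 _ _ _).mul (c1 _ _ _)).sub ((c1 _ _ _).mul (c1 _ _ _))

lemma continuousOn_jumpRic (hS : UniqueDiffOn ℝ S) (hG : SmoothMat G S) (hdet : NonDeg G S)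
  (i j : Fin n) : ContinuousOn (fun q => jumpRic S G q i j) S :=
  have c := fun l i j => (contDiffOn_jumpChr hS hG hdet l i j).continuousOn
  continuousOn_finsetSum _ fun _ _ => (continuousOn_const.mul (c _ _ _)).sub
    (continuousOn_const.mul (c _ _ _))

lemma pd_comp_foldMap {s : Set (𝔼 n)} (hs : UniqueDiffOn ℝ s) {f f' : ℝ → ℝ} {y : F}
  (hf : ∀ t, HasDerivAt f (f' t) t) (hmaps : MapsTo (foldMap f y) s S) {g : 𝔽 → ℝ}
  (hg : SmoothOn g S) {z : 𝔼 n} (hz : z ∈ s) (i : Fin n) : pd s i (fun z => g (foldMap f y z)) z =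
  𝒟 g S (foldMap f y z) (foldVec F i) + f' (z 0) * (δ₀ i * 𝒟 g S (foldMap f y z)
  (jumpVec n F)) := by
  obtain ⟨L, hL, hLi⟩ := hasFDerivWithinAt_comp_foldMap hz (hf _) hmaps hg
  rw [← hLi, pd, ← hL.fderivWithin (hs z hz)]; rfl

lemma chr_comp_foldMap {s : Set (𝔼 n)} (hs : UniqueDiffOn ℝ s) {f f' : ℝ → ℝ} {y : F}
  (hf : ∀ t, HasDerivAt f (f' t) t) (hmaps : MapsTo (foldMap f y) s S) (hG : SmoothMat G S)
  {z : 𝔼 n} (hz : z ∈ s) (l i j : Fin n) : chr s (fun z => G (foldMap f y z)) l i j z =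
  foldChrAt S G l i j (foldMap f y z) (f' (z 0)) := by
  have h : ∀ a b c, pd s c (fun w => G (foldMap f y w) a b) z =
      𝒟 (fun q => G q a b) S (foldMap f y z) (foldVec F c) +
        f' (z 0) * (δ₀ c * jump S G (foldMap f y z) a b) := fun a b c =>
    pd_comp_foldMap hs hf hmaps (hG a b) hz c
  simp only [chr, h, foldChrAt, foldChr, jumpChr]; simp only [mul_sum]; rw [← sum_add_distrib]
  exact sum_congr rfl fun m _ => by ring

lemma pd_chr_comp_foldMap (hS : UniqueDiffOn ℝ S) {s : Set (𝔼 n)} (hs : UniqueDiffOn ℝ s)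
  {f f' f'' : ℝ → ℝ} {y : F} (hf : ∀ t, HasDerivAt f (f' t) t) (hf' : ∀ t, HasDerivAt f' (f'' t) t)
  (hmaps : MapsTo (foldMap f y) s S) (hG : SmoothMat G S) (hdet : NonDeg G S) {z : 𝔼 n} (hz : z ∈ s)
  (r l i j : Fin n) : pd s r (chr s (fun z => G (foldMap f y z)) l i j) z = foldChrDeriv S G r l i j
  (foldMap f y z) (f' (z 0)) + f'' (z 0) * (δ₀ r * jumpChr S G l i j (foldMap f y z)) := by
  obtain ⟨L1, hL1, hL₁i⟩ := hasFDerivWithinAt_comp_foldMap hz (hf _) hmaps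
    (contDiffOn_foldChr hS hG hdet l i j)
  obtain ⟨L2, hL2, hL₂i⟩ := hasFDerivWithinAt_comp_foldMap hz (hf _) hmaps
    (contDiffOn_jumpChr hS hG hdet l i j)
  have h0 : HasFDerivAt (fun z : 𝔼 n => z 0) proj₀ z := (proj₀).hasFDerivAt
  have h1 := (hf' (z 0)).hasFDerivAt.comp z h0; have hsum := hL1.add (h1.hasFDerivWithinAt.mul hL2)
  have hcongr := hsum.congr (fun w hw => chr_comp_foldMap hs hf hmaps hG hw l i j)
    (chr_comp_foldMap hs hf hmaps hG hz l i j)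
  rw [pd, hcongr.fderivWithin (hs z hz)]
  simp only [add_apply, smul_apply, hL₁i, hL₂i, smul_eq_mul, ContinuousLinearMap.comp_apply,
    proj_zero_single, ContinuousLinearMap.toSpanSingleton_apply, Function.comp]
  rw [foldChrDeriv]; ring

lemma ric_comp_foldMap (hS : UniqueDiffOn ℝ S) {s : Set (𝔼 n)} (hs : UniqueDiffOn ℝ s)
  {f f' f'' : ℝ → ℝ} {y : F} (hf : ∀ t, HasDerivAt f (f' t) t) (hf' : ∀ t, HasDerivAt f' (f'' t) t)
  (hmaps : MapsTo (foldMap f y) s S) (hG : SmoothMat G S) (hdet : NonDeg G S) {z : 𝔼 n}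
  (hz : z ∈ s) : ric s (fun z => G (foldMap f y z)) z = foldRic S G (foldMap f y z) (f' (z 0)) + f''
  (z 0) • jumpRic S G (foldMap f y z) := by
  ext i j
  simp only [ric, pd_chr_comp_foldMap hS hs hf hf' hmaps hG hdet hz,
    chr_comp_foldMap hs hf hmaps hG hz, Matrix.add_apply, Matrix.smul_apply, foldRic, jumpRic,
    smul_eq_mul]
  rw [mul_sum, ← sum_add_distrib]; exact sum_congr rfl fun l _ => by ring

lemma bil_jumpRic (hsymm : ∀ q i j, G q i j = G q j i) (q : 𝔽) (v : 𝔼 n) : 2 * bil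
  (jumpRic S G q) v v = 2 * v 0 * (((G q)⁻¹.mulVec (Pi.single 0 1)) ⬝ᵥ ((jump S G q).mulVec v.ofLp))
  - (G q)⁻¹ 0 0 * (v.ofLp ⬝ᵥ ((jump S G q).mulVec v.ofLp)) - v 0 ^ 2 *
  ((G q)⁻¹ * jump S G q).trace := by
  set J := jump S G q with hJ
  have hJs : ∀ i j, J i j = J j i := by intro i j; simp only [hJ, jump, fun q => hsymm q i j]
  have hIs : ∀ i j, (G q)⁻¹ i j = (G q)⁻¹ j i := by
    intro i j; have : (G q).transpose = G q := by ext a b; exact hsymm q b a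
    conv_lhs => rw [← this, ← Matrix.transpose_nonsing_inv]
    rfl
  set I := (G q)⁻¹ with hI
  set e : Fin n → ℝ := Pi.single 0 1 with he
  have he1 : ∀ f : Fin n → ℝ, ∑ i, e i * f i = f 0 := fun f => by simp [he, Pi.single_apply]
  have hq : ∀ i j, jumpRic S G q i j = (1 / 2) * (e i * (∑ m, I m 0 * J m j) +
      e j * (∑ m, I m 0 * J m i) - I 0 0 * J i j) -
      (1 / 2) * (e i * e j * ∑ l, ∑ m, I l m * J m l) := by
    intro i j
    have h1 : ∑ l, e l * jumpChr S G l i j q = (1 / 2) * (e i * (∑ m, I m 0 * J m j) +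
      e j * (∑ m, I m 0 * J m i) - I 0 0 * J i j) := by
      rw [he1, jumpChr]; congr 1
      have h2 : I 0 0 * J i j = ∑ m, e m * (I 0 m * J i j) := by rw [he1]
      rw [h2, mul_sum, mul_sum, ← sum_add_distrib, ← sum_sub_distrib]
      refine sum_congr rfl fun m _ => ?_
      rw [hIs m 0, hJs m j, hJs m i]; ring
    have h3 : ∑ l, jumpChr S G l l j q = (1 / 2) * (e j * ∑ l, ∑ m, I l m * J m l) := by
      simp only [jumpChr]; rw [← mul_sum]; congr 1
      have h4 : ∑ l, ∑ m, I l m * (e l * J j m) = ∑ l, ∑ m, I l m * (e m * J l j) := by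
        rw [sum_comm]; exact sum_congr rfl fun l _ => sum_congr rfl fun m _ => by rw [hIs, hJs j l]
      have h5 : ∑ l, ∑ m, I l m * (e j * J l m) = e j * ∑ l, ∑ m, I l m * J m l := by
        simp only [mul_sum]
        exact sum_congr rfl fun l _ => sum_congr rfl fun m _ => by rw [hJs l m]; ring
      simp only [mul_sub, mul_add, sum_sub_distrib, sum_add_distrib]; rw [← h5]; linarith
    rw [jumpRic, sum_sub_distrib, h1, ← mul_sum, h3]; ring
  have hv0 : ∀ f : Fin n → ℝ, ∑ i, f i * (e i * v i) = f 0 * v 0 := fun f => by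
    simp [he, Pi.single_apply]
  have hev : ∑ i, e i * v i = v 0 := he1 v
  have hNJ : (I.mulVec e) ⬝ᵥ (J.mulVec v.ofLp) = ∑ j, (∑ m, I m 0 * J m j) * v j := by
    have : I.mulVec e = fun m => I m 0 := by ext m; simp [he]
    rw [this]; simp only [dotProduct, Matrix.mulVec, mul_sum, sum_mul]; rw [sum_comm]
    exact sum_congr rfl fun l _ => sum_congr rfl fun m _ => by ring
  have htr : (I * J).trace = ∑ l, ∑ m, I l m * J m l := by simp [Matrix.trace, Matrix.mul_apply]
  rw [hNJ, htr, ← bil_eq_dotProduct]; set T := ∑ l, ∑ m, I l m * J m l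
  set N : Fin n → ℝ := fun j => ∑ m, I m 0 * J m j with hN
  have hexp : ∀ i j, jumpRic S G q i j * v i * v j =
      (1 / 2) * ((e i * v i) * (N j * v j)) + (1 / 2) * ((N i * v i) * (e j * v j)) -
      (1 / 2) * I 0 0 * (J i j * v i * v j) - (1 / 2) * T * ((e i * v i) * (e j * v j)) := by
    intro i j; rw [hq]; ring
  simp only [bil, hexp, sum_sub_distrib, sum_add_distrib, ← mul_sum, ← sum_mul, hev]; ring

end Fold

section Fold

lemma bil_add_mat (M N : 𝕄 n) (c : ℝ) (a b : 𝔼 n) : bil (M + c • N) a b =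
  bil M a b + c * bil N a b := by
  simp only [bil, Matrix.add_apply, Matrix.smul_apply, smul_eq_mul, mul_sum, ← sum_add_distrib]
  exact sum_congr rfl fun i _ => sum_congr rfl fun j _ => by ring

lemma continuousOn_bil {X : Type*} [TopologicalSpace X] {s : Set X} {M : X → 𝕄 n} {v : X → 𝔼 n}
  (hM : ∀ i j, ContinuousOn (fun x => M x i j) s) (hv : ContinuousOn v s) : ContinuousOn
  (fun x => bil (M x) (v x) (v x)) s := by
  have hvi : ∀ i, ContinuousOn (fun x => v x i) s := fun i =>
    (EuclideanSpace.proj i : 𝔼 n →L[ℝ] ℝ).continuous.comp_continuousOn hv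
  exact continuousOn_finsetSum _ fun i _ => continuousOn_finsetSum _ fun j _ =>
    ((hM i j).mul (hvi i)).mul (hvi j)

lemma bil_pos_of_sphere {M : 𝕄 n} (h : ∀ v ∈ Metric.sphere (0 : 𝔼 n) 1, 0 < bil M v v) {a : 𝔼 n}
  (ha : a ≠ 0) : 0 < bil M a a := by
  have hn : ‖a‖ ≠ 0 := norm_ne_zero_iff.2 ha
  have h1 := h (‖a‖⁻¹ • a) (by rw [mem_sphere_zero_iff_norm, norm_smul, norm_inv, norm_norm,
    inv_mul_cancel₀ hn])
  rw [bil_smul_left, bil_smul_right] at h1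
  have h2 : (0 : ℝ) < ‖a‖⁻¹ := inv_pos.2 (norm_pos_iff.2 ha)
  exact (mul_pos_iff_of_pos_left h2).1 ((mul_pos_iff_of_pos_left h2).1 h1)

variable {G : (F × 𝔼 n) × ℝ × ℝ → 𝕄 n} {O : Set ((F × 𝔼 n) × ℝ × ℝ)}

lemma continuous_foldMap {f : ℝ → ℝ} (hf : Continuous f) (y : F) : Continuous
  (foldMap (n := n) f y) := by
  have h0 : Continuous fun z : 𝔼 n => z 0 := (proj₀).continuous
  exact (continuous_const.prodMk continuous_id).prodMk ((h0.sub (hf.comp h0)).prodMk (hf.comp h0))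

lemma ric_foldMap_of_mem (hO : IsOpen O) (hG : SmoothMat G (O ∩ quadrant n F))
  (hdet : NonDeg G (O ∩ quadrant n F)) {s : Set (𝔼 n)} (hs : UniqueDiffOn ℝ s) {f f' f'' : ℝ → ℝ}
  {y : F} (hf : ∀ t, HasDerivAt f (f' t) t) (hf' : ∀ t, HasDerivAt f' (f'' t) t)
  (hmaps : MapsTo (foldMap f y) s (quadrant n F)) {z : 𝔼 n} (hz : z ∈ s) (hzO : foldMap f y z ∈ O) :
  ric s (fun z => G (foldMap f y z)) z = foldRic (O ∩ quadrant n F) G (foldMap f y z)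
  (f' (z 0)) + f'' (z 0) • jumpRic (O ∩ quadrant n F) G (foldMap f y z) := by
  have hcont : Continuous (foldMap (n := n) f y) :=
    continuous_foldMap (continuous_iff_continuousAt.2 fun t => (hf t).continuousAt) y
  have hU : IsOpen (foldMap f y ⁻¹' O) := hO.preimage hcont
  have hS : UniqueDiffOn ℝ (O ∩ quadrant n F) := by
    rw [inter_comm]; exact uniqueDiffOn_quadrant.inter hO
  rw [← ric_comp_foldMap hS (hs.inter hU) hf hf' (fun w hw => ⟨hw.2, hmaps hw.1⟩) hG hdet ⟨hz, hzO⟩]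
  refine ric_congr ?_ EventuallyEq.rfl hz; filter_upwards [hU.mem_nhds hzO] with w hw
  exact propext ⟨fun h => ⟨h, hw⟩, fun h => h.1⟩

lemma uniqueDiffOn_nonneg : UniqueDiffOn ℝ {z : 𝔼 n | 0 ≤ z 0} := by
  refine uniqueDiffOn_convex ?_ ?_
  · exact convex_halfSpace_ge (f := fun z : 𝔼 n => z 0) ⟨fun _ _ => rfl, fun _ _ => rfl⟩ 0
  · refine ⟨𝐞 0, mem_interior.2 ⟨{z | 0 < z 0}, fun z (hz : 0 < z 0) => hz.le, ?_, ?_⟩⟩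
    · exact isOpen_lt continuous_const (proj₀).continuous
    · simp

lemma uniqueDiffOn_nonpos : UniqueDiffOn ℝ {z : 𝔼 n | z 0 ≤ 0} := by
  refine uniqueDiffOn_convex ?_ ?_
  · exact convex_halfSpace_le (f := fun z : 𝔼 n => z 0) ⟨fun _ _ => rfl, fun _ _ => rfl⟩ 0
  · refine ⟨EuclideanSpace.single 0 (-1), mem_interior.2 ⟨{z | z 0 < 0}, fun z (hz : z 0 < 0) => hz.le, ?_, ?_⟩⟩
    · exact isOpen_lt (proj₀).continuous continuous_const
    · simp

lemma tendsto_foldMap_rampε {p : F × 𝔼 n} (hp0 : p.2 0 = 0) : Tendsto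
  (fun x : (F × 𝔼 n) × ℝ => foldMap (rampε x.2) x.1.1 x.1.2) (𝓝[{x | 0 < x.2}] (p, 0))
  (𝓝 (p, 0, 0)) := by
  have hc : Continuous fun x : (F × 𝔼 n) × ℝ => x.1.2 0 :=
    (proj₀).continuous.comp (continuous_snd.comp continuous_fst)
  have h0 : Tendsto (fun x : (F × 𝔼 n) × ℝ => x.1.2 0) (𝓝[{x | 0 < x.2}] (p, 0)) (𝓝 0) := by
    have := (hc.tendsto (p, 0)).mono_left (nhdsWithin_le_nhds (s := {x | 0 < x.2}))
    simpa only [hp0] using this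
  have hε : Tendsto (fun x : (F × 𝔼 n) × ℝ => x.2) (𝓝[{x | 0 < x.2}] (p, 0)) (𝓝 0) :=
    (continuous_snd.tendsto (p, 0)).mono_left nhdsWithin_le_nhds
  have hr : Tendsto (fun x : (F × 𝔼 n) × ℝ => rampε x.2 (x.1.2 0))
      (𝓝[{x | 0 < x.2}] (p, 0)) (𝓝 0) := by
    have hmax := h0.max hε; rw [max_self] at hmax
    refine tendsto_of_tendsto_of_tendsto_of_le_of_le' tendsto_const_nhds hmax ?_ ?_
    · filter_upwards [self_mem_nhdsWithin] with x hx using rampε_nonneg (le_of_lt hx) _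
    · filter_upwards [self_mem_nhdsWithin] with x hx using rampε_le hx _
  have h1 : Tendsto (fun x : (F × 𝔼 n) × ℝ => x.1) (𝓝[{x | 0 < x.2}] (p, 0)) (𝓝 p) :=
    (continuous_fst.tendsto (p, (0 : ℝ))).mono_left nhdsWithin_le_nhds
  have h2 := h0.sub hr; rw [sub_zero] at h2; exact h1.prodMk_nhds (h2.prodMk_nhds hr)

lemma eventually_fold_pos {q0 : 𝔽} {S : Set 𝔽} (hq0 : q0 ∈ S) {A : 𝔽 → ℝ → 𝕄 n} {Q : 𝔽 → 𝕄 n}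
  (hA : ∀ i j, ContinuousOn (fun x : 𝔽 × ℝ => A x.1 x.2 i j) (S ×ˢ univ))
  (hQ : ∀ i j, ContinuousOn (fun q => Q q i j) S) (hA0 : ∀ a, a ≠ 0 → 0 < bil (A q0 0) a a)
  (hA1 : ∀ a, a ≠ 0 → 0 < bil (A q0 1) a a) (hQ0 : ∀ a, a ≠ 0 → 0 < bil (Q q0) a a) : ∀ᶠ x :
  𝔽 × ℝ in 𝓝 (q0, 0), x.1 ∈ S → 0 < x.2 → ∀ (s : ℝ) (a : 𝔼 n), a ≠ 0 → 0 < bil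
  (A x.1 (step s) + (stepDeriv s / x.2) • Q x.1) a a := by
  have hK : IsCompact (Icc (-1 : ℝ) 1 ×ˢ Metric.sphere (0 : 𝔼 n) 1) :=
    isCompact_Icc.prod (isCompact_sphere _ _)
  have key := hK.eventually_forall_of_forall_eventually (x₀ := (q0, (0 : ℝ)))
    (P := fun x y => x.1 ∈ S → 0 < x.2 →
      0 < bil (A x.1 (step y.1) + (stepDeriv y.1 / x.2) • Q x.1) y.2 y.2) ?_
  · filter_upwards [key] with x hx hxS hx0 s a ha
    refine bil_pos_of_sphere (fun v hv => ?_) ha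
    have h1 : step (max (-1) (min 1 s)) = step s ∧ stepDeriv (max (-1) (min 1 s)) = stepDeriv s := by
      rcases le_total s (-1) with h | h
      · rw [min_eq_right (by linarith), max_eq_left h, step_of_le h, step_of_le le_rfl,
          stepDeriv_eq_zero fun h' => by linarith [h'.1],
          stepDeriv_eq_zero fun h' => by linarith [h'.1]]
        simp
      · rcases le_total s 1 with h' | h'
        · rw [min_eq_right h', max_eq_right h]; simp
        · rw [min_eq_left h', max_eq_right (by norm_num), step_of_ge h', step_of_ge le_rfl,
            stepDeriv_eq_zero fun h' => by linarith [h'.2],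
            stepDeriv_eq_zero fun h' => by linarith [h'.2]]
          simp
    have := hx (max (-1) (min 1 s), v) ⟨⟨le_max_left _ _, max_le (by norm_num) (min_le_left _ _)⟩, hv⟩
      hxS hx0
    rwa [h1.1, h1.2] at this
  · rintro ⟨s, v⟩ ⟨hs, hv⟩; have hv0 : v ≠ 0 := by rintro rfl; simp at hv
    set T : Set ((𝔽 × ℝ) × ℝ × 𝔼 n) :=
      {x | x.1.1 ∈ S} with hT
    have hmem : ((q0, (0 : ℝ)), (s, v)) ∈ T := hq0
    have cA : ContinuousOn (fun x : (𝔽 × ℝ) ×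
        ℝ × 𝔼 n => bil (A x.1.1 (step x.2.1)) x.2.2 x.2.2) T := by
      refine continuousOn_bil (fun i j => (hA i j).comp (f := fun x : ((𝔽 × ℝ) × ℝ × 𝔼 n) =>
          (x.1.1, step x.2.1)) ?_ ?_)
        (by fun_prop)
      · exact ((continuous_fst.comp continuous_fst).prodMk (contDiff_step.continuous.comp
          (continuous_fst.comp continuous_snd))).continuousOn
      · intro x hx; exact ⟨hx, mem_univ _⟩
    have cQ : ContinuousOn (fun x : (𝔽 × ℝ) × ℝ × 𝔼 n => bil (Q x.1.1) x.2.2 x.2.2) T :=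
      continuousOn_bil (fun i j => (hQ i j).comp (f := fun x : ((𝔽 × ℝ) × ℝ × 𝔼 n) => x.1.1)
        (continuous_fst.comp continuous_fst).continuousOn
        fun x hx => hx) (by fun_prop)
    have pQ : ∀ᶠ x in 𝓝[T] ((q0, (0 : ℝ)), (s, v)), 0 < bil (Q x.1.1) x.2.2 x.2.2 :=
      (cQ _ hmem).eventually (lt_mem_nhds (hQ0 v hv0))
    suffices h : ∀ᶠ x in 𝓝[T] ((q0, (0 : ℝ)), (s, v)), 0 < x.1.2 →
        0 < bil (A x.1.1 (step x.2.1) + (stepDeriv x.2.1 / x.1.2) • Q x.1.1) x.2.2 x.2.2 by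
      filter_upwards [eventually_nhdsWithin_iff.1 h] with x hx hxS hx0 using hx hxS hx0
    by_cases hs1 : s ∈ Ioo (-1 : ℝ) 1
    · have c1 : ContinuousOn (fun x : (𝔽 × ℝ) ×
          ℝ × 𝔼 n => x.1.2 * bil (A x.1.1 (step x.2.1)) x.2.2 x.2.2 +
            stepDeriv x.2.1 * bil (Q x.1.1) x.2.2 x.2.2) T :=
        ((continuous_snd.comp continuous_fst).continuousOn.mul cA).add
          (((contDiff_stepDeriv.continuous.comp
            (continuous_fst.comp continuous_snd)).continuousOn).mul cQ)
      have h1 := (c1 _ hmem).eventually (lt_mem_nhds (a := 0) (by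
        simp only [zero_mul, zero_add]; exact mul_pos (stepDeriv_pos hs1) (hQ0 v hv0)))
      filter_upwards [h1] with x hx hx0
      rw [bil_add_mat]
      have : bil (A x.1.1 (step x.2.1)) x.2.2 x.2.2 + stepDeriv x.2.1 / x.1.2 *
          bil (Q x.1.1) x.2.2 x.2.2 = (x.1.2 * bil (A x.1.1 (step x.2.1)) x.2.2 x.2.2 +
            stepDeriv x.2.1 * bil (Q x.1.1) x.2.2 x.2.2) / x.1.2 := by
        field_simp
      rw [this]; exact div_pos hx hx0
    · have hA' : 0 < bil (A q0 (step s)) v v := by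
        rcases eq_or_lt_of_le hs.1 with h | h
        · rw [step_of_le h.ge]; exact hA0 v hv0
        · have : 1 ≤ s := by by_contra h'; exact hs1 ⟨h, not_le.1 h'⟩
          rw [step_of_ge this]; exact hA1 v hv0
      have h1 := (cA _ hmem).eventually (lt_mem_nhds hA'); filter_upwards [h1, pQ] with x hx hxQ hx0
      rw [bil_add_mat]; have := mul_nonneg (div_nonneg (stepDeriv_nonneg x.2.1) hx0.le) hxQ.le
      linarith

/-- **Local smoothing.** If the two sides of a fold have positive Ricci curvature and the jump of
the normal derivative is negative definite on tangential vectors, then sufficiently sharp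
smoothings of the fold have positive Ricci curvature. -/
lemma eventually_ric_fold_pos (hO : IsOpen O) (hG : SmoothMat G (O ∩ quadrant n F))
  (hsymm : ∀ q i j, G q i j = G q j i) (hpos : ∀ q ∈ O ∩ quadrant n F, ∀ a, a ≠ 0 → 0 <
  bil (G q) a a) {p : F × 𝔼 n} (hp0 : p.2 0 = 0) (hpO : (p, 0, 0) ∈ O) (hn : ∃ i : Fin n, i ≠ 0)
  (hJ : ∀ a : 𝔼 n, a ≠ 0 → a 0 = 0 → bil (jump (O ∩ quadrant n F) G (p, 0, 0)) a a < 0)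
  (hR1 : ∀ a, a ≠ 0 → 0 < bil (ric {z | 0 ≤ z 0} (fun z => G (foldMap id p.1 z)) p.2) a a)
  (hR2 : ∀ a, a ≠ 0 → 0 < bil (ric {z | z 0 ≤ 0} (fun z => G (foldMap (fun _ => 0) p.1 z)) p.2) a a)
  : ∀ᶠ x : (F × 𝔼 n) × ℝ in 𝓝 (p, 0), 0 < x.2 → ∀ a, a ≠ 0 → 0 < bil
  (ric univ (fun z => G (foldMap (rampε x.2) x.1.1 z)) x.1.2) a a := by
  set S := O ∩ quadrant n F with hSd
  have hS : UniqueDiffOn ℝ S := by rw [hSd, inter_comm]; exact uniqueDiffOn_quadrant.inter hO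
  have hdet : NonDeg G S := fun q hq => det_ne_zero_of_bil (hsymm q) (hpos q hq)
  have hq0 : (p, (0 : ℝ), (0 : ℝ)) ∈ S := ⟨hpO, le_rfl, le_rfl⟩
  have e1 : foldMap id p.1 p.2 = (p, (0 : ℝ), (0 : ℝ)) := by simp [foldMap, hp0]
  have e2 : foldMap (fun _ => 0) p.1 p.2 = (p, (0 : ℝ), (0 : ℝ)) := by simp [foldMap, hp0]
  have hA1 : ∀ a, a ≠ 0 → 0 < bil (foldRic S G (p, 0, 0) 1) a a := by
    intro a ha
    have h := ric_foldMap_of_mem hO hG hdet uniqueDiffOn_nonneg (f := id)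
      (f' := fun _ => 1) (f'' := fun _ => 0) (y := p.1) (z := p.2) (fun t => hasDerivAt_id t)
      (fun t => hasDerivAt_const t 1) (fun z hz => ⟨by simp [foldMap], hz⟩)
      (by simp [hp0]) (by rw [e1]; exact hpO)
    rw [zero_smul, add_zero, e1] at h; rw [← h]; exact hR1 a ha
  have hA0 : ∀ a, a ≠ 0 → 0 < bil (foldRic S G (p, 0, 0) 0) a a := by
    intro a ha
    have h := ric_foldMap_of_mem hO hG hdet uniqueDiffOn_nonpos (f := fun _ => 0)
      (f' := fun _ => 0) (f'' := fun _ => 0) (y := p.1) (z := p.2) (fun t => hasDerivAt_const t 0)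
      (fun t => hasDerivAt_const t 0) (fun z hz => ⟨by simpa [foldMap] using hz, le_rfl⟩)
      (by simp [hp0]) (by rw [e2]; exact hpO)
    rw [zero_smul, add_zero, e2] at h; rw [← h]; exact hR2 a ha
  have hQ0 : ∀ a, a ≠ 0 → 0 < bil (jumpRic S G (p, 0, 0)) a a := by
    intro a ha; have h := bil_jumpRic (S := S) hsymm (p, 0, 0) a
    have h2 := second_order_term_pos (G := G (p, 0, 0)) (J := jump S G (p, 0, 0)) hn
      (posDef_of_bil (hsymm _) (hpos _ hq0)) (fun i j => by simp only [jump, fun q => hsymm q i j])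
      (fun b hb hb0 => by
        have := hJ (WithLp.toLp 2 b) (by simpa using hb) hb0
        rwa [bil_eq_dotProduct] at this) (v := a.ofLp) (by simpa using ha)
    linarith
  have key := eventually_fold_pos hq0 (continuousOn_foldRic hS hG hdet)
    (continuousOn_jumpRic hS hG hdet) hA0 hA1 hQ0
  have ht := tendsto_foldMap_rampε hp0
  have ht2 : Tendsto (fun x : (F × 𝔼 n) × ℝ => x.2) (𝓝[{x | 0 < x.2}] (p, 0)) (𝓝 0) :=
    (continuous_snd.tendsto (p, 0)).mono_left nhdsWithin_le_nhds
  refine eventually_nhdsWithin_iff.1 ?_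
  filter_upwards [(ht.prodMk_nhds ht2).eventually key, ht.eventually (hO.mem_nhds hpO),
    self_mem_nhdsWithin] with x hx hxO hx0 a ha
  have hmaps : ∀ z : 𝔼 n, foldMap (rampε x.2) x.1.1 z ∈ quadrant n F :=
    fun z => ⟨sub_nonpos.2 (le_rampε hx0 _), rampε_nonneg (le_of_lt hx0) _⟩
  rw [ric_foldMap_of_mem hO hG hdet uniqueDiffOn_univ (hasDerivAt_rampε (ne_of_gt hx0))
    (hasDerivAt_step_div x.2) (fun z _ => hmaps z) (mem_univ _) hxO]
  exact hx ⟨hxO, hmaps _⟩ hx0 _ a ha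

end Fold

section Naturality

/-- At `x`, the form `h` is the pullback of `h'` under `ψ`. -/
def IsPullbackAt (ψ : P → P') (h : JForm π) (h' : FibreForm k J' π') (x : P) : Prop :=
  ∀ (u v : Vert k J π x) (u' v' : Vert k J' π' (ψ x)), u'.1 = mfderiv (𝓟 J) (𝓟 J') ψ x u.1 →
    v'.1 = mfderiv (𝓟 J) (𝓟 J') ψ x v.1 → h x u v = h' (ψ x) u' v'

/-- Near `x`, `ψ` is an immersion over `B` between spaces of the same dimension, and `h` is the
pullback of `h'` under `ψ`. -/
def IsLocalPullback (ψ : P → P') (h : JForm π) (h' : FibreForm k J' π') (x : P) : Prop :=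
  ∀ᶠ y in 𝓝 x, SmoothAt ψ y ∧ π' (ψ y) = π y ∧
    Bijective (mfderiv (𝓟 J) (𝓟 J') ψ y) ∧ IsPullbackAt ψ h h' y

lemma IsLocalPullback.eventually {ψ : P → P'} {h : JForm π} {h' : FibreForm k J' π'} {x : P}
  (H : IsLocalPullback ψ h h' x) : ∀ᶠ y in 𝓝 x, IsLocalPullback ψ h h' y :=
  eventually_eventually_nhds.2 H

/-- The coordinate expression of `ψ`. -/
def transit (c : JChart π) (c' : FibredChart k J' π') (ψ : P → P') : 𝕍 → 𝕍 :=
  c'.ext ∘ ψ ∘ c.ext.symm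

/-- The vertical differential of the coordinate expression of `ψ`. -/
def vderiv (c : JChart π) (c' : FibredChart k J' π') (ψ : P → P') (p : 𝕍) : 𝔼 n →L[ℝ] 𝔼 n :=
  (ContinuousLinearMap.snd ℝ _ _).comp ((𝒟 (transit c c' ψ) ℛJ p).comp (inr ℝ _ _))

lemma range_model_eq : ℛJ = univ ×ˢ range J := by
  rw [modelWithCorners_prod_coe, range_prodMap, ModelWithCorners.range_eq_univ]

lemma slice_mem_range {y : 𝔼 k} {z : 𝔼 n} : (y, z) ∈ ℛJ ↔ z ∈ range J := by
  rw [range_model_eq]; simp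

namespace FibredChart

variable (c : FibredChart k J π) (c' : FibredChart k J' π')

lemma exists_open {x : P} (hx : x ∈ 𝒮 c) {Q : P → Prop} (hQ : ∀ᶠ y in 𝓝 x, Q y) : ∃ O : Set 𝕍,
  IsOpen O ∧ c.ext x ∈ O ∧ ∀ p ∈ O ∩ ℛJ, p ∈ c.ext.target ∧ Q (c.ext.symm p) := by
  have h1 : ∀ᶠ p in 𝓝[ℛJ] (c.ext x), p ∈ c.ext.target ∧ Q (c.ext.symm p) := by
    rw [← c.total.map_extend_nhds hx, eventually_map]
    filter_upwards [hQ, c.total.open_source.mem_nhds hx] with y hy hyc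
    exact ⟨c.ext_mem hyc, by rwa [c.symm_ext hyc]⟩
  rw [eventually_nhdsWithin_iff, eventually_nhds_iff] at h1; obtain ⟨O, hO, hOo, hxO⟩ := h1
  exact ⟨O, hOo, hxO, fun p hp => hO p hp.1 hp.2⟩

lemma ext_mem_range (x : P) : c.ext x ∈ ℛJ := ⟨c.total x, rfl⟩

lemma exists_open_target : ∃ O : Set 𝕍, IsOpen O ∧ c.ext.target = O ∩ ℛJ :=
  ⟨_, c.total.open_target.preimage (𝓟 J).continuous_symm, c.total.extend_target⟩

/-- The slice of the domain of coordinates over `y`. -/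
def slice (y : 𝔼 k) : Set (𝔼 n) :=
  {z | (y, z) ∈ c.ext.target}

lemma exists_open_slice (y : 𝔼 k) : ∃ U : Set (𝔼 n), IsOpen U ∧ c.slice y = range J ∩ U := by
  obtain ⟨O, hO, h⟩ := c.exists_open_target
  refine ⟨{z | (y, z) ∈ O}, hO.preimage (Continuous.prodMk_right y), ?_⟩; ext z
  simp only [slice, h, mem_ofPred_eq, mem_inter_iff, slice_mem_range]; exact and_comm

end FibredChart

lemma uniqueDiff_inter {U : Set (𝔼 n)} (hU : IsOpen U) :
    UniqueDiffOn ℝ (range J ∩ U) := J.uniqueDiffOn.inter hU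

lemma range_inter_subset_closure {U : Set (𝔼 n)} (hU : IsOpen U) : range J ∩ U ⊆ closure
  (interior (range J ∩ U)) := by
  rw [interior_inter, hU.interior_eq]; rintro z ⟨hz, hzU⟩; rw [inter_comm]
  exact hU.inter_closure ⟨hzU, J.range_subset_closure_interior hz⟩

lemma range_inter_eq {U : Set (𝔼 n)} (hU : IsOpen U) {z : 𝔼 n} (hz : z ∈ U) : range J =ᶠ[𝓝 z]
  (range J ∩ U : Set _) := by
  filter_upwards [hU.mem_nhds hz] with w hw
  exact propext ⟨fun h => ⟨h, hw⟩, fun h => h.1⟩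

section Transit

variable (c : FibredChart k J π) (c' : FibredChart k J' π') {ψ : P → P'} {x : P}

lemma smooth_transit (hx : x ∈ 𝒮 c) (hx' : ψ x ∈ 𝒮 c') (hψ : SmoothAt ψ x) : SmoothWithinAt
  (transit c c' ψ) ℛJ (c.ext x) := by
  rw [← contMDiffWithinAt_iff_contDiffWithinAt]
  have h1 := c'.total.contMDiffAt_extend c'.total_mem hx'; have h2 := h1.comp x hψ
  have h3 := smooth_extend_symm c.total_mem (c.ext_mem hx)
  exact h2.comp_contMDiffWithinAt_of_eq h3 (c.symm_ext hx)

lemma transit_ext (hx : x ∈ 𝒮 c) : transit c c' ψ (c.ext x) = c'.ext (ψ x) := by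
  simp only [transit, comp_apply, c.symm_ext hx]

lemma transit_fst (hx : x ∈ 𝒮 c) (hx' : ψ x ∈ 𝒮 c') (hπ : π' (ψ x) = π x) : (c'.ext (ψ x)).1 =
  c'.base (c.base.symm (c.ext x).1) := by
  rw [c'.ext_apply_fst, c'.fst_eq _ hx', hπ, c.ext_apply_fst, c.fst_eq x hx,
    c.base.left_inv (c.proj_mem x hx)]

lemma dChart_mfderiv_eq (hx : x ∈ 𝒮 c) (hx' : ψ x ∈ 𝒮 c') (hψ : SmoothAt ψ x)
  (u : TangentSpace (𝓟 J) x) : dChart (𝓟 J') c'.total (ψ x) (mfderiv (𝓟 J) (𝓟 J') ψ x u) = 𝒟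
  (transit c c' ψ) ℛJ (c.ext x) (dChart (𝓟 J) c.total x u) :=
  dChart_mfderiv c.total_mem c'.total_mem (hψ.mdifferentiableAt (by simp)) hx hx' u

lemma mfderiv_mem_vert (hx' : ψ x ∈ 𝒮 c') (hψ : SmoothAt ψ x) (hπ : ∀ᶠ y in 𝓝 x, π' (ψ y) = π y)
  {u : TangentSpace (𝓟 J) x} (hu : u ∈ Vert k J π x) : mfderiv (𝓟 J) (𝓟 J') ψ x u ∈ Vert k J' π'
  (ψ x) := by
  have h1 := mfderiv_comp x ((c'.contMDiffAt_proj hx').mdifferentiableAt (by simp))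
    (hψ.mdifferentiableAt (by simp))
  have hev : π' ∘ ψ =ᶠ[𝓝 x] π := hπ; have h2 := hev.mfderiv_eq (I := 𝓟 J) (I' := 𝓡 k); rw [h1] at h2
  have h3 : mfderiv (𝓟 J) (𝓡 k) π x u = 0 := hu; exact (congrArg (fun L => L u) h2).trans h3

lemma coord_push (hx : x ∈ 𝒮 c) (hx' : ψ x ∈ 𝒮 c') (hψ : SmoothAt ψ x) (u : Vert k J π x)
  (u' : Vert k J' π' (ψ x)) (hu : u'.1 = mfderiv (𝓟 J) (𝓟 J') ψ x u.1) : c'.coord _ u' =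
  vderiv c c' ψ (c.ext x) (c.coord x u) := by
  have h1 := dChart_mfderiv_eq c c' hx hx' hψ u.1
  rw [← hu, c'.dChart_vert hx', c.dChart_vert hx] at h1
  have h2 : c'.coord _ u' = (𝒟 (transit c c' ψ) ℛJ (c.ext x) (0, c.coord x u)).2 := by rw [← h1]
  exact h2

lemma bil_coeff_eq (hx : x ∈ 𝒮 c) (hx' : ψ x ∈ 𝒮 c') (hψ : SmoothAt ψ x)
  (hπ : ∀ᶠ y in 𝓝 x, π' (ψ y) = π y) {h : JForm π} {h' : FibreForm k J' π'}
  (hh : IsPullbackAt ψ h h' x) (a b : 𝔼 n) : bil (c.coeff h (c.ext x)) a b = bil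
  (c'.coeff h' (c'.ext (ψ x))) (vderiv c c' ψ (c.ext x) a) (vderiv c c' ψ (c.ext x) b) := by
  obtain ⟨u, rfl⟩ := c.exists_coord hx a; obtain ⟨v, rfl⟩ := c.exists_coord hx b
  have hu := mfderiv_mem_vert c' hx' hψ hπ u.2; have hv := mfderiv_mem_vert c' hx' hψ hπ v.2
  rw [← c.form_eq_bil h hx, ← coord_push c c' hx hx' hψ u ⟨_, hu⟩ rfl,
    ← coord_push c c' hx hx' hψ v ⟨_, hv⟩ rfl, ← c'.form_eq_bil h' hx']
  exact hh u v _ _ rfl rfl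

lemma bijective_vderiv (hx : x ∈ 𝒮 c) (hx' : ψ x ∈ 𝒮 c') (hψ : SmoothAt ψ x)
  (hπ : ∀ᶠ y in 𝓝 x, π' (ψ y) = π y) (hb : Bijective (mfderiv (𝓟 J) (𝓟 J') ψ x)) : Bijective
  (vderiv c c' ψ (c.ext x)) := by
  have hinj : Injective (vderiv c c' ψ (c.ext x)) := by
    rw [injective_iff_map_eq_zero]; intro a ha; obtain ⟨u, rfl⟩ := c.exists_coord hx a
    have hu := mfderiv_mem_vert c' hx' hψ hπ u.2
    rw [← coord_push c c' hx hx' hψ u ⟨_, hu⟩ rfl] at ha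
    have h1 : (⟨_, hu⟩ : Vert k J' π' (ψ x)) = 0 :=
      c'.coord_injective hx' (ha.trans (map_zero (c'.coordₗ (ψ x))).symm)
    have h2 : u = 0 := Subtype.ext (hb.1 ((congrArg Subtype.val h1).trans (map_zero _).symm))
    rw [h2]; exact map_zero (c.coordₗ x)
  exact ⟨hinj, LinearMap.surjective_of_injective (f := (vderiv c c' ψ (c.ext x)).toLinearMap) hinj⟩

/-- The slice of the transition map over `y`. -/
def sliceMap (c : JChart π) (c' : FibredChart k J' π') (ψ : P → P') (y : 𝔼 k) (z : 𝔼 n) : 𝔼 n :=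
  (transit c c' ψ (y, z)).2

lemma hasFDerivWithinAt_sliceMap (hx : x ∈ 𝒮 c) (hx' : ψ x ∈ 𝒮 c') (hψ : SmoothAt ψ x) :
  HasFDerivWithinAt (sliceMap c c' ψ (c.ext x).1) (vderiv c c' ψ (c.ext x)) (range J)
  (c.ext x).2 := by
  have h1 := ((smooth_transit c c' hx hx' hψ).differentiableWithinAt (by simp)).hasFDerivWithinAt
  have h2 : HasFDerivWithinAt (fun z => ((c.ext x).1, z)) (inr ℝ (𝔼 k) (𝔼 n))
      (range J) (c.ext x).2 := (hasFDerivAt_prodMk_right _ _).hasFDerivWithinAt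
  have h3 := HasFDerivWithinAt.comp (t := ℛJ) (c.ext x).2 h1 h2 (fun z hz => slice_mem_range.2 hz)
  exact (hasFDerivAt_snd.comp_hasFDerivWithinAt _ h3)

lemma contDiffWithinAt_sliceMap (hx : x ∈ 𝒮 c) (hx' : ψ x ∈ 𝒮 c') (hψ : SmoothAt ψ x) :
  SmoothWithinAt (sliceMap c c' ψ (c.ext x).1) (range J) (c.ext x).2 := by
  have h1 := smooth_transit c c' hx hx' hψ
  have h2 : SmoothWithinAt (fun z => ((c.ext x).1, z)) (range J) (c.ext x).2 :=
    (contDiff_prodMk_right _).contDiffWithinAt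
  exact contDiff_snd.comp_contDiffWithinAt (ContDiffWithinAt.comp (t := ℛJ) (c.ext x).2 h1 h2
      (fun z hz => slice_mem_range.2 hz))

end Transit

section Metric

variable (c : FibredChart k J π) {h : FibreForm k J π}

lemma coeff_symm (hh : IsFibreMetric h) (p : 𝕍) (i j : Fin n) :
    c.coeff h p i j = c.coeff h p j i := hh.symm _ _ _

lemma coeff_pos (hh : IsFibreMetric h) {p : 𝕍} (hp : p ∈ c.ext.target) {a : 𝔼 n} (ha : a ≠ 0) : 0 <
  bil (c.coeff h p) a a := by
  obtain ⟨u, rfl⟩ := c.exists_coord (c.mem_source hp) a; rw [← c.form_eq_bil_symm h hp]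
  refine hh.pos _ _ ?_; rintro rfl; exact ha (map_zero (c.coordₗ (c.ext.symm p)))

lemma det_ne_zero (hh : IsFibreMetric h) {p : 𝕍} (hp : p ∈ c.ext.target) : (c.coeff h p).det ≠ 0 :=
  det_ne_zero_of_bil (coeff_symm c hh p) fun _ ha => coeff_pos c hh hp ha

lemma contDiffOn_coeff_slice (hh : IsFibreMetric h) (y : 𝔼 k) (i j : Fin n) : SmoothOn
  (fun z => c.coeff h (y, z) i j) (c.slice y) :=
  (hh.smooth c i j).comp (contDiff_prodMk_right y).contDiffOn fun _ hz => hz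

end Metric

variable (c : FibredChart k J π) (c' : FibredChart k J' π') {ψ : P → P'} {x : P}
  {h : FibreForm k J π} {h' : FibreForm k J' π'}

lemma ricci_eq_bil (c : JChart π) (h : JForm π) (x : P) (u : Vert k J π x) :
    c.ricci h x u = bil (ric (range J) (fun z => c.coeff h ((c.ext x).1, z)) (c.ext x).2)
      (c.coord x u) (c.coord x u) := rfl

lemma exists_slice_data (hx : x ∈ 𝒮 c) (hx' : ψ x ∈ 𝒮 c') (H : IsLocalPullback ψ h h' x) : ∃ U : Set
  (𝔼 n), IsOpen U ∧ (c.ext x).2 ∈ U ∧ range J ∩ U ⊆ c.slice (c.ext x).1 ∧ MapsTo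
  (sliceMap c c' ψ (c.ext x).1) (range J ∩ U) (c'.slice (c'.ext (ψ x)).1) ∧ SmoothOn
  (sliceMap c c' ψ (c.ext x).1) (range J ∩ U) ∧ (∀ z ∈ range J ∩ U,
  𝒟 (sliceMap c c' ψ (c.ext x).1) (range J ∩ U) z = vderiv c c' ψ ((c.ext x).1, z)) ∧
  (∀ z ∈ range J ∩ U, Bijective (vderiv c c' ψ ((c.ext x).1, z))) ∧
  (∀ z ∈ range J ∩ U, ∀ a b, bil (c.coeff h ((c.ext x).1, z)) a b =
  bil (c'.coeff h' ((c'.ext (ψ x)).1, sliceMap c c' ψ (c.ext x).1 z))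
  (vderiv c c' ψ ((c.ext x).1, z) a) (vderiv c c' ψ ((c.ext x).1, z) b)) := by
  have hcont : ContinuousAt ψ x := H.self_of_nhds.1.continuousAt
  obtain ⟨O, hO, hxO, hOp⟩ := c.exists_open hx
    (H.eventually.and (hcont.eventually (c'.total.open_source.mem_nhds hx')))
  set y := (c.ext x).1 with hy
  have hyz : c.ext x = (y, (c.ext x).2) := rfl
  have key : ∀ z ∈ range J ∩ {z | (y, z) ∈ O}, ∃ w ∈ 𝒮 c, ψ w ∈ 𝒮 c' ∧
      c.ext w = (y, z) ∧ IsLocalPullback ψ h h' w ∧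
      c'.ext (ψ w) = ((c'.ext (ψ x)).1, sliceMap c c' ψ y z) := by
    intro z hz; obtain ⟨h1, h2, h3⟩ := hOp (y, z) ⟨hz.2, slice_mem_range.2 hz.1⟩
    refine ⟨c.ext.symm (y, z), c.mem_source h1, h3, c.ext.right_inv h1, h2, ?_⟩
    refine Prod.ext ?_ rfl
    rw [transit_fst c c' (c.mem_source h1) h3 h2.self_of_nhds.2.1, c.ext.right_inv h1,
      transit_fst c c' hx hx' H.self_of_nhds.2.1]
  have hU : IsOpen {z : 𝔼 n | (y, z) ∈ O} := hO.preimage (Continuous.prodMk_right y)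
  refine ⟨{z | (y, z) ∈ O}, hU, hxO, ?_, ?_, ?_, ?_, ?_, ?_⟩
  · exact fun z hz => (hOp (y, z) ⟨hz.2, slice_mem_range.2 hz.1⟩).1
  · intro z hz; obtain ⟨w, hw, hw', hwz, -, hwt⟩ := key z hz
    change ((c'.ext (ψ x)).1, sliceMap c c' ψ y z) ∈ c'.ext.target; rw [← hwt]; exact c'.ext_mem hw'
  · intro z hz; obtain ⟨w, hw, hw', hwz, hwp, -⟩ := key z hz
    have := contDiffWithinAt_sliceMap c c' hw hw' hwp.self_of_nhds.1; rw [hwz] at this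
    exact this.mono inter_subset_left
  · intro z hz; obtain ⟨w, hw, hw', hwz, hwp, -⟩ := key z hz
    have := hasFDerivWithinAt_sliceMap c c' hw hw' hwp.self_of_nhds.1; rw [hwz] at this
    exact (this.mono inter_subset_left).fderivWithin (uniqueDiff_inter hU z hz)
  · intro z hz; obtain ⟨w, hw, hw', hwz, hwp, -⟩ := key z hz; rw [← hwz]
    exact bijective_vderiv c c' hw hw' hwp.self_of_nhds.1 (hwp.mono fun _ h => h.2.1)
      hwp.self_of_nhds.2.2.1
  · intro z hz a b; obtain ⟨w, hw, hw', hwz, hwp, hwt⟩ := key z hz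
    have := bil_coeff_eq c c' hw hw' hwp.self_of_nhds.1 (hwp.mono fun _ h => h.2.1)
      hwp.self_of_nhds.2.2.2 a b
    rwa [hwz, hwt] at this

/-- Naturality of the Ricci curvature of the fibres. -/
lemma ricci_of_isLocalPullback (hh : IsFibreMetric h) (hh' : IsFibreMetric h') (hx : x ∈ 𝒮 c)
  (hx' : ψ x ∈ 𝒮 c') (H : IsLocalPullback ψ h h' x) (u : Vert k J π x) (u' : Vert k J' π' (ψ x))
  (hu : u'.1 = mfderiv (𝓟 J) (𝓟 J') ψ x u.1) : c.ricci h x u = c'.ricci h' (ψ x) u' := by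
  obtain ⟨U, hU, hxU, hsub, hmaps, hsm, hder, hbij, hbil⟩ := exists_slice_data c c' hx hx' H
  have hxr : (c.ext x).2 ∈ range J := slice_mem_range.1 (c.ext_mem_range x)
  obtain ⟨U', hU', hsl⟩ := c'.exists_open_slice (c'.ext (ψ x)).1
  have hxU' : (c'.ext (ψ x)).2 ∈ range J' ∩ U' := by rw [← hsl]; exact c'.ext_mem hx'
  have hmem : ∀ z ∈ range J' ∩ U', ((c'.ext (ψ x)).1, z) ∈ c'.ext.target := fun z hz => by
    rw [← hsl] at hz; exact hz
  rw [ricci_eq_bil, ricci_eq_bil, ric_congr (range_inter_eq hU hxU) EventuallyEq.rfl hxr,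
    ric_congr (range_inter_eq hU' hxU'.2) EventuallyEq.rfl hxU'.1,
    coord_push c c' hx hx' H.self_of_nhds.1 u u' hu]
  have hfd := hder _ ⟨hxr, hxU⟩; rw [hsl] at hmaps
  have := ric_transform (uniqueDiff_inter hU) (range_inter_subset_closure hU)
    (uniqueDiff_inter hU') hsm hmaps
    (fun i j => (contDiffOn_coeff_slice c hh (c.ext x).1 i j).mono hsub)
    (fun i j => by rw [← hsl]; exact contDiffOn_coeff_slice c' hh' (c'.ext (ψ x)).1 i j)
    (fun z hz => det_ne_zero c hh (hsub hz)) (fun z hz => det_ne_zero c' hh' (hmem z hz))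
    (fun z _ i j => coeff_symm c hh _ i j) (fun z _ i j => coeff_symm c' hh' _ i j)
    (fun z hz => by rw [hder z hz]; exact hbij z hz)
    (fun z hz a b => by rw [hder z hz]; exact hbil z hz a b) ⟨hxr, hxU⟩ (c.coord x u) (c.coord x u)
  rw [this, hfd]
  have he : sliceMap c c' ψ (c.ext x).1 (c.ext x).2 = (c'.ext (ψ x)).2 :=
    congrArg Prod.snd (transit_ext c c' hx)
  rw [he]

end Naturality

section Naturality

variable (c : FibredChart k J π) (c' : FibredChart k J' π') {ψ : P → P'} {x : P}
  {h : FibreForm k J π} {h' : FibreForm k J' π'}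

lemma smooth_vderiv (hx : x ∈ 𝒮 c) (hx' : ψ x ∈ 𝒮 c') (hψ : SmoothAt ψ x) : SmoothWithinAt
  (vderiv c c' ψ) ℛJ (c.ext x) := by
  have h1 := (smooth_transit c c' hx hx' hψ).fderivWithin_right (m := ∞)
    (𝓟 J).uniqueDiffOn le_rfl (c.ext_mem_range x)
  exact contDiffWithinAt_const.clm_comp (h1.clm_comp contDiffWithinAt_const)

lemma contDiffWithinAt_bil {s : Set F} {p : F} {M : F → 𝕄 n} {u v : F → 𝔼 n}
  (hM : ∀ i j, SmoothWithinAt (fun q => M q i j) s p) (hu : SmoothWithinAt u s p)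
  (hv : SmoothWithinAt v s p) : SmoothWithinAt (fun q => bil (M q) (u q) (v q)) s p := by
  have hc : ∀ i {w : F → 𝔼 n}, SmoothWithinAt w s p →
      SmoothWithinAt (fun q => w q i) s p := fun i w hw =>
    (EuclideanSpace.proj i : 𝔼 n →L[ℝ] ℝ).contDiff.comp_contDiffWithinAt hw
  exact ContDiffWithinAt.sum fun i _ => ContDiffWithinAt.sum fun j _ =>
    ((hM i j).mul (hc i hu)).mul (hc j hv)

lemma smooth_coeff (hx : x ∈ 𝒮 c) (hx' : ψ x ∈ 𝒮 c') (H : IsLocalPullback ψ h h' x)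
  (hsm : ∀ i j, SmoothWithinAt (fun p => c'.coeff h' p i j) (range (𝓟 J')) (c'.ext (ψ x)))
  (i j : Fin n) : SmoothWithinAt (fun p => c.coeff h p i j) ℛJ (c.ext x) := by
  have hψ := H.self_of_nhds.1; have ht := smooth_transit c c' hx hx' hψ
  have hd := smooth_vderiv c c' hx hx' hψ
  have h1 : ∀ i j, SmoothWithinAt (fun p => c'.coeff h' (transit c c' ψ p) i j)
      ℛJ (c.ext x) := fun i j => by
    have hs := hsm i j; rw [← transit_ext c c' hx] at hs
    exact hs.comp (c.ext x) ht fun p _ => c'.ext_mem_range _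
  have h2 : SmoothWithinAt (fun p => bil (c'.coeff h' (transit c c' ψ p))
      (vderiv c c' ψ p (𝐞 i)) (vderiv c c' ψ p (𝐞 j)))
      ℛJ (c.ext x) :=
    contDiffWithinAt_bil h1 (hd.clm_apply contDiffWithinAt_const)
      (hd.clm_apply contDiffWithinAt_const)
  refine h2.congr_of_eventuallyEq_of_mem ?_ (c.ext_mem_range x)
  obtain ⟨O, hO, hxO, hOp⟩ := c.exists_open hx
    (H.eventually.and (hψ.continuousAt.eventually (c'.total.open_source.mem_nhds hx')))
  filter_upwards [self_mem_nhdsWithin, nhdsWithin_le_nhds (hO.mem_nhds hxO)] with p hpr hpO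
  obtain ⟨hpt, hp1, hp2⟩ := hOp p ⟨hpO, hpr⟩; have hps := c.mem_source hpt
  have := bil_coeff_eq c c' hps hp2 hp1.self_of_nhds.1 (hp1.mono fun _ h => h.2.1)
    hp1.self_of_nhds.2.2.2 (𝐞 i) (𝐞 j)
  rw [c.ext.right_inv hpt, bil_single, ← transit_ext c c' hps, c.ext.right_inv hpt] at this
  exact this

lemma isLocalPullback_id (hx : x ∈ 𝒮 c) (h : JForm π) : IsLocalPullback id h h x := by
  filter_upwards [c.total.open_source.mem_nhds hx] with y hy
  have hid : mfderiv (𝓟 J) (𝓟 J) (id : P → P) y = ContinuousLinearMap.id ℝ _ := mfderiv_id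
  refine ⟨contMDiffAt_id, rfl, ?_, ?_⟩
  · rw [hid]; exact Function.bijective_id
  · intro u v u' v' hu hv; rw [hid] at hu hv; have e1 : u' = u := Subtype.ext hu
    have e2 : v' = v := Subtype.ext hv; rw [e1, e2]; rfl

lemma isFibreMetric_of_local (hsymm : ∀ (x : P) (u v : Vert k J π x), h x u v = h x v u)
  (hpos : ∀ (x : P) (u : Vert k J π x), u ≠ 0 → 0 < h x u u) (hsm : ∀ x, ∃ c : JChart π, x ∈ 𝒮 c ∧
  ∀ i j, SmoothWithinAt (fun p => c.coeff h p i j) ℛJ (c.ext x)) : IsFibreMetric h := by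
  refine ⟨hsymm, hpos, fun c i j p hp => ?_⟩
  obtain ⟨c', hc', hs⟩ := hsm (c.ext.symm p); have hx := c.mem_source hp
  have := smooth_coeff c c' (ψ := id) hx hc' (isLocalPullback_id c hx h) hs i j
  rw [c.ext.right_inv hp] at this; exact this.mono c.total.extend_target_subset_range

lemma IsFibreMetric.contDiffWithinAt (hh : IsFibreMetric h) (hx : x ∈ 𝒮 c) (i j : Fin n) :
  SmoothWithinAt (fun p => c.coeff h p i j) ℛJ (c.ext x) :=
  (hh.smooth c i j _ (c.ext_mem hx)).mono_of_mem_nhdsWithin (c.target_mem_nhdsWithin (c.ext_mem hx))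

lemma ricciPositive_of_local (hh : IsFibreMetric h) (hR : ∀ x, ∃ c : JChart π, x ∈ 𝒮 c ∧ ∀ u :
  Vert k J π x, u ≠ 0 → 0 < c.ricci h x u) : RicciPositive h := by
  intro c x hx u hu; obtain ⟨c', hc', hs⟩ := hR x
  rw [ricci_of_isLocalPullback c c' (ψ := id) hh hh hx hc' (isLocalPullback_id c hx h) u u (by
    rw [mfderiv_id]; rfl)]
  exact hs u hu

lemma symm_pos_of_isPullbackAt (hx' : ψ x ∈ 𝒮 c') (hh' : IsFibreMetric h')
  (H : IsLocalPullback ψ h h' x) : (∀ u v : Vert k J π x, h x u v = h x v u) ∧ ∀ u : Vert k J π x,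
  u ≠ 0 → 0 < h x u u := by
  obtain ⟨hψ, -, hb, hp⟩ := H.self_of_nhds
  have hm : ∀ u : Vert k J π x, _ := fun u =>
    mfderiv_mem_vert c' hx' hψ (H.mono fun _ h => h.2.1) u.2
  refine ⟨fun u v => ?_, fun u hu => ?_⟩
  · rw [hp u v ⟨_, hm u⟩ ⟨_, hm v⟩ rfl rfl, hp v u ⟨_, hm v⟩ ⟨_, hm u⟩ rfl rfl]
    exact hh'.symm _ _ _
  · rw [hp u u ⟨_, hm u⟩ ⟨_, hm u⟩ rfl rfl]; refine hh'.pos _ _ fun h0 => hu ?_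
    exact Subtype.ext (hb.1 ((congrArg Subtype.val h0).trans (map_zero _).symm))

lemma isFibreMetric_of_pullback (hc : ∀ x : P, ∃ c : JChart π, x ∈ 𝒮 c)
  (hc' : ∀ x : P', ∃ c : FibredChart k J' π', x ∈ 𝒮 c) (hh' : IsFibreMetric h')
  (H : ∀ x, IsLocalPullback ψ h h' x) : IsFibreMetric h := by
  refine isFibreMetric_of_local (fun x => ?_) (fun x => ?_) fun x => ?_
  · obtain ⟨c', hx'⟩ := hc' (ψ x); exact (symm_pos_of_isPullbackAt c' hx' hh' (H x)).1
  · obtain ⟨c', hx'⟩ := hc' (ψ x); exact (symm_pos_of_isPullbackAt c' hx' hh' (H x)).2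
  · obtain ⟨c, hx⟩ := hc x; obtain ⟨c', hx'⟩ := hc' (ψ x)
    exact ⟨c, hx, smooth_coeff c c' hx hx' (H x) (hh'.contDiffWithinAt c' hx')⟩

lemma ricciPositive_of_pullback (hc' : ∀ x : P', ∃ c : FibredChart k J' π', x ∈ 𝒮 c)
  (hh : IsFibreMetric h) (hh' : IsFibreMetric h') (hR : RicciPositive h')
  (H : ∀ x, IsLocalPullback ψ h h' x) : RicciPositive h := by
  intro c x hx u hu; obtain ⟨c', hx'⟩ := hc' (ψ x); obtain ⟨hψ, -, hb, -⟩ := (H x).self_of_nhds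
  have hm := mfderiv_mem_vert c' hx' hψ ((H x).mono fun _ h => h.2.1) u.2
  rw [ricci_of_isLocalPullback c c' hh hh' hx hx' (H x) u ⟨_, hm⟩ rfl]
  refine hR c' _ hx' _ fun h0 => hu ?_
  exact Subtype.ext (hb.1 ((congrArg Subtype.val h0).trans (map_zero _).symm))

/-- The pullback of a form under a smooth map over `B`. -/
def pullback (ψ : P → P') (hm : ∀ x, ∀ u ∈ Vert k J π x,
    mfderiv (𝓟 J) (𝓟 J') ψ x u ∈ Vert k J' π' (ψ x)) (h' : FibreForm k J' π') :
    JForm π := fun x =>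
  let L : Vert k J π x →ₗ[ℝ] Vert k J' π' (ψ x) := ((mfderiv (𝓟 J) (𝓟 J') ψ x).toLinearMap.comp
      (Vert k J π x).subtype).codRestrict _ fun u => hm x u.1 u.2
  (h' (ψ x)).compl₁₂ L L

lemma isPullbackAt_pullback (hm : ∀ x, ∀ u ∈ Vert k J π x, mfderiv (𝓟 J) (𝓟 J') ψ x u ∈ Vert k J' π'
  (ψ x)) (h' : FibreForm k J' π') (x : P) : IsPullbackAt ψ (pullback ψ hm h') h' x := by
  intro u v u' v' hu hv; have e1 : u' = ⟨_, hm x u.1 u.2⟩ := Subtype.ext hu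
  have e2 : v' = ⟨_, hm x v.1 v.2⟩ := Subtype.ext hv; rw [e1, e2]; rfl

end Naturality

lemma apply_eq_zero_of_line {V W : Type*} [NormedAddCommGroup V] [NormedSpace ℝ V]
  [NormedAddCommGroup W] [NormedSpace ℝ W] {f : V → W} {L : V →L[ℝ] W} {s : Set V} {p a : V}
  (hf : HasFDerivWithinAt f L s p) (h : ∀ᶠ t : ℝ in 𝓝 0, p + t • a ∈ s ∧ f (p + t • a) = f p) :
  L a = 0 := by
  obtain ⟨U, hU, hUo, hU0⟩ := eventually_nhds_iff.1 h
  have h1 : HasDerivWithinAt (fun t : ℝ => p + t • a) a U 0 := by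
    have := ((hasDerivAt_id (0 : ℝ)).smul_const a).const_add p; simpa using this.hasDerivWithinAt
  have h2 : HasFDerivWithinAt f L s (p + (0 : ℝ) • a) := by simpa using hf
  have h3 := h2.comp_hasDerivWithinAt (0 : ℝ) h1 fun t ht => (hU t ht).1
  have h4 := h3.hasDerivAt (hUo.mem_nhds hU0)
  have h5 : HasDerivAt (f ∘ fun t : ℝ => p + t • a) 0 0 := by
    refine (hasDerivAt_const (0 : ℝ) (f p)).congr_of_eventuallyEq ?_
    filter_upwards [hUo.mem_nhds hU0] with t ht using (hU t ht).2
  exact h4.unique h5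

lemma range_half : ℛ₀ = {z | 0 ≤ z 0} := range_modelWithCornersEuclideanHalfSpace n

lemma continuous_coord_zero : Continuous fun z : 𝔼 n => z 0 := (proj₀).continuous

lemma mem_half {p : 𝕍} : p ∈ ℛ ↔ 0 ≤ p.2 0 := by rw [range_model_eq, range_half]; simp

lemma range_full_prod : range 𝓕 = univ := by
  rw [range_model_eq, ModelWithCorners.range_eq_univ, univ_prod_univ]

lemma boundaryForm_eq {H : Type*} [TopologicalSpace H] (J : ModelWithCorners ℝ (𝔼 n) H)
  {G : 𝔼 n → 𝕄 n} {z a : 𝔼 n} (hdet : (G z).det ≠ 0) : boundaryForm J G z a =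
  (chrL (range J) G z a a) 0 / √((G z)⁻¹ 0 0) := by
  have hinv : ∀ l, ∑ m, G z l m * (G z)⁻¹ m 0 = (1 : 𝕄 n) l 0 := by
    intro l; rw [← Matrix.mul_nonsing_inv (G z) hdet.isUnit, Matrix.mul_apply]
  have h1 : ∀ l, (∑ i, ∑ j, christoffel J G l i j z * a i * a j) = (chrL (range J) G z a a) l := by
    intro l; rw [chrL_apply]; rfl
  simp only [boundaryForm, h1, outwardNormal]
  have h2 : ∀ l, ∑ m, G z l m * (chrL (range J) G z a a) l * (-(G z)⁻¹ m 0 / √((G z)⁻¹ 0 0)) =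
      -((1 : 𝕄 n) l 0 * (chrL (range J) G z a a) l / √((G z)⁻¹ 0 0)) := by
    intro l; rw [← hinv l, sum_mul, Finset.sum_div, ← sum_neg_distrib]
    exact sum_congr rfl fun m _ => by ring
  simp only [h2, sum_neg_distrib, neg_neg]
  rw [Finset.sum_eq_single 0 (by intro b _ hb; simp [hb]) (by simp)]
  simp

section BoundaryCharts

/-- The height of a point above the boundary in a chart. -/
def height (e : OPHomeo E 𝔐₊) (x : E) : ℝ := (e.extend 𝓗 x).2 0

lemma height_nonneg (e : OPHomeo E 𝔐₊) (x : E) : 0 ≤ height e x := mem_half.1 ⟨e x, rfl⟩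

lemma heightL_apply (p : 𝕍) : 𝐡 p = p.2 0 := rfl

variable {e : OpenPartialHomeomorph P (ModelProd (𝔼 k) H)} {e' :
  OpenPartialHomeomorph E (ModelProd (𝔼 k) (ℍ n))}

lemma height_pos_of_interior (he : e ∈ maximalAtlas (𝓟 J) ∞ P) (he' : e' ∈ maximalAtlas 𝓗 ∞ E)
  {ψ : P → E} {x : P} (hψ : MDifferentiableAt (𝓟 J) 𝓗 ψ x) (hx : x ∈ e.source)
  (hx' : ψ x ∈ e'.source) (hs : Function.Surjective (mfderiv (𝓟 J) 𝓗 ψ x))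
  (hi : e.extend (𝓟 J) x ∈ interior ℛJ) : 0 < height e' (ψ x) := by
  refine (height_nonneg e' _).lt_of_ne' fun h0 => ?_
  have hd := fun u => dChart_mfderiv he he' hψ hx hx' u
  set T := e'.extend 𝓗 ∘ ψ ∘ (e.extend (𝓟 J)).symm with hT
  set p := e.extend (𝓟 J) x with hp
  have hr : ℛJ ∈ 𝓝 p := mem_interior_iff_mem_nhds.1 hi; rw [fderivWithin_of_mem_nhds hr] at hd
  have hTp : T p = e'.extend 𝓗 (ψ x) := by simp only [hT, hp, comp_apply, e.extend_left_inv hx]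
  have hsurj : Function.Surjective (fderiv ℝ T p) := by
    intro w; obtain ⟨v, hv⟩ := (dChart_bijective he' hx').2 w; obtain ⟨u, rfl⟩ := hs v
    exact ⟨_, (hd u).symm.trans hv⟩
  have hdiff : DifferentiableAt ℝ T p := by
    by_contra hcon; rw [fderiv_zero_of_not_differentiableAt hcon] at hsurj
    obtain ⟨v, hv⟩ := hsurj ((0 : 𝔼 k), 𝐞 0); have := congrArg (fun q => q.2 0) hv
    simp at this
  have hmin : IsLocalMin (fun q => 𝐡 (T q)) p := by
    refine Eventually.of_forall fun q => ?_
    change 𝐡 (T p) ≤ 𝐡 (T q); rw [hTp, heightL_apply, heightL_apply]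
    exact (le_of_eq h0).trans (height_nonneg e' _)
  have hz := hmin.hasFDerivAt_eq_zero ((𝐡).hasFDerivAt.comp p hdiff.hasFDerivAt)
  obtain ⟨v, hv⟩ := hsurj ((0 : 𝔼 k), 𝐞 0); have := congrArg (fun L => L v) hz
  simp only [ContinuousLinearMap.comp_apply, hv] at this; simp [heightL_apply] at this

lemma interior_range_half_prod : interior ℛ = {p | 0 < p.2 0} := by
  rw [range_model_eq, interior_prod_eq, interior_univ,
    interior_range_modelWithCornersEuclideanHalfSpace]
  ext p; simp

variable {x : E}

lemma height_pos_iff {e : OPHomeo E 𝔐₊} (he : e ∈ maximalAtlas 𝓗 ∞ E)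
  (he' : e' ∈ maximalAtlas 𝓗 ∞ E) (hx : x ∈ e.source) (hx' : x ∈ e'.source) (h : 0 < height e x) :
  0 < height e' x := by
  refine height_pos_of_interior he he' (ψ := id) mdifferentiableAt_id hx hx' ?_ ?_
  · exact mfderiv_id (I := 𝓗) (x := x) ▸ Function.surjective_id
  · rw [interior_range_half_prod]; exact h

lemma mem_bdry_iff (he' : e' ∈ maximalAtlas 𝓗 ∞ E) (hx' : x ∈ e'.source) : x ∈ 𝔅 E ↔ height e' x =
  0 := by
  have h1 : x ∈ 𝔅 E ↔ height (k := k) (n := n) (chartAt 𝔐₊ x) x = 0 := by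
    have : frontier ℛ = {p | p.2 0 = 0} := by
      rw [frontier, (𝓗).isClosed_range.closure_eq, interior_range_half_prod]; ext p
      simp only [Set.mem_sdiff, mem_half, mem_ofPred_eq, not_lt]
      exact ⟨fun h => le_antisymm h.2 h.1, fun h => ⟨h.ge, h.le⟩⟩
    change extChartAt 𝓗 x x ∈ frontier ℛ ↔ _; rw [this]; rfl
  have hc := IsManifold.chart_mem_maximalAtlas (I := 𝓗) (n := ∞) x; rw [h1]
  constructor
  · intro h; by_contra h'
    exact absurd h (height_pos_iff he' hc hx' (mem_chart_source _ x)
      ((height_nonneg _ _).lt_of_ne' h')).ne'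
  · intro h; by_contra h'
    exact absurd h (height_pos_iff hc he' (mem_chart_source _ x) hx'
      ((height_nonneg _ _).lt_of_ne' h')).ne'

lemma line_eventually_mem {e : OPHomeo P (ModelProd (𝔼 k) H)} {x : P} (hx : x ∈ e.source)
  {Q : P → Prop} (hQ : ∀ᶠ y in 𝓝 x, Q y) {a : 𝕍} (hr : ∀ᶠ t : ℝ in 𝓝 0,
  e.extend (𝓟 J) x + t • a ∈ ℛJ) : ∀ᶠ t : ℝ in 𝓝 0, e.extend (𝓟 J) x + t • a ∈
  (e.extend (𝓟 J)).target ∧ Q ((e.extend (𝓟 J)).symm (e.extend (𝓟 J) x + t • a)) := by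
  have h1 : ∀ᶠ p in 𝓝[ℛJ] (e.extend (𝓟 J) x),
      p ∈ (e.extend (𝓟 J)).target ∧ Q ((e.extend (𝓟 J)).symm p) := by
    rw [← e.map_extend_nhds hx, eventually_map]
    filter_upwards [hQ, e.open_source.mem_nhds hx] with y hy hyc
    exact ⟨(e.extend _).map_source (by simpa using hyc), by rwa [e.extend_left_inv hyc]⟩
  have hc : Tendsto (fun t : ℝ => e.extend (𝓟 J) x + t • a) (𝓝 0) (𝓝 (e.extend (𝓟 J) x)) := by
    have : Continuous (fun t : ℝ => e.extend (𝓟 J) x + t • a) := by fun_prop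
    simpa using this.tendsto 0
  exact (tendsto_nhdsWithin_iff.2 ⟨hc, hr⟩).eventually h1

lemma height_dChart_eq_zero {E1 : Type*} [TopologicalSpace E1] [ChartedSpace 𝔐₊ E1]
  [IsManifold 𝓗 ∞ E1] {e : OPHomeo E1 𝔐₊} {x : E1} {ψ : E1 → E} (he : e ∈ maximalAtlas 𝓗 ∞ E1)
  (he' : e' ∈ maximalAtlas 𝓗 ∞ E) (hx : x ∈ e.source) (hx' : ψ x ∈ e'.source) (hb : x ∈ 𝔅 E1)
  (hψ : ContMDiffAt 𝓗 𝓗 ∞ ψ x) (hbd : ∀ᶠ y in 𝓝 x, y ∈ 𝔅 E1 → ψ y ∈ 𝔅 E) {u : TangentSpace 𝓗 x}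
  (hu : (dChart 𝓗 e x u).2 0 = 0) : (dChart 𝓗 e' (ψ x) (mfderiv 𝓗 𝓗 ψ x u)).2 0 = 0 := by
  rw [dChart_mfderiv he he' (hψ.mdifferentiableAt (by simp)) hx hx' u]
  set a := dChart 𝓗 e x u with ha
  set T := e'.extend 𝓗 ∘ ψ ∘ (e.extend 𝓗).symm with hT
  set p := e.extend 𝓗 x with hp
  have hp0 : p.2 0 = 0 := (mem_bdry_iff he hx).1 hb
  have hT' : SmoothWithinAt T ℛ p := by
    rw [← contMDiffWithinAt_iff_contDiffWithinAt]
    have h2 := (e'.contMDiffAt_extend he' hx').comp x hψ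
    have h3 := smooth_extend_symm he ((e.extend 𝓗).map_source (by simpa using hx))
    exact h2.comp_contMDiffWithinAt_of_eq h3 (e.extend_left_inv hx)
  have hd := (hT'.differentiableWithinAt (by simp)).hasFDerivWithinAt
  refine apply_eq_zero_of_line (((𝐡).hasFDerivAt).comp_hasFDerivWithinAt p hd) ?_
  have hr : ∀ t : ℝ, (p + t • a).2 0 = 0 := fun t => by simp [hp0, hu]
  have hev := line_eventually_mem hx
    (hψ.continuousAt.eventually (e'.open_source.mem_nhds hx') |>.and hbd) (a := a)
    (Eventually.of_forall fun t => mem_half.2 (hr t).ge)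
  have hTp : T p = e'.extend 𝓗 (ψ x) := by simp only [hT, hp, comp_apply, e.extend_left_inv hx]
  filter_upwards [hev] with t ht
  refine ⟨mem_half.2 (hr t).ge, ?_⟩
  have hs : (e.extend 𝓗).symm (p + t • a) ∈ e.source := by
    rw [← e.extend_source (I := 𝓗)]; exact (e.extend 𝓗).map_target ht.1
  have hb1 : (e.extend 𝓗).symm (p + t • a) ∈ 𝔅 E1 := by
    rw [mem_bdry_iff he hs, height, (e.extend 𝓗).right_inv ht.1]; exact hr t
  have h1 := (mem_bdry_iff he' ht.2.1).1 (ht.2.2 hb1)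
  have h2 := (mem_bdry_iff he' hx').1 (hbd.self_of_nhds hb); change (T (p + t • a)).2 0 = (T p).2 0
  rw [hTp]; exact h1.trans h2.symm

lemma isBoundaryVector_iff (he' : e' ∈ maximalAtlas 𝓗 ∞ E) (hx' : x ∈ e'.source) (hb : x ∈ 𝔅 E)
  (u : TangentSpace 𝓗 x) : IsBoundaryVector x u ↔ (dChart 𝓗 e' x u).2 0 = 0 := by
  have hc := IsManifold.chart_mem_maximalAtlas (I := 𝓗) (n := ∞) x
  have hid : mfderiv 𝓗 𝓗 (id : E → E) x u = u := by rw [mfderiv_id]; rfl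
  constructor
  · intro h
    have := height_dChart_eq_zero (ψ := id) hc he' (mem_chart_source _ x) hx' hb contMDiffAt_id
      (Eventually.of_forall fun _ h => h) (u := u) h
    rwa [hid] at this
  · intro h
    have := height_dChart_eq_zero (ψ := id) he' hc hx' (mem_chart_source _ x) hb contMDiffAt_id
      (Eventually.of_forall fun _ h => h) (u := u) h
    rw [hid] at this; exact this

end BoundaryCharts

/-- The gradient of the coordinate `z₀`. -/
def grad₀ (G : 𝕄 n) : 𝔼 n := WithLp.toLp 2 fun i => G⁻¹ i 0

lemma grad₀_apply (G : 𝕄 n) (i : Fin n) : grad₀ G i = G⁻¹ i 0 := rfl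

lemma bil_grad₀ {G : 𝕄 n} (hs : ∀ i j, G i j = G j i) (hdet : G.det ≠ 0) (v : 𝔼 n) : bil G
  (grad₀ G) v = v 0 := by
  rw [bil_symm hs, bil_eq_dotProduct]
  have : G.mulVec (grad₀ G).ofLp = Pi.single 0 1 := by
    have h1 : (grad₀ G).ofLp = G⁻¹.mulVec (Pi.single 0 1) := by ext i; simp [grad₀]
    rw [h1, Matrix.mulVec_mulVec, Matrix.mul_nonsing_inv _ hdet.isUnit, Matrix.one_mulVec]
  rw [this]; simp

lemma eq_grad₀ {G : 𝕄 n} (hs : ∀ i j, G i j = G j i) (hdet : G.det ≠ 0) {w : 𝔼 n}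
  (h : ∀ v, bil G w v = v 0) : w = grad₀ G := by
  rw [← sub_eq_zero]; refine eq_zero_of_bil hdet fun v => ?_
  rw [sub_eq_add_neg, ← neg_one_smul ℝ (grad₀ G), bil_add_left, bil_smul_left, h, bil_grad₀ hs hdet]
  ring

lemma grad₀_zero_pos {G : 𝕄 n} (hs : ∀ i j, G i j = G j i) (hp : ∀ a : 𝔼 n, a ≠ 0 → 0 < bil G a a) :
  0 < grad₀ G 0 :=
  inv_zero_zero_pos (posDef_of_bil hs hp)

lemma coord_zero_of_tangential {A : 𝔼 n →L[ℝ] 𝔼 n} (hA : ∀ a, a 0 = 0 → (A a) 0 = 0) (v : 𝔼 n) :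
  (A v) 0 = v 0 * (A (𝐞 0)) 0 := by
  have h1 : A v = A (v - v 0 • 𝐞 0) + v 0 • A (𝐞 0) := by rw [← map_smul, ← map_add, sub_add_cancel]
  rw [h1, PiLp.add_apply, hA _ (by simp), PiLp.smul_apply, zero_add, smul_eq_mul]

lemma grad₀_transform {G G' : 𝕄 n} {A : 𝔼 n →L[ℝ] 𝔼 n} (hs : ∀ i j, G i j = G j i)
  (hs' : ∀ i j, G' i j = G' j i) (hd : G.det ≠ 0) (hd' : G'.det ≠ 0)
  (hA : ∀ a, a 0 = 0 → (A a) 0 = 0) (hb : Function.Surjective A)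
  (h : ∀ u v, bil G u v = bil G' (A u) (A v)) : grad₀ G' = (A (𝐞 0)) 0 • A (grad₀ G) := by
  symm
  refine eq_grad₀ hs' hd' fun v => ?_
  obtain ⟨v, rfl⟩ := hb v; rw [bil_smul_left, ← h, bil_grad₀ hs hd, coord_zero_of_tangential hA v]
  ring

lemma chrL_congr {s t : Set (𝔼 n)} {G : 𝔼 n → 𝕄 n} {z : 𝔼 n} (hst : s =ᶠ[𝓝 z] t) : chrL s G z =
  chrL t G z := by
  simp only [chrL, chr_congr hst EventuallyEq.rfl rfl]

section NormalCurvature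

variable {P : Type*} [TopologicalSpace P] [ChartedSpace (ModelProd (𝔼 k) (ℍ n)) P]
  [IsManifold ((𝓡 k).prod (𝓡∂ n)) ∞ P] {P' : Type*} [TopologicalSpace P']
  [ChartedSpace (ModelProd (𝔼 k) (ℍ n)) P'] [IsManifold ((𝓡 k).prod (𝓡∂ n)) ∞ P'] {π : P → B}
  {π' : P' → B} (c : FibredChart k (𝓡∂ n) π) (c' : FibredChart k (𝓡∂ n) π') {ψ : P → P'} {x : P}
  {h : FibreForm k (𝓡∂ n) π} {h' : FibreForm k (𝓡∂ n) π'}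

lemma FibredChart.ext_zero (hx : x ∈ 𝒮 c) :
    x ∈ 𝔅 P ↔ (c.ext x).2 0 = 0 := mem_bdry_iff c.total_mem hx

lemma FibredChart.isBoundaryVector_iff (hx : x ∈ 𝒮 c) (hb : x ∈ 𝔅 P) (u : Vert k (𝓡∂ n) π x) :
  IsBoundaryVector x u.1 ↔ c.coord x u 0 = 0 :=
  FibreGluing.isBoundaryVector_iff c.total_mem hx hb u.1

lemma normalCurvature_of_pullback (hh : IsFibreMetric h) (hh' : IsFibreMetric h') (hx : x ∈ 𝒮 c)
  (hx' : ψ x ∈ 𝒮 c') (hxb : x ∈ 𝔅 P) (H : IsLocalPullback ψ h h' x)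
  (hbd : ∀ᶠ y in 𝓝 x, y ∈ 𝔅 P → ψ y ∈ 𝔅 P') (u : Vert k (𝓡∂ n) π x) (hu0 : c.coord x u 0 = 0)
  (u' : Vert k (𝓡∂ n) π' (ψ x)) (hu : u'.1 = mfderiv 𝓗 𝓗 ψ x u.1) : c.normalCurvature h x u =
  c'.normalCurvature h' (ψ x) u' := by
  obtain ⟨U, hU, hxU, hsub, hmaps, hsm, hder, hbij, hbil⟩ := exists_slice_data c c' hx hx' H
  have hψ := H.self_of_nhds.1; set y := (c.ext x).1 with hy
  set z := (c.ext x).2 with hz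
  set Φ := sliceMap c c' ψ y with hΦ
  set a := c.coord x u with ha
  have hxr : z ∈ ℛ₀ := slice_mem_range.1 (c.ext_mem_range x)
  have hz0 : z 0 = 0 := (c.ext_zero hx).1 hxb; have hzU : z ∈ ℛ₀ ∩ U := ⟨hxr, hxU⟩
  obtain ⟨U', hU', hsl⟩ := c'.exists_open_slice (c'.ext (ψ x)).1
  have he : Φ z = (c'.ext (ψ x)).2 := congrArg Prod.snd (transit_ext c c' hx)
  have hxU' : Φ z ∈ ℛ₀ ∩ U' := by rw [← hsl, he]; exact c'.ext_mem hx'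
  have hmem : ∀ w ∈ ℛ₀ ∩ U', ((c'.ext (ψ x)).1, w) ∈ c'.ext.target := fun w hw => by
    rw [← hsl] at hw; exact hw
  -- boundary points of the slice
  have hΦ0 : ∀ᶠ w in 𝓝 z, w ∈ ℛ₀ → w 0 = 0 → (Φ w) 0 = 0 := by
    obtain ⟨O, hO, hxO, hOp⟩ := c.exists_open hx
      (hbd.and (hψ.continuousAt.eventually (c'.total.open_source.mem_nhds hx')))
    have hO' : IsOpen {w : 𝔼 n | (y, w) ∈ O} := hO.preimage (Continuous.prodMk_right y)
    filter_upwards [hO'.mem_nhds (show z ∈ {w | (y, w) ∈ O} from hxO)] with w hw hwr hw0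
    obtain ⟨h1, h2, h3⟩ := hOp (y, w) ⟨hw, slice_mem_range.2 hwr⟩
    have h4 : c.ext.symm (y, w) ∈ 𝔅 P := by
      rw [c.ext_zero (c.mem_source h1), c.ext.right_inv h1]; exact hw0
    exact (c'.ext_zero h3).1 (h2 h4)
  obtain ⟨W, hW, hWo, hzW⟩ := eventually_nhds_iff.1 hΦ0
  have hline : ∀ {w b : 𝔼 n}, w ∈ ℛ₀ → w ∈ U ∩ W → w 0 = 0 →
      b 0 = 0 → ∀ᶠ t : ℝ in 𝓝 0, w + t • b ∈ ℛ₀ ∩ U ∧ w + t • b ∈ W ∧ (w + t • b) 0 = 0 := by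
    intro w b hw hwU hw0 hb0
    have hc : Tendsto (fun t : ℝ => w + t • b) (𝓝 0) (𝓝 w) := by
      have : Continuous (fun t : ℝ => w + t • b) := by fun_prop
      simpa using this.tendsto 0
    filter_upwards [hc.eventually (hU.mem_nhds hwU.1), hc.eventually (hWo.mem_nhds hwU.2)]
      with t h1 h2
    have h0 : (w + t • b) 0 = 0 := by simp [hw0, hb0]
    exact ⟨⟨by rw [range_half]; exact h0.ge, h1⟩, h2, h0⟩
  have hA0 : ∀ w ∈ ℛ₀ ∩ U, w ∈ W → w 0 = 0 → ∀ b : 𝔼 n, b 0 = 0 → (𝒟 Φ (ℛ₀ ∩ U) w b) 0 = 0 := by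
    intro w hw hwW hw0 b hb0; have hd := hasFDerivWithin hsm hw
    refine apply_eq_zero_of_line ((proj₀).hasFDerivAt.comp_hasFDerivWithinAt w hd) ?_
    filter_upwards [hline hw.1 ⟨hw.2, hwW⟩ hw0 hb0] with t ht
    refine ⟨ht.1, ?_⟩; change (Φ (w + t • b)) 0 = (Φ w) 0
    rw [hW _ ht.2.1 ht.1.1 ht.2.2, hW w hwW hw.1 hw0]
  set A := vderiv c c' ψ (y, z) with hAd
  have hfz : 𝒟 Φ (ℛ₀ ∩ U) z = A := hder z hzU
  have hAt : ∀ b : 𝔼 n, b 0 = 0 → (A b) 0 = 0 := fun b hb => by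
    rw [← hfz]; exact hA0 z hzU hzW hz0 b hb
  have hsecond : (𝒟 (𝒟 Φ (ℛ₀ ∩ U)) (ℛ₀ ∩ U) z a a) 0 = 0 := by
    have hd := hasFDerivWithin (smoothOn_fderiv (uniqueDiff_inter hU) hsm) hzU
    have hL := (((proj₀).comp
      (ContinuousLinearMap.apply ℝ (𝔼 n) a)).hasFDerivAt).comp_hasFDerivWithinAt z hd
    refine apply_eq_zero_of_line (a := a) hL ?_
    filter_upwards [hline hxr ⟨hxU, hzW⟩ hz0 hu0] with t ht
    refine ⟨ht.1, ?_⟩; change (𝒟 Φ (ℛ₀ ∩ U) (z + t • a) a) 0 = (𝒟 Φ (ℛ₀ ∩ U) z a) 0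
    rw [hA0 _ ht.1 ht.2.1 ht.2.2 a hu0, hA0 z hzU hzW hz0 a hu0]
  set l := (A (𝐞 0)) 0 with hl
  have hAsurj : Function.Surjective A := (hbij z hzU).2
  have hlpos : 0 < l := by
    have hne : l ≠ 0 := by
      intro h0; obtain ⟨v, hv⟩ := hAsurj (𝐞 0); have := coord_zero_of_tangential hAt v
      rw [hv, ← hl, h0] at this; simp at this
    refine lt_of_le_of_ne ?_ hne.symm; have hd := hasFDerivWithin hsm hzU; rw [hfz] at hd
    have hcomp := (proj₀).hasFDerivAt.comp_hasFDerivWithinAt z hd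
    refine IsLocalMinOn.hasFDerivWithinAt_nonneg (f := fun w => (Φ w) 0)
      (s := ℛ₀ ∩ U) (a := z) ?_ hcomp (y := 𝐞 0) ?_
    · filter_upwards [self_mem_nhdsWithin] with w hw
      change (Φ z) 0 ≤ (Φ w) 0; rw [hW z hzW hxr hz0]; have := hmaps hw
      rw [hsl, range_half] at this; exact this.1
    · refine mem_posTangentConeAt_of_frequently_mem (Eventually.frequently ?_)
      have hc : Tendsto (fun t : ℝ => z + t • (𝐞 0 : 𝔼 n)) (𝓝 0) (𝓝 z) := by
        have : Continuous (fun t : ℝ => z + t • (𝐞 0 : 𝔼 n)) := by fun_prop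
        simpa using this.tendsto 0
      filter_upwards [nhdsWithin_le_nhds (hc.eventually (hU.mem_nhds hxU)), self_mem_nhdsWithin]
        with t h1 h2
      refine ⟨?_, h1⟩; rw [range_half]; have h3 : (0 : ℝ) ≤ t := (mem_Ioi.1 h2).le; simp [hz0, h3]
  have hGs := fun p i j => coeff_symm c hh p i j
  have hG's := fun p i j => coeff_symm c' hh' p i j
  have hdet := det_ne_zero c hh (hsub hzU); have hdet' := det_ne_zero c' hh' (hmem _ hxU')
  have hgrad := grad₀_transform (G := c.coeff h (y, z))
    (G' := c'.coeff h' ((c'.ext (ψ x)).1, Φ z)) (hGs _) (hG's _) hdet hdet' hAt hAsurj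
    (fun u v => hbil z hzU u v)
  have hgrad0 := congrArg (fun w : 𝔼 n => w 0) hgrad
  simp only [PiLp.smul_apply, smul_eq_mul, grad₀_apply] at hgrad0
  rw [coord_zero_of_tangential hAt (grad₀ _), ← hl, grad₀_apply] at hgrad0; have hmapsU := hmaps
  rw [hsl] at hmapsU
  have htr := chrL_transform (uniqueDiff_inter hU) (range_inter_subset_closure hU)
    (uniqueDiff_inter hU') hsm hmapsU
    (fun i j => (contDiffOn_coeff_slice c hh y i j).mono hsub)
    (fun i j => by rw [← hsl]; exact contDiffOn_coeff_slice c' hh' (c'.ext (ψ x)).1 i j)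
    (fun z hz => det_ne_zero c hh (hsub hz)) (fun z hz => det_ne_zero c' hh' (hmem z hz))
    (fun z _ i j => coeff_symm c hh _ i j) (fun z _ i j => coeff_symm c' hh' _ i j)
    (fun z hz => by rw [hder z hz]; exact (hbij z hz).2)
    (fun z hz a b => by rw [hder z hz]; exact hbil z hz a b) hzU a a
  have htr0 := congrArg (fun w : 𝔼 n => w 0) htr
  simp only [PiLp.add_apply] at htr0
  rw [hsecond, zero_add, hfz, coord_zero_of_tangential hAt (chrL _ _ _ _ _), ← hl] at htr0
  have hcoord : c'.coord _ u' = A a := coord_push c c' hx hx' hψ u u' hu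
  rw [FibredChart.normalCurvature, FibredChart.normalCurvature, boundaryForm_eq _ hdet,
    ← he, boundaryForm_eq _ hdet', hcoord, chrL_congr (range_inter_eq hU hxU),
    chrL_congr (range_inter_eq hU' hxU'.2), ← htr0, hgrad0]
  have hs : √(l * ((c.coeff h (y, z))⁻¹ 0 0 * l)) = l * √((c.coeff h (y, z))⁻¹ 0 0) := by
    rw [show l * ((c.coeff h (y, z))⁻¹ 0 0 * l) = l ^ 2 * (c.coeff h (y, z))⁻¹ 0 0 by ring,
      Real.sqrt_mul (by positivity), Real.sqrt_sq hlpos.le]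
  rw [hs, mul_comm _ l, mul_div_mul_left _ _ hlpos.ne']

end NormalCurvature

section LeftInverse

variable {V W : Type*} [NormedAddCommGroup V] [NormedSpace ℝ V] [FiniteDimensional ℝ V]
  [NormedAddCommGroup W] [NormedSpace ℝ W] [FiniteDimensional ℝ W]

/-- A bijective continuous linear map, as an equivalence. -/
def bijEquiv (L : V →L[ℝ] W) (hL : Bijective L) : V ≃L[ℝ] W :=
  (LinearEquiv.ofBijective L.toLinearMap hL).toContinuousLinearEquiv

lemma coe_bijEquiv (L : V →L[ℝ] W) (hL : Bijective L) :
    (bijEquiv L hL : V →L[ℝ] W) = L := by ext; rfl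

lemma contDiffOn_of_rightInverse {f : V → W} {g : W → V} {s : Set V} {s' : Set W}
  (hs' : UniqueDiffOn ℝ s') (hs : UniqueDiffOn ℝ s) (hf : SmoothOn f s)
  (hb : ∀ p ∈ s, Bijective (𝒟 f s p)) (hg : ContinuousOn g s') (hm : MapsTo g s' s)
  (hfg : ∀ q ∈ s', f (g q) = q) : SmoothOn g s' := by
  have hd : ∀ q (hq : q ∈ s'), HasFDerivWithinAt g
      ((bijEquiv _ (hb (g q) (hm hq))).symm : W →L[ℝ] V) s' q := by
    intro q hq
    have h1 : Tendsto g (𝓝[s'] q) (𝓝[s] (g q)) :=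
      tendsto_nhdsWithin_iff.2 ⟨hg q hq, eventually_nhdsWithin_of_forall hm⟩
    refine HasFDerivWithinAt.of_local_left_inverse h1 ?_ hq (eventually_nhdsWithin_of_forall hfg)
    rw [coe_bijEquiv]; exact ((hf (g q) (hm hq)).differentiableWithinAt (by simp)).hasFDerivWithinAt
  have hfd : ∀ q ∈ s', 𝒟 g s' q = ContinuousLinearMap.inverse (𝒟 f s (g q)) := by
    intro q hq
    rw [(hd q hq).fderivWithin (hs' q hq), ← ContinuousLinearMap.inverse_equiv, coe_bijEquiv]
  have hf' : SmoothOn (𝒟 f s) s := hf.fderivWithin hs (by simp)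
  rw [contDiffOn_infty]; intro m
  induction m with
  | zero => exact contDiffOn_zero.2 hg
  | succ m ih =>
    rw [Nat.cast_succ, contDiffOn_succ_iff_fderivWithin hs']
    refine ⟨fun q hq => (hd q hq).differentiableWithinAt, by simp, ?_⟩
    refine ContDiffOn.congr ?_ hfd; intro q hq
    have h2 : ContDiffWithinAt ℝ m (fun q => 𝒟 f s (g q)) s' q :=
      ((hf' (g q) (hm hq)).of_le (by exact_mod_cast le_top)).comp q (ih q hq) hm
    have h3 : ContDiffAt ℝ m ContinuousLinearMap.inverse (𝒟 f s (g q)) := by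
      have := contDiffAt_map_inverse (𝕜 := ℝ) (n := m) (bijEquiv _ (hb (g q) (hm hq)))
      rwa [coe_bijEquiv] at this
    exact h3.comp_contDiffWithinAt q h2

lemma exists_local_inverse {f : V → W} {O : Set V} {a : V} (hO : IsOpen O) (ha : a ∈ O)
  (hf : SmoothOn f O) (hb : Bijective (fderiv ℝ f a)) : ∃ e : OPHomeo V W, e.source ⊆ O ∧
  a ∈ e.source ∧ (∀ p, e p = f p) ∧ SmoothOn e.symm e.target ∧ ∀ p ∈ e.source, Bijective
  (fderiv ℝ f p) := by
  have hfa : ContDiffAt ℝ ∞ f a := hf.contDiffAt (hO.mem_nhds ha)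
  have hd : HasFDerivAt f (bijEquiv _ hb : V →L[ℝ] W) a := by
    rw [coe_bijEquiv]; exact (hfa.differentiableAt (by simp)).hasFDerivAt
  let e₀ := hfa.toOpenPartialHomeomorph f hd (by simp)
  have he0 : ∀ p, e₀ p = f p := fun p => by rw [ContDiffAt.toOpenPartialHomeomorph_coe]
  have hcont : ContinuousOn (fderiv ℝ f) O := hf.continuousOn_fderiv_of_isOpen hO (by simp)
  let U : Set V := O ∩ fderiv ℝ f ⁻¹' range ((↑) : (V ≃L[ℝ] W) → (V →L[ℝ] W))
  have hU : IsOpen U := hcont.isOpen_inter_preimage hO ContinuousLinearEquiv.isOpen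
  have hbU : ∀ p ∈ U, Bijective (fderiv ℝ f p) := by
    rintro p ⟨-, L, hL⟩; rw [← hL]; exact L.bijective
  have haU : a ∈ U := ⟨ha, bijEquiv _ hb, coe_bijEquiv _ hb⟩
  refine ⟨e₀.restrOpen U hU, fun p hp => hp.2.1,
    ⟨ContDiffAt.mem_toOpenPartialHomeomorph_source hfa hd (by simp), haU⟩, he0, ?_,
    fun p hp => hbU p hp.2⟩
  intro q hq; have hmem := (e₀.restrOpen U hU).map_target hq
  set p := (e₀.restrOpen U hU).symm q with hp
  refine ContDiffAt.contDiffWithinAt ?_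
  refine (e₀.restrOpen U hU).contDiffAt_symm (f₀' := bijEquiv _ (hbU p hmem.2)) hq ?_ ?_
  · rw [coe_bijEquiv]; have h1 : ContDiffAt ℝ ∞ f p := hf.contDiffAt (hO.mem_nhds hmem.2.1)
    exact ((h1.differentiableAt (by simp)).hasFDerivAt).congr_of_eventuallyEq
      (Eventually.of_forall he0)
  · exact (hf.contDiffAt (hO.mem_nhds hmem.2.1)).congr_of_eventuallyEq (Eventually.of_forall he0)

end LeftInverse

lemma exists_fibredChart {F : P → 𝕍} {N : 𝕍 → P} {U : Set P} {T : Set 𝕍} {b : OPHomeo B (𝔼 k)}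
  (hU : IsOpen U) (hT : IsOpen T) (hb : b ∈ maximalAtlas (𝓡 k) ∞ B)
  (hF : ∀ x ∈ U, F x ∈ T ∩ ℛJ ∧ N (F x) = x) (hN : ∀ p ∈ T ∩ ℛJ, N p ∈ U ∧ F (N p) = p)
  (hFs : ContMDiffOn (𝓟 J) 𝓘(ℝ, 𝕍) ∞ F U) (hNs : ContMDiffOn 𝓘(ℝ, 𝕍) (𝓟 J) ∞ N (T ∩ ℛJ))
  (hπ : ∀ x ∈ U, π x ∈ b.source ∧ (F x).1 = b (π x)) : ∃ c : JChart π, 𝒮 c = U ∧ c.base = b ∧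
  ∀ x ∈ U, c.ext x = F x := by
  have h1 : ∀ q : ModelProd (𝔼 k) H, q ∈ (𝓟 J) ⁻¹' T → (𝓟 J) q ∈ T ∩ ℛJ := fun q hq => ⟨hq, q, rfl⟩
  have hFsymm : ContMDiffOn (𝓟 J) (𝓟 J) ∞ (fun x => (𝓟 J).symm (F x)) U :=
    ((𝓟 J).contMDiffOn_symm).comp hFs fun x hx => (hF x hx).1.2
  have hNI : ContMDiffOn (𝓟 J) (𝓟 J) ∞ (fun q => N ((𝓟 J) q)) ((𝓟 J) ⁻¹' T) :=
    hNs.comp (𝓟 J).contMDiff.contMDiffOn h1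
  let e : OPHomeo P (ModelProd (𝔼 k) H) :=
    { toFun := fun x => (𝓟 J).symm (F x)
      invFun := fun q => N ((𝓟 J) q)
      source := U
      target := (𝓟 J) ⁻¹' T
      map_source' := fun x hx => by
        change (𝓟 J) ((𝓟 J).symm (F x)) ∈ T; rw [(𝓟 J).right_inv (hF x hx).1.2]; exact (hF x hx).1.1
      map_target' := fun q hq => (hN _ (h1 q hq)).1
      left_inv' := fun x hx => by rw [(𝓟 J).right_inv (hF x hx).1.2, (hF x hx).2]
      right_inv' := fun q hq => by rw [(hN _ (h1 q hq)).2, (𝓟 J).left_inv]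
      open_source := hU
      open_target := hT.preimage (𝓟 J).continuous
      continuousOn_toFun := hFsymm.continuousOn
      continuousOn_invFun := hNI.continuousOn }
  have hext : ∀ x ∈ U, (𝓟 J) (e x) = F x := fun x hx => (𝓟 J).right_inv (hF x hx).1.2
  refine ⟨⟨e, b, e.mem_maximalAtlas_of_contMDiffOn hFsymm hNI, hb, fun x hx => (hπ x hx).1,
    fun x hx => ?_⟩, rfl, rfl, hext⟩
  rw [← (hπ x hx).2, ← hext x hx]; rfl

/-- Restriction of a fibred chart to an open set. -/
def FibredChart.restrict (c : JChart π) {U : Set P} (hU : IsOpen U) : JChart π where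
  total := c.total.restr U
  base := c.base
  total_mem := restr_mem_maximalAtlas _ c.total_mem hU
  base_mem := c.base_mem
  proj_mem x hx := c.proj_mem x (by rw [c.total.restr_source' U hU] at hx; exact hx.1)
  fst_eq x hx := c.fst_eq x (by rw [c.total.restr_source' U hU] at hx; exact hx.1)

lemma FibredChart.restrict_source (c : JChart π) {U : Set P} (hU : IsOpen U) :
    (c.restrict hU).total.source = 𝒮 c ∩ U := c.total.restr_source' U hU

lemma IsSmoothFibreBundle.exists_fibredChart {M : Type*} [TopologicalSpace M] [ChartedSpace H M]
  [IsManifold J ∞ M] (hπ : IsSmoothFibreBundle k J π M) (x : P) : ∃ c : JChart π, x ∈ 𝒮 c := by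
  obtain ⟨e, hb, he, he'⟩ := hπ.locally_trivial (π x); have hx : x ∈ e.source := e.mem_source.2 hb
  let b := chartAt (𝔼 k) (π x)
  let f := chartAt H (e x).2
  have hbm : b ∈ maximalAtlas (𝓡 k) ∞ B := IsManifold.chart_mem_maximalAtlas _
  have hd : b.prod f = chartAt (ModelProd (𝔼 k) H) (π x, (e x).2) := rfl
  have hdm : b.prod f ∈ maximalAtlas (𝓟 J) ∞ (B × M) := by
    rw [hd]; exact IsManifold.chart_mem_maximalAtlas _
  let t : OPHomeo P (ModelProd (𝔼 k) H) := e.toOpenPartialHomeomorph.trans (b.prod f)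
  have ht : t ∈ maximalAtlas (𝓟 J) ∞ P := by
    apply t.mem_maximalAtlas_of_contMDiffOn
    · exact (contMDiffOn_of_mem_maximalAtlas hdm).comp (he.mono fun y hy => hy.1) fun y hy => hy.2
    · exact he'.comp ((contMDiffOn_symm_of_mem_maximalAtlas hdm).mono fun y hy => hy.1)
        fun y hy => hy.2
  have hpr : ∀ y ∈ t.source, (e y).1 = π y := fun y hy => e.coe_fst hy.1
  refine ⟨⟨t, b, ht, hbm, fun y hy => ?_, fun y hy => ?_⟩, hx, ?_, mem_chart_source _ _⟩
  · rw [← hpr y hy]; exact hy.2.1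
  · rw [← hpr y hy]; rfl
  · change (e x).1 ∈ b.source; rw [e.coe_fst hx]; exact mem_chart_source _ _

lemma FibredChart.isOpen_target (c : FChart ϖ) : IsOpen c.ext.target := by
  rw [isOpen_iff_mem_nhds]; intro p hp; have := c.target_mem_nhdsWithin hp
  rwa [show range 𝓕 = univ by
    rw [range_model_eq, ModelWithCorners.range_eq_univ, univ_prod_univ], nhdsWithin_univ] at this

lemma FibredChart.contMDiffOn_ext_symm (c : FChart ϖ) :
    ContMDiffOn 𝓘(ℝ, 𝕍) 𝓕 ∞ c.ext.symm c.ext.target := fun _ hp =>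
  (smooth_extend_symm c.total_mem hp).mono c.total.extend_target_subset_range

lemma FibredChart.exists_rechart (c : FChart ϖ) (e : OPHomeo 𝕍 𝕍) (he : SmoothOn e e.source)
  (he' : SmoothOn e.symm e.target) {b : OPHomeo B (𝔼 k)} (hb : b ∈ maximalAtlas (𝓡 k) ∞ B) {x : X}
  (hx : x ∈ 𝒮 c) (hxe : c.ext x ∈ e.source) (hxb : ϖ x ∈ b.source)
  (hfst : ∀ w ∈ 𝒮 c, c.ext w ∈ e.source → ϖ w ∈ b.source → (e (c.ext w)).1 = b (ϖ w)) : ∃ c' :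
  FChart ϖ, x ∈ 𝒮 c' ∧ 𝒮 c' ⊆ 𝒮 c ∧ c'.base = b ∧ (∀ w, w ∈ 𝒮 c' ↔ (w ∈ 𝒮 c ∧ ϖ w ∈ b.source) ∧
  c.ext w ∈ e.source) ∧ ∀ w ∈ 𝒮 c', c'.ext w = e (c.ext w) := by
  have hcπ : ContinuousOn ϖ 𝒮 c := fun w hw =>
    (c.contMDiffAt_proj hw).continuousAt.continuousWithinAt
  have hV : IsOpen (𝒮 c ∩ ϖ ⁻¹' b.source) :=
    hcπ.isOpen_inter_preimage c.total.open_source b.open_source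
  set d := c.restrict hV with hd
  have hds : 𝒮 d = 𝒮 c ∩ ϖ ⁻¹' b.source := by
    rw [hd, c.restrict_source]; exact inter_eq_right.2 inter_subset_left
  have hdc : ∀ w, d.ext w = c.ext w := fun w => rfl
  have hdco : ContinuousOn d.ext 𝒮 d := by simpa using d.total.continuousOn_extend (I := 𝓕)
  have hU : IsOpen (𝒮 d ∩ d.ext ⁻¹' e.source) :=
    hdco.isOpen_inter_preimage d.total.open_source e.open_source
  have hT : IsOpen (e.target ∩ e.symm ⁻¹' d.ext.target) :=
    e.isOpen_inter_preimage_symm d.isOpen_target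
  have hmain : ∃ c' : FChart ϖ, 𝒮 c' = 𝒮 d ∩ d.ext ⁻¹' e.source ∧ c'.base = b ∧
      ∀ w ∈ 𝒮 d ∩ d.ext ⁻¹' e.source, c'.ext w = e (d.ext w) := by
    refine FibreGluing.exists_fibredChart (F := fun w => e (d.ext w))
      (N := fun p => d.ext.symm (e.symm p)) hU hT hb ?_ ?_ ?_ ?_ ?_
    · rintro w ⟨hw, hwe⟩; refine ⟨⟨⟨e.map_source hwe, ?_⟩, ?_⟩, ?_⟩
      · rw [mem_preimage, e.left_inv hwe]; exact d.ext_mem hw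
      · rw [range_model_eq, ModelWithCorners.range_eq_univ, univ_prod_univ]; trivial
      · rw [e.left_inv hwe, d.symm_ext hw]
    · rintro p ⟨⟨hp, hpd⟩, -⟩
      have h4 : d.ext (d.ext.symm (e.symm p)) = e.symm p := d.ext.right_inv hpd
      refine ⟨⟨d.mem_source hpd, ?_⟩, ?_⟩
      · rw [mem_preimage, h4]; exact e.map_target hp
      · rw [h4, e.right_inv hp]
    · refine he.contMDiffOn.comp (fun w hw => ?_) fun w hw => hw.2
      exact (d.total.contMDiffAt_extend d.total_mem hw.1).contMDiffWithinAt
    · exact d.contMDiffOn_ext_symm.comp (he'.contMDiffOn.mono fun p hp => hp.1.1) fun p hp => hp.1.2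
    · rintro w ⟨hw, hwe⟩; rw [hds] at hw; exact ⟨hw.2, hfst w hw.1 hwe hw.2⟩
  obtain ⟨c', h1, h2, h3⟩ := hmain; refine ⟨c', ?_, ?_, h2, ?_, ?_⟩
  · rw [h1, hds]; exact ⟨⟨hx, hxb⟩, hxe⟩
  · rw [h1, hds]; exact fun w hw => hw.1.1
  · rw [h1, hds]; exact fun w => Iff.rfl
  · rw [h1]; exact h3

lemma FibredChart.exists_comp (c : FChart ϖ) {ι : E → X} [Nonempty E] (hι : Topology.IsEmbedding ι)
  (hs : ContMDiff 𝓗 𝓕 ∞ ι) (hb : ∀ x, Bijective (mfderiv 𝓗 𝓕 ι x)) (hπ : ∀ x, ϖ (ι x) = πE x)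
  (hr : ∀ w ∈ 𝒮 c, w ∈ range ι ↔ 0 ≤ (c.ext w).2 0) : ∃ c' : HChart πE, 𝒮 c' = ι ⁻¹' 𝒮 c ∧ c'.base =
  c.base ∧ ∀ x ∈ ι ⁻¹' 𝒮 c, c'.ext x = c.ext (ι x) := by
  set N : 𝕍 → E := fun p => Function.invFun ι (c.ext.symm p) with hNdef
  have hιN : ∀ p ∈ c.ext.target ∩ ℛ, ι (N p) = c.ext.symm p := by
    rintro p ⟨hp, hp0⟩; refine Function.invFun_eq ?_; rw [mem_half] at hp0
    refine (hr _ (c.mem_source hp)).2 ?_; rwa [c.ext.right_inv hp]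
  have hNι : ∀ x, ι x ∈ 𝒮 c → N (c.ext (ι x)) = x := fun x hx => by
    rw [hNdef]; simp only; rw [c.symm_ext hx, Function.leftInverse_invFun hι.injective x]
  have hNc : ContinuousOn N (c.ext.target ∩ ℛ) := by
    rw [hι.continuousOn_iff]
    exact (c.contMDiffOn_ext_symm.continuousOn.mono inter_subset_left).congr hιN
  refine FibreGluing.exists_fibredChart (F := fun x => c.ext (ι x)) (N := N)
    (c.total.open_source.preimage hs.continuous) c.isOpen_target c.base_mem ?_ ?_ ?_ ?_ ?_
  · intro x hx; refine ⟨⟨c.ext_mem hx, ?_⟩, hNι x hx⟩; rw [mem_half]; exact (hr _ hx).1 ⟨x, rfl⟩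
  · intro p hp; refine ⟨?_, ?_⟩
    · rw [mem_preimage, hιN p hp]; exact c.mem_source hp.1
    · rw [hιN p hp, c.ext.right_inv hp.1]
  · intro x hx
    exact ((c.total.contMDiffAt_extend c.total_mem hx).comp x hs.contMDiffAt).contMDiffWithinAt
  · intro p hp; set x := N p with hx
    have hxc : ι x ∈ 𝒮 c := by rw [hx, hιN p hp]; exact c.mem_source hp.1
    let e₀ := chartAt 𝔐₊ x
    have hUo : IsOpen (ι ⁻¹' 𝒮 c) := c.total.open_source.preimage hs.continuous
    let e := e₀.restr (ι ⁻¹' 𝒮 c)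
    have hes : e.source = e₀.source ∩ ι ⁻¹' 𝒮 c := e₀.restr_source' _ hUo
    have he : e ∈ maximalAtlas 𝓗 ∞ E :=
      restr_mem_maximalAtlas _ (IsManifold.chart_mem_maximalAtlas x) hUo
    have hxe : x ∈ e.source := by rw [hes]; exact ⟨mem_chart_source _ _, hxc⟩
    set f := c.ext ∘ ι ∘ (e.extend 𝓗).symm with hf
    obtain ⟨O, hO, hOs⟩ := (continuousOn_iff'.1 hNc) e.source e.open_source
    have hOp : p ∈ O := (hOs.subset ⟨hxe, hp⟩).1
    have hNe : ∀ q ∈ (c.ext.target ∩ O) ∩ ℛ, N q ∈ e.source :=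
      fun q hq => (hOs.symm.subset ⟨hq.1.2, hq.1.1, hq.2⟩).1
    have hu : ∀ {T : Set 𝕍}, IsOpen T → UniqueDiffOn ℝ (T ∩ ℛ) := fun hT => by
      rw [inter_comm]; exact (𝓗).uniqueDiffOn.inter hT
    have hsrc : ∀ q ∈ (e.extend 𝓗).target, (e.extend 𝓗).symm q ∈ e.source := fun q hq => by
      simpa only [e.extend_source] using (e.extend 𝓗).map_target hq
    have hnh : ∀ q ∈ (e.extend 𝓗).target, (e.extend 𝓗).target ∈ 𝓝[ℛ] q := by
      intro q hq; have := e.extend_target_mem_nhdsWithin (I := 𝓗) (hsrc q hq)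
      rwa [(e.extend _).right_inv hq] at this
    have hue : UniqueDiffOn ℝ (e.extend 𝓗).target := by
      have h5 : (e.extend 𝓗).target = (𝓗).symm ⁻¹' e.target ∩ ℛ := e.extend_target (I := 𝓗)
      rw [h5]; exact hu (e.open_target.preimage (𝓗).continuous_symm)
    have hfsm : SmoothOn f (e.extend 𝓗).target := by
      rw [← contMDiffOn_iff_contDiffOn]; intro q hq
      have h6 : ContMDiffAt 𝓗 𝓘(ℝ, 𝕍) ∞ (c.ext ∘ ι) ((e.extend 𝓗).symm q) := by
        refine (c.total.contMDiffAt_extend c.total_mem ?_).comp _ hs.contMDiffAt; have := hsrc q hq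
        rw [hes] at this; exact this.2
      exact h6.comp_contMDiffWithinAt q
        ((smooth_extend_symm he hq).mono e.extend_target_subset_range)
    have hfb : ∀ q ∈ (e.extend 𝓗).target, Bijective (𝒟 f (e.extend 𝓗).target q) := by
      intro q hq; have hw := hsrc q hq
      have hwc : ι ((e.extend 𝓗).symm q) ∈ 𝒮 c := by rw [hes] at hw; exact hw.2
      set y := (e.extend 𝓗).symm q with hy
      have hyq : e.extend 𝓗 y = q := (e.extend _).right_inv hq
      have h7 := dChart_mfderiv he c.total_mem (hs.mdifferentiableAt (by simp)) hw hwc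
      rw [hyq] at h7
      have h8 : 𝒟 f (e.extend 𝓗).target q = 𝒟 f ℛ q := by
        refine (fderivWithin_of_mem_nhdsWithin (hnh q hq)
          ((𝓗).uniqueDiffOn q (e.extend_target_subset_range hq)) ?_).symm
        exact (hfsm q hq).differentiableWithinAt (by simp)
      rw [h8]; have hA := dChart_bijective he hw
      have hB := (dChart_bijective c.total_mem hwc).comp (hb y)
      have h9 : (𝒟 f ℛ q) ∘ (dChart 𝓗 e y) = (dChart 𝓕 c.total (ι y)) ∘
            (mfderiv 𝓗 𝓕 ι y) := funext fun u => (h7 u).symm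
      rw [← h9] at hB; exact (Function.Bijective.of_comp_iff _ hA).1 hB
    have hg := contDiffOn_of_rightInverse (f := f) (g := fun q => e.extend 𝓗 (N q))
      (s' := (c.ext.target ∩ O) ∩ ℛ)
      (hu (c.isOpen_target.inter hO)) hue hfsm hfb ?_ ?_ ?_
    · have h10 : ContMDiffOn 𝓘(ℝ, 𝕍) 𝓗 ∞ N ((c.ext.target ∩ O) ∩ ℛ) := by
        have h11 : ContMDiffOn 𝓘(ℝ, 𝕍) 𝓗 ∞ (e.extend 𝓗).symm (e.extend 𝓗).target := fun q hq =>
          (smooth_extend_symm he hq).mono e.extend_target_subset_range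
        refine (h11.comp hg.contMDiffOn fun q hq => ?_).congr fun q hq => ?_
        · exact (e.extend _).map_source (by simpa only [e.extend_source] using hNe q hq)
        · exact (e.extend_left_inv (hNe q hq)).symm
      refine (h10 p ⟨⟨hp.1, hOp⟩, hp.2⟩).mono_of_mem_nhdsWithin ?_
      filter_upwards [self_mem_nhdsWithin, mem_nhdsWithin_of_mem_nhds (hO.mem_nhds hOp)]
        with q hq hqO
      exact ⟨⟨hq.1, hqO⟩, hq.2⟩
    · refine (e.continuousOn_extend (I := 𝓗)).comp
        (hNc.mono fun q hq => ⟨hq.1.1, hq.2⟩) fun q hq => ?_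
      simpa only [e.extend_source] using hNe q hq
    · intro q hq; exact (e.extend _).map_source (by simpa only [e.extend_source] using hNe q hq)
    · intro q hq; change c.ext (ι ((e.extend _).symm (e.extend _ (N q)))) = q
      rw [e.extend_left_inv (hNe q hq), hιN q ⟨hq.1.1, hq.2⟩, c.ext.right_inv hq.1.1]
  · intro x hx; refine ⟨?_, ?_⟩
    · rw [← hπ]; exact c.proj_mem _ hx
    · rw [← hπ]; exact c.fst_eq _ hx

lemma isClosed_bdry : IsClosed (𝔅 E) := by
  rw [← isOpen_compl_iff, isOpen_iff_mem_nhds]; intro x hx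
  let e := chartAt 𝔐₊ x
  have he : e ∈ maximalAtlas 𝓗 ∞ E := IsManifold.chart_mem_maximalAtlas x
  have hxe : x ∈ e.source := mem_chart_source _ x
  have hc : ContinuousAt (height e) x := by
    have h1 : ContinuousAt (e.extend 𝓗) x := e.continuousAt_extend hxe
    exact ((𝐡).continuous.continuousAt).comp h1
  have h0 : height e x ≠ 0 := fun h => hx ((mem_bdry_iff he hxe).2 h)
  filter_upwards [hc.eventually_ne h0, e.open_source.mem_nhds hxe] with y hy hye hyb
  exact hy ((mem_bdry_iff he hye).1 hyb)

section Topology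

lemma SmoothBdryMap.continuous {f : 𝔅 E1 → 𝔅 E2} (hf : SmoothBdryMap f) : Continuous f := by
  rw [continuous_iff_continuousAt]; intro x; obtain ⟨F, hF, hFf⟩ := hf x
  rw [Topology.IsInducing.subtypeVal.continuousAt_iff]
  have h1 : ContinuousAt (fun y : 𝔅 E1 => F y) x :=
    hF.continuousAt.comp continuous_subtype_val.continuousAt
  refine h1.congr ?_; filter_upwards [continuous_subtype_val.continuousAt.eventually hFf] with y hy
  exact hy y.2

variable (φ)

/-- The boundary diffeomorphism, as a homeomorphism. -/
def FibrewiseBdryDiffeo.homeo : 𝔅 E1 ≃ₜ 𝔅 E2 where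
  toEquiv := φ.toEquiv
  continuous_toFun := φ.smooth.continuous
  continuous_invFun := φ.smooth_symm.continuous

open Classical in
/-- A normal form for points of the glued space. -/
def glueRep : Glued φ → E1 ⊕ E2 :=
  Quot.lift (Sum.elim (fun x => if hx : x ∈ 𝔅 E1 then Sum.inr (φ.toEquiv ⟨x, hx⟩ : E2)
    else Sum.inl x) Sum.inr) (by rintro _ _ ⟨x⟩; simp)

lemma glueRep_incl₂ (y : E2) : glueRep φ (ι₂ y) = Sum.inr y := rfl

lemma glueRep_incl₁ (x : E1) (hx : x ∉ 𝔅 E1) : glueRep φ (ι₁ x) = Sum.inl x := by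
  classical
  exact dif_neg hx

lemma incl₁_bdry (x : 𝔅 E1) : ι₁ (x : E1) = ι₂ (φ.toEquiv x : E2) := Quot.sound (GlueRel.glue x)

lemma incl₂_injective : Injective ι₂ := fun x y h => by
  simpa [glueRep_incl₂] using congrArg (glueRep φ) h

lemma incl_eq_iff (x : E1) (y : E2) : ι₁ x = ι₂ y ↔ ∃ hx : x ∈ 𝔅 E1, y = φ.toEquiv ⟨x, hx⟩ := by
  constructor
  · intro h
    by_cases hx : x ∈ 𝔅 E1
    · refine ⟨hx, incl₂_injective φ ?_⟩; rw [← h, ← incl₁_bdry φ ⟨x, hx⟩]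
    · have := congrArg (glueRep φ) h; rw [glueRep_incl₁ φ x hx, glueRep_incl₂] at this; simp at this
  · rintro ⟨hx, rfl⟩; exact incl₁_bdry φ ⟨x, hx⟩

lemma incl₁_injective : Injective ι₁ := fun x y h => by
  by_cases hx : x ∈ 𝔅 E1
  · rw [incl₁_bdry φ ⟨x, hx⟩] at h; obtain ⟨hy, h1⟩ := (incl_eq_iff φ y _).1 h.symm
    have h2 := φ.toEquiv.injective (Subtype.ext h1); exact congrArg Subtype.val h2
  · by_cases hy : y ∈ 𝔅 E1
    · rw [incl₁_bdry φ ⟨y, hy⟩] at h; exact absurd ((incl_eq_iff φ x _).1 h).1 hx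
    · have := congrArg (glueRep φ) h; rw [glueRep_incl₁ φ x hx, glueRep_incl₁ φ y hy] at this
      exact Sum.inl_injective this

lemma glued_cases (w : Glued φ) : (∃ x, w = ι₁ x) ∨ ∃ y, w = ι₂ y := by
  induction w using Quot.ind with
  | mk a => rcases a with x | y
            · exact Or.inl ⟨x, rfl⟩
            · exact Or.inr ⟨y, rfl⟩

lemma mem_seam_iff₁ (x : E1) : ι₁ x ∈ seam φ ↔ x ∈ 𝔅 E1 := by
  constructor
  · rintro ⟨y, hy, h⟩; exact incl₁_injective φ h ▸ hy
  · exact fun h => ⟨x, h, rfl⟩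

lemma mem_seam_iff₂ (y : E2) : ι₂ y ∈ seam φ ↔ y ∈ 𝔅 E2 := by
  constructor
  · rintro ⟨x, hx, h⟩; obtain ⟨hx', rfl⟩ := (incl_eq_iff φ x y).1 h; exact (φ.toEquiv ⟨x, hx'⟩).2
  · intro h; refine ⟨φ.toEquiv.symm ⟨y, h⟩, (φ.toEquiv.symm ⟨y, h⟩).2, ?_⟩
    rw [incl₁_bdry, φ.toEquiv.apply_symm_apply]

lemma seam_eq_inter : seam φ = range ι₁ ∩ range ι₂ := by
  ext w
  constructor
  · rintro ⟨x, hx, rfl⟩; exact ⟨⟨x, rfl⟩, _, (incl₁_bdry φ ⟨x, hx⟩).symm⟩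
  · rintro ⟨⟨x, rfl⟩, y, hy⟩; exact (mem_seam_iff₁ φ x).2 ((incl_eq_iff φ x y).1 hy.symm).1

lemma continuous_incl₁ : Continuous ι₁ := continuous_quot_mk.comp continuous_inl

lemma continuous_incl₂ : Continuous ι₂ := continuous_quot_mk.comp continuous_inr

lemma isClosed_glued_iff {S : Set (Glued φ)} : IsClosed S ↔ IsClosed (ι₁ ⁻¹' S) ∧ IsClosed
  (ι₂ ⁻¹' S) := by
  have h : Topology.IsQuotientMap (Quot.mk (GlueRel φ)) := isQuotientMap_quot_mk
  have h2 : IsClosed S ↔ IsClosed (Quot.mk (GlueRel φ) ⁻¹' S) := (h.isClosed_preimage).symm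
  rw [h2, isClosed_sum_iff]; rfl

lemma isClosedMap_incl₁ : IsClosedMap ι₁ := by
  intro C hC; rw [isClosed_glued_iff, preimage_image_eq _ (incl₁_injective φ)]; refine ⟨hC, ?_⟩
  have h1 : ι₂ ⁻¹' (ι₁ '' C) = Subtype.val '' (φ.homeo '' (Subtype.val ⁻¹' C : Set (𝔅 E1))) := by
    ext y
    constructor
    · rintro ⟨x, hx, h⟩; obtain ⟨hb, rfl⟩ := (incl_eq_iff φ x y).1 h
      exact ⟨_, ⟨⟨x, hb⟩, hx, rfl⟩, rfl⟩
    · rintro ⟨_, ⟨x, hx, rfl⟩, rfl⟩; exact ⟨x, hx, incl₁_bdry φ x⟩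
  rw [h1]
  exact isClosed_bdry.isClosedMap_subtype_val _
    (φ.homeo.isClosedMap _ (hC.preimage continuous_subtype_val))

lemma isClosedMap_incl₂ : IsClosedMap ι₂ := by
  intro C hC; rw [isClosed_glued_iff, preimage_image_eq _ (incl₂_injective φ)]; refine ⟨?_, hC⟩
  have h1 : ι₁ ⁻¹' (ι₂ '' C) = Subtype.val '' (φ.homeo ⁻¹' (Subtype.val ⁻¹' C : Set (𝔅 E2))) := by
    ext x
    constructor
    · rintro ⟨y, hy, h⟩; obtain ⟨hb, rfl⟩ := (incl_eq_iff φ x y).1 h.symm; exact ⟨⟨x, hb⟩, hy, rfl⟩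
    · rintro ⟨x, hx, rfl⟩; exact ⟨_, hx, (incl₁_bdry φ x).symm⟩
  rw [h1]
  exact isClosed_bdry.isClosedMap_subtype_val _
    ((hC.preimage continuous_subtype_val).preimage φ.homeo.continuous)

lemma closed_incl₁ : Topology.IsClosedEmbedding ι₁ :=
  .of_continuous_injective_isClosedMap (continuous_incl₁ φ) (incl₁_injective φ)
    (isClosedMap_incl₁ φ)

lemma closed_incl₂ : Topology.IsClosedEmbedding ι₂ :=
  .of_continuous_injective_isClosedMap (continuous_incl₂ φ) (incl₂_injective φ)
    (isClosedMap_incl₂ φ)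

lemma compactSpace_glued : CompactSpace (Glued φ) :=
  inferInstanceAs (CompactSpace (Quot (GlueRel φ)))

lemma t2Space_glued : T2Space (Glued φ) := by
  have hcl : IsClosedMap (Quot.mk (GlueRel φ)) := by
    intro C hC
    have : Quot.mk (GlueRel φ) '' C = ι₁ '' (Sum.inl ⁻¹' C) ∪ ι₂ '' (Sum.inr ⁻¹' C) := by
      ext w
      constructor
      · rintro ⟨x | y, h, rfl⟩
        · exact Or.inl ⟨x, h, rfl⟩
        · exact Or.inr ⟨y, h, rfl⟩
      · rintro (⟨x, h, rfl⟩ | ⟨y, h, rfl⟩)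
        · exact ⟨_, h, rfl⟩
        · exact ⟨_, h, rfl⟩
    rw [this]
    exact (isClosedMap_incl₁ φ _ (hC.preimage continuous_inl)).union
      (isClosedMap_incl₂ φ _ (hC.preimage continuous_inr))
  have hpt : ∀ w : Glued φ, IsClosed (Quot.mk (GlueRel φ) ⁻¹' {w}) := by
    intro w
    induction w using Quot.ind with
    | mk a =>
      refine IsClosed.preimage continuous_quot_mk ?_; have := hcl {a} isClosed_singleton
      rwa [image_singleton] at this
  refine ⟨fun w w' hne => ?_⟩
  obtain ⟨U, V, hU, hV, hwU, hwV, hd⟩ := normal_separation (hpt w) (hpt w')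
    (Disjoint.preimage _ (disjoint_singleton.2 hne))
  refine ⟨(Quot.mk (GlueRel φ) '' Uᶜ)ᶜ, (Quot.mk (GlueRel φ) '' Vᶜ)ᶜ,
    (hcl _ hU.isClosed_compl).isOpen_compl, (hcl _ hV.isClosed_compl).isOpen_compl, ?_, ?_, ?_⟩
  · rintro ⟨a, ha, h⟩; exact ha (hwU h)
  · rintro ⟨a, ha, h⟩; exact ha (hwV h)
  · rw [disjoint_left]; intro z hz hz'
    induction z using Quot.ind with
    | mk a =>
      have h1 : a ∈ U := by_contra fun h => hz ⟨a, h, rfl⟩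
      have h2 : a ∈ V := by_contra fun h => hz' ⟨a, h, rfl⟩
      exact disjoint_left.1 hd h1 h2

lemma eventually_nhds_seam {x : 𝔅 E1} {Q : Glued φ → Prop} (h₁ : ∀ᶠ y in 𝓝 (x : E1), Q (ι₁ y))
  (h₂ : ∀ᶠ y in 𝓝 (φ.toEquiv x : E2), Q (ι₂ y)) : ∀ᶠ w in 𝓝 (ι₁ (x : E1)), Q w := by
  obtain ⟨U, hU, hUo, hxU⟩ := eventually_nhds_iff.1 h₁
  obtain ⟨V, hV, hVo, hxV⟩ := eventually_nhds_iff.1 h₂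
  have hc := (isClosedMap_incl₁ φ _ hUo.isClosed_compl).union
    (isClosedMap_incl₂ φ _ hVo.isClosed_compl)
  rw [eventually_nhds_iff]; refine ⟨_, ?_, hc.isOpen_compl, ?_⟩
  · intro w hw; rcases glued_cases φ w with ⟨y, rfl⟩ | ⟨y, rfl⟩
    · exact hU y (by_contra fun h => hw (Or.inl ⟨y, h, rfl⟩))
    · exact hV y (by_contra fun h => hw (Or.inr ⟨y, h, rfl⟩))
  · rintro (⟨y, hy, h⟩ | ⟨y, hy, h⟩)
    · exact hy (incl₁_injective φ h ▸ hxU)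
    · rw [incl₁_bdry] at h; exact hy (incl₂_injective φ h ▸ hxV)

lemma isCompact_seam : IsCompact (seam φ) := isClosed_bdry.isCompact.image (continuous_incl₁ φ)

end Topology

section SideFunction

lemma heightL_e₀ : 𝐡 𝐮 = 1 := by simp [heightL_apply, e₀]

/-- In the fibred chart `c`, the closed sets `A` and `A'` are the half-spaces `{z₀ ≥ 0}` and
`{z₀ ≤ 0}`. -/
structure FibredChart.IsSided (c : JChart π) (A A' : Set P) : Prop where
  pos : ∀ w ∈ 𝒮 c, w ∈ A ↔ 0 ≤ (c.ext w).2 0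
  neg : ∀ w ∈ 𝒮 c, w ∈ A' ↔ (c.ext w).2 0 ≤ 0

/-- The derivative `∂T/∂z₀` in a fibred chart. -/
def FibredChart.deriv₀ (c : JChart π) (T : P → ℝ) (w : P) : ℝ := 𝒟 (T ∘ c.ext.symm) ℛJ (c.ext w) 𝐮

lemma FibredChart.differentiableWithinAt_comp_symm (c : JChart π) {T : P → ℝ} (hT : SmoothFun T)
  {w : P} (hw : w ∈ 𝒮 c) : SmoothWithinAt (T ∘ c.ext.symm) ℛJ (c.ext w) := by
  rw [← contMDiffWithinAt_iff_contDiffWithinAt]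
  exact hT.contMDiffAt.comp_contMDiffWithinAt_of_eq
    (smooth_extend_symm c.total_mem (c.ext_mem hw)) rfl

lemma FibredChart.deriv₀_add (c : JChart π) {T T' : P → ℝ} (hT : SmoothFun T) (hT' : SmoothFun T')
  {w : P} (hw : w ∈ 𝒮 c) : c.deriv₀ (fun x => T x + T' x) w = c.deriv₀ T w + c.deriv₀ T' w := by
  have h1 := (c.differentiableWithinAt_comp_symm hT hw).differentiableWithinAt (by simp)
  have h2 := (c.differentiableWithinAt_comp_symm hT' hw).differentiableWithinAt (by simp)
  have h3 := (h1.hasFDerivWithinAt.add h2.hasFDerivWithinAt).fderivWithin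
    ((𝓟 J).uniqueDiffOn _ (c.ext_mem_range w))
  exact congrArg (fun L => L 𝐮) h3

/-- The model domain is invariant under translation in the direction of `∂/∂z₀`. -/
def IsUpward (J : ModelWithCorners ℝ (𝔼 n) H) : Prop :=
  ∀ z ∈ range J, ∀ t : ℝ, 0 ≤ t → z + t • 𝐞 0 ∈ range J

lemma isUpward_full : IsUpward (𝓡 n) := fun _ _ _ _ => by
  rw [ModelWithCorners.range_eq_univ]; trivial

lemma isUpward_half : IsUpward (𝓡∂ n) := fun z hz t ht => by
  rw [range_half] at hz ⊢; change 0 ≤ (z + t • (𝐞 0 : 𝔼 n)) 0; have : (0 : ℝ) ≤ z 0 := hz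
  simpa using add_nonneg this ht

lemma FibredChart.deriv₀_nonneg (c : JChart π) (hJ : IsUpward J) {A A' : Set P}
  (hc : c.IsSided A A') {T : P → ℝ} (hT : SmoothFun T) (hpos : ∀ w ∈ A, 0 ≤ T w) {w : P}
  (hw : w ∈ 𝒮 c) (hwA : w ∈ A) (h0 : T w = 0) : 0 ≤ c.deriv₀ T w := by
  have h1 := ((c.differentiableWithinAt_comp_symm hT hw).differentiableWithinAt
    (by simp)).hasFDerivWithinAt
  set S := ℛJ ∩ {p | 0 ≤ p.2 0} with hS
  have hw0 : 0 ≤ (c.ext w).2 0 := (hc.pos w hw).1 hwA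
  have hmin : IsLocalMinOn (T ∘ c.ext.symm) S (c.ext w) := by
    have h2 := c.target_mem_nhdsWithin (c.ext_mem hw)
    filter_upwards [nhdsWithin_mono _ inter_subset_left h2, self_mem_nhdsWithin] with p hp hpS
    simp only [comp_apply, c.symm_ext hw, h0]; refine hpos _ ((hc.pos _ (c.mem_source hp)).2 ?_)
    rw [c.ext.right_inv hp]; exact hpS.2
  refine hmin.hasFDerivWithinAt_nonneg (h1.mono inter_subset_left) ?_
  apply mem_posTangentConeAt_of_frequently_mem; refine Eventually.frequently ?_
  filter_upwards [self_mem_nhdsWithin] with t ht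
  have ht' : (0 : ℝ) < t := ht; refine ⟨?_, ?_⟩
  · have h3 := c.ext_mem_range w; rw [range_model_eq] at h3 ⊢; refine ⟨trivial, ?_⟩
    exact hJ _ h3.2 t ht'.le
  · change 0 ≤ (c.ext w + t • 𝐮).2 0; simpa [e₀] using add_nonneg hw0 ht'.le

variable [T2Space P] [CompactSpace P]

lemma FibredChart.exists_bump_coord (c : JChart π) {w : P} (hw : w ∈ 𝒮 c) : ∃ b : P → ℝ,
  SmoothFun b ∧ (∀ x, 0 ≤ b x ∧ b x ≤ 1) ∧ (∀ᶠ x in 𝓝 w, b x = 1) ∧ tsupport b ⊆ 𝒮 c := by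
  obtain ⟨V, hV, hVw, hVc⟩ := exists_mem_nhds_isClosed_subset (c.total.open_source.mem_nhds hw)
  obtain ⟨f, hf1, hf0, hf⟩ := exists_contMDiffMap_one_nhds_of_subset_interior (n := ⊤)
    (𝓟 J) (isClosed_singleton (x := w)) (t := V)
    (singleton_subset_iff.2 (mem_interior_iff_mem_nhds.2 hV))
  refine ⟨f, f.contMDiff, fun x => ⟨(hf x).1, (hf x).2⟩, by simpa using hf1, ?_⟩
  refine (closure_minimal ?_ hVw).trans hVc; intro x hx; by_contra h; exact hx (hf0 x h)

lemma FibredChart.contMDiff_bump_mul (c : JChart π) {b : P → ℝ} (hb : SmoothFun b)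
  (hs : tsupport b ⊆ 𝒮 c) {f : P → ℝ} (hf : ContMDiffOn (𝓟 J) 𝓘(ℝ) ∞ f 𝒮 c) :
  SmoothFun fun x => b x * f x := by
  refine contMDiff_of_tsupport fun x hx => ?_
  have hx' : x ∈ 𝒮 c := hs (tsupport_mul_subset_left hx)
  exact hb.contMDiffAt.mul (hf.contMDiffAt (c.total.open_source.mem_nhds hx'))

lemma FibredChart.contMDiffOn_coord₀ (c : JChart π) :
    ContMDiffOn (𝓟 J) 𝓘(ℝ) ∞ (fun x => (c.ext x).2 0) 𝒮 c := fun x hx =>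
  ((𝐡).contDiff.contMDiff.contMDiffAt.comp x
    (c.total.contMDiffAt_extend c.total_mem hx)).contMDiffWithinAt

/-- A smooth function which is positive on one side of a hypersurface, negative on the other side,
and has non-vanishing fibrewise differential along it. -/
lemma exists_side_function (hJ : IsUpward J) {A A' : Set P} (hA : IsClosed A) (hA' : IsClosed A')
  (hU : ∀ w, w ∈ A ∨ w ∈ A') (hc : ∀ w ∈ A ∩ A', ∃ c : JChart π, w ∈ 𝒮 c ∧ c.IsSided A A') : ∃ T :
  P → ℝ, SmoothFun T ∧ (∀ w, 0 ≤ T w ↔ w ∈ A) ∧ (∀ w, T w ≤ 0 ↔ w ∈ A') ∧ ∀ w ∈ A ∩ A', ∃ c :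
  JChart π, w ∈ 𝒮 c ∧ c.IsSided A A' ∧ 0 < c.deriv₀ T w := by
  obtain ⟨T0, hT0⟩ := exists_contMDiffMap_forall_mem_convex_of_local (n := ⊤) (𝓟 J)
    (t := fun w => {s : ℝ | (w ∈ A → 0 ≤ s) ∧ (w ∈ A' → s ≤ 0) ∧ (w ∉ A → s < 0) ∧
      (w ∉ A' → 0 < s)})
    (by
      intro w
      have e : {s : ℝ | (w ∈ A → 0 ≤ s) ∧ (w ∈ A' → s ≤ 0) ∧ (w ∉ A → s < 0) ∧ (w ∉ A' → 0 < s)} =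
          {s | w ∈ A → 0 ≤ s} ∩ ({s | w ∈ A' → s ≤ 0} ∩ ({s | w ∉ A → s < 0} ∩
            {s | w ∉ A' → 0 < s})) := rfl
      rw [e]
      have h1 : ∀ (p : Prop) (C : Set ℝ), Convex ℝ C → Convex ℝ {s | p → s ∈ C} := by
        intro p C hC
        by_cases hp : p <;> simp [hp, hC, convex_univ]
      exact (h1 _ (Ici 0) (convex_Ici 0)).inter ((h1 _ (Iic 0) (convex_Iic 0)).inter
        ((h1 _ (Iio 0) (convex_Iio 0)).inter (h1 _ (Ioi 0) (convex_Ioi 0)))))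
    (by
      intro w
      by_cases hwA : w ∈ A
      · by_cases hwA' : w ∈ A'
        · obtain ⟨c, hwc, hcs⟩ := hc w ⟨hwA, hwA'⟩
          refine ⟨𝒮 c, c.total.open_source.mem_nhds hwc, fun x => (c.ext x).2 0,
            c.contMDiffOn_coord₀, fun x hx => ⟨(hcs.pos x hx).1, (hcs.neg x hx).1, fun h => ?_,
              fun h => ?_⟩⟩
          · exact not_le.1 fun h' => h ((hcs.pos x hx).2 h')
          · exact not_le.1 fun h' => h ((hcs.neg x hx).2 h')
        · refine ⟨A'ᶜ, hA'.isOpen_compl.mem_nhds hwA', fun _ => 1, contMDiffOn_const,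
            fun x hx => ⟨fun _ => zero_le_one, fun h => absurd h hx,
              fun h => absurd ((hU x).resolve_left h) hx, fun _ => zero_lt_one⟩⟩
      · refine ⟨Aᶜ, hA.isOpen_compl.mem_nhds hwA, fun _ => -1, contMDiffOn_const,
            fun x hx => ⟨fun h => absurd h hx, fun _ => by norm_num, fun _ => by norm_num,
              fun h => absurd ((hU x).resolve_right h) hx⟩⟩)
  have hT1 : ∃ T : P → ℝ, SmoothFun T ∧ (∀ w ∈ A, 0 ≤ T w) ∧ (∀ w ∈ A', T w ≤ 0) ∧
      ∀ w ∈ A ∩ A', w ∈ A ∩ A' → ∃ c : JChart π, w ∈ 𝒮 c ∧ c.IsSided A A' ∧ 0 < c.deriv₀ T w := by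
    refine (hA.inter hA').isCompact.induction_on (p := fun s => ∃ T : P → ℝ,
      SmoothFun T ∧ (∀ w ∈ A, 0 ≤ T w) ∧ (∀ w ∈ A', T w ≤ 0) ∧
      ∀ w ∈ A ∩ A', w ∈ s → ∃ c : JChart π, w ∈ 𝒮 c ∧ c.IsSided A A' ∧ 0 < c.deriv₀ T w) ?_ ?_ ?_ ?_
    · exact ⟨fun _ => 0, contMDiff_const, fun _ _ => le_rfl, fun _ _ => le_rfl,
        fun w _ hw => absurd hw (notMem_empty w)⟩
    · rintro s s' hs ⟨T, h1, h2, h3, h4⟩; exact ⟨T, h1, h2, h3, fun w hw hws => h4 w hw (hs hws)⟩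
    · rintro s s' ⟨T, h1, h2, h3, h4⟩ ⟨T', h1', h2', h3', h4'⟩
      refine ⟨fun w => T w + T' w, h1.add h1', fun w hw => add_nonneg (h2 w hw) (h2' w hw),
        fun w hw => add_nonpos (h3 w hw) (h3' w hw), ?_⟩
      rintro w hw (hws | hws)
      · obtain ⟨c, hwc, hcs, hp⟩ := h4 w hw hws; refine ⟨c, hwc, hcs, ?_⟩
        rw [c.deriv₀_add h1 h1' hwc]
        exact add_pos_of_pos_of_nonneg hp (c.deriv₀_nonneg hJ hcs h1' h2' hwc hw.1
          (le_antisymm (h3' w hw.2) (h2' w hw.1)))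
      · obtain ⟨c, hwc, hcs, hp⟩ := h4' w hw hws; refine ⟨c, hwc, hcs, ?_⟩
        rw [c.deriv₀_add h1 h1' hwc]
        exact add_pos_of_nonneg_of_pos (c.deriv₀_nonneg hJ hcs h1 h2 hwc hw.1
          (le_antisymm (h3 w hw.2) (h2 w hw.1))) hp
    · intro w hw; obtain ⟨c, hwc, hcs⟩ := hc w hw
      obtain ⟨b, hb, hb01, hb1, hbs⟩ := c.exists_bump_coord hwc
      have hb0 : ∀ x, x ∉ 𝒮 c → b x = 0 := fun x hx =>
        image_eq_zero_of_notMem_tsupport fun h => hx (hbs h)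
      refine ⟨{x | (∀ᶠ y in 𝓝 x, b y = 1) ∧ x ∈ 𝒮 c}, mem_nhdsWithin_of_mem_nhds
        ((eventually_eventually_nhds.2 hb1).and (c.total.open_source.mem_nhds hwc)),
        fun x => b x * (c.ext x).2 0, c.contMDiff_bump_mul hb hbs c.contMDiffOn_coord₀, ?_, ?_, ?_⟩
      · intro x hx
        by_cases hxc : x ∈ 𝒮 c
        · exact mul_nonneg (hb01 x).1 ((hcs.pos x hxc).1 hx)
        · simp [hb0 x hxc]
      · intro x hx
        by_cases hxc : x ∈ 𝒮 c
        · exact mul_nonpos_of_nonneg_of_nonpos (hb01 x).1 ((hcs.neg x hxc).1 hx)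
        · simp [hb0 x hxc]
      · rintro x - ⟨hx1, hxc⟩; refine ⟨c, hxc, hcs, ?_⟩
        have hev : (fun x => b x * (c.ext x).2 0) ∘ c.ext.symm =ᶠ[𝓝[ℛJ] (c.ext x)] 𝐡 := by
          obtain ⟨O, hO, hxO, hOQ⟩ := c.exists_open hxc hx1
          filter_upwards [mem_nhdsWithin_of_mem_nhds (hO.mem_nhds hxO), self_mem_nhdsWithin]
            with p hp hpr
          obtain ⟨hpt, hp1⟩ := hOQ p ⟨hp, hpr⟩
          simp only [comp_apply, hp1, one_mul, c.ext.right_inv hpt]; rfl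
        have h5 := hev.fderivWithin_eq (𝕜 := ℝ) (hev.self_of_nhdsWithin (c.ext_mem_range x))
        rw [FibredChart.deriv₀, h5, (𝐡).fderivWithin
          ((𝓟 J).uniqueDiffOn _ (c.ext_mem_range x)), heightL_e₀]
        exact one_pos
  obtain ⟨T, h1, h2, h3, h4⟩ := hT1
  have hz : ∀ w ∈ A ∩ A', T0 w = 0 := fun w hw => le_antisymm ((hT0 w).2.1 hw.2) ((hT0 w).1 hw.1)
  refine ⟨fun w => T0 w + T w, T0.contMDiff.add h1, fun w => ⟨fun h => ?_, fun h => ?_⟩,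
    fun w => ⟨fun h => ?_, fun h => ?_⟩, fun w hw => ?_⟩
  · by_contra hw; have := (hT0 w).2.2.1 hw; have := h3 w ((hU w).resolve_left hw); linarith
  · exact add_nonneg ((hT0 w).1 h) (h2 w h)
  · by_contra hw; have := (hT0 w).2.2.2 hw; have := h2 w ((hU w).resolve_right hw); linarith
  · exact add_nonpos ((hT0 w).2.1 h) (h3 w h)
  · obtain ⟨c, hwc, hcs, hp⟩ := h4 w hw hw; refine ⟨c, hwc, hcs, ?_⟩
    rw [c.deriv₀_add T0.contMDiff h1 hwc]
    exact add_pos_of_nonneg_of_pos (c.deriv₀_nonneg hJ hcs T0.contMDiff (fun w h => (hT0 w).1 h)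
      hwc hw.1 (hz w hw)) hp

end SideFunction

lemma bijective_transit (c : JChart π) (c' : FibredChart k J' π') {ψ : P → P'} {x : P}
  (hx : x ∈ 𝒮 c) (hx' : ψ x ∈ 𝒮 c') (hψ : SmoothAt ψ x) : Bijective
  (𝒟 (transit c c' ψ) ℛJ (c.ext x)) ↔ Bijective (mfderiv (𝓟 J) (𝓟 J') ψ x) := by
  have hA := dChart_bijective c.total_mem hx; have hB := dChart_bijective c'.total_mem hx'
  have h : (dChart (𝓟 J') c'.total (ψ x)) ∘ (mfderiv (𝓟 J) (𝓟 J') ψ x) =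
      (𝒟 (transit c c' ψ) ℛJ (c.ext x)) ∘
        (dChart (𝓟 J) c.total x) := funext fun u => dChart_mfderiv_eq c c' hx hx' hψ u
  rw [← Function.Bijective.of_comp_iff _ hA, ← h, Function.Bijective.of_comp_iff' hB]

lemma flatL_apply (p : 𝕍) : 𝐟 p = p - p.2 0 • 𝐮 := rfl

lemma flatL_height (p : 𝕍) : (𝐟 p).2 0 = 0 := by simp [flatL_apply, e₀]

lemma flatL_fst (p : 𝕍) : (𝐟 p).1 = p.1 := by simp [flatL_apply, e₀]

lemma flatL_eq_self {p : 𝕍} (hp : p.2 0 = 0) : 𝐟 p = p := by simp [flatL_apply, hp]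

lemma eventually_pos_of_normal_deriv {G : 𝕍 → ℝ} {O : Set 𝕍} (hO : IsOpen O)
  (hG : SmoothOn G (O ∩ ℛ)) (hG0 : ∀ p ∈ O, p.2 0 = 0 → G p = 0) {p₀ : 𝕍} (hp0 : p₀ ∈ O)
  (h0 : p₀.2 0 = 0) (hd : 0 < 𝒟 G ℛ p₀ 𝐮) : ∀ᶠ p in 𝓝 p₀, 0 < p.2 0 → 0 < G p := by
  set s := O ∩ ℛ with hs
  have hus : UniqueDiffOn ℝ s := by rw [hs, inter_comm]; exact (𝓗).uniqueDiffOn.inter hO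
  have hp₀s : p₀ ∈ s := ⟨hp0, mem_half.2 h0.ge⟩
  have hd' : 0 < 𝒟 G s p₀ 𝐮 := by rwa [hs, inter_comm, fderivWithin_inter (hO.mem_nhds hp0)]
  have hcont : ContinuousOn (fun p => 𝒟 G s p 𝐮) s :=
    (hG.continuousOn_fderivWithin hus (by simp)).clm_apply continuousOn_const
  have hev : ∀ᶠ p in 𝓝[s] p₀, 0 < 𝒟 G s p 𝐮 := (hcont p₀ hp₀s).eventually_const_lt hd'
  rw [eventually_nhdsWithin_iff] at hev
  obtain ⟨r, hr, hball⟩ := Metric.eventually_nhds_iff_ball.1 (hev.and (hO.mem_nhds hp0))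
  have hflat : ∀ᶠ p in 𝓝 p₀, 𝐟 p ∈ ball p₀ r := by
    refine (𝐟).continuous.continuousAt.eventually_mem ?_; rw [flatL_eq_self h0]
    exact ball_mem_nhds _ hr
  filter_upwards [ball_mem_nhds p₀ hr, hflat] with p hp hpf hpos
  set γ : ℝ → 𝕍 := fun t => 𝐟 p + t • 𝐮 with hγ
  have hγh : ∀ t, (γ t).2 0 = t := fun t => by
    have := flatL_height p; simp only [hγ, Prod.snd_add, PiLp.add_apply, this]; simp [e₀]
  have hγp : γ (p.2 0) = p := by simp [hγ, flatL_apply]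
  have hγb : ∀ t ∈ Icc 0 (p.2 0), γ t ∈ ball p₀ r := by
    intro t ht
    have h1 := (convex_ball p₀ r) hpf hp (a := 1 - t / p.2 0) (b := t / p.2 0)
      (sub_nonneg.2 ((div_le_one hpos).2 ht.2)) (div_nonneg ht.1 hpos.le) (by ring)
    convert h1 using 1; have h2 : t = t / p.2 0 * p.2 0 := (div_mul_cancel₀ t hpos.ne').symm
    simp only [hγ, flatL_apply]
    conv_lhs => rw [h2]
    module
  have hγs : ∀ t ∈ Icc 0 (p.2 0), γ t ∈ s := fun t ht =>
    ⟨(hball _ (hγb t ht)).2, mem_half.2 ((hγh t).ge.trans' ht.1)⟩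
  have hγd : ∀ t, HasDerivAt γ 𝐮 t := fun t => by
    have := ((hasDerivAt_id t).smul_const 𝐮).const_add (𝐟 p); rwa [one_smul] at this
  have hγc : Continuous γ := continuous_iff_continuousAt.2 fun t => (hγd t).continuousAt
  obtain ⟨t, ht, hslope⟩ := exists_hasDerivAt_eq_slope (G ∘ γ) (fun t => 𝒟 G s (γ t) 𝐮) hpos
    (hG.continuousOn.comp hγc.continuousOn hγs) (by
      intro t ht; have h2 := (hG _ (hγs t ⟨ht.1.le, ht.2.le⟩)).differentiableWithinAt (by simp)
      have h3 : s ∈ 𝓝 (γ t) := by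
        filter_upwards [hO.mem_nhds (hγs t ⟨ht.1.le, ht.2.le⟩).1,
          (𝐡).continuous.continuousAt.eventually_const_lt
            (show (0 : ℝ) < 𝐡 (γ t) from ht.1.trans_eq (hγh t).symm)] with q hq hq'
        exact ⟨hq, mem_half.2 (le_of_lt hq')⟩
      exact (h2.hasFDerivWithinAt.hasFDerivAt h3).comp_hasDerivAt t (hγd t))
  have h4 := (hball _ (hγb t ⟨ht.1.le, ht.2.le⟩)).1 (hγs t ⟨ht.1.le, ht.2.le⟩)
  have h5 : (G ∘ γ) 0 = 0 := hG0 _ (hγs 0 ⟨le_rfl, hpos.le⟩).1 (hγh 0)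
  rw [hslope, h5, sub_zero, sub_zero] at h4; have := (div_pos_iff_of_pos_right hpos).1 h4
  simpa [hγp] using this

lemma exists_sign (c : HChart πE) (c' : FChart ϖ) {ι : E → X} {x : E} (hx : x ∈ 𝒮 c)
  (hx' : ι x ∈ 𝒮 c') (hι : ContMDiff 𝓗 𝓕 ∞ ι) (hb : Bijective (mfderiv 𝓗 𝓕 ι x))
  (hflat : ∀ᶠ y in 𝓝 x, y ∈ 𝔅 E → (c'.ext (ι y)).2 0 = 0) (hxb : x ∈ 𝔅 E) : ∃ σ : ℝ,
  (σ = 1 ∨ σ = -1) ∧ ∀ᶠ y in 𝓝 x, y ∉ 𝔅 E → 0 < σ * (c'.ext (ι y)).2 0 := by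
  set T := transit c c' ι with hT
  set p₀ := c.ext x with hp₀
  obtain ⟨O, hO, hxO, hOQ⟩ := c.exists_open hx
    (hflat.and (hι.continuous.continuousAt.eventually_mem (c'.total.open_source.mem_nhds hx')))
  have h0 : p₀.2 0 = 0 := (c.ext_zero hx).1 hxb
  have hTs : SmoothOn T (O ∩ ℛ) := by
    intro p hp; obtain ⟨hpt, -, hpc⟩ := hOQ p hp
    have h1 := smooth_transit c c' (c.mem_source hpt) hpc hι.contMDiffAt
    rw [c.ext.right_inv hpt] at h1; exact h1.mono inter_subset_right
  have hTh : ∀ p ∈ O, p.2 0 = 0 → 𝐡 (T p) = 0 := by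
    intro p hp hp0; obtain ⟨hpt, hpf, hpc⟩ := hOQ p ⟨hp, mem_half.2 hp0.ge⟩
    refine hpf ((c.ext_zero (c.mem_source hpt)).2 ?_); rwa [c.ext.right_inv hpt]
  have hTd := ((smooth_transit c c' hx hx' hι.contMDiffAt).differentiableWithinAt
    (by simp)).hasFDerivWithinAt
  have hbij := (bijective_transit c c' hx hx' hι.contMDiffAt).2 hb; rw [← hT, ← hp₀] at hTd hbij
  have hGd := (𝐡).hasFDerivAt.comp_hasFDerivWithinAt p₀ hTd; set L := 𝒟 T ℛ p₀ with hL
  have hne : 𝐡 (L 𝐮) ≠ 0 := by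
    intro hz; obtain ⟨a, ha⟩ := hbij.2 𝐮
    have h1 : (𝐡 ∘L L) (𝐟 a) = 0 := by
      refine apply_eq_zero_of_line hGd ?_
      have h2 : ∀ t : ℝ, (p₀ + t • 𝐟 a).2 0 = 0 := fun t => by simp [h0, flatL_height]
      have h3 : ∀ᶠ t : ℝ in 𝓝 0, p₀ + t • 𝐟 a ∈ O := by
        have : Continuous fun t : ℝ => p₀ + t • 𝐟 a := by fun_prop
        refine this.continuousAt.eventually_mem ?_
        simpa only [zero_smul, add_zero] using hO.mem_nhds hxO
      filter_upwards [h3] with t ht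
      refine ⟨mem_half.2 (h2 t).ge, ?_⟩; exact (hTh _ ht (h2 t)).trans (hTh _ hxO h0).symm
    rw [ContinuousLinearMap.comp_apply] at h1
    have h4 : a = 𝐟 a + a.2 0 • 𝐮 := by simp [flatL_apply]
    have h5 := congrArg 𝐡 ha
    rw [h4, map_add, map_smul, map_add, map_smul, h1, hz, heightL_e₀, smul_zero, add_zero] at h5
    exact zero_ne_one h5
  obtain ⟨σ, hσ, hσp⟩ : ∃ σ : ℝ, (σ = 1 ∨ σ = -1) ∧ 0 < σ * 𝐡 (L 𝐮) := by
    rcases hne.lt_or_gt with h | h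
    · exact ⟨-1, Or.inr rfl, by linarith⟩
    · exact ⟨1, Or.inl rfl, by linarith⟩
  refine ⟨σ, hσ, ?_⟩
  have hkey := eventually_pos_of_normal_deriv (G := fun p => σ * 𝐡 (T p)) hO
    (contDiffOn_const.mul ((𝐡).contDiff.comp_contDiffOn hTs))
    (fun p hp hp0 => by simp only [hTh p hp hp0, mul_zero]) hxO h0 (by
      have h6 : HasFDerivWithinAt (fun p => σ * 𝐡 (T p)) _ _ _ := hGd.const_mul σ
      rw [h6.fderivWithin ((𝓗).uniqueDiffOn _ (c.ext_mem_range x))]; exact hσp)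
  have hc : ContinuousAt c.ext x := c.total.continuousAt_extend hx
  filter_upwards [hc.eventually hkey, c.total.open_source.mem_nhds hx] with y hy hyc hyb
  have h7 := hy ((mem_half.1 (c.ext_mem_range y)).lt_of_ne' fun h => hyb ((c.ext_zero hyc).2 h))
  rwa [hT, transit_ext c c' hyc] at h7

lemma exists_flat_chart (c : HChart πE) (d : FChart ϖ) {ι : E → X} {x : E} (hx : x ∈ 𝒮 c)
  (hx' : ι x ∈ 𝒮 d) (hι : ContMDiff 𝓗 𝓕 ∞ ι) (hb : Bijective (mfderiv 𝓗 𝓕 ι x))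
  (hπ : ∀ y, ϖ (ι y) = πE y) (hxb : x ∈ 𝔅 E) : ∃ c' : FChart ϖ, ι x ∈ 𝒮 c' ∧ ∀ᶠ y in 𝓝 x, y ∈ 𝔅 E →
  (c'.ext (ι y)).2 0 = 0 := by
  set F := transit c d ι with hF
  set p₀ := c.ext x with hp0
  obtain ⟨O, hO, hxO, hOQ⟩ := c.exists_open hx
    (hι.continuous.continuousAt.eventually_mem (d.total.open_source.mem_nhds hx'))
  have h0 : p₀.2 0 = 0 := (c.ext_zero hx).1 hxb
  have hFs : SmoothOn F (O ∩ ℛ) := by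
    intro p hp; obtain ⟨hpt, hpc⟩ := hOQ p hp
    have h1 := smooth_transit c d (c.mem_source hpt) hpc hι.contMDiffAt
    rw [c.ext.right_inv hpt] at h1; exact h1.mono inter_subset_right
  have hFd := ((smooth_transit c d hx hx' hι.contMDiffAt).differentiableWithinAt
    (by simp)).hasFDerivWithinAt
  have hbij := (bijective_transit c d hx hx' hι.contMDiffAt).2 hb; rw [← hF, ← hp0] at hFd hbij
  set L := 𝒟 F ℛ p₀ with hL
  have hv : (L 𝐮).1 = 0 := by
    obtain ⟨u, hu⟩ := c.exists_coord hx (𝐞 0)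
    have h2 := dChart_mfderiv_eq c d hx hx' hι.contMDiffAt u.1
    have h3 := mfderiv_mem_vert d hx' hι.contMDiffAt (Eventually.of_forall hπ) u.2
    rw [c.dChart_vert hx, hu] at h2; rw [hL, hF, hp0]; change (𝒟 (transit c d ι) _ _ (0, 𝐞 0)).1 = 0
    rw [← h2]; exact (d.mem_vert_iff hx' _).1 h3
  have hmaps : ∀ q ∈ 𝐟 ⁻¹' O, 𝐟 q ∈ O ∩ ℛ := fun q hq => ⟨hq, mem_half.2 (flatL_height q).ge⟩
  set Θ : 𝕍 → _ := fun q => F (𝐟 q) + 𝐡 q • L 𝐮 with hΘ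
  have hΘs : SmoothOn Θ (𝐟 ⁻¹' O) := (hFs.comp (𝐟).contDiff.contDiffOn hmaps).add
      ((𝐡).contDiff.contDiffOn.smul contDiffOn_const)
  have hfp : 𝐟 p₀ = p₀ := flatL_eq_self h0
  have hp₀m : p₀ ∈ 𝐟 ⁻¹' O := by rw [mem_preimage, hfp]; exact hxO
  have hΘd : HasFDerivAt Θ L p₀ := by
    have h1 : HasFDerivWithinAt F L ℛ (𝐟 p₀) := by rwa [hfp]
    have h2 := h1.comp_hasFDerivAt p₀ (𝐟).hasFDerivAt (Eventually.of_forall fun q =>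
      mem_half.2 (flatL_height q).ge)
    have h3 := h2.add ((𝐡).hasFDerivAt.smul_const (L 𝐮)); refine h3.congr_fderiv ?_
    refine ContinuousLinearMap.ext fun a => ?_
    change L (𝐟 a) + a.2 0 • L 𝐮 = L a; rw [← map_smul, ← map_add, flatL_apply, sub_add_cancel]
  obtain ⟨e, heO, hpe, hee, hes, -⟩ := exists_local_inverse
    (hO.preimage (𝐟).continuous) hp₀m hΘs (by rw [hΘd.fderiv]; exact hbij)
  have hΘp : e p₀ = d.ext (ι x) := by
    rw [hee, hΘ]; simp only; rw [hfp, heightL_apply, h0, zero_smul, add_zero]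
    exact transit_ext c d hx
  have hxt : d.ext (ι x) ∈ e.target := hΘp ▸ e.map_source hpe
  obtain ⟨c', hwc', -, -, -, hext⟩ := d.exists_rechart e.symm hes
    ((hΘs.mono heO).congr fun q _ => hee q) c.base_mem hx' hxt
    (by rw [hπ]; exact c.proj_mem x hx) (by
      intro w hw hwe hwb; set q := e.symm (d.ext w) with hq
      have hqs : q ∈ e.source := e.map_target hwe
      have h1 : Θ q = d.ext w := by rw [← hee, hq, e.right_inv hwe]
      obtain ⟨hft, hfc⟩ := hOQ _ (hmaps q (heO hqs))
      have h2 : (Θ q).1 = (F (𝐟 q)).1 := by simp [hΘ, hv]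
      have h3 : d.base (ϖ (ι (c.ext.symm (𝐟 q)))) = d.base (ϖ w) := by
        rw [← d.fst_eq _ hfc, ← d.fst_eq w hw, ← d.ext_apply_fst, ← d.ext_apply_fst, ← h1, h2]; rfl
      have h4 := d.base.injOn (d.proj_mem _ hfc) (d.proj_mem w hw) h3
      rw [← h4, hπ, ← c.fst_eq _ (c.mem_source hft), ← c.ext_apply_fst,
        c.ext.right_inv hft, flatL_fst])
  refine ⟨c', hwc', ?_⟩; have hc : ContinuousAt c.ext x := c.total.continuousAt_extend hx
  filter_upwards [hc.eventually_mem (e.open_source.mem_nhds hpe), c.total.open_source.mem_nhds hx,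
    hι.continuous.continuousAt.eventually_mem (c'.total.open_source.mem_nhds hwc')]
    with y hy hyc hyc' hyb
  have hy0 : (c.ext y).2 0 = 0 := (c.ext_zero hyc).1 hyb
  have h5 : e (c.ext y) = d.ext (ι y) := by
    rw [hee, hΘ]; simp only; rw [flatL_eq_self hy0, heightL_apply, hy0, zero_smul, add_zero]
    exact transit_ext c d hyc
  rw [hext _ hyc', ← h5, e.left_inv hy, hy0]

section Compatible

variable [ChartedSpace (ModelProd (𝔼 k) (𝔼 n)) (Glued φ)] [IsManifold ((𝓡 k).prod (𝓡 n)) ∞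
  (Glued φ)] {h₁ : FibreForm k (𝓡∂ n) π₁} {h₂ : FibreForm k (𝓡∂ n) π₂}
  {h : FibreForm k (𝓡 n) (gluedProj φ)} {c : FibredChart k (𝓡 n) (gluedProj φ)}
  {c₁ : FibredChart k (𝓡∂ n) π₁} {c₂ : FibredChart k (𝓡∂ n) π₂}

lemma reflL_apply (p : 𝕍) : 𝐫 p = p - (2 : ℝ) • (p.2 0 • 𝐮) := rfl

lemma reflL_height (p : 𝕍) : (𝐫 p).2 0 = -p.2 0 := by
  simp only [reflL_apply, e₀, Prod.snd_sub, Prod.smul_snd, PiLp.sub_apply, PiLp.smul_apply,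
    PiLp.single_apply, if_true, smul_eq_mul]
  ring

lemma reflL_fst (p : 𝕍) : (𝐫 p).1 = p.1 := by simp [reflL_apply, e₀]

lemma reflL_reflL (p : 𝕍) : 𝐫 (𝐫 p) = p := by rw [reflL_apply, reflL_height, reflL_apply]; module

/-- The reflection as a homeomorphism. -/
def reflHomeo (k n : ℕ) [NeZero n] : (𝔼 k × 𝔼 n) ≃ₜ (𝔼 k × 𝔼 n) where
  toFun := reflL k n
  invFun := reflL k n
  left_inv := reflL_reflL
  right_inv := reflL_reflL
  continuous_toFun := (reflL k n).continuous
  continuous_invFun := (reflL k n).continuous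

lemma FibredChart.exists_reflect (c : FChart ϖ) {x : X} (hx : x ∈ 𝒮 c) : ∃ c' : FChart ϖ, 𝒮 c' =
  𝒮 c ∧ c'.base = c.base ∧ ∀ w ∈ 𝒮 c, c'.ext w = 𝐫 (c.ext w) := by
  obtain ⟨c', -, -, h1, h2, h3⟩ := c.exists_rechart (reflHomeo k n).toOpenPartialHomeomorph
    (𝐫).contDiff.contDiffOn (𝐫).contDiff.contDiffOn c.base_mem hx (mem_univ _)
    (c.proj_mem x hx) (fun w hw _ _ => (reflL_fst _).trans (c.fst_eq w hw))
  have h4 : 𝒮 c' = 𝒮 c := by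
    ext w; rw [h2]; exact ⟨fun h => h.1.1, fun h => ⟨⟨h, c.proj_mem w h⟩, mem_univ _⟩⟩
  exact ⟨c', h4, h1, fun w hw => h3 w (h4 ▸ hw)⟩

section Seam

variable (φ)

lemma isSided_of_signs (h₁ : ∀ y, ι₁ y ∈ 𝒮 c → (y ∈ 𝔅 E1 → (c.ext (ι₁ y)).2 0 = 0) ∧
  (y ∉ 𝔅 E1 → 0 < (c.ext (ι₁ y)).2 0)) (h₂ : ∀ y, ι₂ y ∈ 𝒮 c → y ∉ 𝔅 E2 → (c.ext (ι₂ y)).2 0 < 0) :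
  c.IsSided (range ι₁) (range ι₂) := by
  have key : ∀ w ∈ 𝒮 c, (w ∈ range ι₁ ∧ w ∈ range ι₂ ∧ (c.ext w).2 0 = 0) ∨
      (w ∈ range ι₁ ∧ w ∉ range ι₂ ∧ 0 < (c.ext w).2 0) ∨
      (w ∉ range ι₁ ∧ w ∈ range ι₂ ∧ (c.ext w).2 0 < 0) := by
    intro w hw
    by_cases hs : w ∈ seam φ
    · obtain ⟨y, hy, rfl⟩ := hs; have : ι₁ y ∈ seam φ := ⟨y, hy, rfl⟩; rw [seam_eq_inter] at this
      exact Or.inl ⟨this.1, this.2, (h₁ y hw).1 hy⟩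
    · rcases glued_cases φ w with ⟨y, rfl⟩ | ⟨y, rfl⟩
      · have hy : y ∉ 𝔅 E1 := fun h => hs ((mem_seam_iff₁ φ y).2 h)
        exact Or.inr (Or.inl ⟨⟨y, rfl⟩, fun h => hs (by rw [seam_eq_inter]; exact ⟨⟨y, rfl⟩, h⟩),
          (h₁ y hw).2 hy⟩)
      · have hy : y ∉ 𝔅 E2 := fun h => hs ((mem_seam_iff₂ φ y).2 h)
        exact Or.inr (Or.inr ⟨fun h => hs (by rw [seam_eq_inter]; exact ⟨h, ⟨y, rfl⟩⟩),
          ⟨y, rfl⟩, h₂ y hw hy⟩)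
  constructor
  · intro w hw; rcases key w hw with ⟨h, h', h0⟩ | ⟨h, h', h0⟩ | ⟨h, h', h0⟩
    · exact ⟨fun _ => h0.ge, fun _ => h⟩
    · exact ⟨fun _ => h0.le, fun _ => h⟩
    · exact ⟨fun h1 => absurd h1 h, fun h1 => absurd h1 h0.not_ge⟩
  · intro w hw; rcases key w hw with ⟨h, h', h0⟩ | ⟨h, h', h0⟩ | ⟨h, h', h0⟩
    · exact ⟨fun _ => h0.le, fun _ => h'⟩
    · exact ⟨fun h1 => absurd h1 h', fun h1 => absurd h1 h0.not_ge⟩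
    · exact ⟨fun _ => h0.le, fun _ => h'⟩

/-- Around the seam there are charts in which `E1` and `E2` are complementary half-spaces. -/
lemma exists_sided_chart (hW : IsCompatible φ) (hc1 : HasCharts k n π₁) (hc2 : HasCharts k n π₂)
  {w : Glued φ} (hw : w ∈ seam φ) : ∃ c : FChart (gluedProj φ), w ∈ 𝒮 c ∧ c.IsSided (range ι₁)
  (range ι₂) := by
  obtain ⟨x, hx, rfl⟩ := hw; set x' : 𝔅 E2 := φ.toEquiv ⟨x, hx⟩ with hx'
  have hxx' : ι₁ x = ι₂ x' := incl₁_bdry φ ⟨x, hx⟩; obtain ⟨c₁, hxc₁⟩ := hc1 x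
  obtain ⟨c₂, hxc₂⟩ := hc2 x'; obtain ⟨d, hxd⟩ := hW.fibred (ι₁ x)
  obtain ⟨c, hxc, hflat⟩ := exists_flat_chart c₁ d hxc₁ hxd hW.smooth₁ (hW.bijective₁ x)
    (fun y => rfl) hx
  have hflat' : ∀ᶠ w in 𝓝 (ι₁ x), ∀ y, ι₁ y = w → y ∈ 𝔅 E1 → (c.ext w).2 0 = 0 := by
    have h1 := hflat; rw [(closed_incl₁ φ).isEmbedding.nhds_eq_comap, eventually_comap] at h1
    filter_upwards [h1] with w hw y hy
    rw [← hy]; exact hw y hy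
  have hxc' : ι₂ x' ∈ 𝒮 c := hxx' ▸ hxc
  have hflat₂ : ∀ᶠ y in 𝓝 (x' : E2), y ∈ 𝔅 E2 → (c.ext (ι₂ y)).2 0 = 0 := by
    rw [hxx'] at hflat'
    filter_upwards [(continuous_incl₂ φ).continuousAt.eventually hflat'] with y hy hyb
    refine hy (φ.toEquiv.symm ⟨y, hyb⟩) ?_ (φ.toEquiv.symm ⟨y, hyb⟩).2
    rw [incl₁_bdry, φ.toEquiv.apply_symm_apply]
  obtain ⟨σ1, hσ1, h₁⟩ := exists_sign c₁ c hxc₁ hxc hW.smooth₁ (hW.bijective₁ x) hflat hx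
  obtain ⟨σ2, hσ2, h₂⟩ := exists_sign c₂ c hxc₂ hxc' hW.smooth₂ (hW.bijective₂ x') hflat₂ x'.2
  have hne : σ2 ≠ σ1 := by
    intro h; rw [h] at h₂
    have h3 : ∀ᶠ w in 𝓝 (ι₁ x), 0 ≤ σ1 * (c.ext w).2 0 := by
      refine eventually_nhds_seam φ (x := ⟨x, hx⟩) ?_ ?_
      · filter_upwards [h₁, hflat] with y hy hy'
        by_cases hyb : y ∈ 𝔅 E1
        · rw [hy' hyb, mul_zero]
        · exact (hy hyb).le
      · filter_upwards [h₂, hflat₂] with y hy hy'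
        by_cases hyb : y ∈ 𝔅 E2
        · rw [hy' hyb, mul_zero]
        · exact (hy hyb).le
    have h4 := line_eventually_mem (J := 𝓡 n) hxc h3 (a := 𝐮) (Eventually.of_forall fun t => by
      rw [range_full_prod]; trivial)
    obtain ⟨r, hr, hball⟩ := Metric.eventually_nhds_iff.1 h4
    have h0 : (c.ext (ι₁ x)).2 0 = 0 := hflat.self_of_nhds hx
    have h5 := hball (y := -σ1 * (r / 2)) (by
      rcases hσ1 with rfl | rfl <;> simp [abs_of_pos hr] <;> linarith)
    have h6 := h5.2
    have h7 : (c.ext (c.ext.symm (c.ext (ι₁ x) + (-σ1 * (r / 2)) • 𝐮))).2 0 = -σ1 * (r / 2) := by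
      rw [c.ext.right_inv h5.1]; simp only [Prod.snd_add, PiLp.add_apply, h0, e₀]; simp
    rw [h7] at h6; rcases hσ1 with rfl | rfl <;> linarith
  have hmain : ∃ d : FChart (gluedProj φ), ι₁ x ∈ 𝒮 d ∧
      (∀ᶠ y in 𝓝 x, (y ∈ 𝔅 E1 → (d.ext (ι₁ y)).2 0 = 0) ∧ (y ∉ 𝔅 E1 → 0 < (d.ext (ι₁ y)).2 0)) ∧
      ∀ᶠ y in 𝓝 (x' : E2), y ∉ 𝔅 E2 → (d.ext (ι₂ y)).2 0 < 0 := by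
    rcases hσ1 with rfl | rfl
    · have hσ : σ2 = -1 := hσ2.resolve_left hne; subst hσ; refine ⟨c, hxc, ?_, ?_⟩
      · filter_upwards [h₁, hflat] with y hy hy'
        exact ⟨hy', fun h => by simpa using hy h⟩
      · filter_upwards [h₂] with y hy h
        have := hy h; linarith
    · have hσ : σ2 = 1 := hσ2.resolve_right hne; subst hσ
      obtain ⟨d, hd, -, hdc⟩ := c.exists_reflect hxc; refine ⟨d, hd ▸ hxc, ?_, ?_⟩
      · filter_upwards [h₁, hflat, hW.smooth₁.continuous.continuousAt.eventually_mem
          (c.total.open_source.mem_nhds hxc)] with y hy hy' hyc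
        rw [hdc _ hyc, reflL_height]
        exact ⟨fun h => by rw [hy' h, neg_zero], fun h => by simpa using hy h⟩
      · filter_upwards [h₂, hW.smooth₂.continuous.continuousAt.eventually_mem
          (c.total.open_source.mem_nhds hxc')] with y hy hyc h
        rw [hdc _ hyc, reflL_height]; have := hy h; linarith
  obtain ⟨d, hxd, hd1, hd2⟩ := hmain
  have hev : ∀ᶠ w in 𝓝 (ι₁ x), (∀ y, ι₁ y = w → (y ∈ 𝔅 E1 → (d.ext (ι₁ y)).2 0 = 0) ∧
        (y ∉ 𝔅 E1 → 0 < (d.ext (ι₁ y)).2 0)) ∧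
      ∀ y, ι₂ y = w → y ∉ 𝔅 E2 → (d.ext (ι₂ y)).2 0 < 0 := by
    have h1 := hd1; rw [(closed_incl₁ φ).isEmbedding.nhds_eq_comap, eventually_comap] at h1
    have h2 := hd2; rw [(closed_incl₂ φ).isEmbedding.nhds_eq_comap, eventually_comap, ← hxx'] at h2
    exact h1.and h2
  obtain ⟨U, hU, hUo, hxU⟩ := eventually_nhds_iff.1 hev
  refine ⟨d.restrict hUo, ?_, isSided_of_signs φ ?_ ?_⟩
  · rw [d.restrict_source]; exact ⟨hxd, hxU⟩
  · intro y hy; rw [d.restrict_source] at hy; exact (hU _ hy.2).1 y rfl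
  · intro y hy; rw [d.restrict_source] at hy; exact (hU _ hy.2).2 y rfl

end Seam

lemma FibredChart.exists_height_chart (c : FChart ϖ) {T : X → ℝ} (hT : ContMDiff 𝓕 𝓘(ℝ) ∞ T) {x : X}
  (hx : x ∈ 𝒮 c) (hd : 0 < c.deriv₀ T x) : ∃ c' : FChart ϖ, x ∈ 𝒮 c' ∧ ∀ w ∈ 𝒮 c', (c'.ext w).2 0 =
  T w := by
  set f := T ∘ c.ext.symm with hf
  have hfs : SmoothOn f c.ext.target := by
    rw [← contMDiffOn_iff_contDiffOn]; exact hT.comp_contMDiffOn c.contMDiffOn_ext_symm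
  set S : 𝕍 → _ := fun p => 𝐟 p + f p • 𝐮 with hS
  have hSs : SmoothOn S c.ext.target := (𝐟).contDiff.contDiffOn.add (hfs.smul contDiffOn_const)
  have hxt := c.ext_mem hx
  have hfd : HasFDerivAt f (fderiv ℝ f (c.ext x)) (c.ext x) :=
    ((hfs.contDiffAt (c.isOpen_target.mem_nhds hxt)).differentiableAt (by simp)).hasFDerivAt
  have hd' : 0 < fderiv ℝ f (c.ext x) 𝐮 := by
    have := hd; rwa [FibredChart.deriv₀, range_full_prod, fderivWithin_univ] at this
  have hSd := (𝐟).hasFDerivAt.add (hfd.smul_const 𝐮)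
  have hb : Bijective (fderiv ℝ S (c.ext x)) := by
    have h1 : fderiv ℝ S (c.ext x) = _ := hSd.fderiv
    have hinj : Injective (fderiv ℝ S (c.ext x)) := by
      rw [injective_iff_map_eq_zero]; intro a ha
      have h2 : 𝐟 a + fderiv ℝ f (c.ext x) a • 𝐮 = 0 := by rw [h1] at ha; exact ha
      have h3 := congrArg 𝐟 h2; have h4 : 𝐟 𝐮 = 0 := by simp [flatL_apply, e₀]
      rw [map_add, map_smul, h4, smul_zero, add_zero, map_zero,
        flatL_eq_self (flatL_height a)] at h3
      rw [h3, zero_add] at h2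
      have h5 : fderiv ℝ f (c.ext x) a = 0 := by
        have := congrArg 𝐡 h2; rwa [map_smul, heightL_e₀, map_zero, smul_eq_mul, mul_one] at this
      have h6 : a = a.2 0 • 𝐮 := by rw [flatL_apply] at h3; exact sub_eq_zero.1 h3
      rw [h6, map_smul, smul_eq_mul] at h5
      have h7 : a.2 0 = 0 := (mul_eq_zero.1 h5).resolve_right hd'.ne'; rw [h6, h7, zero_smul]
    exact ⟨hinj, LinearMap.surjective_of_injective (f := (fderiv ℝ S (c.ext x)).toLinearMap) hinj⟩
  obtain ⟨e, heO, hpe, hee, hes, -⟩ := exists_local_inverse c.isOpen_target hxt hSs hb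
  have hSh : ∀ p, (S p).2 0 = f p := fun p => by
    have := flatL_height p; simp only [hS, Prod.snd_add, PiLp.add_apply, this]; simp [e₀]
  obtain ⟨c', hxc', -, -, hsrc, hext⟩ := c.exists_rechart e ((hSs.mono heO).congr fun q _ => hee q)
    hes c.base_mem hx hpe (c.proj_mem x hx) (fun w hw _ _ => by
      rw [hee, ← c.fst_eq w hw, ← c.ext_apply_fst]; simp [hS, e₀, flatL_fst])
  refine ⟨c', hxc', fun w hw => ?_⟩
  rw [hext w hw, hee, hSh, hf, comp_apply, c.symm_ext ((hsrc w).1 hw).1.1]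

section SeamFunction

variable (φ)

/-- A function on the glued space which serves as the coordinate transverse to the seam. -/
structure SeamFunction (T : Glued φ → ℝ) : Prop where
  smooth : ContMDiff 𝓕 𝓘(ℝ) ∞ T
  nonneg_iff : ∀ w, 0 ≤ T w ↔ w ∈ range ι₁
  nonpos_iff : ∀ w, T w ≤ 0 ↔ w ∈ range ι₂
  chart : ∀ w ∈ seam φ, ∃ c : FChart (gluedProj φ), w ∈ 𝒮 c ∧ ∀ w' ∈ 𝒮 c, (c.ext w').2 0 = T w'

lemma exists_isSeamFunction (hW : IsCompatible φ) (hc1 : HasCharts k n π₁)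
  (hc2 : HasCharts k n π₂) : ∃ T : Glued φ → ℝ, SeamFunction φ T := by
  have := t2Space_glued φ; have := compactSpace_glued φ
  obtain ⟨T, hT, hp, hn, hch⟩ := exists_side_function (J := 𝓡 n) (π := gluedProj φ) isUpward_full
    (closed_incl₁ φ).isClosed_range (closed_incl₂ φ).isClosed_range
    (fun w => (glued_cases φ w).imp (fun ⟨x, hx⟩ => ⟨x, hx.symm⟩) fun ⟨x, hx⟩ => ⟨x, hx.symm⟩)
    (fun w hw => exists_sided_chart φ hW hc1 hc2 (by rwa [seam_eq_inter]))
  refine ⟨T, hT, hp, hn, fun w hw => ?_⟩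
  obtain ⟨c, hwc, -, hd⟩ := hch w (by rwa [← seam_eq_inter])
  exact c.exists_height_chart hT hwc hd

end SeamFunction

/-- A function with `q(0) = 0`, `q'(0) = 1` which is small and supported near `0` on the half-line,
with derivative bounded below by a small negative number. -/
lemma exists_profile {δ ε : ℝ} (hδ : 0 < δ) (hε : 0 < ε) : ∃ q q' : ℝ → ℝ, ContDiff ℝ ∞ q ∧
  (∀ t, HasDerivAt q (q' t) t) ∧ q 0 = 0 ∧ q' 0 = 1 ∧ ∀ t, 0 ≤ t → 0 ≤ q t ∧ q t ≤ ε ∧ q t ≤ t ∧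
  -δ ≤ q' t ∧ q' t ≤ 1 ∧ (ε ≤ t → q t = 0 ∧ q' t = 0) := by
  obtain ⟨C, hC⟩ := (isCompact_Icc (a := (-1 : ℝ)) (b := 1)).exists_bound_of_continuousOn
    contDiff_stepDeriv.continuous.continuousOn
  have hC0 : 0 ≤ C := (norm_nonneg _).trans (hC 0 ⟨by norm_num, by norm_num⟩)
  have hCb : ∀ t, stepDeriv t ≤ C := fun t => by
    by_cases h : t ∈ Icc (-1 : ℝ) 1
    · exact (le_abs_self _).trans (hC t h)
    · rw [stepDeriv_eq_zero fun h' => h (Ioo_subset_Icc_self h')]; exact hC0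
  set L : ℝ := C / δ + 1 with hL
  have hL1 : 1 ≤ L := by rw [hL]; linarith [div_nonneg hC0 hδ.le]
  have hL0 : 0 < L := one_pos.trans_le hL1
  have hLC : C / L ≤ δ := by rw [div_le_iff₀ hL0, hL, mul_add, mul_div_cancel₀ _ hδ.ne']; linarith
  set η : ℝ := ε / (3 * L) with hη
  have hη0 : 0 < η := by positivity
  have hηε : η ≤ ε := by rw [hη, div_le_iff₀ (by positivity)]; nlinarith
  set q1 : ℝ → ℝ := fun t => (1 - ramp (1 - t)) * step (2 - t / L) with hq₁
  set q1' : ℝ → ℝ := fun t => step (1 - t) * step (2 - t / L) +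
    (1 - ramp (1 - t)) * (stepDeriv (2 - t / L) * (-(1 / L))) with hq1'
  have hd1 : ∀ t, HasDerivAt q1 (q1' t) t := by
    intro t
    have h1 : HasDerivAt (fun t => 1 - ramp (1 - t)) (step (1 - t)) t := by
      have := ((hasDerivAt_ramp (1 - t)).comp t ((hasDerivAt_id t).const_sub 1)).const_sub 1
      simpa using! this
    have h2 : HasDerivAt (fun t => step (2 - t / L)) (stepDeriv (2 - t / L) * (-(1 / L))) t :=
      HasDerivAt.comp (h₂ := step) t (hasDerivAt_step (2 - t / L)) (((hasDerivAt_id t).div_const L).const_sub 2)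
    exact h1.mul h2
  have hb : ∀ t, 0 ≤ t → 0 ≤ 1 - ramp (1 - t) ∧ 1 - ramp (1 - t) ≤ 1 ∧ 1 - ramp (1 - t) ≤ t := by
    intro t ht; have h1 := ramp_le (1 - t); rw [max_eq_right (by linarith)] at h1
    have h2 := ramp_nonneg (1 - t); have h3 := le_ramp (1 - t)
    exact ⟨by linarith, by linarith, by linarith⟩
  refine ⟨fun t => η * q1 (t / η), fun t => q1' (t / η), ?_, ?_, ?_, ?_, ?_⟩
  · have h1 : ContDiff ℝ ∞ q1 := by
      refine (contDiff_const.sub (contDiff_ramp.comp (contDiff_const.sub contDiff_id))).mul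
        (contDiff_step.comp (contDiff_const.sub (contDiff_id.div_const L)))
    exact contDiff_const.mul (h1.comp (contDiff_id.div_const η))
  · intro t; have h1 := ((hd1 (t / η)).comp t ((hasDerivAt_id t).div_const η)).const_mul η
    have h2 : η * (q1' (t / η) * (1 / η)) = q1' (t / η) := by field_simp
    rw [h2] at h1; exact h1
  · simp [hq₁, ramp_of_ge le_rfl]
  · simp [hq1', ramp_of_ge le_rfl, step_of_ge le_rfl, step_of_ge one_le_two]
  · intro t ht; have hs : 0 ≤ t / η := div_nonneg ht hη0.le; obtain ⟨h1, h2, h3⟩ := hb _ hs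
    have s0 := step_nonneg (2 - t / η / L); have s1 := step_le_one (2 - t / η / L)
    have r0 := step_nonneg (1 - t / η); have r1 := step_le_one (1 - t / η)
    have d0 := stepDeriv_nonneg (2 - t / η / L); have d1 := hCb (2 - t / η / L)
    have hq1 : q1 (t / η) ≤ 1 - ramp (1 - t / η) := mul_le_of_le_one_right h1 s1
    have hm : (1 - ramp (1 - t / η)) * (stepDeriv (2 - t / η / L) * (1 / L)) ≤ δ := by
      have : stepDeriv (2 - t / η / L) * (1 / L) ≤ C / L := by rw [mul_one_div]; gcongr
      calc _ ≤ 1 * (C / L) := by gcongr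
        _ ≤ δ := by rw [one_mul]; exact hLC
    have hm0 : 0 ≤ (1 - ramp (1 - t / η)) * (stepDeriv (2 - t / η / L) * (1 / L)) := by positivity
    have hq' : q1' (t / η) = step (1 - t / η) * step (2 - t / η / L) -
        (1 - ramp (1 - t / η)) * (stepDeriv (2 - t / η / L) * (1 / L)) := by
      simp only [hq1']; ring
    refine ⟨mul_nonneg hη0.le (mul_nonneg h1 s0), ?_, ?_, ?_, ?_, ?_⟩
    · calc η * q1 (t / η) ≤ η * 1 := by gcongr; linarith
        _ ≤ ε := by linarith
    · calc η * q1 (t / η) ≤ η * (t / η) := by gcongr; linarith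
        _ = t := mul_div_cancel₀ _ hη0.ne'
    · change -δ ≤ q1' (t / η); rw [hq']; have := mul_nonneg r0 s0; linarith
    · change q1' (t / η) ≤ 1; rw [hq']; have := mul_le_one₀ r1 s0 s1; linarith
    · intro htε
      have h3L : 3 * L ≤ t / η := by
        rw [le_div_iff₀ hη0, hη, mul_div_cancel₀ _ (by positivity)]; exact htε
      have h4 : 3 ≤ t / η / L := by rwa [le_div_iff₀ hL0]
      have h5 : step (2 - t / η / L) = 0 := step_of_le (by linarith)
      have h6 : stepDeriv (2 - t / η / L) = 0 := stepDeriv_eq_zero fun h => by have := h.1; linarith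
      constructor
      · simp only [hq₁, h5, mul_zero]
      · change q1' (t / η) = 0; rw [hq', h5, h6]; ring

lemma norm_e₀ : ‖𝐮‖ = 1 := by simp [e₀, Prod.norm_def]

lemma shear_estimate {C m r r' α : ℝ} {f : 𝕍} {d v : 𝔼 n} (hC1 : 1 ≤ C) (hm0 : 0 < m)
  (hm : m ≤ 1 + v 0) (hvC : ‖v‖ ≤ C) (hdC : ‖d‖ ≤ C * ‖f‖) (h1 : 0 ≤ r)
  (h2 : r ≤ 1 / (2 * (C * (1 + C) / min m (1 / 2) + C))) (h4 : -(1 / (2 * C)) ≤ r') (h5 : r' ≤ 1)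
  (hf : f.2 0 = 0) (ha : f + α • 𝐮 + (r • inr ℝ _ _ d + (r' * α) • inr ℝ _ _ v) = 0) : f = 0 ∧ α =
  0 := by
  have hC0 : 0 < C := one_pos.trans_le hC1; set μ := min m (1 / 2) with hμ
  have hμ0 : 0 < μ := lt_min hm0 one_half_pos; set K := C * (1 + C) / μ + C with hK
  have hK0 : 0 < K := by positivity
  have hnr : ∀ z : 𝔼 n, ‖inr ℝ (𝔼 k) (𝔼 n) z‖ = ‖z‖ := fun z => by simp [Prod.norm_def]
  have hv0 : ‖v 0‖ ≤ C := (PiLp.norm_apply_le v 0).trans hvC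
  have hd0 : ‖d 0‖ ≤ C * ‖f‖ := (PiLp.norm_apply_le d 0).trans hdC
  have e1 : α * (1 + r' * v 0) = -(r * d 0) := by
    have := congrArg 𝐡 ha; simp only [map_add, map_smul, map_zero, heightL_apply] at this
    have e3 : α + (r * d 0 + r' * α * v 0) = 0 := by simpa [hf, e₀] using this
    linarith
  have hlow : μ ≤ 1 + r' * v 0 := by
    rcases le_or_gt 0 r' with h | h
    · have h6 := hm; have h7 : μ ≤ m := min_le_left _ _; have h8 : μ ≤ 1 / 2 := min_le_right _ _
      have h9 : μ ≤ 1 + v 0 := h7.trans h6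
      nlinarith [mul_le_mul_of_nonneg_left h9 h, mul_le_mul_of_nonneg_left (h8.trans
        (by norm_num : (1 / 2 : ℝ) ≤ 1)) (sub_nonneg.2 h5)]
    · have h8 : μ ≤ 1 / 2 := min_le_right _ _
      have h9 : |r' * v 0| ≤ 1 / 2 := by
        rw [abs_mul]
        calc |r'| * |v 0| ≤ 1 / (2 * C) * C := by
              gcongr
              · rw [abs_of_neg h]; linarith
              · exact hv0
          _ = 1 / 2 := by field_simp
      linarith [neg_abs_le (r' * v 0)]
  have hq1 : |r'| ≤ 1 := by
    rw [abs_le]; refine ⟨le_trans ?_ h4, h5⟩; rw [neg_le_neg_iff, div_le_one (by positivity)]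
    linarith
  have b1 : |α| * μ ≤ r * (C * ‖f‖) := by
    calc |α| * μ ≤ |α| * |1 + r' * v 0| := by
          gcongr; exact hlow.trans (le_abs_self _)
      _ = r * |d 0| := by rw [← abs_mul, e1, abs_neg, abs_mul, abs_of_nonneg h1]
      _ ≤ _ := by gcongr; exact hd0
  have b2 : ‖f‖ ≤ |α| * (1 + C) + r * (C * ‖f‖) := by
    have e4 : f = -(α • 𝐮 + (r • inr ℝ _ _ d + (r' * α) • inr ℝ _ _ v)) := by
      rw [eq_neg_iff_add_eq_zero, ← ha, ← add_assoc]
    have n1 : ‖α • 𝐮‖ = |α| := by rw [norm_smul, norm_e₀, mul_one, Real.norm_eq_abs]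
    have n2 : ‖r • inr ℝ (𝔼 k) _ d‖ ≤ r * (C * ‖f‖) := by
      rw [norm_smul, hnr, Real.norm_of_nonneg h1]; gcongr
    have n3 : ‖(r' * α) • inr ℝ (𝔼 k) _ v‖ ≤
        |α| * C := by
      rw [norm_smul, hnr, Real.norm_eq_abs, abs_mul]
      calc |r'| * |α| * ‖v‖ ≤ 1 * |α| * C := by gcongr
        _ = |α| * C := by ring
    calc ‖f‖ = ‖α • 𝐮 + (r • inr ℝ _ _ d +
        (r' * α) • inr ℝ _ _ v)‖ := by
          conv_lhs => rw [e4]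
          rw [norm_neg]
      _ ≤ |α| + (r * (C * ‖f‖) + |α| * C) :=
          (norm_add_le _ _).trans (add_le_add n1.le ((norm_add_le _ _).trans (add_le_add n2 n3)))
      _ = _ := by ring
  have b3 : |α| ≤ r * (C * ‖f‖) / μ := by rwa [le_div_iff₀ hμ0]
  have hqK : r * K ≤ 1 / 2 := by
    calc r * K ≤ 1 / (2 * K) * K := by gcongr
      _ = 1 / 2 := by field_simp
  have b4 : ‖f‖ ≤ r * K * ‖f‖ := by
    calc ‖f‖ ≤ r * (C * ‖f‖) / μ * (1 + C) + r * (C * ‖f‖) :=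
          b2.trans (by gcongr)
      _ = _ := by rw [hK]; ring
  have hf0 : ‖f‖ = 0 := by
    have := mul_le_mul_of_nonneg_right hqK (norm_nonneg f); have := norm_nonneg f; linarith
  have hα0 : α = 0 := by rw [hf0] at b3; simpa using b3
  exact ⟨norm_eq_zero.1 hf0, hα0⟩

/-- A diffeomorphism of a half-space, close to the identity and supported near a part of the
boundary, which fixes the boundary and has a prescribed normal derivative there. -/
lemma exists_shear {w : 𝕍 → 𝔼 n} (hw : ContDiff ℝ ∞ w) (hwc : HasCompactSupport w)
  (hw0 : ∀ p, -1 < w p 0) {ρ : ℝ} (hρ : 0 < ρ) : ∃ Θ : 𝕍 → 𝕍, ContDiff ℝ ∞ Θ ∧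
  (∀ p, (Θ p).1 = p.1) ∧ (∀ p, p.2 0 = 0 → Θ p = p) ∧ (∀ p, w (𝐟 p) = 0 → Θ p = p) ∧
  (∀ p, 0 ≤ p.2 0 → 0 ≤ (Θ p).2 0 ∧ dist (Θ p) p ≤ ρ ∧ (ρ ≤ p.2 0 → Θ p = p) ∧
  Bijective (fderiv ℝ Θ p)) ∧ ∀ p, p.2 0 = 0 → ∀ a, fderiv ℝ Θ p a = a + (0, a.2 0 • w p) := by
  obtain ⟨C1, hC₁⟩ := hwc.exists_bound_of_continuous hw.continuous
  obtain ⟨C2, hC₂⟩ := (hwc.fderiv ℝ).exists_bound_of_continuous (hw.continuous_fderiv (by simp))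
  obtain ⟨C, hC1, hCw, hCd⟩ : ∃ C : ℝ, 1 ≤ C ∧ (∀ p, ‖w p‖ ≤ C) ∧ ∀ p, ‖fderiv ℝ w p‖ ≤ C :=
    ⟨max 1 (max C1 C2), le_max_left _ _,
      fun p => (hC₁ p).trans ((le_max_left _ _).trans (le_max_right _ _)),
      fun p => (hC₂ p).trans ((le_max_right _ _).trans (le_max_right _ _))⟩
  have hC0 : 0 < C := one_pos.trans_le hC1
  obtain ⟨m, hm0, hm⟩ : ∃ m : ℝ, 0 < m ∧ ∀ p, m ≤ 1 + w p 0 := by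
    have hcont : Continuous fun p => 1 + w p 0 :=
      continuous_const.add (continuous_coord_zero.comp hw.continuous)
    rcases (tsupport w).eq_empty_or_nonempty with he | hne
    · refine ⟨1, one_pos, fun p => ?_⟩
      rw [image_eq_zero_of_notMem_tsupport (f := w) (x := p) (by rw [he]; exact notMem_empty p)]
      simp
    · obtain ⟨p1, -, hp1⟩ := hwc.isCompact.exists_isMinOn hne hcont.continuousOn
      refine ⟨min 1 (1 + w p1 0), lt_min one_pos (by linarith [hw0 p1]), fun p => ?_⟩
      by_cases hp : p ∈ tsupport w
      · exact (min_le_right _ _).trans (hp1 hp)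
      · rw [image_eq_zero_of_notMem_tsupport hp]; simp
  set μ := min m (1 / 2) with hμ
  have hμ0 : 0 < μ := lt_min hm0 one_half_pos; set K := C * (1 + C) / μ + C with hK
  have hK0 : 0 < K := by positivity
  set ε := min (ρ / C) (1 / (2 * K)) with hε
  have hε0 : 0 < ε := lt_min (div_pos hρ hC0) (by positivity)
  obtain ⟨q, q', hqs, hqd, hq0, hq'0, hq⟩ := exists_profile (δ := 1 / (2 * C)) (by positivity) hε0
  have hερ : ε ≤ ρ := (min_le_left _ _).trans (div_le_self hρ.le hC1)
  set Θ : 𝕍 → 𝕍 := fun p => p + q (p.2 0) • inr ℝ _ _ (w (𝐟 p)) with hΘ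
  have hΘs : ContDiff ℝ ∞ Θ := contDiff_id.add ((hqs.comp (𝐡).contDiff).smul
      ((inr ℝ (𝔼 k) (𝔼 n)).contDiff.comp
        (hw.comp (𝐟).contDiff)))
  have hΘd : ∀ p a, fderiv ℝ Θ p a = a + (q (p.2 0) • inr ℝ _ _ (fderiv ℝ w (𝐟 p) (𝐟 a)) +
        (q' (p.2 0) * a.2 0) • inr ℝ _ _ (w (𝐟 p))) := by
    intro p a
    have h1 : HasFDerivAt (fun p => q (𝐡 p)) (q' (p.2 0) • 𝐡) p :=
      (hqd (p.2 0)).comp_hasFDerivAt p (𝐡).hasFDerivAt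
    have h2 := (hw.differentiable (by simp) (𝐟 p)).hasFDerivAt.comp p (𝐟).hasFDerivAt
    have h3 := (inr ℝ (𝔼 k) (𝔼 n)).hasFDerivAt.comp p h2
    have h4 := (hasFDerivAt_id p).add (h1.smul h3); have h5 : HasFDerivAt Θ _ p := h4
    rw [h5.fderiv]; rfl
  have hdist : ∀ p, Θ p - p = q (p.2 0) • inr ℝ _ _ (w (𝐟 p)) := fun p => by simp [hΘ]
  have hnr : ∀ z : 𝔼 n, ‖inr ℝ (𝔼 k) (𝔼 n) z‖ = ‖z‖ := fun z => by simp [Prod.norm_def]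
  refine ⟨Θ, hΘs, fun p => by simp [hΘ], fun p hp => by simp [hΘ, hp, hq0],
    fun p hp => by simp [hΘ, hp], fun p hp => ⟨?_, ?_, ?_, ?_⟩, fun p hp a => ?_⟩
  · obtain ⟨h1, h2, h3, -⟩ := hq _ hp
    have h4 : (Θ p).2 0 = p.2 0 + q (p.2 0) * w (𝐟 p) 0 := by simp [hΘ]
    rw [h4]; nlinarith [hw0 (𝐟 p)]
  · obtain ⟨h1, h2, h3, -⟩ := hq _ hp
    rw [dist_eq_norm, hdist, norm_smul, hnr, Real.norm_of_nonneg h1]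
    calc q (p.2 0) * ‖w (𝐟 p)‖ ≤ ρ / C * C := by
          gcongr
          · exact h2.trans (min_le_left _ _)
          · exact hCw _
      _ = ρ := div_mul_cancel₀ _ hC0.ne'
  · intro hpρ; have := ((hq _ hp).2.2.2.2.2 (hερ.trans hpρ)).1; simp [hΘ, this]
  · have hinj : Injective (fderiv ℝ Θ p) := by
      rw [injective_iff_map_eq_zero]; intro a ha; rw [hΘd] at ha
      obtain ⟨h1, h2, h3, h4, h5, -⟩ := hq _ hp
      have haf : a = 𝐟 a + a.2 0 • 𝐮 := by rw [flatL_apply]; abel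
      rw [haf]
      obtain ⟨hf0, hα0⟩ := shear_estimate (α := a.2 0) (f := 𝐟 a) hC1 hm0
        (hm (𝐟 p)) (hCw _) ((ContinuousLinearMap.le_opNorm _ _).trans
          (mul_le_mul_of_nonneg_right (hCd _) (norm_nonneg _))) h1 (h2.trans (min_le_right _ _))
        h4 h5 (flatL_height a) (by rwa [← haf])
      rw [hf0, hα0, zero_smul, add_zero]
    exact ⟨hinj, LinearMap.surjective_of_injective (f := (fderiv ℝ Θ p).toLinearMap) hinj⟩
  · rw [hΘd, hp, hq0, hq'0, flatL_eq_self hp, zero_smul, zero_add, one_mul]; congr 1; simp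

/-- A compact neighbourhood of a boundary point of the half-space. -/
def halfBox (p₀ : 𝕍) (r : ℝ) : Set 𝕍 :=
  {p | 0 ≤ p.2 0 ∧ p.2 0 ≤ r ∧ 𝐟 p ∈ closedBall p₀ r}

lemma dist_le_of_mem_halfBox {p₀ p : 𝕍} {r : ℝ} (hp : p ∈ halfBox p₀ r) : dist p p₀ ≤ r + r := by
  have h1 : dist p (𝐟 p) ≤ r := by
    rw [dist_eq_norm, flatL_apply, sub_sub_cancel, norm_smul, norm_e₀, mul_one,
      Real.norm_of_nonneg hp.1]
    exact hp.2.1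
  exact (dist_triangle p (𝐟 p) p₀).trans (add_le_add h1 (Metric.mem_closedBall.1 hp.2.2))

lemma isCompact_halfBox (p₀ : 𝕍) (r : ℝ) : IsCompact (halfBox p₀ r) := by
  have hcK : Continuous fun p : 𝕍 => p.2 0 := (𝐡).continuous
  refine Metric.isCompact_of_isClosed_isBounded ?_ (Metric.isBounded_closedBall.subset fun p hp =>
    Metric.mem_closedBall.2 (dist_le_of_mem_halfBox hp))
  have h1 : IsClosed {p : 𝕍 | 0 ≤ p.2 0} := isClosed_le continuous_const hcK
  have h2 : IsClosed {p : 𝕍 | p.2 0 ≤ r} := isClosed_le hcK continuous_const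
  have h3 : IsClosed (𝐟 ⁻¹' closedBall p₀ r) := isClosed_closedBall.preimage (𝐟).continuous
  have h4 := h1.inter (h2.inter h3); exact h4

lemma exists_local_bump {V : Type*} [NormedAddCommGroup V] [NormedSpace ℝ V] [FiniteDimensional ℝ V]
  (p₀ : V) {r : ℝ} (hr : 0 < r) : ∃ χ : V → ℝ, ContDiff ℝ ∞ χ ∧ HasCompactSupport χ ∧
  (∀ᶠ p in 𝓝 p₀, χ p = 1) ∧ (∀ p, 0 ≤ χ p ∧ χ p ≤ 1) ∧ ∀ p, χ p ≠ 0 → p ∈ closedBall p₀ r := by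
  let χ : ContDiffBump p₀ := ⟨r / 2, r, by positivity, by linarith⟩
  refine ⟨χ, χ.contDiff, χ.hasCompactSupport, χ.eventuallyEq_one,
    fun p => ⟨χ.nonneg' p, χ.le_one⟩, fun p hp => Metric.ball_subset_closedBall ?_⟩
  have : p ∈ Function.support χ := hp; rwa [χ.support_eq] at this

lemma exists_local_shear {p₀ : 𝕍} {r : ℝ} (hr : 0 < r) : ∃ χ : 𝕍 → ℝ, (∀ᶠ p in 𝓝 p₀, χ p = 1) ∧
  (∀ p, χ p ≠ 0 → p ∈ ball p₀ r) ∧ ∀ v : 𝕍 → 𝔼 n, SmoothOn v (ball p₀ r) →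
  (∀ p ∈ ball p₀ r, -1 < v p 0) → ∃ (Θ : 𝕍 → 𝕍) (K : Set 𝕍), ContDiff ℝ ∞ Θ ∧ (∀ p, (Θ p).1 = p.1) ∧
  (∀ p, p.2 0 = 0 → Θ p = p) ∧ (∀ p, 0 ≤ p.2 0 → 0 ≤ (Θ p).2 0 ∧ Bijective (fderiv ℝ Θ p)) ∧
  IsCompact K ∧ (∀ p ∈ K, p ∈ ball p₀ r ∧ 0 ≤ p.2 0 ∧ Θ p ∈ ball p₀ r) ∧
  (∀ p, 0 ≤ p.2 0 → p ∉ K → Θ p = p) ∧ ∀ p, p.2 0 = 0 → ∀ a, fderiv ℝ Θ p a = a +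
  (0, a.2 0 • (χ p • v p)) := by
  obtain ⟨χ, hχd, hχc, hχ1, hχ01, hsub'⟩ := exists_local_bump p₀ (r := r / 4) (by positivity)
  have hsub : closedBall p₀ (r / 4) ⊆ ball p₀ r := closedBall_subset_ball (by linarith)
  refine ⟨χ, hχ1, fun p hp => hsub (hsub' p hp), fun v hv hv0 => ?_⟩
  have hw : ContDiff ℝ ∞ fun p => χ p • v p := contDiff_iff_contDiffAt.2 fun p => by
    by_cases hp : p ∈ closedBall p₀ (r / 4)
    · exact hχd.contDiffAt.smul (hv.contDiffAt (isOpen_ball.mem_nhds (hsub hp)))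
    · refine (contDiffAt_const (c := 0)).congr_of_eventuallyEq ?_
      filter_upwards [isClosed_closedBall.isOpen_compl.mem_nhds hp] with q hq
      rw [show χ q = 0 from by_contra fun h => hq (hsub' q h), zero_smul]
  have hw0 : ∀ p, -1 < (χ p • v p) 0 := fun p => by
    change -1 < χ p * v p 0
    by_cases hp : χ p = 0
    · rw [hp]; linarith
    · have h1 := hv0 p (hsub (hsub' p hp)); obtain ⟨h2, h3⟩ := hχ01 p
      rcases le_total 0 (v p 0) with h | h <;> nlinarith
  obtain ⟨Θ, hΘ, hfst, hΘ0, hΘw, hΘp, hΘd⟩ := exists_shear hw hχc.smul_right hw0 (ρ := r / 4)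
    (by positivity)
  have hd : ∀ p ∈ halfBox p₀ (r / 4), dist p p₀ ≤ r / 4 + r / 4 := fun p hp =>
    dist_le_of_mem_halfBox hp
  refine ⟨Θ, halfBox p₀ (r / 4), hΘ, hfst, hΘ0, fun p hp => ⟨(hΘp p hp).1, (hΘp p hp).2.2.2⟩,
    isCompact_halfBox _ _, fun p hp => ⟨?_, hp.1, ?_⟩, fun p h0 hp => ?_, hΘd⟩
  · exact mem_ball.2 ((hd p hp).trans_lt (by linarith))
  · have h1 := dist_triangle (Θ p) p p₀; have h2 := (hΘp p hp.1).2.1; have h3 := hd p hp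
    exact mem_ball.2 (by linarith)
  · by_cases h1 : p.2 0 ≤ r / 4
    · refine hΘw p ?_; by_contra hc; exact hp ⟨h0, h1, hsub' _ fun h => hc (by rw [h, zero_smul])⟩
    · exact (hΘp p h0).2.2.1 (not_le.1 h1).le

lemma FibredChart.exists_map_of_coord [T2Space E] (c : HChart πE) {Θ : 𝕍 → 𝕍} (hΘ : ContDiff ℝ ∞ Θ)
  (hfst : ∀ p, (Θ p).1 = p.1) (hnn : ∀ p, 0 ≤ p.2 0 → 0 ≤ (Θ p).2 0) {K : Set 𝕍} (hK : IsCompact K)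
  (hKt : K ⊆ c.ext.target) (hΘK : ∀ p ∈ K, Θ p ∈ c.ext.target) (hid : ∀ p, 0 ≤ p.2 0 → p ∉ K → Θ p =
  p) : ∃ ψ : E → E, SmoothH ψ ∧ (∀ y, πE (ψ y) = πE y) ∧ (∀ y ∈ 𝒮 c, ψ y ∈ 𝒮 c ∧ c.ext (ψ y) =
  Θ (c.ext y)) ∧ (∀ y, (y ∈ 𝒮 c → c.ext y ∉ K) → ∀ᶠ y' in 𝓝 y, ψ y' = y') ∧ ∀ y ∈ 𝒮 c, 𝒟
  (transit c c ψ) ℛ (c.ext y) = fderiv ℝ Θ (c.ext y) := by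
  classical
  let ψ : E → E := fun y => if y ∈ 𝒮 c then c.ext.symm (Θ (c.ext y)) else y
  have h0 : ∀ y, 0 ≤ (c.ext y).2 0 := fun y => mem_half.1 (c.ext_mem_range y)
  have ht : ∀ y ∈ 𝒮 c, Θ (c.ext y) ∈ c.ext.target := fun y hy => by
    by_cases hyK : c.ext y ∈ K
    · exact hΘK _ hyK
    · rw [hid _ (h0 y) hyK]; exact c.ext_mem hy
  have hψ : ∀ y ∈ 𝒮 c, ψ y = c.ext.symm (Θ (c.ext y)) := fun y hy => if_pos hy
  have hmem : ∀ y ∈ 𝒮 c, ψ y ∈ 𝒮 c ∧ c.ext (ψ y) = Θ (c.ext y) := fun y hy => by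
      rw [hψ y hy]; exact ⟨c.mem_source (ht y hy), c.ext.right_inv (ht y hy)⟩
  have hK' : IsClosed (c.ext.symm '' K) :=
    (hK.image_of_continuousOn (c.total.continuousOn_extend_symm.mono hKt)).isClosed
  have hfar : ∀ y, (y ∈ 𝒮 c → c.ext y ∉ K) → ∀ᶠ y' in 𝓝 y, ψ y' = y' := by
    intro y hy
    have hyK : y ∉ c.ext.symm '' K := by
      rintro ⟨p, hp, rfl⟩; exact hy (c.mem_source (hKt hp)) (by rwa [c.ext.right_inv (hKt hp)])
    filter_upwards [hK'.isOpen_compl.mem_nhds hyK] with y' hy'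
    by_cases hys : y' ∈ 𝒮 c
    · rw [hψ y' hys, hid _ (h0 y') fun hc => hy' ⟨_, hc, c.symm_ext hys⟩, c.symm_ext hys]
    · exact if_neg hys
  have hsm : SmoothH ψ := by
    intro y
    by_cases hy : y ∈ 𝒮 c
    · have e1 : ψ =ᶠ[𝓝 y] fun y' => c.ext.symm (Θ (c.ext y')) := by
        filter_upwards [c.total.open_source.mem_nhds hy] with y' hy' using hψ y' hy'
      refine ContMDiffAt.congr_of_eventuallyEq ?_ e1
      have h1 : ContMDiffAt 𝓗 𝓘(ℝ, 𝕍) ∞ (fun y' => Θ (c.ext y')) y :=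
        hΘ.contDiffAt.contMDiffAt.comp y (c.total.contMDiffAt_extend c.total_mem hy)
      have h2 := smooth_extend_symm c.total_mem (ht y hy)
      have h3 := ContMDiffWithinAt.comp (t := ℛ) y h2
        (contMDiffWithinAt_univ.2 h1) fun y' _ => mem_half.2 (hnn _ (h0 y'))
      exact contMDiffWithinAt_univ.1 h3
    · exact contMDiffAt_id.congr_of_eventuallyEq (hfar y fun h => absurd h hy)
  refine ⟨ψ, hsm, fun y => ?_, hmem, hfar, fun y hy => ?_⟩
  · by_cases hy : y ∈ 𝒮 c
    · refine c.base.injOn (c.proj_mem _ (hmem y hy).1) (c.proj_mem _ hy) ?_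
      rw [← c.fst_eq _ hy, ← c.fst_eq _ (hmem y hy).1]
      exact (congrArg Prod.fst (hmem y hy).2).trans (hfst _)
    · rw [show ψ y = y from if_neg hy]
  · have e1 : transit c c ψ =ᶠ[𝓝[ℛ] c.ext y] Θ := by
      filter_upwards [c.target_mem_nhdsWithin (c.ext_mem hy)] with p hp
      change c.ext (ψ (c.ext.symm p)) = _; rw [(hmem _ (c.mem_source hp)).2, c.ext.right_inv hp]
    rw [e1.fderivWithin_eq (by rw [transit_ext c c hy, (hmem y hy).2])]
    exact (hΘ.differentiable (by simp) _).fderivWithin ((𝓗).uniqueDiffOn _ (c.ext_mem_range y))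

lemma FibredChart.exists_shear_map [T2Space E] (c : HChart πE) {x : E} (hx : x ∈ 𝒮 c) {N : Set E}
  (hN : N ∈ 𝓝 x) {O : Set 𝕍} (hO : IsOpen O) (hxO : c.ext x ∈ O) : ∃ χ : 𝕍 → ℝ,
  (∀ᶠ p in 𝓝 (c.ext x), χ p = 1) ∧ (∀ p, χ p ≠ 0 → p ∈ O) ∧ ∀ v : 𝕍 → 𝔼 n, SmoothOn v O →
  (∀ p ∈ O, -1 < v p 0) → ∃ ψ : E → E, SmoothH ψ ∧ (∀ y, πE (ψ y) = πE y) ∧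
  (∀ y, Bijective (mfderiv 𝓗 𝓗 ψ y)) ∧ (∀ y ∈ 𝔅 E, ψ y = y) ∧ (∀ y, y ∉ N ∨ y ∉ 𝒮 c → ∀ᶠ y' in 𝓝 y,
  ψ y' = y') ∧ ∀ y ∈ 𝔅 E, y ∈ 𝒮 c → ∀ a, vderiv c c ψ (c.ext y) a = a + (a 0 * χ (c.ext y)) • v
  (c.ext y) := by
  obtain ⟨D, hD, hxD, hDm⟩ := c.exists_open hx hN
  obtain ⟨r, hr, hball⟩ := Metric.isOpen_iff.1 (hD.inter hO) _ ⟨hxD, hxO⟩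
  obtain ⟨χ, hχ1, hχs, H⟩ := exists_local_shear (p₀ := c.ext x) hr
  refine ⟨χ, hχ1, fun p hp => (hball (hχs p hp)).2, fun v hv hv0 => ?_⟩
  obtain ⟨Θ, K, hΘ, hfst, hΘ0, hΘp, hKc, hK, hid, hΘd⟩ := H v (hv.mono fun p hp => (hball hp).2)
    fun p hp => hv0 p (hball hp).2
  have hmemD : ∀ p ∈ ball (c.ext x) r, 0 ≤ p.2 0 → p ∈ c.ext.target ∧ c.ext.symm p ∈ N :=
    fun p hp h0 => hDm p ⟨(hball hp).1, mem_half.2 h0⟩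
  obtain ⟨ψ, hψ, hψπ, hψm, hψf, hψd⟩ := c.exists_map_of_coord hΘ hfst (fun p hp => (hΘp p hp).1)
    hKc (fun p hp => (hmemD p (hK p hp).1 (hK p hp).2.1).1)
    (fun p hp => (hmemD _ (hK p hp).2.2 (hΘp p (hK p hp).2.1).1).1) hid
  have hfar : ∀ y, y ∉ N ∨ y ∉ 𝒮 c → ∀ᶠ y' in 𝓝 y, ψ y' = y' := fun y hy =>
    hψf y fun hys hyK => by
      have := (hmemD _ (hK _ hyK).1 (hK _ hyK).2.1).2; rw [c.symm_ext hys] at this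
      exact hy.elim (fun h => h this) fun h => h hys
  refine ⟨ψ, hψ, hψπ, fun y => ?_, fun y hy => ?_, hfar, fun y hy hys a => ?_⟩
  · by_cases hy : y ∈ 𝒮 c
    · rw [← bijective_transit c c hy (hψm y hy).1 (hψ y), hψd y hy]
      exact (hΘp _ (mem_half.1 (c.ext_mem_range y))).2
    · rw [Filter.EventuallyEq.mfderiv_eq (show ψ =ᶠ[𝓝 y] id from hfar y (Or.inr hy)), mfderiv_id]
      exact Function.bijective_id
  · by_cases hys : y ∈ 𝒮 c
    · have e1 := c.symm_ext (hψm y hys).1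
      rw [(hψm y hys).2, hΘ0 _ ((c.ext_zero hys).1 hy), c.symm_ext hys] at e1; exact e1.symm
    · exact (hfar y (Or.inr hys)).self_of_nhds
  · change (𝒟 (transit c c ψ) ℛ (c.ext y) (0, a)).2 = _
    rw [hψd y hys, hΘd _ ((c.ext_zero hys).1 hy)]; simp [smul_smul]

lemma FibredChart.line_mem_bdry (c : HChart πE) {y : E} (hy : y ∈ 𝒮 c) (hyb : y ∈ 𝔅 E)
  {Q : E → Prop} (hQ : ∀ᶠ y' in 𝓝 y, Q y') {a : 𝕍} (ha : a.2 0 = 0) : ∀ᶠ t : ℝ in 𝓝 0,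
  c.ext y + t • a ∈ c.ext.target ∧ c.ext.symm (c.ext y + t • a) ∈ 𝔅 E ∧ Q
  (c.ext.symm (c.ext y + t • a)) := by
  have h0 : (c.ext y).2 0 = 0 := (c.ext_zero hy).1 hyb
  have h1 : ∀ t : ℝ, (c.ext y + t • a).2 0 = 0 := fun t => by
    change (c.ext y).2 0 + t * a.2 0 = 0; rw [h0, ha, mul_zero, add_zero]
  filter_upwards [line_eventually_mem hy hQ (a := a)
    (Eventually.of_forall fun t => mem_half.2 (h1 t).ge)] with t ht
  refine ⟨ht.1, (c.ext_zero (c.mem_source ht.1)).2 ?_, ht.2⟩; rw [c.ext.right_inv ht.1]; exact h1 t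

lemma FibredChart.vderiv_tangential (c : HChart πE) {ψ : E → E} (hψ : SmoothH ψ)
  (hψb : ∀ y ∈ 𝔅 E, ψ y = y) {y : E} (hy : y ∈ 𝒮 c) (hyb : y ∈ 𝔅 E) {a : 𝔼 n} (ha : a 0 = 0) :
  vderiv c c ψ (c.ext y) a = a := by
  have hy' : ψ y ∈ 𝒮 c := by rwa [hψb y hyb]
  have h1 := ((smooth_transit c c hy hy' (hψ y)).differentiableWithinAt
    (by simp)).hasFDerivWithinAt.sub (hasFDerivWithinAt_id (c.ext y) ℛ)
  have h2 := apply_eq_zero_of_line h1 (a := (0, a)) (by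
    filter_upwards [c.line_mem_bdry hy hyb (Q := fun _ => True) (Eventually.of_forall fun _ => trivial)
      (a := (0, a)) ha] with t ht
    have e : ∀ p ∈ c.ext.target, c.ext.symm p ∈ 𝔅 E → transit c c ψ p = p := fun p hp hb => by
      change c.ext (ψ (c.ext.symm p)) = p; rw [hψb _ hb, c.ext.right_inv hp]
    refine ⟨c.total.extend_target_subset_range ht.1, ?_⟩; simp only [Pi.sub_apply, id_eq]
    rw [e _ ht.1 ht.2.1, e _ (c.ext_mem hy) (by rwa [c.symm_ext hy]), sub_self, sub_self])
  have h3 := congrArg Prod.snd (sub_eq_zero.1 h2); exact h3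

lemma exists_pullback_fixing_bdry (hc : HasCharts k n πE) {ψ : E → E} (hψ : SmoothH ψ)
  (hπ : ∀ y, πE (ψ y) = πE y) (hb : ∀ y, Bijective (mfderiv 𝓗 𝓗 ψ y)) (hψb : ∀ y ∈ 𝔅 E, ψ y = y)
  {h : HForm πE} (hh : IsFibreMetric h) (hR : RicciPositive h) : ∃ h' : HForm πE, IsFibreMetric h' ∧
  RicciPositive h' ∧ (∀ (c : HChart πE), ∀ y ∈ 𝒮 c, y ∈ 𝔅 E → ∀ a b,
  bil (c.coeff h' (c.ext y)) a b = bil (c.coeff h (c.ext y)) (vderiv c c ψ (c.ext y) a)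
  (vderiv c c ψ (c.ext y) b)) ∧ (∀ y ∈ 𝔅 E, ∀ u v : Vert k (𝓡∂ n) πE y, IsBoundaryVector y u.1 →
  IsBoundaryVector y v.1 → h' y u v = h y u v) ∧ (∀ (c : HChart πE), ∀ y ∈ 𝒮 c, y ∈ 𝔅 E → ∀ u :
  Vert k (𝓡∂ n) πE y, IsBoundaryVector y u.1 → c.normalCurvature h' y u = c.normalCurvature h y u) ∧
  ∀ y, (∀ᶠ y' in 𝓝 y, ψ y' = y') → h' y = h y := by
  have hm : ∀ x, ∀ u ∈ Vert k (𝓡∂ n) πE x, mfderiv 𝓗 𝓗 ψ x u ∈ Vert k (𝓡∂ n) πE (ψ x) :=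
    fun x u hu => by
      obtain ⟨c, hx⟩ := hc (ψ x); exact mfderiv_mem_vert c hx (hψ x) (Eventually.of_forall hπ) hu
  have hpb := isPullbackAt_pullback hm h
  have hloc : ∀ x, IsLocalPullback ψ (pullback ψ hm h) h x := fun x =>
    Eventually.of_forall fun y => ⟨hψ y, hπ y, hb y, hpb y⟩
  have hh' := isFibreMetric_of_pullback hc hc hh hloc
  have hbil : ∀ (c : HChart πE), ∀ y ∈ 𝒮 c, y ∈ 𝔅 E → ∀ a b,
      bil (c.coeff (pullback ψ hm h) (c.ext y)) a b =
        bil (c.coeff h (c.ext y)) (vderiv c c ψ (c.ext y) a) (vderiv c c ψ (c.ext y) b) :=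
    fun c y hy hyb a b => by
      rw [bil_coeff_eq c c hy (by rwa [hψb y hyb]) (hψ y) (Eventually.of_forall hπ)
        (hpb y), hψb y hyb]
  refine ⟨pullback ψ hm h, hh', ricciPositive_of_pullback hc hh' hh hR hloc, hbil, ?_, ?_, ?_⟩
  · intro y hyb u v hu hv; obtain ⟨c, hy⟩ := hc y; rw [c.isBoundaryVector_iff hy hyb] at hu hv
    rw [c.form_eq_bil _ hy, c.form_eq_bil _ hy, hbil c y hy hyb, c.vderiv_tangential hψ hψb hy hyb hu,
      c.vderiv_tangential hψ hψb hy hyb hv]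
  · intro c y hy hyb u hu; rw [c.isBoundaryVector_iff hy hyb] at hu
    have hy' : ψ y ∈ 𝒮 c := by rwa [hψb y hyb]
    rw [normalCurvature_of_pullback c c hh' hh hy hy' hyb (hloc y)
      (Eventually.of_forall fun y' hy' => by rwa [hψb y' hy']) u hu ⟨_, hm y u.1 u.2⟩ rfl]
    have e := coord_push c c hy hy' (hψ y) u ⟨_, hm y u.1 u.2⟩ rfl
    rw [c.vderiv_tangential hψ hψb hy hyb hu] at e; unfold FibredChart.normalCurvature
    rw [e, hψb y hyb]
  · intro y hy; have e1 : mfderiv 𝓗 𝓗 ψ y = mfderiv 𝓗 𝓗 id y := Filter.EventuallyEq.mfderiv_eq hy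
    obtain ⟨c, hyc⟩ := hc y; refine LinearMap.ext fun u => LinearMap.ext fun v => ?_
    have hy' : ψ y ∈ 𝒮 c := by rwa [hy.self_of_nhds]
    rw [c.form_eq_bil _ hyc, c.form_eq_bil _ hyc,
      bil_coeff_eq c c hyc hy' (hψ y) (Eventually.of_forall hπ) (hpb y),
      hy.self_of_nhds]
    have e2 : ∀ a, vderiv c c ψ (c.ext y) a = a := fun a => by
      have h1 : transit c c ψ =ᶠ[𝓝[ℛ] c.ext y] id := by
        rw [← c.total.map_extend_nhds hyc]; refine eventually_map.2 ?_
        filter_upwards [hy, c.total.open_source.mem_nhds hyc] with y' h1 h2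
        rw [transit_ext c c h2, h1, id_eq]
      change (𝒟 (transit c c ψ) ℛ (c.ext y) (0, a)).2 = a
      rw [h1.fderivWithin_eq (by rw [transit_ext c c hyc, hy.self_of_nhds]; rfl),
        fderivWithin_id ((𝓗).uniqueDiffOn _ (c.ext_mem_range y))]
      rfl
    rw [e2, e2]

section NormalShear

lemma refl₀_apply (a : 𝔼 n) : 𝐬 a = a - (2 : ℝ) • (a 0 • 𝐞 0) := by simp [refl₀, reflL_apply, e₀]

lemma refl₀_zero (a : 𝔼 n) : 𝐬 a 0 = -a 0 := by simp [refl₀_apply]; ring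

lemma refl₀_of_tangential {a : 𝔼 n} (ha : a 0 = 0) : 𝐬 a = a := by simp [refl₀_apply, ha]

lemma refl₀_refl₀ (a : 𝔼 n) : 𝐬 (𝐬 a) = a := by
  rw [refl₀_apply (𝐬 a), refl₀_zero, refl₀_apply]; module

lemma reflL_inr (a : 𝔼 n) : 𝐫 (0, a) = (0, 𝐬 a) := by
  rw [reflL_apply, refl₀_apply]; ext <;> simp [e₀]

/-- The unit normal of `{z₀ = 0}` pointing towards `{z₀ > 0}`. -/
def normal₀ (G : 𝕄 n) : 𝔼 n := (√(grad₀ G 0))⁻¹ • grad₀ G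

/-- The vector `V` for which `a ↦ S a - a0 V`, with `S` the reflection, is an isometry, provided
that the metrics agree tangentially. -/
def matchVec (G1 G2 : 𝕄 n) : 𝔼 n := (normal₀ G1 0)⁻¹ • (normal₀ G2 + 𝐬 (normal₀ G1))

variable {G1 G2 G : 𝕄 n}

lemma normal₀_zero (h : 0 < grad₀ G 0) : normal₀ G 0 = √(grad₀ G 0) := by
  change (√(grad₀ G 0))⁻¹ * grad₀ G 0 = _; have := Real.sqrt_pos.2 h; field_simp
  exact (Real.sq_sqrt h.le).symm

lemma bil_normal₀ (hs : ∀ i j, G i j = G j i) (hdet : G.det ≠ 0) (a : 𝔼 n) : bil G (normal₀ G) a =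
  (√(grad₀ G 0))⁻¹ * a 0 := by
  rw [normal₀, bil_smul_left, bil_grad₀ hs hdet]

lemma neg_one_lt_matchVec (h₁ : 0 < grad₀ G1 0) (h₂ : 0 < grad₀ G2 0) : -1 < matchVec G1 G2 0 := by
  change -1 < (normal₀ G1 0)⁻¹ * (normal₀ G2 0 + 𝐬 (normal₀ G1) 0)
  rw [refl₀_zero, normal₀_zero h₁, normal₀_zero h₂]; have h1 := Real.sqrt_pos.2 h₁
  have h2 := Real.sqrt_pos.2 h₂
  have : (√(grad₀ G1 0))⁻¹ * (√(grad₀ G2 0) + -√(grad₀ G1 0)) =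
      (√(grad₀ G1 0))⁻¹ * √(grad₀ G2 0) - 1 := by field_simp; ring
  rw [this]; have : 0 < (√(grad₀ G1 0))⁻¹ * √(grad₀ G2 0) := by positivity
  linarith

lemma matchVec_eq_zero (hs : ∀ i j, G1 i j = G1 j i) (hd : G1.det ≠ 0)
  (hs' : ∀ i j, G2 i j = G2 j i) (hd' : G2.det ≠ 0) (h : ∀ a b, bil G1 a b = bil G2 (𝐬 a) (𝐬 b)) :
  matchVec G1 G2 = 0 := by
  have e : -𝐬 (grad₀ G1) = grad₀ G2 := eq_grad₀ hs' hd' fun v => by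
    rw [← neg_one_smul ℝ, bil_smul_left, ← refl₀_refl₀ v, ← h, bil_grad₀ hs hd, refl₀_zero,
      refl₀_zero, refl₀_zero]; ring
  have e0 : grad₀ G2 0 = grad₀ G1 0 := by
    rw [← e]; change -(𝐬 (grad₀ G1) 0) = _; rw [refl₀_zero, neg_neg]
  rw [matchVec, normal₀, normal₀, e0, ← e, map_smul]; simp

lemma bil_matchVec (hs : ∀ i j, G1 i j = G1 j i) (hp : ∀ a : 𝔼 n, a ≠ 0 → 0 < bil G1 a a)
  (hs' : ∀ i j, G2 i j = G2 j i) (hp' : ∀ a : 𝔼 n, a ≠ 0 → 0 < bil G2 a a)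
  (h : ∀ a b, a 0 = 0 → b 0 = 0 → bil G1 a b = bil G2 a b) (a b : 𝔼 n) : bil G1 a b = bil G2
  (𝐬 a + (𝐬 a 0) • matchVec G1 G2) (𝐬 b + (𝐬 b 0) • matchVec G1 G2) := by
  have h1 := grad₀_zero_pos hs hp; have h2 := grad₀_zero_pos hs' hp'; have hn1 := normal₀_zero h1
  have hn2 := normal₀_zero h2; have q1 := Real.sqrt_pos.2 h1; have q2 := Real.sqrt_pos.2 h2
  have hn1' : normal₀ G1 0 ≠ 0 := by rw [hn1]; exact q1.ne'
  have key : ∀ a : 𝔼 n, ∃ (t : 𝔼 n) (α : ℝ), t 0 = 0 ∧ a = t + α • normal₀ G1 ∧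
      𝐬 a + (𝐬 a 0) • matchVec G1 G2 = t + (-α) • normal₀ G2 := fun a => by
    have ht : (a - (a 0 / normal₀ G1 0) • normal₀ G1) 0 = 0 := by
      change a 0 - (a 0 / normal₀ G1 0) * normal₀ G1 0 = 0; field_simp; ring
    refine ⟨a - (a 0 / normal₀ G1 0) • normal₀ G1, a 0 / normal₀ G1 0, ht, by module, ?_⟩
    have e := refl₀_of_tangential ht; rw [map_sub, map_smul] at e
    have e' : 𝐬 a = a - (a 0 / normal₀ G1 0) • normal₀ G1 +
        (a 0 / normal₀ G1 0) • 𝐬 (normal₀ G1) := by rw [← e]; module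
    rw [refl₀_zero, e', matchVec, div_eq_mul_inv]; module
  obtain ⟨t, α, ht, ea, ea'⟩ := key a; obtain ⟨s, β, hs0, eb, eb'⟩ := key b; rw [ea', eb', ea, eb]
  have hd1 := det_ne_zero_of_bil hs hp; have hd2 := det_ne_zero_of_bil hs' hp'
  simp only [bil_add_left, bil_add_right, bil_smul_left, bil_smul_right, bil_normal₀ hs hd1,
    bil_normal₀ hs' hd2, bil_symm hs t, bil_symm hs' t, ht, hs0, hn1, hn2]
  rw [inv_mul_cancel₀ q1.ne', inv_mul_cancel₀ q2.ne', ← bil_symm hs, ← bil_symm hs', h t s ht hs0]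
  ring

end NormalShear

section TangentPoints

variable {E H M : Type*} [NormedAddCommGroup E] [NormedSpace ℝ E] [TopologicalSpace H]
  {I : ModelWithCorners ℝ E H} [TopologicalSpace M] [ChartedSpace H M] [IsManifold I ∞ M]
  {e : OpenPartialHomeomorph M H}

lemma tangent_eq_iff (he : e ∈ maximalAtlas I ∞ M) {x y : M} (hxy : x = y) (hx : x ∈ e.source)
  (u : TangentSpace I x) (v : TangentSpace I y) : (⟨x, u⟩ : TangentBundle I M) = ⟨y, v⟩ ↔
  dChart I e x u = dChart I e y v := by
  subst hxy
  constructor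
  · intro h; rw [eq_of_heq (Bundle.TotalSpace.mk.inj h).2]
  · intro h; rw [(dChart_bijective he hx).1 h]

end TangentPoints

section PushForm

variable {ψ : P → P'} {x : P}

lemma mfderiv_mem_vert_iff (hψ : MDifferentiableAt (𝓟 J) (𝓟 J') ψ x)
  (hπ' : MDifferentiableAt (𝓟 J') (𝓡 k) π' (ψ x)) (hπ : ∀ y, π' (ψ y) = π y)
  (u : TangentSpace (𝓟 J) x) : mfderiv (𝓟 J) (𝓟 J') ψ x u ∈ Vert k J' π' (ψ x) ↔
  u ∈ Vert k J π x := by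
  obtain rfl : π = π' ∘ ψ := funext fun y => (hπ y).symm
  have h := mfderiv_comp x hπ' hψ
  change mfderiv (𝓟 J') (𝓡 k) π' (ψ x) (mfderiv (𝓟 J) (𝓟 J') ψ x u) = 0
    ↔ mfderiv (𝓟 J) (𝓡 k) (π' ∘ ψ) x u = 0
  rw [h]; rfl

lemma exists_push (hψ : MDifferentiableAt (𝓟 J) (𝓟 J') ψ x) (hπ' :
  MDifferentiableAt (𝓟 J') (𝓡 k) π' (ψ x)) (hπ : ∀ y, π' (ψ y) = π y)
  (hb : Bijective (mfderiv (𝓟 J) (𝓟 J') ψ x)) : ∃ L : Vert k J π x ≃ₗ[ℝ] Vert k J' π' (ψ x), ∀ u,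
  (L u).1 = mfderiv (𝓟 J) (𝓟 J') ψ x u.1 := by
  let L : Vert k J π x →ₗ[ℝ] Vert k J' π' (ψ x) := ((mfderiv (𝓟 J) (𝓟 J') ψ x).toLinearMap.comp
      (Vert k J π x).subtype).codRestrict _ fun u => (mfderiv_mem_vert_iff hψ hπ' hπ u.1).2 u.2
  refine ⟨LinearEquiv.ofBijective L ⟨fun u v h => ?_, fun w => ?_⟩, fun u => rfl⟩
  · exact Subtype.ext (hb.1 (congrArg Subtype.val h))
  · obtain ⟨u, hu⟩ := hb.2 w.1
    exact ⟨⟨u, (mfderiv_mem_vert_iff hψ hπ' hπ u).1 (by rw [hu]; exact w.2)⟩, Subtype.ext hu⟩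

end PushForm

section Matching

variable (φ)

/-- At the boundary point `x`, the metrics of the two parts agree on the tangent space of the glued
space. -/
def IsMatchedAt (h₁ : HForm π₁) (h₂ : HForm π₂) (x : 𝔅 E1) : Prop :=
  ∀ (u v : Vert k (𝓡∂ n) π₁ (x : E1)) (u' v' : Vert k (𝓡∂ n) π₂ (φ.toEquiv x : E2)),
    tangentMap 𝓗 𝓕 ι₁ ⟨x, u.1⟩ = tangentMap 𝓗 𝓕 ι₂ ⟨φ.toEquiv x, u'.1⟩ →
    tangentMap 𝓗 𝓕 ι₁ ⟨x, v.1⟩ = tangentMap 𝓗 𝓕 ι₂ ⟨φ.toEquiv x, v'.1⟩ →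
    h₁ _ u v = h₂ _ u' v'

/-- The charts of the two parts induced by a chart of the glued space in which they are
half-spaces. -/
structure HalfCharts (c : FChart (gluedProj φ)) (c₁ : HChart π₁)
    (c₂ : HChart π₂) : Prop where
  sided : c.IsSided (range ι₁) (range ι₂)
  source₁ : 𝒮 c₁ = ι₁ ⁻¹' 𝒮 c
  source₂ : 𝒮 c₂ = ι₂ ⁻¹' 𝒮 c
  ext₁ : ∀ x ∈ 𝒮 c₁, c₁.ext x = c.ext (ι₁ x)
  ext₂ : ∀ y ∈ 𝒮 c₂, c₂.ext y = 𝐫 (c.ext (ι₂ y))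

variable {φ}

lemma exists_halfCharts [Nonempty E1] [Nonempty E2] (hW : IsCompatible φ)
  (hc : c.IsSided (range ι₁) (range ι₂)) {w : Glued φ} (hw : w ∈ 𝒮 c) : ∃ c₁ c₂,
  HalfCharts φ c c₁ c₂ := by
  obtain ⟨c₁, hs1, -, he1⟩ := c.exists_comp (πE := π₁) (closed_incl₁ φ).isEmbedding
    hW.smooth₁ hW.bijective₁ (fun _ => rfl) hc.pos
  obtain ⟨c', hs', -, he'⟩ := c.exists_reflect hw
  obtain ⟨c₂, hs2, -, he2⟩ := c'.exists_comp (πE := π₂) (closed_incl₂ φ).isEmbedding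
    hW.smooth₂ hW.bijective₂ (fun _ => rfl) fun w hw => by
      rw [hs'] at hw; rw [he' w hw, reflL_height, neg_nonneg]; exact (hc.neg w hw)
  rw [hs'] at hs2 he2
  exact ⟨c₁, c₂, hc, hs1, hs2, fun x hx => he1 x (hs1 ▸ hx), fun y hy => by
    rw [hs2] at hy; rw [he2 y hy, he' _ hy]⟩

namespace HalfCharts

local notation "HC" => HalfCharts φ c c₁ c₂

lemma mem₁ (hc : HC) {x : E1} : x ∈ 𝒮 c₁ ↔ ι₁ x ∈ 𝒮 c := by rw [hc.source₁]; rfl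

lemma mem₂ (hc : HC) {y : E2} : y ∈ 𝒮 c₂ ↔ ι₂ y ∈ 𝒮 c := by rw [hc.source₂]; rfl

lemma fderiv_transit₁ (hc : HC) {x : E1} (hx : x ∈ 𝒮 c₁) : 𝒟 (transit c₁ c ι₁) ℛ (c₁.ext x) =
  ContinuousLinearMap.id ℝ _ := by
  have e : transit c₁ c ι₁ =ᶠ[𝓝[ℛ] c₁.ext x] id := by
    filter_upwards [c₁.target_mem_nhdsWithin (c₁.ext_mem hx)] with p hp
    change c.ext (ι₁ (c₁.ext.symm p)) = p; rw [← hc.ext₁ _ (c₁.mem_source hp), c₁.ext.right_inv hp]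
  rw [e.fderivWithin_eq (by rw [transit_ext _ _ hx, ← hc.ext₁ _ hx]; rfl),
    fderivWithin_id ((𝓗).uniqueDiffOn _ (c₁.ext_mem_range x))]

lemma fderiv_transit₂ (hc : HC) {y : E2} (hy : y ∈ 𝒮 c₂) : 𝒟 (transit c₂ c ι₂) ℛ (c₂.ext y) =
  𝐫 := by
  have e : transit c₂ c ι₂ =ᶠ[𝓝[ℛ] c₂.ext y] 𝐫 := by
    filter_upwards [c₂.target_mem_nhdsWithin (c₂.ext_mem hy)] with p hp
    change c.ext (ι₂ (c₂.ext.symm p)) = _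
    rw [← reflL_reflL (c.ext _), ← hc.ext₂ _ (c₂.mem_source hp), c₂.ext.right_inv hp]
  rw [e.fderivWithin_eq (by rw [transit_ext _ _ hy, hc.ext₂ _ hy, reflL_reflL])]
  exact (𝐫).fderivWithin ((𝓗).uniqueDiffOn _ (c₂.ext_mem_range y))

lemma vderiv₁ (hc : HC) {x : E1} (hx : x ∈ 𝒮 c₁) (a : 𝔼 n) : vderiv c₁ c ι₁ (c₁.ext x) a = a := by
  change (𝒟 (transit c₁ c ι₁) ℛ (c₁.ext x) (0, a)).2 = a; rw [hc.fderiv_transit₁ hx]; rfl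

lemma vderiv₂ (hc : HC) {y : E2} (hy : y ∈ 𝒮 c₂) (a : 𝔼 n) : vderiv c₂ c ι₂ (c₂.ext y) a = 𝐬 a := by
  change (𝒟 (transit c₂ c ι₂) ℛ (c₂.ext y) (0, a)).2 = _; rw [hc.fderiv_transit₂ hy, reflL_inr]

lemma bdry₁ (hc : HC) {x : 𝔅 E1} (hx : (x : E1) ∈ 𝒮 c₁) : (φ.toEquiv x : E2) ∈ 𝒮 c₂ := by
  rw [hc.mem₂, ← incl₁_bdry]; exact hc.mem₁.1 hx

lemma reflL_of_zero {p : 𝕍} (hp : p.2 0 = 0) : 𝐫 p = p := by simp [reflL_apply, hp]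

lemma ext_bdry (hc : HC) {x : 𝔅 E1} (hx : (x : E1) ∈ 𝒮 c₁) : c₂.ext (φ.toEquiv x : E2) =
  c₁.ext x := by
  rw [hc.ext₂ _ (hc.bdry₁ hx), ← incl₁_bdry, ← hc.ext₁ _ hx, reflL_of_zero ((c₁.ext_zero hx).1 x.2)]

lemma tangent_eq_iff (hc : HC) (hW : IsCompatible φ) {x : 𝔅 E1} (hx : (x : E1) ∈ 𝒮 c₁)
  (u : Vert k (𝓡∂ n) π₁ (x : E1)) (u' : Vert k (𝓡∂ n) π₂ (φ.toEquiv x : E2)) :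
  tangentMap 𝓗 𝓕 ι₁ ⟨x, u.1⟩ = tangentMap 𝓗 𝓕 ι₂ ⟨φ.toEquiv x, u'.1⟩ ↔ c₂.coord _ u' = 𝐬
  (c₁.coord _ u) := by
  have hy := hc.bdry₁ hx
  refine (FibreGluing.tangent_eq_iff c.total_mem (incl₁_bdry φ x) (hc.mem₁.1 hx) _ _).trans ?_
  rw [dChart_mfderiv_eq c₁ c hx (hc.mem₁.1 hx) (hW.smooth₁ _),
    dChart_mfderiv_eq c₂ c hy (hc.mem₂.1 hy) (hW.smooth₂ _), hc.fderiv_transit₁ hx,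
    hc.fderiv_transit₂ hy, c₁.dChart_vert hx, c₂.dChart_vert hy, reflL_inr]
  constructor
  · intro h; have h' : c₁.coord _ u = 𝐬 (c₂.coord _ u') := congrArg Prod.snd h; rw [h', refl₀_refl₀]
  · intro h; rw [h, refl₀_refl₀]; rfl

lemma isMatchedAt_iff (hc : HC) (hW : IsCompatible φ) {x : 𝔅 E1} (hx : (x : E1) ∈ 𝒮 c₁) :
  IsMatchedAt φ h₁ h₂ x ↔ ∀ a b, bil (c₁.coeff h₁ (c₁.ext x)) a b = bil (c₂.coeff h₂ (c₁.ext x))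
  (𝐬 a) (𝐬 b) := by
  have hy := hc.bdry₁ hx
  constructor
  · intro H a b; obtain ⟨u, rfl⟩ := c₁.exists_coord hx a; obtain ⟨v, rfl⟩ := c₁.exists_coord hx b
    obtain ⟨u', hu⟩ := c₂.exists_coord hy (𝐬 (c₁.coord _ u))
    obtain ⟨v', hv⟩ := c₂.exists_coord hy (𝐬 (c₁.coord _ v))
    rw [← hu, ← hv, ← hc.ext_bdry hx, ← c₂.form_eq_bil _ hy, hc.ext_bdry hx, ← c₁.form_eq_bil _ hx]
    exact H _ _ _ _ ((hc.tangent_eq_iff hW hx _ _).2 hu) ((hc.tangent_eq_iff hW hx _ _).2 hv)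
  · intro H u v u' v' hu hv; rw [hc.tangent_eq_iff hW hx] at hu hv
    rw [c₁.form_eq_bil _ hx, c₂.form_eq_bil _ hy, hu, hv, H, hc.ext_bdry hx]

lemma isBdryPush_of_coord (hc : HC) {x : 𝔅 E1} (hx : (x : E1) ∈ 𝒮 c₁)
  (u : Vert k (𝓡∂ n) π₁ (x : E1)) (u' : Vert k (𝓡∂ n) π₂ (φ.toEquiv x : E2))
  (h0 : c₁.coord _ u 0 = 0) (h : c₂.coord _ u' = c₁.coord _ u) :
  IsBdryPush φ.toEquiv x u.1 u'.1 := by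
  obtain ⟨F, hF⟩ := φ.smooth x; refine ⟨F, hF, ?_⟩; have hy := hc.bdry₁ hx
  have hFx : F x = φ.toEquiv x := hF.2.self_of_nhds x.2; have hy' : F x ∈ 𝒮 c₂ := by rwa [hFx]
  refine (FibreGluing.tangent_eq_iff c₂.total_mem hFx hy' _ _).2 ?_
  rw [dChart_mfderiv c₁.total_mem c₂.total_mem (hF.1.mdifferentiableAt (by simp)) hx hy',
    c₂.dChart_vert hy]
  change 𝒟 (c₂.ext ∘ F ∘ c₁.ext.symm) _ (c₁.ext x) (dChart 𝓗 c₁.total x u.1) = _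
  rw [c₁.dChart_vert hx, h]
  have hd : DifferentiableWithinAt ℝ (c₂.ext ∘ F ∘ c₁.ext.symm) ℛ (c₁.ext x) := by
    have h1 := smooth_extend_symm c₁.total_mem (c₁.ext_mem hx)
    have h2 := (c₂.total.contMDiffAt_extend c₂.total_mem hy').comp (x : E1) hF.1
    have h3 := h2.comp_contMDiffWithinAt_of_eq h1 (c₁.symm_ext hx)
    exact (contMDiffWithinAt_iff_contDiffWithinAt.1 h3).differentiableWithinAt (by simp)
  have h1 := hd.hasFDerivWithinAt.sub (hasFDerivWithinAt_id (c₁.ext x) ℛ)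
  have h2 := apply_eq_zero_of_line h1 (a := (0, c₁.coord _ u)) (by
    filter_upwards [c₁.line_mem_bdry hx x.2 (hF.2.and (c₁.total.open_source.mem_nhds hx))
      (a := (0, c₁.coord _ u)) h0] with t ht
    have e : ∀ z : E1, z ∈ 𝒮 c₁ → ∀ hz : z ∈ 𝔅 E1, F z = φ.toEquiv ⟨z, hz⟩ →
        c₂.ext (F z) = c₁.ext z := fun z hzs hz hFz => by
      rw [hFz, hc.ext_bdry (x := ⟨z, hz⟩) hzs]
    refine ⟨c₁.total.extend_target_subset_range ht.1, ?_⟩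
    simp only [Pi.sub_apply, id_eq, comp_apply]
    rw [e _ ht.2.2.2 ht.2.1 (ht.2.2.1 ht.2.1), c₁.ext.right_inv ht.1, sub_self, c₁.symm_ext hx,
      e _ hx x.2 hFx, sub_self])
  exact sub_eq_zero.1 h2

lemma bil_eq_of_isometry (hc : HC) (hφ : IsFibrewiseIsometry φ h₁ h₂) {x : 𝔅 E1}
  (hx : (x : E1) ∈ 𝒮 c₁) {a b : 𝔼 n} (ha : a 0 = 0) (hb : b 0 = 0) : bil
  (c₁.coeff h₁ (c₁.ext x)) a b = bil (c₂.coeff h₂ (c₁.ext x)) a b := by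
  have hy := hc.bdry₁ hx; obtain ⟨u, rfl⟩ := c₁.exists_coord hx a
  obtain ⟨v, rfl⟩ := c₁.exists_coord hx b; obtain ⟨u', hu⟩ := c₂.exists_coord hy (c₁.coord _ u)
  obtain ⟨v', hv⟩ := c₂.exists_coord hy (c₁.coord _ v)
  have h := hφ x u v u' v' ((c₁.isBoundaryVector_iff hx x.2 u).2 ha)
    ((c₁.isBoundaryVector_iff hx x.2 v).2 hb) (hc.isBdryPush_of_coord hx u u' ha hu)
    (hc.isBdryPush_of_coord hx v v' hb hv)
  rw [c₁.form_eq_bil _ hx, c₂.form_eq_bil _ hy, hc.ext_bdry hx, hu, hv] at h; exact h.symm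

end HalfCharts

end Matching

section MatchVecSmooth

variable {V : Type*} [NormedAddCommGroup V] [NormedSpace ℝ V] {s : Set V}

lemma contDiffOn_normal₀ {G : V → 𝕄 n} (hG : SmoothMat G s) (hs : ∀ p ∈ s, ∀ i j, G p i j = G p j i)
  (hp : ∀ p ∈ s, ∀ a : 𝔼 n, a ≠ 0 → 0 < bil (G p) a a) : SmoothOn (fun p => normal₀ (G p)) s := by
  have h1 : ∀ i, SmoothOn (fun p => grad₀ (G p) i) s := fun i =>
    contDiffOn_inv hG (fun p h => det_ne_zero_of_bil (hs p h) (hp p h)) i 0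
  have h2 : SmoothOn (fun p => grad₀ (G p)) s := contDiffOn_euclidean.2 h1
  have h0 : ∀ p ∈ s, 0 < grad₀ (G p) 0 := fun p h => grad₀_zero_pos (hs p h) (hp p h)
  exact (((h1 0).sqrt fun p h => (h0 p h).ne').inv
    fun p h => (Real.sqrt_pos.2 (h0 p h)).ne').smul h2

lemma contDiffOn_matchVec {G1 G2 : V → 𝕄 n} (hG : SmoothMat G1 s)
  (hs : ∀ p ∈ s, ∀ i j, G1 p i j = G1 p j i) (hp : ∀ p ∈ s, ∀ a : 𝔼 n, a ≠ 0 → 0 < bil (G1 p) a a)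
  (hG' : SmoothMat G2 s) (hs' : ∀ p ∈ s, ∀ i j, G2 p i j = G2 p j i)
  (hp' : ∀ p ∈ s, ∀ a : 𝔼 n, a ≠ 0 → 0 < bil (G2 p) a a) : SmoothOn
  (fun p => matchVec (G1 p) (G2 p)) s := by
  have h1 := contDiffOn_normal₀ hG hs hp; have h2 := contDiffOn_normal₀ hG' hs' hp'
  have h0 : ∀ p ∈ s, normal₀ (G1 p) 0 ≠ 0 := fun p h => by
    have := grad₀_zero_pos (hs p h) (hp p h); rw [normal₀_zero this]
    exact (Real.sqrt_pos.2 this).ne'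
  exact ((contDiffOn_euclidean.1 h1 0).inv h0).smul (h2.add ((𝐬).contDiff.comp_contDiffOn h1))

end MatchVecSmooth

lemma IsBdryPush.isBoundaryVector {x : 𝔅 E1} {u : TangentSpace 𝓗 (x : E1)}
  {u' : TangentSpace 𝓗 (φ.toEquiv x : E2)} (H : IsBdryPush φ.toEquiv x u u')
  (hu : IsBoundaryVector (x : E1) u) : IsBoundaryVector (φ.toEquiv x : E2) u' := by
  obtain ⟨F, hF, hFu⟩ := H; have hFx : F x = φ.toEquiv x := hF.2.self_of_nhds x.2
  have he := IsManifold.chart_mem_maximalAtlas (I := 𝓗) (n := ∞) (x : E1)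
  have he' := IsManifold.chart_mem_maximalAtlas (I := 𝓗) (n := ∞) (φ.toEquiv x : E2)
  have hx := mem_chart_source 𝔐₊ (x : E1); have hx' := mem_chart_source 𝔐₊ (φ.toEquiv x : E2)
  rw [isBoundaryVector_iff he hx x.2] at hu; rw [isBoundaryVector_iff he' hx' (φ.toEquiv x).2]
  have h1 := height_dChart_eq_zero he he' hx (by rwa [hFx]) x.2 hF.1
    (hF.2.mono fun y hy hyb => by rw [hy hyb]; exact (φ.toEquiv _).2) hu
  rw [← (tangent_eq_iff he' hFx (by rwa [hFx]) _ _).1 hFu]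
  exact h1

variable (φ) in
/-- A modification of the metric `h₂` inside `N` which does not affect the hypotheses on the
boundary. -/
structure IsAdmissible (h₁ : HForm π₁) (h₂ : HForm π₂)
    (N : Set (Glued φ)) (h : HForm π₂) : Prop where
  metric : IsFibreMetric h
  ricci : RicciPositive h
  isometry : IsFibrewiseIsometry φ h₁ h
  curvature : NormalCurvatureCondition φ h₁ h
  off : ∀ y, ι₂ y ∉ N → h y = h₂ y

lemma HalfCharts.mem_target (hc : HalfCharts φ c c₁ c₂) {q : 𝕍} (hq : q ∈ c.ext.target) :
  (0 ≤ q.2 0 → q ∈ c₁.ext.target) ∧ (q.2 0 ≤ 0 → 𝐫 q ∈ c₂.ext.target) := by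
  have hw := c.mem_source hq; have e := c.ext.right_inv hq
  constructor
  · intro h0; obtain ⟨x, hx⟩ := (hc.sided.pos _ hw).2 (by rwa [e])
    have hxs : x ∈ 𝒮 c₁ := by rw [hc.mem₁, hx]; exact hw
    rw [← e, ← hx, ← hc.ext₁ x hxs]; exact c₁.ext_mem hxs
  · intro h0; obtain ⟨y, hy⟩ := (hc.sided.neg _ hw).2 (by rwa [e])
    have hys : y ∈ 𝒮 c₂ := by rw [hc.mem₂, hy]; exact hw
    rw [← e, ← hy, ← hc.ext₂ y hys]; exact c₂.ext_mem hys

lemma exists_matched_near (hW : IsCompatible φ) (hc1 : HasCharts k n π₁) (hc2 : HasCharts k n π₂)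
  (hh1 : IsFibreMetric h₁) (h₂ : HForm π₂) {N : Set (Glued φ)} (hN : IsOpen N) (hNs : seam φ ⊆ N)
  (x : 𝔅 E1) : ∃ U ∈ 𝓝 x, ∀ h, IsAdmissible φ h₁ h₂ N h → ∃ h', IsAdmissible φ h₁ h₂ N h' ∧ ∀ x',
  x' ∈ U ∨ IsMatchedAt φ h₁ h x' → IsMatchedAt φ h₁ h' x' := by
  have hxs : ι₁ x ∈ seam φ := (mem_seam_iff₁ φ _).2 x.2; have : Nonempty E1 := ⟨x⟩
  have : Nonempty E2 := ⟨φ.toEquiv x⟩; obtain ⟨c, hcx, hcs⟩ := exists_sided_chart φ hW hc1 hc2 hxs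
  obtain ⟨c₁, c₂, hc⟩ := exists_halfCharts hW hcs hcx; have hx1 : (x : E1) ∈ 𝒮 c₁ := hc.mem₁.2 hcx
  have hx2 := hc.bdry₁ hx1; have hxe : c₁.ext x = c.ext (ι₁ x) := hc.ext₁ _ hx1
  have hx0 : (c₁.ext x).2 0 = 0 := (c₁.ext_zero hx1).1 x.2
  have hO : IsOpen (𝐟 ⁻¹' c.ext.target) := c.isOpen_target.preimage (𝐟).continuous
  have hxO : c₂.ext (φ.toEquiv x : E2) ∈ 𝐟 ⁻¹' c.ext.target := by
    rw [hc.ext_bdry hx1, mem_preimage, flatL_eq_self hx0, hxe]; exact c.ext_mem hcx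
  have hNx : ι₂ ⁻¹' N ∈ 𝓝 (φ.toEquiv x : E2) := (hN.preimage (continuous_incl₂ φ)).mem_nhds (by
      rw [mem_preimage, ← incl₁_bdry]; exact hNs hxs)
  obtain ⟨χ, hχ1, hχO, H⟩ := c₂.exists_shear_map hx2 hNx hO hxO; rw [hc.ext_bdry hx1] at hχ1
  refine ⟨{x' | (x' : E1) ∈ 𝒮 c₁ ∧ χ (c₁.ext x') = 1}, ?_, fun h hh => ?_⟩
  · have h1 : ∀ᶠ y in 𝓝 (x : E1), y ∈ 𝒮 c₁ ∧ χ (c₁.ext y) = 1 :=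
      (c₁.total.open_source.eventually_mem hx1).and
        ((c₁.total.continuousAt_extend (I := 𝓗) hx1).eventually hχ1)
    exact continuous_subtype_val.continuousAt.eventually h1
  have hO1 : ∀ p ∈ 𝐟 ⁻¹' c.ext.target, 𝐟 p ∈ c₁.ext.target := fun p hp =>
    (hc.mem_target hp).1 (flatL_height p).ge
  have hO2 : ∀ p ∈ 𝐟 ⁻¹' c.ext.target, 𝐟 p ∈ c₂.ext.target := fun p hp => by
    have := (hc.mem_target hp).2 (flatL_height p).le
    rwa [HalfCharts.reflL_of_zero (flatL_height p)] at this
  obtain ⟨ψ, hψ, hψπ, hψb, hψf, hψl, hψv⟩ := H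
    (fun p => matchVec (c₁.coeff h₁ (𝐟 p)) (c₂.coeff h (𝐟 p)))
    (contDiffOn_matchVec (fun i j => (hh1.smooth c₁ i j).comp (𝐟).contDiff.contDiffOn hO1)
      (fun p _ => coeff_symm c₁ hh1 _) (fun p hp a ha => coeff_pos c₁ hh1 (hO1 p hp) ha)
      (fun i j => (hh.metric.smooth c₂ i j).comp (𝐟).contDiff.contDiffOn hO2)
      (fun p _ => coeff_symm c₂ hh.metric _)
      (fun p hp a ha => coeff_pos c₂ hh.metric (hO2 p hp) ha))
    fun p hp => neg_one_lt_matchVec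
      (grad₀_zero_pos (coeff_symm c₁ hh1 _) fun a ha => coeff_pos c₁ hh1 (hO1 p hp) ha)
      (grad₀_zero_pos (coeff_symm c₂ hh.metric _) fun a ha => coeff_pos c₂ hh.metric (hO2 p hp) ha)
  obtain ⟨h', hm, hR, hbil, htan, hcur, hoff⟩ :=
    exists_pullback_fixing_bdry hc2 hψ hψπ hψb hψf hh.metric hh.ricci
  refine ⟨h', ⟨hm, hR, ?_, ?_, ?_⟩, ?_⟩
  · intro x' u v u' v' hu hv pu pv
    rw [htan _ (φ.toEquiv x').2 _ _ (pu.isBoundaryVector hu) (pv.isBoundaryVector hv)]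
    exact hh.isometry x' u v u' v' hu hv pu pv
  · intro x' u u' hu hu1 pu d₁ d₂ hd1 hd2
    rw [hcur d₂ _ hd2 (φ.toEquiv x').2 u' (pu.isBoundaryVector hu)]
    exact hh.curvature x' u u' hu hu1 pu d₁ d₂ hd1 hd2
  · intro y hy; rw [hoff y (hψl y (Or.inl hy)), hh.off y hy]
  · intro x' hx'
    by_cases hx1' : (x' : E1) ∈ 𝒮 c₁
    · have hx2' := hc.bdry₁ hx1'; have ht1 := c₁.ext_mem hx1'; have ht2 := c₂.ext_mem hx2'
      rw [hc.ext_bdry hx1'] at ht2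
      have hflat : 𝐟 (c₁.ext x') = c₁.ext x' := flatL_eq_self ((c₁.ext_zero hx1').1 x'.2)
      have hp1 := fun (a : 𝔼 n) ha => coeff_pos c₁ hh1 ht1 (a := a) ha
      have hp2 := fun (a : 𝔼 n) ha => coeff_pos c₂ hh.metric ht2 (a := a) ha
      rw [hc.isMatchedAt_iff hW hx1'] at hx' ⊢; intro a b
      have e := hbil c₂ _ hx2' (φ.toEquiv x').2 (𝐬 a) (𝐬 b)
      rw [hψv _ (φ.toEquiv x').2 hx2', hψv _ (φ.toEquiv x').2 hx2', hc.ext_bdry hx1', hflat] at e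
      rw [e]; rcases hx' with hx' | hx'
      · rw [hx'.2, mul_one, mul_one]
        exact bil_matchVec (coeff_symm c₁ hh1 _) hp1 (coeff_symm c₂ hh.metric _) hp2
          (fun a b ha hb => hc.bil_eq_of_isometry hh.isometry hx1' ha hb) a b
      · rw [matchVec_eq_zero (coeff_symm c₁ hh1 _) (det_ne_zero c₁ hh1 ht1)
          (coeff_symm c₂ hh.metric _) (det_ne_zero c₂ hh.metric ht2) hx', smul_zero,
          smul_zero, add_zero, add_zero]
        exact hx' a b
    · have hx2' : (φ.toEquiv x' : E2) ∉ 𝒮 c₂ := by rwa [hc.mem₂, ← incl₁_bdry, ← hc.mem₁]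
      have hx'' := hx'.resolve_left fun h => hx1' h.1
      intro u v u' v' hu hv; rw [hoff _ (hψl _ (Or.inr hx2'))]; exact hx'' u v u' v' hu hv

/-- The second metric can be changed near the boundary so that the two metrics agree there. -/
lemma exists_matched (hW : IsCompatible φ) (hc1 : HasCharts k n π₁) (hc2 : HasCharts k n π₂)
  (hh1 : IsFibreMetric h₁) {N : Set (Glued φ)} (hN : IsOpen N) (hNs : seam φ ⊆ N)
  (hh2 : IsAdmissible φ h₁ h₂ N h₂) : ∃ h, IsAdmissible φ h₁ h₂ N h ∧ ∀ x,
  IsMatchedAt φ h₁ h x := by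
  have : CompactSpace (𝔅 E1) := isCompact_iff_compactSpace.1 isClosed_bdry.isCompact
  have key := isCompact_univ.induction_on (X := 𝔅 E1)
    (p := fun s => ∀ h, IsAdmissible φ h₁ h₂ N h → ∃ h', IsAdmissible φ h₁ h₂ N h' ∧
      ∀ x', x' ∈ s ∨ IsMatchedAt φ h₁ h x' → IsMatchedAt φ h₁ h' x')
    (fun h hh => ⟨h, hh, fun x' hx' => hx'.resolve_left id⟩)
    (fun s t hst ht h hh => by
      obtain ⟨h', hh', H⟩ := ht h hh
      exact ⟨h', hh', fun x' hx' => H x' (hx'.imp_left fun h => hst h)⟩)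
    (fun s t hs ht h hh => by
      obtain ⟨h', hh', H⟩ := hs h hh; obtain ⟨h'', hh'', H'⟩ := ht h' hh'
      refine ⟨h'', hh'', fun x' hx' => H' x' ?_⟩
      rcases hx' with (hx' | hx') | hx'
      · exact Or.inr (H x' (Or.inl hx'))
      · exact Or.inl hx'
      · exact Or.inr (H x' (Or.inr hx')))
    (fun x _ => by
      obtain ⟨U, hU, H⟩ := exists_matched_near hW hc1 hc2 hh1 h₂ hN hNs x
      exact ⟨U, mem_nhdsWithin_of_mem_nhds hU, H⟩)
  obtain ⟨h, hh, H⟩ := key h₂ hh2; exact ⟨h, hh, fun x => H x (Or.inl (mem_univ _))⟩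

/-- Metrics which agree along the seam define a form on the glued space. -/
lemma exists_glued_form (hW : IsCompatible φ) (hm : ∀ x, IsMatchedAt φ h₁ h₂ x) : ∃ h : FForm
  (gluedProj φ), (∀ x, IsPullbackAt ι₁ h₁ h x) ∧ ∀ y, IsPullbackAt ι₂ h₂ h y := by
  have key : ∀ w : Glued φ, ∃ β : LinearMap.BilinForm ℝ (Vert k (𝓡 n) (gluedProj φ) w),
      (∀ x (u v : Vert k (𝓡∂ n) π₁ x) (u' v' : Vert k (𝓡 n) (gluedProj φ) w),
        (⟨w, u'.1⟩ : TangentBundle 𝓕 (Glued φ)) = tangentMap 𝓗 𝓕 ι₁ ⟨x, u.1⟩ →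
        (⟨w, v'.1⟩ : TangentBundle 𝓕 (Glued φ)) = tangentMap 𝓗 𝓕 ι₁ ⟨x, v.1⟩ →
        h₁ x u v = β u' v') ∧
      ∀ y (u v : Vert k (𝓡∂ n) π₂ y) (u' v' : Vert k (𝓡 n) (gluedProj φ) w),
        (⟨w, u'.1⟩ : TangentBundle 𝓕 (Glued φ)) = tangentMap 𝓗 𝓕 ι₂ ⟨y, u.1⟩ →
        (⟨w, v'.1⟩ : TangentBundle 𝓕 (Glued φ)) = tangentMap 𝓗 𝓕 ι₂ ⟨y, v.1⟩ →
        h₂ y u v = β u' v' := by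
    have hL1 : ∀ x, ∃ L : Vert k (𝓡∂ n) π₁ x ≃ₗ[ℝ] Vert k (𝓡 n) (gluedProj φ) (ι₁ x),
        ∀ u, (L u).1 = mfderiv 𝓗 𝓕 ι₁ x u.1 := fun x =>
      exists_push (hW.smooth₁.mdifferentiable (by simp) x) (hW.smooth_proj.mdifferentiable
        (by simp) _) (fun _ => rfl) (hW.bijective₁ x)
    have hL2 : ∀ x, ∃ L : Vert k (𝓡∂ n) π₂ x ≃ₗ[ℝ] Vert k (𝓡 n) (gluedProj φ) (ι₂ x),
        ∀ u, (L u).1 = mfderiv 𝓗 𝓕 ι₂ x u.1 := fun x =>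
      exists_push (hW.smooth₂.mdifferentiable (by simp) x) (hW.smooth_proj.mdifferentiable
        (by simp) _) (fun _ => rfl) (hW.bijective₂ x)
    have hdef₁ : ∀ (x : E1) (L : Vert k (𝓡∂ n) π₁ x ≃ₗ[ℝ] Vert k (𝓡 n) (gluedProj φ) (ι₁ x)),
        (∀ u, (L u).1 = mfderiv 𝓗 𝓕 ι₁ x u.1) →
        ∀ u u', (⟨ι₁ x, u'.1⟩ : TangentBundle 𝓕 (Glued φ)) = tangentMap 𝓗 𝓕 ι₁ ⟨x, u.1⟩ →
          L.symm u' = u := fun x L hL u u' h => by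
      rw [LinearEquiv.symm_apply_eq]
      exact Subtype.ext ((eq_of_heq (Bundle.TotalSpace.mk.inj h).2).trans (hL u).symm)
    have hdef₂ : ∀ (x : E2) (L : Vert k (𝓡∂ n) π₂ x ≃ₗ[ℝ] Vert k (𝓡 n) (gluedProj φ) (ι₂ x)),
        (∀ u, (L u).1 = mfderiv 𝓗 𝓕 ι₂ x u.1) →
        ∀ u u', (⟨ι₂ x, u'.1⟩ : TangentBundle 𝓕 (Glued φ)) = tangentMap 𝓗 𝓕 ι₂ ⟨x, u.1⟩ →
          L.symm u' = u := fun x L hL u u' h => by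
      rw [LinearEquiv.symm_apply_eq]
      exact Subtype.ext ((eq_of_heq (Bundle.TotalSpace.mk.inj h).2).trans (hL u).symm)
    intro w
    by_cases hw : w ∈ range ι₂
    · obtain ⟨y, rfl⟩ := hw; obtain ⟨L, hL⟩ := hL2 y
      refine ⟨(h₂ y).compl₁₂ L.symm L.symm, fun x u v u' v' hu hv => ?_,
        fun y' u v u' v' hu hv => ?_⟩
      · have hb : ι₂ y = ι₁ x := (Bundle.TotalSpace.mk.inj hu).1
        obtain ⟨hx, rfl⟩ := (incl_eq_iff φ x y).1 hb.symm
        have e : ∀ u' : Vert k (𝓡 n) (gluedProj φ) (ι₂ (φ.toEquiv ⟨x, hx⟩ : E2)),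
            (⟨_, u'.1⟩ : TangentBundle 𝓕 (Glued φ)) =
            tangentMap 𝓗 𝓕 ι₂ ⟨_, (L.symm u').1⟩ :=
          fun u' => by change _ = Bundle.TotalSpace.mk _ _; rw [← hL, LinearEquiv.apply_symm_apply]
        exact hm ⟨x, hx⟩ u v (L.symm u') (L.symm v') (hu.symm.trans (e u')) (hv.symm.trans (e v'))
      · obtain rfl := incl₂_injective φ (Bundle.TotalSpace.mk.inj hu).1
        change _ = h₂ y (L.symm u') (L.symm v'); rw [hdef₂ y L hL u u' hu, hdef₂ y L hL v v' hv]
    · obtain ⟨x, rfl⟩ := (glued_cases φ w).resolve_right fun ⟨y, hy⟩ => hw ⟨y, hy.symm⟩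
      obtain ⟨L, hL⟩ := hL1 x
      refine ⟨(h₁ x).compl₁₂ L.symm L.symm, fun x' u v u' v' hu hv => ?_,
        fun y' u v u' v' hu hv => absurd ⟨y', (Bundle.TotalSpace.mk.inj hu).1.symm⟩ hw⟩
      obtain rfl := incl₁_injective φ (Bundle.TotalSpace.mk.inj hu).1
      change _ = h₁ x (L.symm u') (L.symm v'); rw [hdef₁ x L hL u u' hu, hdef₁ x L hL v v' hv]
  choose h H1 H2 using key
  refine ⟨h, fun x u v u' v' hu hv => H1 _ x u v u' v' ?_ ?_,
    fun x u v u' v' hu hv => H2 _ x u v u' v' ?_ ?_⟩ <;>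
  first | rw [hu]; rfl | rw [hv]; rfl

section LocalFold

/-- The point `p` with the coordinate `z₀` replaced by `s`. -/
def setHeight (p : 𝕍) (s : ℝ) : 𝕍 := p + (s - p.2 0) • 𝐮

lemma setHeight_height (p : 𝕍) (s : ℝ) : (setHeight p s).2 0 = s := by simp [setHeight, e₀]

lemma setHeight_self (p : 𝕍) : setHeight p (p.2 0) = p := by simp [setHeight]

lemma contDiff_setHeight {P : F → 𝕍} {s : F → ℝ} (hP : ContDiff ℝ ∞ P) (hs : ContDiff ℝ ∞ s) :
  ContDiff ℝ ∞ fun q => setHeight (P q) (s q) :=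
  hP.add ((hs.sub ((𝐡).contDiff.comp hP)).smul contDiff_const)

/-- `A(z₀ := σ) + A(z₀ := τ) - A(z₀ := 0)`. -/
def localFold {W : Type*} [AddCommGroup W] (A : 𝕍 → W) (q : 𝕍 × ℝ × ℝ) : W :=
  A (setHeight q.1 q.2.1) + A (setHeight q.1 q.2.2) - A (setHeight q.1 0)

/-- The domain of `localFold`. -/
def foldDomain (U : Set 𝕍) : Set (𝕍 × ℝ × ℝ) :=
  {q | setHeight q.1 q.2.1 ∈ U ∧ setHeight q.1 q.2.2 ∈ U ∧ setHeight q.1 0 ∈ U}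

variable {U : Set (𝔼 k × 𝔼 n)}

lemma isOpen_foldDomain (hU : IsOpen U) : IsOpen (foldDomain U) := by
  have h1 : Continuous fun q : 𝕍 × ℝ × ℝ =>
    setHeight q.1 q.2.1 := (contDiff_setHeight contDiff_fst
      (contDiff_fst.comp contDiff_snd)).continuous
  have h2 : Continuous fun q : 𝕍 × ℝ × ℝ =>
    setHeight q.1 q.2.2 := (contDiff_setHeight contDiff_fst
      (contDiff_snd.comp contDiff_snd)).continuous
  have h3 : Continuous fun q : 𝕍 × ℝ × ℝ =>
    setHeight q.1 0 := (contDiff_setHeight contDiff_fst contDiff_const).continuous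
  exact (hU.preimage h1).inter ((hU.preimage h2).inter (hU.preimage h3))

lemma mem_foldDomain {p : 𝕍} (hp : p ∈ U) (h0 : p.2 0 = 0) :
  (p, (0 : ℝ), (0 : ℝ)) ∈ foldDomain U := by
  have e : setHeight p 0 = p := by rw [← h0, setHeight_self]
  exact ⟨by rwa [e], by rwa [e], by rwa [e]⟩

lemma contDiffOn_localFold {A : 𝕍 → ℝ} (h₁ : SmoothOn A (U ∩ {p | 0 ≤ p.2 0}))
  (h₂ : SmoothOn A (U ∩ {p | p.2 0 ≤ 0})) : SmoothOn (localFold A)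
  (foldDomain U ∩ quadrant n (𝔼 k)) := by
  refine ((h₂.comp (contDiff_setHeight contDiff_fst
    (contDiff_fst.comp contDiff_snd)).contDiffOn ?_).add (h₁.comp (contDiff_setHeight contDiff_fst
    (contDiff_snd.comp contDiff_snd)).contDiffOn ?_)).sub
    (h₁.comp (contDiff_setHeight contDiff_fst contDiff_const).contDiffOn ?_)
  · exact fun q hq => ⟨hq.1.1, (setHeight_height _ _).trans_le hq.2.1⟩
  · exact fun q hq => ⟨hq.1.2.1, hq.2.2.trans_eq (setHeight_height _ _).symm⟩
  · exact fun q hq => ⟨hq.1.2.2, (setHeight_height _ _).ge⟩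

end LocalFold

section Folding

/-- Near `w`, the family `𝒢(σ, τ)` of forms, defined for `σ ≤ 0 ≤ τ`, is smooth and restricts to
`h` for `σ = 0`, `τ = T` and for `σ = T`, `τ = 0`. -/
structure IsFoldAt (T : X → ℝ) (h : FForm ϖ) (𝒢 : ℝ × ℝ → FForm ϖ) (w : X) :
    Prop where
  smooth : ∀ c : FChart ϖ, w ∈ 𝒮 c → ∃ O : Set (𝕍 × ℝ × ℝ), IsOpen O ∧
      (c.ext w, 0, 0) ∈ O ∧ ∀ i j, SmoothOn (fun q => c.coeff (𝒢 q.2) q.1 i j)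
        (O ∩ quadrant n (𝔼 k))
  agree : ∀ᶠ w' in 𝓝 w, (0 ≤ T w' → 𝒢 (0, T w') w' = h w') ∧ (T w' ≤ 0 → 𝒢 (T w', 0) w' = h w')

lemma FibredChart.exists_smooth_toForm (c c' : FChart ϖ) {M : 𝕍 × ℝ × ℝ → 𝕄 n}
  {O Q : Set (𝕍 × ℝ × ℝ)} {Q' : Set (ℝ × ℝ)} (hQ : Q = univ ×ˢ Q') (hO : IsOpen O)
  (hM : SmoothMat M (O ∩ Q)) {w : X} (hw : w ∈ 𝒮 c) (hw' : w ∈ 𝒮 c') {s : ℝ × ℝ}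
  (hs : (c.ext w, s) ∈ O) : ∃ O' : Set (𝕍 × ℝ × ℝ), IsOpen O' ∧ (c'.ext w, s) ∈ O' ∧ ∀ i j, SmoothOn
  (fun q => c'.coeff (fun w => c.toForm w (M (c.ext w, q.2))) q.1 i j) (O' ∩ Q) := by
  have hid : ∀ w, ContMDiffAt 𝓕 𝓕 ∞ (id : X → X) w := fun w => contMDiffAt_id
  let D : Set 𝕍 := c'.ext.target ∩ c'.ext.symm ⁻¹' 𝒮 c
  have hD : IsOpen D := c'.contMDiffOn_ext_symm.continuousOn.isOpen_inter_preimage c'.isOpen_target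
    c.total.open_source
  have hDe : ∀ p ∈ D, ∃ w, w ∈ 𝒮 c ∧ w ∈ 𝒮 c' ∧ c'.ext w = p := fun p hp =>
    ⟨_, hp.2, c'.mem_source hp.1, c'.ext.right_inv hp.1⟩
  have htr : SmoothOn (transit c' c id) D := fun p hp => by
    obtain ⟨w, h1, h2, rfl⟩ := hDe p hp
    exact (smooth_transit c' c h2 h1 (hid w)).mono fun p _ => by rw [range_full_prod]; trivial
  have hvd : SmoothOn (vderiv c' c id) D := fun p hp => by
    obtain ⟨w, h1, h2, rfl⟩ := hDe p hp
    exact (smooth_vderiv c' c h2 h1 (hid w)).mono fun p _ => by rw [range_full_prod]; trivial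
  have hcoef : ∀ p ∈ D, ∀ s i j, c'.coeff (fun w => c.toForm w (M (c.ext w, s))) p i j =
      bil (M (transit c' c id p, s)) (vderiv c' c id p (𝐞 i))
        (vderiv c' c id p (𝐞 j)) := fun p hp s i j => by
    obtain ⟨w, h1, h2, rfl⟩ := hDe p hp
    have e := c'.coeff_eq_of_form (fun w => c.toForm w (M (c.ext w, s))) h2
      (fun i j => bil (M (c.ext w, s)) (vderiv c' c id (c'.ext w) (𝐞 i))
        (vderiv c' c id (c'.ext w) (𝐞 j))) fun u v => by
      have hp : ∀ u : Vert k (𝓡 n) ϖ w, c.coord w u = vderiv c' c id (c'.ext w) (c'.coord w u) :=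
        fun u => coord_push c' c (ψ := id) h2 h1 (hid w) u u (by rw [mfderiv_id]; rfl)
      rw [c.toForm_apply, hp, hp]
      let L := vderiv c' c id (c'.ext w)
      exact eq_bil_of_basis (LinearMap.mk₂ ℝ (fun a b => bil (M (c.ext w, s)) (L a) (L b))
        (fun a a' b => by rw [map_add, bil_add_left])
        (fun r a b => by rw [map_smul, bil_smul_left]; rfl)
        (fun a b b' => by rw [map_add, bil_add_right])
        (fun r a b => by rw [map_smul, bil_smul_right]; rfl)) _ _
    rw [e, transit_ext c' c h2]; rfl
  have hΦ : SmoothOn (fun q : 𝕍 × ℝ × ℝ => (transit c' c id q.1, q.2)) (Prod.fst ⁻¹' D) :=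
    (htr.comp contDiffOn_fst fun _ h => h).prodMk contDiffOn_snd
  refine ⟨Prod.fst ⁻¹' D ∩ (fun q => (transit c' c id q.1, q.2)) ⁻¹' O,
    hΦ.continuousOn.isOpen_inter_preimage (hD.preimage continuous_fst) hO, ⟨⟨c'.ext_mem hw', ?_⟩, ?_⟩,
    fun i j => ?_⟩
  · change c'.ext.symm (c'.ext w) ∈ 𝒮 c; rwa [c'.symm_ext hw']
  · change (transit c' c id (c'.ext w), s) ∈ O; rwa [transit_ext c' c hw']
  · set S : Set (𝕍 × ℝ × ℝ) :=
      (Prod.fst ⁻¹' D ∩ (fun q => (transit c' c id q.1, q.2)) ⁻¹' O) ∩ Q with hS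
    have hSD : ∀ q ∈ S, q.1 ∈ D := fun q hq => hq.1.1
    have hv0 : SmoothOn (fun q => vderiv c' c id q.1) S := hvd.comp contDiffOn_fst hSD
    have hv : ∀ i : Fin n, SmoothOn (fun q => vderiv c' c id q.1 (𝐞 i)) S := fun i =>
      hv0.clm_apply contDiffOn_const
    have hMS : ∀ i j, SmoothOn (fun q => M (transit c' c id q.1, q.2) i j) S := fun i j => by
      refine (hM i j).comp (hΦ.mono hSD) fun q hq => ⟨hq.1.2, ?_⟩
      have := hq.2; rw [hQ] at this ⊢; exact ⟨trivial, this.2⟩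
    intro q hq
    exact (contDiffWithinAt_bil (fun i j => hMS i j q hq) (hv i q hq) (hv j q hq)).congr
      (fun q' hq' => hcoef q'.1 (hSD q' hq') q'.2 i j) (hcoef q.1 (hSD q hq) q.2 i j)

lemma quadrant_eq {F : Type*} : quadrant n F = univ ×ˢ {s : ℝ × ℝ | s.1 ≤ 0 ∧ 0 ≤ s.2} := by
  ext q; simp [quadrant]

variable {T : X → ℝ} {h : FibreForm k (𝓡 n) ϖ}

lemma exists_isFoldAt_of_chart (c : FChart ϖ) (hT : ∀ w ∈ 𝒮 c, (c.ext w).2 0 = T w)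
  (h₁ : ∀ i j, SmoothOn (fun p => c.coeff h p i j) (c.ext.target ∩ {p | 0 ≤ p.2 0}))
  (h₂ : ∀ i j, SmoothOn (fun p => c.coeff h p i j) (c.ext.target ∩ {p | p.2 0 ≤ 0}))
  (hs : ∀ p i j, c.coeff h p i j = c.coeff h p j i) : ∃ 𝒢 : ℝ × ℝ → FForm ϖ,
  (∀ s w u v, 𝒢 s w u v = 𝒢 s w v u) ∧ ∀ w ∈ 𝒮 c, T w = 0 → IsFoldAt T h 𝒢 w := by
  refine ⟨fun s w => c.toForm w (localFold (c.coeff h) (c.ext w, s)), fun s w u v => ?_,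
    fun w hw h0 => ⟨fun c' hw' => ?_, ?_⟩⟩
  · refine bil_symm (fun i j => ?_) _ _
    simp only [localFold, Matrix.sub_apply, Matrix.add_apply]; rw [hs _ i j, hs _ i j, hs _ i j]
  · refine c.exists_smooth_toForm c' quadrant_eq (isOpen_foldDomain c.isOpen_target)
      (fun i j => ?_) hw hw' (mem_foldDomain (c.ext_mem hw) (by rw [hT w hw, h0]))
    exact contDiffOn_localFold (h₁ i j) (h₂ i j)
  · filter_upwards [c.total.open_source.mem_nhds hw] with w' hw'
    have e1 : c.toForm w' (c.coeff h (c.ext w')) = h w' :=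
      LinearMap.ext fun u => LinearMap.ext fun v => (c.form_eq_bil h hw' u v).symm
    have e2 : setHeight (c.ext w') (T w') = c.ext w' := by rw [← hT w' hw', setHeight_self]
    constructor
    · intro _; simp only [localFold, e2]; rw [add_sub_cancel_left, e1]
    · intro _; simp only [localFold, e2]; rw [add_sub_cancel_right, e1]

lemma FibredChart.coeff_congr {h h' : FForm ϖ} (c : FChart ϖ) {w : X} (hw : w ∈ 𝒮 c)
  (H : ∀ᶠ w' in 𝓝 w, h w' = h' w') : ∀ᶠ p in 𝓝 (c.ext w), c.coeff h p = c.coeff h' p := by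
  obtain ⟨O, hO, hwO, H'⟩ := c.exists_open hw H; filter_upwards [hO.mem_nhds hwO] with p hp
  have := (H' p ⟨hp, by rw [range_full_prod]; trivial⟩).2
  funext i j; change h _ _ _ = h' _ _ _; rw [this]

variable [T2Space X] [CompactSpace X]

lemma IsFoldAt.combine {𝒢₀ 𝒢 : ℝ × ℝ → FForm ϖ} {b : X → ℝ} (hb : ContMDiff 𝓕 𝓘(ℝ) ∞ b) {w : X}
  (H0 : IsFoldAt T h 𝒢₀ w) (H : IsFoldAt T h 𝒢 w) : IsFoldAt T h
  (fun s w => b w • 𝒢₀ s w + (1 - b w) • 𝒢 s w) w := by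
  refine ⟨fun c hw => ?_, ?_⟩
  · obtain ⟨O0, hO0, hw0, hs0⟩ := H0.smooth c hw; obtain ⟨O, hO, hwO, hs⟩ := H.smooth c hw
    have hbs : SmoothOn (b ∘ c.ext.symm) c.ext.target :=
      contMDiffOn_iff_contDiffOn.1 (hb.comp_contMDiffOn c.contMDiffOn_ext_symm)
    refine ⟨O0 ∩ O ∩ Prod.fst ⁻¹' c.ext.target,
      (hO0.inter hO).inter (c.isOpen_target.preimage continuous_fst),
      ⟨⟨hw0, hwO⟩, c.ext_mem hw⟩, fun i j => ?_⟩
    have hb' : SmoothOn (fun q : 𝕍 × ℝ × ℝ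
        => b (c.ext.symm q.1)) (O0 ∩ O ∩ Prod.fst ⁻¹' c.ext.target ∩ quadrant n (𝔼 k)) :=
      hbs.comp contDiffOn_fst fun q hq => hq.1.2
    exact (hb'.mul ((hs0 i j).mono fun q hq => ⟨hq.1.1.1, hq.2⟩)).add
      ((contDiffOn_const.sub hb').mul ((hs i j).mono fun q hq => ⟨hq.1.1.2, hq.2⟩))
  · filter_upwards [H0.agree, H.agree] with w' h1 h2
    refine ⟨fun h0 => ?_, fun h0 => ?_⟩
    · simp only [h1.1 h0, h2.1 h0, ← add_smul]; rw [add_sub_cancel, one_smul]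
    · simp only [h1.2 h0, h2.2 h0, ← add_smul]; rw [add_sub_cancel, one_smul]

lemma IsFoldAt.congr {𝒢₀ 𝒢 : ℝ × ℝ → FForm ϖ} {w : X} (H : IsFoldAt T h 𝒢 w)
  (hG : ∀ᶠ w' in 𝓝 w, ∀ s, 𝒢₀ s w' = 𝒢 s w') : IsFoldAt T h 𝒢₀ w := by
  refine ⟨fun c hw => ?_, ?_⟩
  · obtain ⟨O, hO, hwO, hs⟩ := H.smooth c hw; obtain ⟨D, hD, hwD, hDG⟩ := c.exists_open hw hG
    refine ⟨O ∩ Prod.fst ⁻¹' D, hO.inter (hD.preimage continuous_fst), ⟨hwO, hwD⟩, fun i j => ?_⟩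
    refine ((hs i j).mono fun q hq => ⟨hq.1.1, hq.2⟩).congr fun q hq => ?_
    have := (hDG q.1 ⟨hq.1.2, by rw [range_full_prod]; trivial⟩).2 q.2
    change 𝒢₀ _ _ _ _ = 𝒢 _ _ _ _; rw [this]
  · filter_upwards [H.agree, hG] with w' h1 h2
    rw [h2, h2]; exact h1

/-- Families of forms as in `IsFoldAt` can be glued. -/
lemma exists_fold {S : Set X} (hS : IsCompact S) (hloc : ∀ x ∈ S, ∃
  (c : FChart ϖ) (𝒢 : ℝ × ℝ → FForm ϖ), x ∈ 𝒮 c ∧ (∀ s w u v, 𝒢 s w u v = 𝒢 s w v u) ∧ ∀ w ∈ 𝒮 c,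
  w ∈ S → IsFoldAt T h 𝒢 w) : ∃ 𝒢 : ℝ × ℝ → FForm ϖ, (∀ s w u v, 𝒢 s w u v = 𝒢 s w v u) ∧ ∀ w ∈ S,
  IsFoldAt T h 𝒢 w := by
  have key := hS.induction_on
    (p := fun t => ∀ 𝒢 : ℝ × ℝ → FForm ϖ, (∀ s w u v, 𝒢 s w u v = 𝒢 s w v u) →
      ∃ 𝒢' : ℝ × ℝ → FForm ϖ, (∀ s w u v, 𝒢' s w u v = 𝒢' s w v u) ∧
        ∀ w ∈ S, w ∈ t ∨ IsFoldAt T h 𝒢 w → IsFoldAt T h 𝒢' w)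
    (fun 𝒢 h𝒢 => ⟨𝒢, h𝒢, fun w _ hw => hw.resolve_left id⟩)
    (fun s t hst ht 𝒢 h𝒢 => by
      obtain ⟨𝒢', h1, h2⟩ := ht 𝒢 h𝒢
      exact ⟨𝒢', h1, fun w hwS hw => h2 w hwS (hw.imp_left fun h => hst h)⟩)
    (fun s t hs ht 𝒢 h𝒢 => by
      obtain ⟨𝒢', h1, h2⟩ := hs 𝒢 h𝒢; obtain ⟨𝒢'', h3, h4⟩ := ht 𝒢' h1
      refine ⟨𝒢'', h3, fun w hwS hw => h4 w hwS ?_⟩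
      rcases hw with (hw | hw) | hw
      · exact Or.inr (h2 w hwS (Or.inl hw))
      · exact Or.inl hw
      · exact Or.inr (h2 w hwS (Or.inr hw)))
    (fun x hx => by
      obtain ⟨c, 𝒢₀, hxc, hsymm₀, hfold₀⟩ := hloc x hx
      obtain ⟨b, hb, -, hb1, hbs⟩ := c.exists_bump_coord hxc
      refine ⟨{w | ∀ᶠ w' in 𝓝 w, b w' = 1} ∩ 𝒮 c, mem_nhdsWithin_of_mem_nhds
        (inter_mem (eventually_eventually_nhds.2 hb1) (c.total.open_source.mem_nhds hxc)),
        fun 𝒢 h𝒢 => ⟨fun s w => b w • 𝒢₀ s w + (1 - b w) • 𝒢 s w, fun s w u v => ?_,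
          fun w hwS hw => ?_⟩⟩
      · change b w * 𝒢₀ s w u v + (1 - b w) * 𝒢 s w u v = b w * 𝒢₀ s w v u + (1 - b w) * 𝒢 s w v u
        rw [hsymm₀, h𝒢]
      · rcases hw with hw | hw
        · refine (hfold₀ w hw.2 hwS).congr ?_; filter_upwards [hw.1] with w' hw' s
          rw [hw', sub_self, zero_smul, add_zero, one_smul]
        · by_cases hwc : w ∈ 𝒮 c
          · exact (hfold₀ w hwc hwS).combine hb hw
          · refine hw.congr ?_; have : w ∉ tsupport b := fun h => hwc (hbs h)
            filter_upwards [(isClosed_tsupport b).isOpen_compl.mem_nhds this] with w' hw' s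
            rw [image_eq_zero_of_notMem_tsupport hw', sub_zero, zero_smul, zero_add, one_smul])
  obtain ⟨𝒢, h1, h2⟩ := key (fun _ _ => 0) fun _ _ _ _ => rfl
  exact ⟨𝒢, h1, fun w hw => h2 w hw (Or.inl hw)⟩

end Folding

section Reflection

lemma refl₀_bijective : Bijective 𝐬 :=
  ⟨fun a b h => by rw [← refl₀_refl₀ a, h, refl₀_refl₀], fun a => ⟨𝐬 a, refl₀_refl₀ a⟩⟩

lemma bil_ext {M N : 𝕄 n} (h : ∀ a b, bil M a b = bil N a b) : M = N := by
  funext i j; rw [← bil_single M i j, h, bil_single]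

variable {U : Set (𝔼 n)} {G A : 𝔼 n → 𝕄 n}

lemma reflect_curvature (hU : IsOpen U) (hG : SmoothMat G (ℛ₀ ∩ U))
  (hs : ∀ z ∈ ℛ₀ ∩ U, ∀ i j, G z i j = G z j i) (hp : ∀ z ∈ ℛ₀ ∩ U, ∀ a : 𝔼 n, a ≠ 0 → 0 <
  bil (G z) a a) (hGA : ∀ z ∈ ℛ₀ ∩ U, ∀ a b, bil (G z) a b = bil (A (𝐬 z)) (𝐬 a) (𝐬 b)) {z : 𝔼 n}
  (hz : z ∈ ℛ₀ ∩ U) (a b : 𝔼 n) : bil (ric {z | z 0 ≤ 0} A (𝐬 z)) a b = bil (ric ℛ₀ G z) (𝐬 a)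
  (𝐬 b) ∧ chrL {z | z 0 ≤ 0} A (𝐬 z) a b = 𝐬 (chrL ℛ₀ G z (𝐬 a) (𝐬 b)) := by
  have hs1 : UniqueDiffOn ℝ (ℛ₀ ∩ U) := uniqueDiff_inter hU
  have hU' : IsOpen (𝐬 ⁻¹' U) := hU.preimage (𝐬).continuous
  have hs2 : UniqueDiffOn ℝ ({z : 𝔼 n | z 0 ≤ 0} ∩ 𝐬 ⁻¹' U) := uniqueDiffOn_nonpos.inter hU'
  have hmem : ∀ z ∈ {z : 𝔼 n | z 0 ≤ 0} ∩ 𝐬 ⁻¹' U, 𝐬 z ∈ ℛ₀ ∩ U := fun z hz => ⟨by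
    rw [range_half, mem_ofPred_eq, refl₀_zero]; exact neg_nonneg.2 hz.1, hz.2⟩
  have hA' : ∀ z ∈ {z : 𝔼 n | z 0 ≤ 0} ∩ 𝐬 ⁻¹' U, ∀ a b,
      bil (A z) a b = bil (G (𝐬 z)) (𝐬 a) (𝐬 b) := fun z hz a b => by
    rw [hGA _ (hmem z hz), refl₀_refl₀, refl₀_refl₀, refl₀_refl₀]
  have hAs : ∀ z ∈ {z : 𝔼 n | z 0 ≤ 0} ∩ 𝐬 ⁻¹' U, ∀ i j, A z i j = A z j i := fun z hz i j => by
    rw [← bil_single (A z), ← bil_single (A z), hA' z hz, hA' z hz, bil_symm (hs _ (hmem z hz))]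
  have hAp : ∀ z ∈ {z : 𝔼 n | z 0 ≤ 0} ∩ 𝐬 ⁻¹' U, (A z).det ≠ 0 :=
    fun z hz => det_ne_zero_of_bil (hAs z hz) fun a ha => by
      rw [hA' z hz]
      exact hp _ (hmem z hz) _ fun h => ha (refl₀_bijective.1 (h.trans (map_zero _).symm))
  have hAd : ∀ i j, SmoothOn (fun z => A z i j)
      ({z : 𝔼 n | z 0 ≤ 0} ∩ 𝐬 ⁻¹' U) := fun i j z hz => by
    refine (contDiffWithinAt_bil (M := fun z => G (𝐬 z)) (u := fun _ => 𝐬 (𝐞 i))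
      (v := fun _ => 𝐬 (𝐞 j)) (fun i j => ?_)
      contDiffWithinAt_const contDiffWithinAt_const).congr (fun z hz => ?_) ?_
    · exact ((hG i j).comp (𝐬).contDiff.contDiffOn hmem) z hz
    · rw [← bil_single (A z), hA' z hz]
    · rw [← bil_single (A z), hA' z hz]
  have hGd : ∀ z ∈ ℛ₀ ∩ U, (G z).det ≠ 0 := fun z hz => det_ne_zero_of_bil (hs z hz) (hp z hz)
  have hfd : ∀ z ∈ ℛ₀ ∩ U, 𝒟 𝐬 (ℛ₀ ∩ U) z = 𝐬 := fun z hz => (𝐬).fderivWithin (hs1 z hz)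
  have hmaps : MapsTo 𝐬 (ℛ₀ ∩ U) ({z : 𝔼 n | z 0 ≤ 0} ∩ 𝐬 ⁻¹' U) := fun z hz => by
    have h0 := hz.1; rw [range_half, mem_ofPred_eq] at h0; refine ⟨?_, ?_⟩
    · rw [mem_ofPred_eq, refl₀_zero]; linarith
    · rw [mem_preimage, refl₀_refl₀]; exact hz.2
  have hset₁ : (ℛ₀ : Set _) =ᶠ[𝓝 z] (ℛ₀ ∩ U : Set _) := range_inter_eq hU hz.2
  have hset₂ : {z : 𝔼 n | z 0 ≤ 0} =ᶠ[𝓝 (𝐬 z)] ({z : 𝔼 n | z 0 ≤ 0} ∩ 𝐬 ⁻¹' U : Set _) := by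
    filter_upwards [hU'.mem_nhds (hmaps hz).2] with z' hz'
    exact propext ⟨fun h => ⟨h, hz'⟩, fun h => h.1⟩
  have e1 := ric_transform hs1 (range_inter_subset_closure hU) hs2 (𝐬).contDiff.contDiffOn
    hmaps hG hAd hGd hAp hs hAs (fun z hz => by rw [hfd z hz]; exact refl₀_bijective)
    (fun z hz u v => by rw [hfd z hz]; exact hGA z hz u v) hz (𝐬 a) (𝐬 b)
  have e2 := chrL_transform hs1 (range_inter_subset_closure hU) hs2 (𝐬).contDiff.contDiffOn
    hmaps hG hAd hGd hAp hs hAs (fun z hz => by rw [hfd z hz]; exact refl₀_bijective.2)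
    (fun z hz u v => by rw [hfd z hz]; exact hGA z hz u v) hz (𝐬 a) (𝐬 b)
  have e3 : 𝒟 (𝒟 𝐬 (ℛ₀ ∩ U)) (ℛ₀ ∩ U) z = 0 := by
    rw [fderivWithin_congr hfd (hfd z hz), fderivWithin_const_apply]
  rw [hfd z hz, refl₀_refl₀, refl₀_refl₀] at e1 e2; rw [e3] at e2
  rw [ric_congr hset₂ (EventuallyEq.refl _ _) (hmaps hz).1,
    ric_congr hset₁ (EventuallyEq.refl _ _) hz.1, chrL_congr hset₂, chrL_congr hset₁, e1, e2]
  exact ⟨rfl, by simp⟩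

end Reflection

section Jump

variable {G : (F × 𝔼 n) × ℝ × ℝ → 𝕄 n} {O : Set ((F × 𝔼 n) × ℝ × ℝ)}

lemma bil_jumpChr {S : Set 𝔽} (q : 𝔽) {a : 𝔼 n} (ha : a 0 = 0) : bil
  (Matrix.of fun i j => jumpChr S G 0 i j q) a a = -(1 / 2) * (G q)⁻¹ 0 0 * bil
  (jump S G q) a a := by
  have h0 : ∀ i, δ₀ i * a i = 0 := fun i => by
    by_cases hi : i = 0
    · rw [hi, ha, mul_zero]
    · rw [Pi.single_eq_of_ne hi, zero_mul]
  have e : ∀ i j, jumpChr S G 0 i j q * a i * a j =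
      -(1 / 2) * (G q)⁻¹ 0 0 * (jump S G q i j * a i * a j) := fun i j => by
    have : jumpChr S G 0 i j q * a i * a j = (1 / 2) * ∑ m, (G q)⁻¹ 0 m *
        (((δ₀ i * a i) * jump S G q j m * a j) +
        ((δ₀ j * a j) * jump S G q i m * a i) -
        δ₀ m * jump S G q i j * a i * a j) := by
      rw [jumpChr, mul_sum, mul_sum, sum_mul, sum_mul]; exact sum_congr rfl fun m _ => by ring
    rw [this, Finset.sum_eq_single 0]
    · rw [h0, h0, Pi.single_eq_same]; ring
    · intro m _ hm; rw [h0, h0, Pi.single_eq_of_ne hm]; ring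
    · intro h; exact absurd (Finset.mem_univ _) h
  simp only [bil, Matrix.of_apply, e, mul_sum]

/-- The jump of the second fundamental forms in terms of the jump of the normal derivatives. -/
lemma bil_chr_sub (hO : IsOpen O) (hG : SmoothMat G (O ∩ quadrant n F)) {p : F × 𝔼 n}
  (hp0 : p.2 0 = 0) (hpO : (p, 0, 0) ∈ O) {a : 𝔼 n} (ha : a 0 = 0) : bil
  (Matrix.of fun i j => chr {z | 0 ≤ z 0} (fun z => G (foldMap id p.1 z)) 0 i j p.2) a a - bil
  (Matrix.of fun i j => chr {z | z 0 ≤ 0} (fun z => G (foldMap (fun _ => 0) p.1 z)) 0 i j p.2) a a =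
  -(1 / 2) * (G (p, 0, 0))⁻¹ 0 0 * bil (jump (O ∩ quadrant n F) G (p, 0, 0)) a a := by
  have hU1 : IsOpen (foldMap (n := n) id p.1 ⁻¹' O) := hO.preimage (continuous_foldMap continuous_id _)
  have hU2 : IsOpen (foldMap (n := n) (fun _ => 0) p.1 ⁻¹' O) :=
    hO.preimage (continuous_foldMap continuous_const _)
  have hq1 : foldMap id p.1 p.2 = (p, 0, 0) := by simp [foldMap, hp0]
  have hq2 : foldMap (fun _ => 0) p.1 p.2 = (p, 0, 0) := by simp [foldMap, hp0]
  have hset : ∀ {s U : Set (𝔼 n)}, IsOpen U → p.2 ∈ U →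
      s =ᶠ[𝓝 p.2] (s ∩ U : Set _) := fun {s U} hU hpU => by
    filter_upwards [hU.mem_nhds hpU] with z hz
    exact propext ⟨fun h => ⟨h, hz⟩, fun h => h.1⟩
  have hm1 : p.2 ∈ foldMap (n := n) id p.1 ⁻¹' O := by rw [mem_preimage, hq1]; exact hpO
  have hm2 : p.2 ∈ foldMap (n := n) (fun _ => 0) p.1 ⁻¹' O := by rw [mem_preimage, hq2]; exact hpO
  have hmaps₁ : MapsTo (foldMap (n := n) id p.1) ({z | 0 ≤ z 0} ∩ foldMap id p.1 ⁻¹' O)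
      (O ∩ quadrant n F) := fun z hz => ⟨hz.2, by simp [foldMap], hz.1⟩
  have hmaps₂ : MapsTo (foldMap (n := n) (fun _ => 0) p.1)
      ({z | z 0 ≤ 0} ∩ foldMap (fun _ => 0) p.1 ⁻¹' O) (O ∩ quadrant n F) := fun z hz =>
    ⟨hz.2, by simpa [foldMap] using hz.1, by simp [foldMap]⟩
  have e1 : ∀ i j, chr {z | 0 ≤ z 0} (fun z => G (foldMap id p.1 z)) 0 i j p.2 =
      foldChrAt (O ∩ quadrant n F) G 0 i j (p, 0, 0) 1 := fun i j => by
    rw [chr_congr (hset hU1 hm1) (EventuallyEq.refl _ _) rfl,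
      chr_comp_foldMap (f' := fun _ => 1) (uniqueDiffOn_nonneg.inter hU1)
        hasDerivAt_id hmaps₁ hG ⟨hp0.ge, hm1⟩, hq1]
  have e2 : ∀ i j, chr {z | z 0 ≤ 0} (fun z => G (foldMap (fun _ => 0) p.1 z)) 0 i j p.2 =
      foldChrAt (O ∩ quadrant n F) G 0 i j (p, 0, 0) 0 := fun i j => by
    rw [chr_congr (hset hU2 hm2) (EventuallyEq.refl _ _) rfl,
      chr_comp_foldMap (f' := fun _ => 0) (uniqueDiffOn_nonpos.inter hU2)
        (fun t => hasDerivAt_const t 0) hmaps₂ hG ⟨hp0.le, hm2⟩, hq2]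
  rw [← bil_jumpChr _ ha]; simp only [e1, e2, foldChrAt]
  simp only [bil, Matrix.of_apply, ← sum_sub_distrib]
  exact sum_congr rfl fun i _ => sum_congr rfl fun j _ => by ring

end Jump

section GluedForm

variable (φ)

/-- The form on the glued space which restricts to `h₁` and `h₂`. -/
structure GluedForm (h₁ : HForm π₁) (h₂ : HForm π₂)
    (h : FForm (gluedProj φ)) : Prop where
  compatible : IsCompatible φ
  metric₁ : IsFibreMetric h₁
  metric₂ : IsFibreMetric h₂
  pull₁ : ∀ x, IsPullbackAt ι₁ h₁ h x
  pull₂ : ∀ y, IsPullbackAt ι₂ h₂ h y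

variable {φ} {q : 𝔼 k × 𝔼 n}

lemma reflL_mk (y : 𝔼 k) (z : 𝔼 n) : 𝐫 (y, z) = (y, 𝐬 z) :=
  Prod.ext (reflL_fst _) (by simp [reflL_apply, refl₀_apply, e₀, smul_smul])

local notation "HC" => HalfCharts φ c c₁ c₂
local notation "GF" => GluedForm φ h₁ h₂ h

namespace HalfCharts

lemma coeff₁ (hc : HC) (hg : GF) (hq : q ∈ c.ext.target) (h0 : 0 ≤ q.2 0) : c.coeff h q =
  c₁.coeff h₁ q := by
  have hq1 := (hc.mem_target hq).1 h0; have hx := c₁.mem_source hq1; refine bil_ext fun a b => ?_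
  have := bil_coeff_eq c₁ c hx (hc.mem₁.1 hx) (hg.compatible.smooth₁ _)
    (.of_forall fun _ => rfl) (hg.pull₁ _) a b
  rw [hc.vderiv₁ hx, hc.vderiv₁ hx, ← hc.ext₁ _ hx, c₁.ext.right_inv hq1] at this; exact this.symm

lemma coeff₂ (hc : HC) (hg : GF) (hq : q ∈ c.ext.target) (h0 : q.2 0 ≤ 0) (a b : 𝔼 n) : bil
  (c₂.coeff h₂ (𝐫 q)) a b = bil (c.coeff h q) (𝐬 a) (𝐬 b) := by
  have hq2 := (hc.mem_target hq).2 h0; have hy := c₂.mem_source hq2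
  have := bil_coeff_eq c₂ c hy (hc.mem₂.1 hy) (hg.compatible.smooth₂ _)
    (.of_forall fun _ => rfl) (hg.pull₂ _) a b
  rwa [hc.vderiv₂ hy, hc.vderiv₂ hy, ← reflL_reflL (c.ext _), ← hc.ext₂ _ hy,
    c₂.ext.right_inv hq2, reflL_reflL] at this

lemma coeff₂' (hc : HC) (hg : GF) (hq : q ∈ c.ext.target) (h0 : q.2 0 ≤ 0) (a b : 𝔼 n) : bil
  (c.coeff h q) a b = bil (c₂.coeff h₂ (𝐫 q)) (𝐬 a) (𝐬 b) := by
  rw [hc.coeff₂ hg hq h0, refl₀_refl₀, refl₀_refl₀]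

lemma coeff_symm (hc : HC) (hg : GF) (hq : q ∈ c.ext.target) (i j : Fin n) : c.coeff h q i j =
  c.coeff h q j i := by
  obtain h0 | h0 := le_total 0 (q.2 0)
  · rw [hc.coeff₁ hg hq h0, FibreGluing.coeff_symm c₁ hg.metric₁]
  · rw [← bil_single (c.coeff h q), ← bil_single (c.coeff h q), hc.coeff₂' hg hq h0,
      hc.coeff₂' hg hq h0, bil_symm (FibreGluing.coeff_symm c₂ hg.metric₂ _)]

lemma coeff_pos (hc : HC) (hg : GF) (hq : q ∈ c.ext.target) {a : 𝔼 n} (ha : a ≠ 0) : 0 < bil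
  (c.coeff h q) a a := by
  obtain h0 | h0 := le_total 0 (q.2 0)
  · rw [hc.coeff₁ hg hq h0]; exact FibreGluing.coeff_pos c₁ hg.metric₁ ((hc.mem_target hq).1 h0) ha
  · rw [hc.coeff₂' hg hq h0]
    exact FibreGluing.coeff_pos c₂ hg.metric₂ ((hc.mem_target hq).2 h0)
      fun H => ha (refl₀_bijective.1 (H.trans (map_zero _).symm))

lemma contDiffOn_coeff₁ (hc : HC) (hg : GF) (i j : Fin n) : SmoothOn (fun p => c.coeff h p i j)
  (c.ext.target ∩ {p | 0 ≤ p.2 0}) :=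
  ((hg.metric₁.smooth c₁ i j).mono fun _ hp => (hc.mem_target hp.1).1 hp.2).congr
    fun p hp => by rw [hc.coeff₁ hg hp.1 hp.2]

lemma contDiffOn_coeff₂ (hc : HC) (hg : GF) (i j : Fin n) :
    SmoothOn (fun p => c.coeff h p i j) (c.ext.target ∩ {p | p.2 0 ≤ 0}) := fun p hp => by
  have e : ∀ p ∈ c.ext.target ∩ {p | p.2 0 ≤ 0}, c.coeff h p i j = bil (c₂.coeff h₂ (𝐫 p))
      (𝐬 (𝐞 i)) (𝐬 (𝐞 j)) := fun p hp => by
    rw [← bil_single (c.coeff h p), hc.coeff₂' hg hp.1 hp.2]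
  refine (contDiffWithinAt_bil (M := fun p => c₂.coeff h₂ (𝐫 p)) (fun i j => ?_)
    contDiffWithinAt_const contDiffWithinAt_const).congr e (e p hp)
  exact (hg.metric₂.smooth c₂ i j).comp (𝐫).contDiff.contDiffOn
    (fun p hp => (hc.mem_target hp.1).2 hp.2) p hp

lemma eventuallyEq_slice (hc : HC) (hg : GF) (hq : q ∈ c.ext.target) :
  (fun z => c.coeff h (q.1, z)) =ᶠ[𝓝[{z | 0 ≤ z 0}] q.2] fun z => c₁.coeff h₁ (q.1, z) := by
  have h1 : ∀ᶠ z in 𝓝 q.2, (q.1, z) ∈ c.ext.target :=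
    (Continuous.prodMk_right q.1).continuousAt.eventually (c.isOpen_target.mem_nhds hq)
  filter_upwards [h1.filter_mono nhdsWithin_le_nhds, self_mem_nhdsWithin] with z hz h0
  exact hc.coeff₁ hg hz h0

lemma ric₁ (hc : HC) (hg : GF) (hR : RicciPositive h₁) (hq : q ∈ c.ext.target) (h0 : 0 ≤ q.2 0)
  {a : 𝔼 n} (ha : a ≠ 0) : 0 < bil (ric {z | 0 ≤ z 0} (fun z => c.coeff h (q.1, z)) q.2) a a := by
  have hq1 := (hc.mem_target hq).1 h0; have hx := c₁.mem_source hq1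
  rw [ric_congr EventuallyEq.rfl (hc.eventuallyEq_slice hg hq) h0, ← range_half]
  obtain ⟨u, rfl⟩ := c₁.exists_coord hx a
  have := hR c₁ _ hx u fun hu => ha (by rw [hu]; exact map_zero (c₁.coordₗ _))
  rwa [ricci_eq_bil, c₁.ext.right_inv hq1] at this

lemma reflected (hc : HC) (hg : GF) (hq : q ∈ c.ext.target) (h0 : q.2 0 ≤ 0) (a b : 𝔼 n) : bil
  (ric {z | z 0 ≤ 0} (fun z => c.coeff h (q.1, z)) q.2) a b = bil
  (ric ℛ₀ (fun z => c₂.coeff h₂ (q.1, z)) (𝐬 q.2)) (𝐬 a) (𝐬 b) ∧ chrL {z | z 0 ≤ 0}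
  (fun z => c.coeff h (q.1, z)) q.2 a b = 𝐬 (chrL ℛ₀ (fun z => c₂.coeff h₂ (q.1, z)) (𝐬 q.2) (𝐬 a)
  (𝐬 b)) := by
  obtain ⟨U, hU, hsl⟩ := c₂.exists_open_slice q.1
  have hV : IsOpen {z : 𝔼 n | (q.1, 𝐬 z) ∈ c.ext.target} :=
    c.isOpen_target.preimage (continuous_const.prodMk (𝐬).continuous)
  have hmem : ∀ {z}, z ∈ ℛ₀ ∩ (U ∩ {z | (q.1, 𝐬 z) ∈ c.ext.target}) →
      (q.1, z) ∈ c₂.ext.target := fun {z} hz => by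
    have : z ∈ c₂.slice q.1 := by rw [hsl]; exact ⟨hz.1, hz.2.1⟩
    exact this
  have key := reflect_curvature (hU.inter hV) (G := fun z => c₂.coeff h₂ (q.1, z))
    (A := fun z => c.coeff h (q.1, z))
    (fun i j => (contDiffOn_coeff_slice c₂ hg.metric₂ q.1 i j).mono fun z hz => hmem hz)
    (fun z _ => FibreGluing.coeff_symm c₂ hg.metric₂ _)
    (fun z hz a ha => FibreGluing.coeff_pos c₂ hg.metric₂ (hmem hz) ha)
    (fun z hz a b => by
      have hz0 : (𝐬 z) 0 ≤ 0 := by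
        rw [refl₀_zero, neg_nonpos]; have := hz.1; rwa [range_half] at this
      rw [← hc.coeff₂ hg hz.2.2 hz0, reflL_mk, refl₀_refl₀]) (z := 𝐬 q.2) ?_ a b
  · rwa [refl₀_refl₀] at key
  · have h1 := (hc.mem_target hq).2 h0; rw [show q = (q.1, q.2) from rfl, reflL_mk] at h1
    have h2 : 𝐬 q.2 ∈ c₂.slice q.1 := h1; rw [hsl] at h2
    exact ⟨h2.1, h2.2, by rw [mem_ofPred_eq, refl₀_refl₀]; exact hq⟩

lemma ric₂ (hc : HC) (hg : GF) (hR : RicciPositive h₂) (hq : q ∈ c.ext.target) (h0 : q.2 0 ≤ 0)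
  {a : 𝔼 n} (ha : a ≠ 0) : 0 < bil (ric {z | z 0 ≤ 0} (fun z => c.coeff h (q.1, z)) q.2) a a := by
  have hq2 := (hc.mem_target hq).2 h0; have hy := c₂.mem_source hq2
  rw [(hc.reflected hg hq h0 a a).1]; obtain ⟨u, hu⟩ := c₂.exists_coord hy (𝐬 a)
  have := hR c₂ _ hy u fun h' => ha (refl₀_bijective.1 (by
    rw [← hu, h', map_zero]; exact map_zero (c₂.coordₗ _)))
  have e : 𝐫 q = (q.1, 𝐬 q.2) := reflL_mk q.1 q.2
  rw [ricci_eq_bil, c₂.ext.right_inv hq2, hu, e] at this; exact this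

lemma chr_lt_chr (hc : HC) (hg : GF) (hcurv : NormalCurvatureCondition φ h₁ h₂)
  (hq : q ∈ c.ext.target) (h0 : q.2 0 = 0) {a : 𝔼 n} (ha : a ≠ 0) (ha0 : a 0 = 0) : chrL
  {z | z 0 ≤ 0} (fun z => c.coeff h (q.1, z)) q.2 a a 0 < chrL {z | 0 ≤ z 0}
  (fun z => c.coeff h (q.1, z)) q.2 a a 0 := by
  have hq1 := (hc.mem_target hq).1 h0.ge
  obtain ⟨x, hx, ex⟩ : ∃ x : 𝔅 E1, (x : E1) ∈ 𝒮 c₁ ∧ c₁.ext x = q :=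
    ⟨⟨_, (c₁.ext_zero (c₁.mem_source hq1)).2 (by rw [c₁.ext.right_inv hq1, h0])⟩,
      c₁.mem_source hq1, c₁.ext.right_inv hq1⟩
  have hy := hc.bdry₁ hx; have ey : c₂.ext (φ.toEquiv x : E2) = q := (hc.ext_bdry hx).trans ex
  have hS : 𝐬 q.2 = q.2 := refl₀_of_tangential h0; have hSa : 𝐬 a = a := refl₀_of_tangential ha0
  have hs1 := FibreGluing.coeff_symm c₁ hg.metric₁ q
  have hs2 := FibreGluing.coeff_symm c₂ hg.metric₂ q
  have hq2 : q ∈ c₂.ext.target := by rw [← ey]; exact c₂.ext_mem hy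
  have hd1 := det_ne_zero c₁ hg.metric₁ hq1; have hd2 := det_ne_zero c₂ hg.metric₂ hq2
  have hgr : grad₀ (c₂.coeff h₂ q) 0 = grad₀ (c₁.coeff h₁ q) 0 := by
    rw [grad₀_transform hs1 hs2 hd1 hd2 (A := 𝐬) (fun a ha => by rw [refl₀_zero, ha, neg_zero])
      refl₀_bijective.2 fun u v => by
        rw [← hc.coeff₁ hg hq h0.ge, hc.coeff₂' hg hq h0.le, reflL_of_zero h0]]
    change (𝐬 (𝐞 0)) 0 * (𝐬 (grad₀ (c₁.coeff h₁ q))) 0 = _; rw [refl₀_zero, refl₀_zero]; simp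
  have hbp := FibreGluing.coeff_pos c₁ hg.metric₁ hq1 ha
  obtain ⟨r, hrp, hr⟩ : ∃ r, 0 < r ∧ bil (c₁.coeff h₁ q) a a = r ^ 2 :=
    ⟨_, Real.sqrt_pos.2 hbp, (Real.sq_sqrt hbp.le).symm⟩
  obtain ⟨u, hu⟩ := c₁.exists_coord hx (r⁻¹ • a); obtain ⟨u', hu'⟩ := c₂.exists_coord hy (r⁻¹ • a)
  have hra : (r⁻¹ • a) 0 = 0 := by change r⁻¹ * a 0 = 0; rw [ha0, mul_zero]
  have key := hcurv x u u' ((c₁.isBoundaryVector_iff hx x.2 u).2 (by rw [hu, hra])) (by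
    rw [c₁.form_eq_bil h₁ hx, hu, ex, bil_smul_left, bil_smul_right, hr]
    field_simp) (hc.isBdryPush_of_coord hx u u' (by rw [hu, hra]) (by rw [hu, hu'])) c₁ c₂ hx hy
  have e1 : chrL {z | 0 ≤ z 0} (fun z => c.coeff h (q.1, z)) q.2 =
      chrL ℛ₀ (fun z => c₁.coeff h₁ (q.1, z)) q.2 := by
    simp only [chrL, chr_congr (EventuallyEq.of_eq range_half.symm) (hc.eventuallyEq_slice hg hq)
      (hc.coeff₁ hg hq h0.ge)]
  have e2 := (hc.reflected hg hq h0.le a a).2; rw [hS, hSa] at e2; rw [e1, e2, refl₀_zero]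
  rw [FibredChart.normalCurvature, FibredChart.normalCurvature, ex, ey, hu, hu',
    boundaryForm_eq (𝓡∂ n) (G := fun z => c₁.coeff h₁ (q.1, z)) (z := q.2) hd1,
    boundaryForm_eq (𝓡∂ n) (G := fun z => c₂.coeff h₂ (q.1, z)) (z := q.2) hd2, ← neg_div] at key
  have hg0 : (c₂.coeff h₂ (q.1, q.2))⁻¹ 0 0 = (c₁.coeff h₁ (q.1, q.2))⁻¹ 0 0 := hgr
  have hgp : 0 < (c₁.coeff h₁ (q.1, q.2))⁻¹ 0 0 :=
    grad₀_zero_pos hs1 fun _ => FibreGluing.coeff_pos c₁ hg.metric₁ hq1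
  rw [hg0, div_lt_div_iff_of_pos_right (Real.sqrt_pos.2 hgp)] at key
  simp only [map_smul, smul_apply, PiLp.smul_apply, smul_eq_mul, ← mul_neg] at key
  exact lt_of_mul_lt_mul_left (lt_of_mul_lt_mul_left key (inv_pos.2 hrp).le) (inv_pos.2 hrp).le

end HalfCharts

end GluedForm

/-- Near `w`, the form is smooth, and at `w` it is a metric of positive Ricci curvature. -/
def IsGoodAt (g : FForm ϖ) (w : X) : Prop := (∀ u v, g w u v = g w v u) ∧ ∃ c : FChart ϖ, w ∈ 𝒮 c ∧
    (∀ i j, ContDiffAt ℝ ∞ (fun p => c.coeff g p i j) (c.ext w)) ∧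
    ∀ a, a ≠ 0 → 0 < bil (c.coeff g (c.ext w)) a a ∧
      0 < bil (ric univ (fun z => c.coeff g ((c.ext w).1, z)) (c.ext w).2) a a

lemma isFibreMetric_and_ricciPositive {g : FForm ϖ} (hg : ∀ w, IsGoodAt g w) : IsFibreMetric g ∧
  RicciPositive g := by
  have hne : ∀ (c : FChart ϖ) {w} (_ : w ∈ 𝒮 c) {u : Vert k (𝓡 n) ϖ w},
      u ≠ 0 → c.coord w u ≠ 0 := fun c w hw u hu h => hu <| (c.coordEquiv hw).injective <| by
    rw [map_zero]; exact h
  have h1 : IsFibreMetric g := by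
    refine isFibreMetric_of_local (fun w => (hg w).1) (fun w u hu => ?_) fun w => ?_
    · obtain ⟨-, c, hw, -, h⟩ := hg w; rw [c.form_eq_bil g hw]; exact (h _ (hne c hw hu)).1
    · obtain ⟨-, c, hw, h, -⟩ := hg w; exact ⟨c, hw, fun i j => (h i j).contDiffWithinAt⟩
  refine ⟨h1, ricciPositive_of_local h1 fun w => ?_⟩
  obtain ⟨-, c, hw, -, h⟩ := hg w; refine ⟨c, hw, fun u hu => ?_⟩
  rw [ricci_eq_bil, ModelWithCorners.range_eq_univ]; exact (h _ (hne c hw hu)).2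

lemma IsGoodAt.congr {g g' : FForm ϖ} {w : X} (hg : IsGoodAt g w) (h : ∀ᶠ w' in 𝓝 w, g w' = g' w') :
  IsGoodAt g' w := by
  obtain ⟨hs, c, hw, hd, hp⟩ := hg; have hc := c.coeff_congr hw h
  have hsl : (fun z => c.coeff g ((c.ext w).1, z)) =ᶠ[𝓝 (c.ext w).2]
      fun z => c.coeff g' ((c.ext w).1, z) :=
    (Continuous.prodMk_right (c.ext w).1).continuousAt.eventually hc
  rw [h.self_of_nhds] at hs
  refine ⟨hs, c, hw, fun i j => (hd i j).congr_of_eventuallyEq (hc.mono fun p hp =>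
    (congrFun (congrFun hp i) j).symm), ?_⟩
  rwa [hc.self_of_nhds, ric_congr EventuallyEq.rfl (hsl.filter_mono nhdsWithin_le_nhds)
    (mem_univ _)] at hp

lemma FibredChart.exists_translate (c : FChart ϖ) {w : X} (hw : w ∈ 𝒮 c) {C : Set X}
  (hC : IsClosed C) (hwC : w ∉ C) {σ : ℝ} (hσ : 0 < σ * σ) : ∃ c' : FChart ϖ, w ∈ 𝒮 c' ∧
  ∀ w' ∈ 𝒮 c', w' ∉ C ∧ 0 < σ * (c'.ext w').2 0 := by
  let v : 𝕍 := (σ - (c.ext w).2 0) • 𝐮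
  have hv : ∀ p : 𝕍, (p + v).1 = p.1 ∧ (p + v).2 0 = p.2 0 + (σ - (c.ext w).2 0) :=
    fun p => ⟨by simp [v, e₀], by simp [v, e₀]⟩
  let S : Set 𝕍 := {p | 0 < σ * (p + v).2 0}
  have hS : IsOpen S := isOpen_lt continuous_const
    (continuous_const.mul ((𝐡).continuous.comp (continuous_add_const v)))
  have hwS : c.ext w ∈ S := by change 0 < σ * (c.ext w + v).2 0; rwa [(hv _).2, add_sub_cancel]
  obtain ⟨d, hwd, -, -, hds, hde⟩ := c.exists_rechart
    ((Homeomorph.addRight v).toOpenPartialHomeomorph.restrOpen S hS)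
    (contDiff_id.add contDiff_const).contDiffOn (contDiff_id.add contDiff_const).contDiffOn
    c.base_mem hw ⟨trivial, hwS⟩ (c.proj_mem w hw) fun w' hw' _ _ => by
      change (c.ext w' + v).1 = _; rw [(hv _).1]; exact c.fst_eq w' hw'
  refine ⟨d.restrict hC.isOpen_compl, ?_, fun w' hw' => ?_⟩
  · rw [d.restrict_source]; exact ⟨hwd, hwC⟩
  · rw [d.restrict_source] at hw'; refine ⟨hw'.2, ?_⟩; change 0 < σ * (d.ext w').2 0
    rw [hde w' hw'.1]; exact ((hds w').1 hw'.1).2.2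

lemma exists_sided_chart_off_seam (hW : IsCompatible φ) {w : Glued φ} (hw : w ∉ seam φ) : ∃ c :
  FChart (gluedProj φ), w ∈ 𝒮 c ∧ c.IsSided (range ι₁) (range ι₂) ∧ (c.ext w).2 0 ≠ 0 := by
  have hcl₁ := (closed_incl₁ φ).isClosed_range; have hcl₂ := (closed_incl₂ φ).isClosed_range
  have hU : ∀ w, w ∈ range ι₁ ∨ w ∈ range ι₂ := fun w =>
    (glued_cases φ w).imp (fun ⟨x, hx⟩ => ⟨x, hx.symm⟩) fun ⟨x, hx⟩ => ⟨x, hx.symm⟩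
  obtain ⟨c, hwc⟩ := hW.fibred w; rw [seam_eq_inter] at hw
  by_cases h2 : w ∈ range ι₂
  · obtain ⟨c', hw', H⟩ := c.exists_translate hwc hcl₁ (fun h1 => hw ⟨h1, h2⟩) (σ := -1) (by norm_num)
    refine ⟨c', hw', ⟨fun x hx => ?_, fun x hx => ?_⟩, fun h0 => ?_⟩
    · exact iff_of_false (H x hx).1 (by linarith [(H x hx).2])
    · exact iff_of_true ((hU x).resolve_left (H x hx).1) (by linarith [(H x hx).2])
    · linarith [(H w hw').2]
  · obtain ⟨c', hw', H⟩ := c.exists_translate hwc hcl₂ h2 (σ := 1) (by norm_num)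
    refine ⟨c', hw', ⟨fun x hx => ?_, fun x hx => ?_⟩, fun h0 => ?_⟩
    · exact iff_of_true ((hU x).resolve_right (H x hx).1) (by linarith [(H x hx).2])
    · exact iff_of_false (H x hx).1 (by linarith [(H x hx).2])
    · linarith [(H w hw').2]

lemma GluedForm.symm [Nonempty E1] [Nonempty E2] (hg : GluedForm φ h₁ h₂ h)
  (hc : c.IsSided (range ι₁) (range ι₂)) {w : Glued φ} (hw : w ∈ 𝒮 c)
  (u v : Vert k (𝓡 n) (gluedProj φ) w) : h w u v = h w v u := by
  obtain ⟨c₁, c₂, hcc⟩ := exists_halfCharts hg.compatible hc hw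
  rw [c.form_eq_bil h hw, c.form_eq_bil h hw, bil_symm (hcc.coeff_symm hg (c.ext_mem hw))]

lemma GluedForm.isGoodAt [Nonempty E1] [Nonempty E2] (hg : GluedForm φ h₁ h₂ h)
  (hR1 : RicciPositive h₁) (hR2 : RicciPositive h₂) {w : Glued φ} (hw : w ∉ seam φ) :
  IsGoodAt h w := by
  obtain ⟨c, hwc, hc, h0⟩ := exists_sided_chart_off_seam hg.compatible hw
  obtain ⟨c₁, c₂, hcc⟩ := exists_halfCharts hg.compatible hc hwc; have hq := c.ext_mem hwc
  have hT := c.isOpen_target.mem_nhds hq; have hcon := (𝐡).continuous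
  refine ⟨hg.symm hc hwc, c, hwc, fun i j => ?_, fun a ha => ⟨hcc.coeff_pos hg hq ha, ?_⟩⟩
  · obtain h0 | h0 := lt_or_gt_of_ne h0
    · exact (hcc.contDiffOn_coeff₂ hg i j).contDiffAt (inter_mem hT
        ((hcon.continuousAt.eventually (gt_mem_nhds h0)).mono fun p hp => hp.le))
    · exact (hcc.contDiffOn_coeff₁ hg i j).contDiffAt (inter_mem hT
        ((hcon.continuousAt.eventually (lt_mem_nhds h0)).mono fun p hp => hp.le))
  · have hs : ∀ {s : Set (𝔼 n)}, s ∈ 𝓝 (c.ext w).2 → (univ : Set (𝔼 n)) =ᶠ[𝓝 (c.ext w).2] s :=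
      fun h => (eventuallyEq_univ.2 h).symm
    obtain h0 | h0 := lt_or_gt_of_ne h0
    · rw [ric_congr (hs ((continuous_coord_zero.continuousAt.eventually (gt_mem_nhds h0)).mono
        fun p hp => le_of_lt hp)) EventuallyEq.rfl trivial]
      exact hcc.ric₂ hg hR2 hq h0.le ha
    · rw [ric_congr (hs ((continuous_coord_zero.continuousAt.eventually (lt_mem_nhds h0)).mono
        fun p hp => le_of_lt hp)) EventuallyEq.rfl trivial]
      exact hcc.ric₁ hg hR1 hq h0.le ha

/-- The smoothed form, in terms of the family `𝒢` extending both parts of a form. -/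
def foldForm (T : X → ℝ) (𝒢 : ℝ × ℝ → FForm ϖ) (ε : ℝ) : FForm ϖ :=
  fun w => 𝒢 (T w - rampε ε (T w), rampε ε (T w)) w

lemma coeff_foldForm {T : X → ℝ} (𝒢 : ℝ × ℝ → FForm ϖ) (ε : ℝ) {c : FChart ϖ}
  (hcT : ∀ w ∈ 𝒮 c, (c.ext w).2 0 = T w) {p : 𝕍} (hp : p ∈ c.ext.target) : c.coeff
  (foldForm T 𝒢 ε) p = c.coeff (𝒢 (foldMap (rampε ε) p.1 p.2).2) (foldMap (rampε ε) p.1 p.2).1 := by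
  have e : T (c.ext.symm p) = p.2 0 := by rw [← hcT _ (c.mem_source hp), c.ext.right_inv hp]
  funext i j
  change 𝒢 (T (c.ext.symm p) - rampε ε (T (c.ext.symm p)), rampε ε (T (c.ext.symm p))) _ _ _ = _
  rw [e]; rfl

lemma FibredChart.coeff_eq_coeff (c : FChart ϖ) {h h' : FForm ϖ} {p : 𝕍}
  (H : h (c.ext.symm p) = h' (c.ext.symm p)) : c.coeff h p = c.coeff h' p := by
  funext i j; change h _ _ _ = h' _ _ _; rw [H]

lemma eventually_bil_pos {X : Type*} [TopologicalSpace X] {s : Set X} {M : X → 𝕄 n}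
  (hM : ∀ i j, ContinuousOn (fun x => M x i j) s) {x : X} (hx : x ∈ s)
  (hp : ∀ a : 𝔼 n, a ≠ 0 → 0 < bil (M x) a a) : ∀ᶠ y in 𝓝[s] x, ∀ a : 𝔼 n, a ≠ 0 → 0 < bil
  (M y) a a := by
  have h1 : ∀ v ∈ Metric.sphere (0 : 𝔼 n) 1, ∀ᶠ z : X × 𝔼 n in 𝓝[s] x ×ˢ 𝓝 v,
      0 < bil (M z.1) z.2 z.2 := fun v hv => by
    have hc : ContinuousOn (fun z : X × 𝔼 n => bil (M z.1) z.2 z.2) (s ×ˢ univ) :=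
      continuousOn_bil (fun i j => (hM i j).comp continuousOn_fst fun z hz => hz.1) continuousOn_snd
    have := (hc (x, v) ⟨hx, trivial⟩).eventually (lt_mem_nhds (hp v (ne_of_mem_of_not_mem hv
      (by simp))))
    rwa [nhdsWithin_prod_eq, nhdsWithin_univ] at this
  have h2 := (isCompact_sphere (0 : 𝔼 n) 1).prod_nhdsSet_eq_biSup (𝓝[s] x)
  have h3 : ∀ᶠ z : X × 𝔼 n in 𝓝[s] x ×ˢ 𝓝ˢ (Metric.sphere (0 : 𝔼 n) 1), 0 < bil (M z.1) z.2 z.2 := by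
    rw [h2]; simpa only [eventually_iSup] using h1
  filter_upwards [h3.curry] with y hy a ha
  exact bil_pos_of_sphere (fun v hv => (hy.self_of_nhdsSet v hv)) ha

lemma eventually_fold_smooth_pos {G : 𝔽 → 𝕄 n} {O : Set 𝔽} (hO : IsOpen O)
  (hG : SmoothMat G (O ∩ quadrant n F)) (hpos : ∀ q ∈ O ∩ quadrant n F, ∀ a, a ≠ 0 → 0 <
  bil (G q) a a) {p : F × 𝔼 n} (hp0 : p.2 0 = 0) (hpO : (p, 0, 0) ∈ O) : ∀ᶠ x : (F × 𝔼 n) × ℝ in 𝓝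
  (p, 0), 0 < x.2 → (∀ i j, ContDiffAt ℝ ∞ (fun p => G (foldMap (rampε x.2) p.1 p.2) i j) x.1) ∧
  ∀ a, a ≠ 0 → 0 < bil (G (foldMap (rampε x.2) x.1.1 x.1.2)) a a := by
  have h := (tendsto_foldMap_rampε hp0).eventually (hO.mem_nhds hpO)
  rw [eventually_nhdsWithin_iff] at h; filter_upwards [h] with x hx hx2
  have hq : ∀ p : F × 𝔼 n, foldMap (rampε x.2) p.1 p.2 ∈ quadrant n F := fun p =>
    ⟨sub_nonpos.2 (le_rampε hx2 _), rampε_nonneg (le_of_lt hx2) _⟩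
  have h0 : ContDiff ℝ ∞ fun p : F × 𝔼 n => p.2 0 := (proj₀).contDiff.comp contDiff_snd
  have hm : ContDiff ℝ ∞ fun p : F × 𝔼 n => foldMap (rampε x.2) p.1 p.2 :=
    contDiff_id.prodMk ((h0.sub ((contDiff_rampε x.2).comp h0)).prodMk ((contDiff_rampε x.2).comp h0))
  have hU : IsOpen ((fun p : F × 𝔼 n => foldMap (rampε x.2) p.1 p.2) ⁻¹' O) :=
    hO.preimage hm.continuous
  exact ⟨fun i j => ((hG i j).comp hm.contDiffOn fun p hp => ⟨hp, hq p⟩).contDiffAt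
    (hU.mem_nhds (hx hx2)), hpos _ ⟨hx hx2, hq _⟩⟩

lemma ric_eq_zero_of_subsingleton (hn : ∀ i : Fin n, i = 0) (s : Set (𝔼 n)) (G : 𝔼 n → 𝕄 n)
  (z : 𝔼 n) : ric s G z = 0 := by
  funext i j; refine Finset.sum_eq_zero fun l _ => ?_
  rw [hn i, hn l, sub_self, zero_add]; exact Finset.sum_eq_zero fun m _ => by rw [hn m, sub_self]

section Smoothing

variable [Nonempty E1] [Nonempty E2] {T : Glued φ → ℝ}

lemma SeamFunction.zero_iff (hT : SeamFunction φ T) (w : Glued φ) : T w = 0 ↔ w ∈ seam φ := by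
  rw [seam_eq_inter, mem_inter_iff, ← hT.nonneg_iff, ← hT.nonpos_iff, and_comm]
  exact le_antisymm_iff

lemma SeamFunction.isSided (hT : SeamFunction φ T) (hc : ∀ w ∈ 𝒮 c, (c.ext w).2 0 = T w) : c.IsSided
  (range ι₁) (range ι₂) :=
  ⟨fun w hw => by rw [hc w hw, hT.nonneg_iff], fun w hw => by rw [hc w hw, hT.nonpos_iff]⟩

lemma eventually_isGoodAt (hg : GluedForm φ h₁ h₂ h) (hR1 : RicciPositive h₁)
  (hR2 : RicciPositive h₂) (hcurv : NormalCurvatureCondition φ h₁ h₂) (hT : SeamFunction φ T)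
  {𝒢 : ℝ × ℝ → FForm (gluedProj φ)} (h𝒢 : ∀ s w u v, 𝒢 s w u v = 𝒢 s w v u) {w : Glued φ}
  (hw : w ∈ seam φ) (H : IsFoldAt T h 𝒢 w) : ∀ᶠ x : Glued φ × ℝ in 𝓝 (w, 0), 0 < x.2 → IsGoodAt
  (foldForm T 𝒢 x.2) x.1 := by
  obtain ⟨c, hwc, hcT⟩ := hT.chart w hw
  obtain ⟨c₁, c₂, hc⟩ := exists_halfCharts hg.compatible (hT.isSided hcT) hwc
  obtain ⟨O1, hO1, hwO₁, hG1⟩ := H.smooth c hwc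
  obtain ⟨D, hD, hwD, hagree⟩ := c.exists_open hwc H.agree
  have hagree' : ∀ p ∈ D, p ∈ c.ext.target ∧ (0 ≤ p.2 0 → c.coeff (𝒢 (0, p.2 0)) p = c.coeff h p) ∧
      (p.2 0 ≤ 0 → c.coeff (𝒢 (p.2 0, 0)) p = c.coeff h p) := fun p hp => by
    obtain ⟨hpt, h1, h2⟩ := hagree p ⟨hp, by rw [range_full_prod]; trivial⟩
    have e : T (c.ext.symm p) = p.2 0 := by rw [← hcT _ (c.mem_source hpt), c.ext.right_inv hpt]
    rw [e] at h1 h2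
    exact ⟨hpt, fun h0 => c.coeff_eq_coeff (h1 h0), fun h0 => c.coeff_eq_coeff (h2 h0)⟩
  set p := c.ext w with hp
  have hp0 : p.2 0 = 0 := by rw [hp, hcT w hwc, (hT.zero_iff w).2 hw]
  have hpt : p ∈ c.ext.target := c.ext_mem hwc
  set G : 𝕍 × ℝ × ℝ → 𝕄 n := fun q => c.coeff (𝒢 q.2) q.1 with hGdef
  have hGp : G (p, 0, 0) = c.coeff h p := by have := (hagree' p hwD).2.1 hp0.ge; rwa [hp0] at this
  obtain ⟨O, hO, hpO, hOO₁, hGpos⟩ : ∃ O : Set (𝕍 × ℝ × ℝ), IsOpen O ∧ (p, 0, 0) ∈ O ∧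
      O ⊆ O1 ∧ ∀ q ∈ O ∩ quadrant n (𝔼 k), ∀ a, a ≠ 0 → 0 < bil (G q) a a := by
    have h1 := eventually_bil_pos (M := G) (fun i j => (hG1 i j).continuousOn) (x := (p, 0, 0))
      ⟨hwO₁, le_rfl, le_rfl⟩ fun a ha => by rw [hGp]; exact hc.coeff_pos hg hpt ha
    rw [eventually_nhdsWithin_iff, eventually_nhds_iff] at h1; obtain ⟨O', hO', hOo, hp'⟩ := h1
    exact ⟨O1 ∩ O', hO1.inter hOo, ⟨hwO₁, hp'⟩, inter_subset_left,
      fun q hq => hO' q hq.1.2 ⟨hq.1.1, hq.2⟩⟩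
  have hG : ∀ i j, SmoothOn (fun q => G q i j) (O ∩ quadrant n (𝔼 k)) := fun i j =>
    (hG1 i j).mono fun q hq => ⟨hOO₁ hq.1, hq.2⟩
  have hDs : ∀ᶠ z in 𝓝 p.2, (p.1, z) ∈ D :=
    (Continuous.prodMk_right p.1).continuousAt.eventually (hD.mem_nhds hwD)
  have hs1 : (fun z => G (foldMap id p.1 z)) =ᶠ[𝓝[{z | 0 ≤ z 0}] p.2] fun z => c.coeff h (p.1, z) := by
    filter_upwards [hDs.filter_mono nhdsWithin_le_nhds, self_mem_nhdsWithin] with z hz h0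
    have := (hagree' _ hz).2.1 h0; simpa [hGdef, foldMap] using this
  have hs2 : (fun z => G (foldMap (fun _ => 0) p.1 z)) =ᶠ[𝓝[{z | z 0 ≤ 0}] p.2]
      fun z => c.coeff h (p.1, z) := by
    filter_upwards [hDs.filter_mono nhdsWithin_le_nhds, self_mem_nhdsWithin] with z hz h0
    have := (hagree' _ hz).2.2 h0; simpa [hGdef, foldMap] using this
  have hn : ∃ i : Fin n, i ≠ 0 := by
    by_contra! hn; have := hc.ric₁ hg hR1 hpt hp0.ge (a := 𝐞 0) (by simp)
    rw [ric_eq_zero_of_subsingleton hn] at this; simp [bil] at this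
  have hJ : ∀ a : 𝔼 n, a ≠ 0 → a 0 = 0 →
      bil (jump (O ∩ quadrant n (𝔼 k)) G (p, 0, 0)) a a < 0 := fun a ha ha0 => by
    have h1 := bil_chr_sub hO hG hp0 hpO ha0; have h2 := hc.chr_lt_chr hg hcurv hpt hp0 ha ha0
    rw [chrL_apply, chrL_apply] at h2
    have h3 : 0 < (G (p, 0, 0))⁻¹ 0 0 := inv_zero_zero_pos (posDef_of_bil (fun i j => h𝒢 _ _ _ _)
      (hGpos _ ⟨hpO, le_rfl, le_rfl⟩))
    simp only [chr_congr EventuallyEq.rfl hs1 (hs1.eq_of_nhdsWithin hp0.ge),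
      chr_congr EventuallyEq.rfl hs2 (hs2.eq_of_nhdsWithin hp0.le)] at h1
    by_contra! h4; have h5 := mul_nonneg h3.le h4; linarith
  have key := eventually_ric_fold_pos hO hG (fun q i j => h𝒢 _ _ _ _) hGpos hp0 hpO hn hJ
    (fun a ha => by rw [ric_congr EventuallyEq.rfl hs1 hp0.ge]; exact hc.ric₁ hg hR1 hpt hp0.ge ha)
    (fun a ha => by rw [ric_congr EventuallyEq.rfl hs2 hp0.le]; exact hc.ric₂ hg hR2 hpt hp0.le ha)
  have hcont : Tendsto (fun x : Glued φ × ℝ => (c.ext x.1, x.2)) (𝓝 (w, 0)) (𝓝 (p, 0)) := by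
    have h1 : ContinuousAt c.ext w := c.total.continuousAt_extend hwc
    exact (h1.comp continuousAt_fst).prodMk_nhds continuousAt_snd
  filter_upwards [hcont.eventually key,
    hcont.eventually (eventually_fold_smooth_pos hO hG hGpos hp0 hpO),
    continuous_fst.continuousAt.eventually (c.total.open_source.mem_nhds hwc)] with x hx1 hx2 hx hx0
  obtain ⟨h1, h2⟩ := hx2 hx0; have hxt := c.ext_mem hx
  have hev : ∀ᶠ q in 𝓝 (c.ext x.1), G (foldMap (rampε x.2) q.1 q.2) = c.coeff (foldForm T 𝒢 x.2) q :=
    (c.isOpen_target.eventually_mem hxt).mono fun q hq => (coeff_foldForm 𝒢 x.2 hcT hq).symm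
  have hsl : (fun z => G (foldMap (rampε x.2) (c.ext x.1).1 z)) =ᶠ[𝓝 (c.ext x.1).2]
      fun z => c.coeff (foldForm T 𝒢 x.2) ((c.ext x.1).1, z) :=
    (Continuous.prodMk_right (c.ext x.1).1).continuousAt.eventually hev
  refine ⟨fun u v => h𝒢 _ _ _ _, c, hx, fun i j => (h1 i j).congr_of_eventuallyEq
    (hev.mono fun q hq => (congrFun (congrFun hq i) j).symm), fun a ha => ⟨?_, ?_⟩⟩
  · rw [← hev.self_of_nhds]; exact h2 a ha
  · rw [← ric_congr EventuallyEq.rfl (hsl.filter_mono nhdsWithin_le_nhds) (mem_univ _)]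
    exact hx1 hx0 a ha

lemma GluedForm.isSymm (hg : GluedForm φ h₁ h₂ h) (hT : SeamFunction φ T) (w : Glued φ)
  (u v : Vert k (𝓡 n) (gluedProj φ) w) : h w u v = h w v u := by
  by_cases hw : w ∈ seam φ
  · obtain ⟨c, hwc, hcT⟩ := hT.chart w hw; exact hg.symm (hT.isSided hcT) hwc u v
  · obtain ⟨c, hwc, hc, -⟩ := exists_sided_chart_off_seam hg.compatible hw; exact hg.symm hc hwc u v

open Classical in
/-- The glued metric can be smoothed near the seam. -/
lemma exists_smoothing (hg : GluedForm φ h₁ h₂ h) (hR1 : RicciPositive h₁) (hR2 : RicciPositive h₂)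
  (hcurv : NormalCurvatureCondition φ h₁ h₂) (hT : SeamFunction φ T) {N : Set (Glued φ)}
  (hN : IsOpen N) (hNs : seam φ ⊆ N) : ∃ g, IsFibreMetric g ∧ RicciPositive g ∧ ∀ w ∉ N, g w =
  h w := by
  have := t2Space_glued φ; have := compactSpace_glued φ; have hS := isCompact_seam φ
  obtain ⟨𝒢, h𝒢, hfold⟩ := exists_fold (T := T) (h := h) hS fun w hw => by
    obtain ⟨c, hwc, hcT⟩ := hT.chart w hw
    obtain ⟨c₁, c₂, hc⟩ := exists_halfCharts hg.compatible (hT.isSided hcT) hwc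
    obtain ⟨𝒢, h1, h2⟩ := exists_isFoldAt_of_chart c hcT (hc.contDiffOn_coeff₁ hg)
      (hc.contDiffOn_coeff₂ hg) fun p i j => hg.isSymm hT _ _ _
    exact ⟨c, 𝒢, hwc, h1, fun w hw hwS => h2 w hw ((hT.zero_iff w).2 hwS)⟩
  have h1 : ∀ᶠ x : Glued φ × ℝ in 𝓝ˢ (seam φ) ×ˢ 𝓝 0, 0 < x.2 → IsGoodAt (foldForm T 𝒢 x.2) x.1 := by
    rw [hS.nhdsSet_prod_eq_biSup]; simp only [eventually_iSup, ← nhds_prod_eq]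
    exact fun w hw => eventually_isGoodAt hg hR1 hR2 hcurv hT h𝒢 hw (hfold w hw)
  obtain ⟨pa, hpa, pb, hpb, hab⟩ := eventually_prod_iff.1 h1
  have h2 : ∀ᶠ w in 𝓝ˢ (seam φ), (0 ≤ T w → 𝒢 (0, T w) w = h w) ∧ (T w ≤ 0 → 𝒢 (T w, 0) w = h w) :=
    eventually_nhdsSet_iff_forall.2 fun w hw => (hfold w hw).agree
  obtain ⟨U, hU, hSU, hUp⟩ := mem_nhdsSet_iff_exists.1 (hpa.and (h2.and (hN.mem_nhdsSet.2 hNs)))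
  obtain ⟨δ, hδ, hUδ⟩ : ∃ δ > 0, ∀ w ∉ U, δ ≤ |T w| := by
    obtain hemp | hne := (Uᶜ : Set (Glued φ)).eq_empty_or_nonempty
    · exact ⟨1, one_pos, fun w hw => absurd hw (by rw [← mem_compl_iff, hemp]; exact notMem_empty w)⟩
    · obtain ⟨w0, hw0, hmin⟩ := hU.isClosed_compl.isCompact.exists_isMinOn hne
        hT.smooth.continuous.abs.continuousOn
      exact ⟨|T w0|, abs_pos.2 fun h0 => hw0 (hSU ((hT.zero_iff _).1 h0)), fun w hw => hmin hw⟩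
  obtain ⟨ε, ⟨hεb, hεδ⟩, hε⟩ : ∃ ε, (pb ε ∧ ε < δ) ∧ 0 < ε :=
    (((hpb.and (gt_mem_nhds hδ)).filter_mono nhdsWithin_le_nhds).and
      (self_mem_nhdsWithin (s := Ioi (0 : ℝ)))).exists
  have hfar : ∀ w ∈ U, ε ≤ |T w| → foldForm T 𝒢 ε w = h w := fun w hw hwT => by
    have := (hUp hw).2.1; obtain h0 | h0 := le_abs.1 hwT
    · rw [foldForm, rampε_of_ge hε h0, sub_self]; exact this.1 (hε.le.trans h0)
    · rw [foldForm, rampε_of_le hε (by linarith), sub_zero]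
      exact this.2 (by linarith)
  let g : FForm (gluedProj φ) := fun w => if w ∈ U then foldForm T 𝒢 ε w else h w
  have hgN : ∀ w ∉ N, g w = h w := fun w hw => if_neg fun hwU => hw (hUp hwU).2.2
  have hgood : ∀ w, IsGoodAt g w := fun w => by
    by_cases hw : w ∈ U
    · exact (hab (hUp hw).1 hεb hε).congr ((hU.eventually_mem hw).mono fun w' hw' => (if_pos hw').symm)
    · refine (hg.isGoodAt hR1 hR2 fun hwS => hw (hSU hwS)).congr ?_
      have hlt : ε < |T w| := hεδ.trans_le (hUδ w hw)
      filter_upwards [hT.smooth.continuous.abs.continuousAt.eventually (lt_mem_nhds hlt)] with w' hw'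
      by_cases hwU : w' ∈ U
      · exact ((if_pos hwU).trans (hfar w' hwU (le_of_lt hw'))).symm
      · exact (if_neg hwU).symm
  obtain ⟨h3, h4⟩ := isFibreMetric_and_ricciPositive hgood; exact ⟨g, h3, h4, hgN⟩

end Smoothing

lemma IsSmoothFibreBundle.surjective {P H M : Type*} [TopologicalSpace P] [TopologicalSpace H]
    [ChartedSpace (ModelProd (𝔼 k) H) P] {J : ModelWithCorners ℝ (𝔼 n) H} {π : P → B}
    [TopologicalSpace M] [ChartedSpace H M] [Nonempty M] (hπ : IsSmoothFibreBundle k J π M) :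
    Function.Surjective π := fun b => by
  obtain ⟨e, hb, -⟩ := hπ.locally_trivial b; obtain ⟨m⟩ := ‹Nonempty M›
  exact ⟨_, e.proj_symm_apply' (x := m) hb⟩

/-- Two metrics of positive Ricci curvature can be glued. -/
lemma exists_glued_metric [Nonempty E1] [Nonempty E2] (hW : IsCompatible φ) (hc1 : HasCharts k n π₁)
  (hc2 : HasCharts k n π₂) (hh1 : IsFibreMetric h₁) (hR1 : RicciPositive h₁)
  (hh2 : IsFibreMetric h₂) (hR2 : RicciPositive h₂) (hφ : IsFibrewiseIsometry φ h₁ h₂)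
  (hcurv : NormalCurvatureCondition φ h₁ h₂) {N : Set (Glued φ)} (hN : IsOpen N)
  (hNs : seam φ ⊆ N) : ∃ g, IsFibreMetric g ∧ RicciPositive g ∧ AgreesOutside φ g h₁ h₂ N := by
  obtain ⟨h', hh', hm⟩ := exists_matched hW hc1 hc2 hh1 hN hNs ⟨hh2, hR2, hφ, hcurv, fun _ _ => rfl⟩
  obtain ⟨h, hp1, hp2⟩ := exists_glued_form hW hm
  obtain ⟨T, hT⟩ := exists_isSeamFunction φ hW hc1 hc2
  obtain ⟨g, hg, hgR, hgN⟩ := exists_smoothing ⟨hW, hh1, hh'.metric, hp1, hp2⟩ hR1 hh'.ricci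
    hh'.curvature hT hN hNs
  refine ⟨g, hg, hgR, fun x hx u v u' v' hu hv => ?_, fun y hy u v u' v' hu hv => ?_⟩
  · rw [hgN _ hx]; exact (hp1 x u v u' v' hu hv).symm
  · rw [hgN _ hy, ← hh'.off y hy]; exact (hp2 y u v u' v' hu hv).symm

end Compatible

/-- The retraction onto the half-space `{z₀ ≥ 0}`. -/
def clamp (p : 𝕍) : 𝕍 := p + max (-p.2 0) 0 • 𝐮

lemma clamp_height (p : 𝕍) : (clamp p).2 0 = max 0 (p.2 0) := by
  have : (clamp p).2 0 = p.2 0 + max (-p.2 0) 0 := by simp [clamp, e₀]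
  rw [this, ← max_add_add_left, add_neg_cancel, add_zero]

lemma clamp_eq_self {p : 𝕍} (hp : 0 ≤ p.2 0) : clamp p = p := by
  rw [clamp, max_eq_right (neg_nonpos.2 hp), zero_smul, add_zero]

lemma norm_clamp_sub_le (p q : 𝕍) : ‖clamp p - clamp q‖ ≤ 2 * ‖p - q‖ := by
  have e : clamp p - clamp q = (p - q) + (max (-p.2 0) 0 - max (-q.2 0) 0) • 𝐮 := by
    simp only [clamp]; module
  have h1 : |max (-p.2 0) 0 - max (-q.2 0) 0| ≤ ‖p - q‖ := by
    refine (abs_max_sub_max_le_abs _ _ _).trans ?_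
    rw [show -p.2 0 - -q.2 0 = -((p - q).2 0) from (by simp; ring), abs_neg, ← Real.norm_eq_abs]
    exact (PiLp.norm_apply_le _ _).trans (norm_snd_le _)
  rw [e]; refine (norm_add_le _ _).trans ?_; rw [norm_smul, norm_e₀, mul_one, Real.norm_eq_abs]
  linarith

lemma exists_half_inverse {f : 𝕍 → 𝕍} {a : 𝕍} {O : Set 𝕍} (hO : IsOpen O) (ha : a ∈ O)
  (ha0 : a.2 0 = 0) (hf : ∀ p ∈ O, 0 ≤ p.2 0 → SmoothWithinAt f ℛ p)
  (hf1 : ∀ p ∈ O, p.2 0 = 0 → (f p).2 0 = 0) (hL : Injective (𝒟 f ℛ a)) (hd : 0 < (𝒟 f ℛ a 𝐮).2 0) :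
  ∃ (U T : Set 𝕍) (g : 𝕍 → 𝕍), IsOpen U ∧ IsOpen T ∧ a ∈ U ∧ U ⊆ O ∧
  (∀ p ∈ U, 0 ≤ p.2 0 → f p ∈ T ∧ g (f p) = p) ∧ (∀ q ∈ T, 0 ≤ q.2 0 → g q ∈ U ∧ 0 ≤ (g q).2 0 ∧
  f (g q) = q) ∧ SmoothOn g (T ∩ ℛ) := by
  set H := ℛ with hH
  have hmH : ∀ {p : 𝕍}, p ∈ H ↔ 0 ≤ p.2 0 := mem_half
  have hHu : UniqueDiffOn ℝ H := (𝓗).uniqueDiffOn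
  have hbij : Bijective (𝒟 f H a) := ⟨hL, LinearMap.injective_iff_surjective.1 hL⟩
  set L := bijEquiv _ hbij with hLdef
  have hLc : (L : 𝕍 →L[ℝ] 𝕍) = 𝒟 f H a := coe_bijEquiv _ hbij
  have hLp : ∀ v, L v = 𝒟 f H a v := fun v => congrArg (fun A => A v) hLc
  set N := ‖(L.symm : 𝕍 →L[ℝ] 𝕍)‖₊ with hN
  have hsym : ∀ v, ‖v‖ ≤ N * ‖L v‖ := fun v => by
    have := (L.symm : 𝕍 →L[ℝ] 𝕍).le_opNorm (L v)
    rwa [ContinuousLinearEquiv.coe_coe, L.symm_apply_apply] at this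
  have hNpos : 0 < N := by
    have h1 := hsym 𝐮; rw [norm_e₀] at h1; by_contra! h
    rw [le_antisymm h zero_le, NNReal.coe_zero, zero_mul] at h1; linarith
  set c : NNReal := N⁻¹ / 4 with hc
  have hcpos : 0 < c := by positivity
  have hcN : (N : ℝ) * c = 1 / 4 := by rw [hc]; push_cast; field_simp
  have hcont : ContinuousWithinAt (𝒟 f H) H a :=
    ((hf a ha ha0.ge).fderivWithin_right (m := ∞) hHu le_rfl (hmH.2 ha0.ge)).continuousWithinAt
  obtain ⟨ρ, hρ, hρO⟩ : ∃ ρ > 0, ∀ p ∈ ball a ρ, p ∈ O ∧ (0 ≤ p.2 0 → ‖𝒟 f H p - L‖ ≤ c) := by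
    have h1 : ∀ᶠ p in 𝓝[H] a, ‖𝒟 f H p - L‖ < c := by
      have h2 : Tendsto (fun p => ‖𝒟 f H p - 𝒟 f H a‖) (𝓝[H] a) (𝓝 0) :=
        tendsto_iff_norm_sub_tendsto_zero.1 hcont
      rw [hLc]; exact h2.eventually (gt_mem_nhds (NNReal.coe_pos.2 hcpos))
    rw [eventually_nhdsWithin_iff] at h1
    obtain ⟨ρ, hρ, h⟩ := Metric.eventually_nhds_iff_ball.1 (h1.and (hO.mem_nhds ha))
    exact ⟨ρ, hρ, fun p hp => ⟨(h p hp).2, fun h0 => ((h p hp).1 (hmH.2 h0)).le⟩⟩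
  have happ : ∀ p ∈ ball a ρ ∩ H, ∀ q ∈ ball a ρ ∩ H,
      ‖f p - f q - L (p - q)‖ ≤ c * ‖p - q‖ := fun p hp q hq => by
    refine Convex.norm_image_sub_le_of_norm_hasFDerivWithin_le' (f' := 𝒟 f H)
      (s := ball a ρ ∩ H) (φ := (L : 𝕍 →L[ℝ] 𝕍)) (fun x hx => ?_)
      (fun x hx => (hρO x hx.1).2 (hmH.1 hx.2)) ?_ hq hp
    · exact (((hf x (hρO x hx.1).1 (hmH.1 hx.2)).differentiableWithinAt
        (by simp)).hasFDerivWithinAt).mono inter_subset_right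
    · exact (convex_ball a ρ).inter (𝓗).convex_range
  set F : 𝕍 → 𝕍 := fun p => f (clamp p) + L (p - clamp p) with hF
  have hclamp : ∀ p ∈ ball a (ρ / 2), clamp p ∈ ball a ρ ∩ H := fun p hp => by
    refine ⟨?_, hmH.2 (by rw [clamp_height]; exact le_max_left _ _)⟩
    have := norm_clamp_sub_le p a; rw [clamp_eq_self ha0.ge] at this; rw [mem_ball_iff_norm] at hp ⊢
    linarith
  have hFapp : ApproximatesLinearOn F (L : 𝕍 →L[ℝ] 𝕍) (ball a (ρ / 2))
      (2 * c) := fun p hp q hq => by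
    have h1 := happ _ (hclamp p hp) _ (hclamp q hq); have h2 := norm_clamp_sub_le p q
    have e : F p - F q - L (p - q) = f (clamp p) - f (clamp q) - L (clamp p - clamp q) := by
      simp only [hF, map_sub]; abel
    rw [ContinuousLinearEquiv.coe_coe, e]
    refine h1.trans ((mul_le_mul_of_nonneg_left h2 c.coe_nonneg).trans_eq ?_); push_cast; ring
  have hc2 : 2 * c < N⁻¹ := by
    have h1 : (0 : ℝ) < c := NNReal.coe_pos.2 hcpos
    have h2 : (c : ℝ) = (N : ℝ)⁻¹ / 4 := by rw [hc]; push_cast; rfl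
    rw [← NNReal.coe_lt_coe]; push_cast; linarith
  set Φ := hFapp.toOpenPartialHomeomorph F _ (Or.inr hc2) isOpen_ball with hΦ
  have hFf : ∀ {p}, 0 ≤ p.2 0 → F p = f p := fun {p} h0 => by
    simp only [hF, clamp_eq_self h0, sub_self, map_zero, add_zero]
  have hneg : ∀ p ∈ ball a (ρ / 2), 0 ≤ (F p).2 0 → 0 ≤ p.2 0 := fun p hp h => by
    by_contra! h0; have h1 : (clamp p).2 0 = 0 := by rw [clamp_height, max_eq_left h0.le]
    have h2 := hf1 _ (hρO _ (hclamp p hp).1).1 h1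
    have h3 : p - clamp p = p.2 0 • 𝐮 := by rw [clamp, max_eq_left (by linarith)]; module
    have h4 : (F p).2 0 = p.2 0 * (𝒟 f H a 𝐮).2 0 := by
      simp only [hF, h3, map_smul, hLp]; change (f (clamp p)).2 0 + _ = _; rw [h2, zero_add]; rfl
    rw [h4] at h; exact absurd (mul_neg_of_neg_of_pos h0 hd) (not_lt.2 h)
  have hball : ball a (ρ / 2) ⊆ ball a ρ := ball_subset_ball (by linarith)
  have hΦs : ∀ q ∈ Φ.target, 0 ≤ q.2 0 → Φ.symm q ∈ ball a (ρ / 2) ∧ 0 ≤ (Φ.symm q).2 0 ∧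
      f (Φ.symm q) = q := fun q hq h0 => by
    have h1 : Φ.symm q ∈ ball a (ρ / 2) := Φ.map_target hq
    have h2 : F (Φ.symm q) = q := Φ.right_inv hq; have h3 := hneg _ h1 (by rwa [h2])
    exact ⟨h1, h3, by rw [← hFf h3, h2]⟩
  refine ⟨ball a (ρ / 2), Φ.target, Φ.symm, isOpen_ball, Φ.open_target,
    mem_ball_self (by linarith), fun p hp => (hρO p (hball hp)).1, fun p hp h0 => ?_, hΦs, ?_⟩
  · rw [← hFf h0]; exact ⟨Φ.map_source hp, Φ.left_inv hp⟩
  · have hfd : ∀ p ∈ ball a (ρ / 2) ∩ H, 𝒟 f (ball a (ρ / 2) ∩ H) p = 𝒟 f H p := fun p hp => by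
      rw [inter_comm, fderivWithin_inter (isOpen_ball.mem_nhds hp.1)]
    refine contDiffOn_of_rightInverse (f := f) (s := ball a (ρ / 2) ∩ H) ?_ ?_
      (fun p hp => (hf p (hρO p (hball hp.1)).1 (hmH.1 hp.2)).mono inter_subset_right)
      (fun p hp => ?_) (Φ.continuousOn_symm.mono inter_subset_left)
      (fun q hq => ⟨(hΦs q hq.1 (hmH.1 hq.2)).1, hmH.2 (hΦs q hq.1 (hmH.1 hq.2)).2.1⟩)
      fun q hq => (hΦs q hq.1 (hmH.1 hq.2)).2.2
    · rw [inter_comm]; exact hHu.inter Φ.open_target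
    · rw [inter_comm]; exact hHu.inter isOpen_ball
    · rw [hfd p hp]; have h1 := (hρO p (hball hp.1)).2 (hmH.1 hp.2)
      have hinj : Injective (𝒟 f H p) := by
        rw [injective_iff_map_eq_zero]; intro v hv
        have h2 := (𝒟 f H p - (L : 𝕍 →L[ℝ] 𝕍)).le_of_opNorm_le h1 v
        rw [sub_apply, hv, zero_sub, norm_neg] at h2
        have h3 := (hsym v).trans (mul_le_mul_of_nonneg_left h2 N.coe_nonneg)
        rw [← mul_assoc, hcN] at h3; exact norm_le_zero_iff.1 (by linarith)
      exact ⟨hinj, LinearMap.injective_iff_surjective.1 hinj⟩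

lemma FibredChart.exists_flattening [T2Space E] (c : HChart πE) {x : E} (hx : x ∈ 𝒮 c)
  (hxb : x ∈ 𝔅 E) : ∃ α : E → E, SmoothH α ∧ (∀ y, πE (α y) = πE y) ∧ (∀ y ∈ 𝔅 E, α y = y) ∧
  ∀ᶠ y in 𝓝 x, α y ∈ 𝔅 E := by
  obtain ⟨D, hD, hxD, hDm⟩ := c.exists_open hx (Q := fun _ => True) (by simp)
  obtain ⟨r, hr, hball⟩ := Metric.isOpen_iff.1 hD _ hxD; set a := c.ext x with ha
  have ha0 : a.2 0 = 0 := (c.ext_zero hx).1 hxb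
  obtain ⟨χ, hχ, -, hχ1, hχ01, hχs⟩ := exists_local_bump a (r := r / 4) (by linarith)
  have hh := (𝐡).contDiff (n := ∞)
  let Θ : 𝕍 → 𝕍 := fun p => p - (χ p * p.2 0) • 𝐮
  have hΘ0 : ∀ p, (Θ p).2 0 = (1 - χ p) * p.2 0 := fun p => by
    have : (Θ p).2 0 = p.2 0 - χ p * p.2 0 := by simp [Θ, e₀]
    rw [this]; ring
  have hΘnn : ∀ p, 0 ≤ p.2 0 → 0 ≤ (Θ p).2 0 := fun p hp => by
    rw [hΘ0]; exact mul_nonneg (by linarith [(hχ01 p).2]) hp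
  have hmt : ∀ {p}, p ∈ ball a r → 0 ≤ p.2 0 → p ∈ c.ext.target := fun {p} hp h0 =>
    (hDm p ⟨hball hp, mem_half.2 h0⟩).1
  let K : Set 𝕍 := closedBall a (r / 4) ∩ {p | 0 ≤ p.2 0}
  have hKc : IsCompact K := (isCompact_closedBall a (r / 4)).inter_right
    (isClosed_le continuous_const (𝐡).continuous)
  have hKΘ : ∀ p ∈ K, Θ p ∈ ball a r := fun p hp => by
    have h1 : ‖p - a‖ ≤ r / 4 := mem_closedBall_iff_norm.1 hp.1
    have h2 : |p.2 0| ≤ r / 4 := by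
      have : |(p - a).2 0| ≤ ‖p - a‖ :=
        (Real.norm_eq_abs _).symm.trans_le ((PiLp.norm_apply_le _ _).trans (norm_snd_le _))
      have e : (p - a).2 0 = p.2 0 - a.2 0 := rfl; rw [e, ha0, sub_zero] at this
      exact this.trans h1
    rw [mem_ball_iff_norm, show Θ p - a = (p - a) - (χ p * p.2 0) • 𝐮 from by simp only [Θ]; abel]
    refine (norm_sub_le _ _).trans_lt ?_
    rw [norm_smul, norm_e₀, mul_one, norm_mul, Real.norm_eq_abs, Real.norm_eq_abs,
      abs_of_nonneg (hχ01 p).1]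
    nlinarith [(hχ01 p).2, abs_nonneg (p.2 0)]
  obtain ⟨α, hα, hαπ, hαm, hαf, -⟩ := c.exists_map_of_coord (Θ := Θ)
    (contDiff_id.sub ((hχ.mul hh).smul contDiff_const)) (fun p => by simp [Θ, e₀])
    (fun p h0 => hΘnn p h0) hKc
    (fun p hp => hmt (closedBall_subset_ball (by linarith) hp.1) hp.2)
    (fun p hp => hmt (hKΘ p hp) (hΘnn p hp.2)) fun p h0 hp => by
      have : χ p = 0 := by_contra fun h => hp ⟨hχs p h, h0⟩
      simp [Θ, this]
  refine ⟨α, hα, hαπ, fun y hy => ?_, ?_⟩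
  · by_cases hys : y ∈ 𝒮 c
    · have e1 := c.symm_ext (hαm y hys).1
      have e2 : Θ (c.ext y) = c.ext y := by
        simp only [Θ, (c.ext_zero hys).1 hy, mul_zero, zero_smul, sub_zero]
      rw [(hαm y hys).2, e2, c.symm_ext hys] at e1; exact e1.symm
    · exact (hαf y fun h => absurd h hys).self_of_nhds
  · filter_upwards [(c.total.continuousAt_extend hx).eventually hχ1,
      c.total.open_source.mem_nhds hx] with y hy hys
    rw [c.ext_zero (hαm y hys).1, (hαm y hys).2, hΘ0]; change (1 - χ (c.ext y)) * _ = 0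
    rw [show χ (c.ext y) = 1 from hy, sub_self, zero_mul]

/-- A map over the base which retracts a neighbourhood of the boundary onto the boundary. -/
lemma exists_retraction [T2Space E] [CompactSpace E] (hc : HasCharts k n πE) : ∃ r : E → E,
  SmoothH r ∧ (∀ y, πE (r y) = πE y) ∧ (∀ y ∈ 𝔅 E, r y = y) ∧ ∀ x ∈ 𝔅 E, ∀ᶠ y in 𝓝 x,
  r y ∈ 𝔅 E := by
  have hS : IsCompact (𝔅 E) := isClosed_bdry.isCompact
  have key := hS.induction_on (p := fun s => ∃ r : E → E, SmoothH r ∧ (∀ y, πE (r y) = πE y) ∧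
      (∀ y ∈ 𝔅 E, r y = y) ∧ ∀ x ∈ s, x ∈ 𝔅 E → ∀ᶠ y in 𝓝 x, r y ∈ 𝔅 E)
    ⟨id, contMDiff_id, fun _ => rfl, fun _ _ => rfl, fun x hx => absurd hx (notMem_empty x)⟩
    (fun s t hst ⟨r, h1, h2, h3, h4⟩ => ⟨r, h1, h2, h3, fun x hx => h4 x (hst hx)⟩)
    (fun s t ⟨r, h1, h2, h3, h4⟩ ⟨r', h1', h2', h3', h4'⟩ => by
      refine ⟨r' ∘ r, h1'.comp h1, fun y => (h2' _).trans (h2 y), fun y hy => ?_, fun x hx hxb => ?_⟩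
      · rw [comp_apply, h3 y hy, h3' y hy]
      · obtain hx | hx := hx
        · filter_upwards [h4 x hx hxb] with y hy
          rwa [comp_apply, h3' _ hy]
        · have h5 : Tendsto r (𝓝 x) (𝓝 x) := by
            have := h1.continuous.tendsto x; rwa [h3 x hxb] at this
          exact h5.eventually (h4' x hx hxb))
    fun x hxb => by
      obtain ⟨c, hx⟩ := hc x; obtain ⟨α, h1, h2, h3, h4⟩ := c.exists_flattening hx hxb
      exact ⟨_, mem_nhdsWithin_of_mem_nhds (eventually_eventually_nhds.2 h4), α, h1, h2, h3,
        fun y hy _ => hy⟩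
  obtain ⟨r, h1, h2, h3, h4⟩ := key; exact ⟨r, h1, h2, h3, fun x hx => h4 x hx hx⟩

lemma flatL_add_height (p : 𝕍) : 𝐟 p + p.2 0 • 𝐮 = p := by rw [flatL_apply, sub_add_cancel]

/-- A map over the base near a boundary point, to the half-space, is a chart if its restriction to
the boundary has a left inverse and its height has a positive derivative. -/
lemma FibredChart.exists_half_chart (c : HChart πE) {x : E} (hx : x ∈ 𝒮 c) (hxb : x ∈ 𝔅 E)
  {U : Set E} (hU : IsOpen U) (hxU : x ∈ U) {b : OPHomeo B (𝔼 k)} (hb : b ∈ maximalAtlas (𝓡 k) ∞ B)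
  {F : E → 𝕍} (hF : ContMDiffOn 𝓗 𝓘(ℝ, 𝕍) ∞ F U) (hFb : ∀ y ∈ U, πE y ∈ b.source ∧ (F y).1 =
  b (πE y)) {t : E → ℝ} (ht : ∀ y, 0 ≤ t y) (htb : ∀ y ∈ 𝔅 E, t y = 0) (htd : 0 < c.deriv₀ t x)
  (hFt : ∀ y ∈ U, (F y).2 0 = t y) {G : 𝕍 → 𝕍} (hG : DifferentiableWithinAt ℝ G ℛ (F x))
  (hGF : ∀ᶠ y in 𝓝 x, y ∈ 𝔅 E → G (F y) = c.ext y) : ∃ d : HChart πE, x ∈ 𝒮 d ∧ 𝒮 d ⊆ U ∧ d.base =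
  b ∧ ∀ y ∈ 𝒮 d, d.ext y = F y := by
  obtain ⟨D, hD, hxD, hDm⟩ := c.exists_open hx (hU.eventually_mem hxU)
  have hDm' : ∀ p ∈ D, 0 ≤ p.2 0 → p ∈ c.ext.target ∧ c.ext.symm p ∈ U := fun p hp h0 =>
    hDm p ⟨hp, mem_half.2 h0⟩
  have hx0 : (c.ext x).2 0 = 0 := (c.ext_zero hx).1 hxb
  have hsx : c.ext.symm (c.ext x) = x := c.symm_ext hx
  have hf : ∀ p ∈ D, 0 ≤ p.2 0 → SmoothWithinAt (F ∘ c.ext.symm) ℛ p := fun p hp h0 => by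
    obtain ⟨h1, h2⟩ := hDm' p hp h0; rw [← contMDiffWithinAt_iff_contDiffWithinAt]
    exact (hF.contMDiffAt (hU.mem_nhds h2)).comp_contMDiffWithinAt_of_eq
      (smooth_extend_symm c.total_mem h1) rfl
  have hft : ∀ p ∈ D, 0 ≤ p.2 0 → (F (c.ext.symm p)).2 0 = t (c.ext.symm p) := fun p hp h0 =>
    hFt _ (hDm' p hp h0).2
  have hf1 : ∀ p ∈ D, p.2 0 = 0 → (F (c.ext.symm p)).2 0 = 0 := fun p hp h0 => by
    obtain ⟨h1, h2⟩ := hDm' p hp h0.ge; rw [hft p hp h0.ge]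
    refine htb _ ((c.ext_zero (c.mem_source h1)).2 ?_); rwa [c.ext.right_inv h1]
  let A := 𝒟 (F ∘ c.ext.symm) ℛ (c.ext x)
  have hdiff : HasFDerivWithinAt (F ∘ c.ext.symm) A ℛ (c.ext x) :=
    ((hf _ hxD hx0.ge).differentiableWithinAt (by simp)).hasFDerivWithinAt
  have hd : 0 < (A 𝐮).2 0 := by
    have h1 := (𝐡).hasFDerivAt.comp_hasFDerivWithinAt (c.ext x) hdiff
    have h2 : HasFDerivWithinAt (t ∘ c.ext.symm) ((𝐡).comp A) ℛ (c.ext x) := by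
      refine h1.congr_of_eventuallyEq ?_ (hft _ hxD hx0.ge).symm
      filter_upwards [self_mem_nhdsWithin, mem_nhdsWithin_of_mem_nhds (hD.mem_nhds hxD)] with p h h'
      exact (hft p h' (mem_half.1 h)).symm
    have h3 : c.deriv₀ t x = _ := congrArg (fun A => A 𝐮)
      (h2.fderivWithin ((𝓗).uniqueDiffOn _ (c.total.extend_target_subset_range (c.ext_mem hx))))
    rwa [h3] at htd
  have hline : ∀ w : 𝕍, w.2 0 = 0 → (A w).2 0 = 0 ∧ (A w = 0 → w = 0) := by
    intro w hw
    have hl : HasDerivAt (fun s : ℝ => c.ext x + s • w) w 0 := by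
      simpa using ((hasDerivAt_id (0 : ℝ)).smul_const w).const_add (c.ext x)
    have e0 : c.ext x + (0 : ℝ) • w = c.ext x := by rw [zero_smul, add_zero]
    have hev := c.line_mem_bdry hx hxb ((hU.eventually_mem hxU).and hGF) hw
    have h1 : HasDerivAt (fun s : ℝ => F (c.ext.symm (c.ext x + s • w))) (A w) 0 := by
      refine HasFDerivWithinAt.comp_hasDerivAt (t := ℛ)
        (l := F ∘ c.ext.symm) (0 : ℝ) (by rwa [e0]) hl ?_
      filter_upwards [hev] with s hs using c.total.extend_target_subset_range hs.1
    have hzero : ∀ᶠ s : ℝ in 𝓝 0, (F (c.ext.symm (c.ext x + s • w))).2 0 = 0 := by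
      filter_upwards [hev] with s hs
      rw [hFt _ hs.2.2.1, htb _ hs.2.1]
    constructor
    · have h2 := (𝐡).hasFDerivAt.comp_hasDerivAt (0 : ℝ) h1
      exact h2.unique ((hasDerivAt_const (0 : ℝ) (0 : ℝ)).congr_of_eventuallyEq hzero)
    · intro h0; have e1 : F (c.ext.symm (c.ext x + (0 : ℝ) • w)) = F x := by rw [e0, hsx]
      have h2 := HasFDerivWithinAt.comp_hasDerivAt (t := ℛ)
        (l := G) (0 : ℝ) (by rw [e1]; exact hG.hasFDerivWithinAt) h1 (by
          filter_upwards [hzero] with s hs using mem_half.2 hs.ge)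
      rw [h0, map_zero] at h2; refine (hl.congr_of_eventuallyEq ?_).unique h2
      filter_upwards [hev] with s hs
      rw [comp_apply, hs.2.2.2 hs.2.1, c.ext.right_inv hs.1]
  have hL : Injective A := by
    rw [injective_iff_map_eq_zero]; intro v hv; have h1 := (hline _ (flatL_height v)).1
    have h2 : A (𝐟 v) + v.2 0 • A 𝐮 = 0 := by rw [← map_smul, ← map_add, flatL_add_height, hv]
    have h3 := congrArg 𝐡 h2
    rw [map_add, map_smul, map_zero, heightL_apply, heightL_apply, h1, zero_add, smul_eq_mul] at h3
    exact (hline v ((mul_eq_zero.1 h3).resolve_right hd.ne')).2 hv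
  obtain ⟨V, T, g, hV, hT, hxV, hVD, hfT, hgV, hgs⟩ := exists_half_inverse hD hxD hx0 hf hf1 hL hd
  have hnn : ∀ y, 0 ≤ (c.ext y).2 0 := fun y => mem_half.1 (c.ext_mem_range y)
  have hW : IsOpen (𝒮 c ∩ c.ext ⁻¹' V) := c.total.isOpen_extend_preimage hV
  have hWU : ∀ y ∈ 𝒮 c ∩ c.ext ⁻¹' V, y ∈ U := fun y hy => by
    have := (hDm' _ (hVD hy.2) (hnn y)).2; rwa [c.symm_ext hy.1] at this
  have hfy : ∀ y ∈ 𝒮 c, (F ∘ c.ext.symm) (c.ext y) = F y := fun y hy => by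
    rw [comp_apply, c.symm_ext hy]
  have key : ∃ d : HChart πE, 𝒮 d = 𝒮 c ∩ c.ext ⁻¹' V ∧
      d.base = b ∧ ∀ y ∈ 𝒮 c ∩ c.ext ⁻¹' V, d.ext y = F y := by
    refine exists_fibredChart (T := T) (N := c.ext.symm ∘ g) hW hT hb (fun y hy => ?_)
      (fun p hp => ?_) (hF.mono hWU) ?_ fun y hy => hFb y (hWU y hy)
    · have h1 := hfT _ hy.2 (hnn y); rw [hfy y hy.1] at h1; refine ⟨⟨h1.1, mem_half.2 ?_⟩, ?_⟩
      · rw [hFt y (hWU y hy)]; exact ht y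
      · rw [comp_apply, h1.2, c.symm_ext hy.1]
    · obtain ⟨h1, h2, h3⟩ := hgV p hp.1 (mem_half.1 hp.2); have h4 := (hDm' _ (hVD h1) h2).1
      refine ⟨⟨c.mem_source h4, ?_⟩, h3⟩; change c.ext (c.ext.symm (g p)) ∈ V
      rwa [c.ext.right_inv h4]
    · intro p hp; obtain ⟨h1, h2, h3⟩ := hgV p hp.1 (mem_half.1 hp.2)
      have h4 := (hDm' _ (hVD h1) h2).1
      exact (smooth_extend_symm c.total_mem h4).comp (t := ℛ) p (hgs.contMDiffOn p hp)
        fun q hq => mem_half.2 (hgV q hq.1 (mem_half.1 hq.2)).2.1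
  obtain ⟨d, hds, hdb, hde⟩ := key
  exact ⟨d, hds ▸ ⟨hx, hxV⟩, fun y hy => hWU y (hds ▸ hy), hdb, fun y hy => hde y (hds ▸ hy)⟩

section CollarMaps

/-- Near `∂E`, the map `(ρ, t)` is a fibrewise collar over `∂E1 ≃ ∂E`. -/
structure CollarMap (π₁ : E1 → B) (π : E → B) (β : 𝔅 E1 ≃ 𝔅 E) (ρ : E → E1)
    (t : E → ℝ) (V : Set E) : Prop where
  isOpen : IsOpen V
  subset : 𝔅 E ⊆ V
  smooth : ContMDiffOn 𝓗 𝓗 ∞ ρ V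
  proj : ∀ y ∈ V, π₁ (ρ y) = π y
  mem : ∀ y ∈ V, ρ y ∈ 𝔅 E1
  bdry : ∀ x : 𝔅 E1, ρ (β x) = x
  smooth_height : ContMDiff 𝓗 𝓘(ℝ) ∞ t
  nonneg : ∀ y, 0 ≤ t y
  zero : ∀ y ∈ 𝔅 E, t y = 0
  deriv_pos : ∀ y ∈ 𝔅 E, ∃ c : HChart π, y ∈ 𝒮 c ∧ 0 < c.deriv₀ t y

variable {β : Bdry k n E1 ≃ Bdry k n E}

lemma exists_collarMap [T2Space E] [CompactSpace E] [Nonempty E1] (hc : HasCharts k n πE)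
  (hβ : SmoothBdryMap β.symm) (hπ : ∀ x, πE (β x) = π₁ x) : ∃ ρ t V, CollarMap π₁ πE β ρ t V := by
  classical
  obtain ⟨r, hr, hrπ, hrb, hrm⟩ := exists_retraction hc
  obtain ⟨t, ht, ht1, ht2, htd⟩ := exists_side_function (k := k) (π := πE) isUpward_half
    (A := univ) (A' := 𝔅 E) isClosed_univ isClosed_bdry (fun w => Or.inl (mem_univ w))
    fun w _ => by
      obtain ⟨c, hw⟩ := hc w
      have h0 : ∀ y, 0 ≤ (c.ext y).2 0 := fun y => mem_half.1 (c.ext_mem_range y)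
      exact ⟨c, hw, fun y _ => ⟨fun _ => h0 y, fun _ => mem_univ y⟩, fun y hy =>
        (c.ext_zero hy).trans ⟨fun h => h.le, fun h => h.antisymm (h0 y)⟩⟩
  have h0 : ∀ y, 0 ≤ t y := fun y => (ht1 y).2 (mem_univ y)
  let β' : E → E1 := fun y => if h : y ∈ 𝔅 E then β.symm ⟨y, h⟩ else Classical.arbitrary E1
  have hβ' : ∀ y (h : y ∈ 𝔅 E), β' y = β.symm ⟨y, h⟩ := fun y h => dif_pos h
  have hV : ∀ {y}, y ∈ interior (r ⁻¹' 𝔅 E) → r y ∈ 𝔅 E := fun h =>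
    interior_subset (s := r ⁻¹' 𝔅 E) h
  refine ⟨β' ∘ r, t, interior (r ⁻¹' 𝔅 E), isOpen_interior, fun y hy =>
    mem_interior_iff_mem_nhds.2 (hrm y hy), fun y hy => ContMDiffAt.contMDiffWithinAt ?_,
    fun y hy => ?_, fun y hy => ?_, fun x => ?_, ht, h0, fun y hy =>
    ((ht2 y).2 hy).antisymm (h0 y), fun y hy => ?_⟩
  · obtain ⟨G, hG, hGβ⟩ := hβ ⟨r y, hV hy⟩
    refine (hG.comp_of_eq (x := y) (hr y) rfl).congr_of_eventuallyEq ?_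
    filter_upwards [hr.continuous.continuousAt.eventually hGβ, isOpen_interior.mem_nhds hy] with z h h'
    rw [comp_apply, comp_apply, h (hV h'), hβ' _ (hV h')]
  · rw [comp_apply, hβ' _ (hV hy), ← hπ, β.apply_symm_apply]; exact hrπ y
  · rw [comp_apply, hβ' _ (hV hy)]; exact (β.symm _).2
  · rw [comp_apply, hrb _ (β x).2, hβ' _ (β x).2, Subtype.coe_eta, β.symm_apply_apply]
  · obtain ⟨c, h1, -, h2⟩ := htd y ⟨mem_univ y, hy⟩; exact ⟨c, h1, h2⟩

lemma CollarMap.exists_chart {ρ : E → E1} {t : E → ℝ} {V : Set E} (H : CollarMap π₁ πE β ρ t V)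
  (hβ : SmoothBdryMap β) (c : HChart π₁) {x : 𝔅 E1} (hx : (x : E1) ∈ 𝒮 c) : ∃ d : HChart πE,
  (β x : E) ∈ 𝒮 d ∧ d.base = c.base ∧ ∀ y ∈ 𝒮 d, y ∈ V ∧ ρ y ∈ 𝒮 c ∧ d.ext y = c.ext
  (ρ y) + t y • 𝐮 := by
  obtain ⟨c', hx', htd⟩ := H.deriv_pos _ (β x).2; obtain ⟨Φ, hΦ, hΦβ⟩ := hβ x
  have hU : IsOpen (V ∩ ρ ⁻¹' 𝒮 c) :=
    H.smooth.continuousOn.isOpen_inter_preimage H.isOpen c.total.open_source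
  have hxU : (β x : E) ∈ V ∩ ρ ⁻¹' 𝒮 c := ⟨H.subset (β x).2, by rw [mem_preimage, H.bdry]; exact hx⟩
  have ht0 : t (β x) = 0 := H.zero _ (β x).2
  have hFx : c.ext (ρ (β x)) + t (β x) • 𝐮 = c.ext x := by rw [H.bdry, ht0, zero_smul, add_zero]
  have hΦx : Φ x = β x := hΦβ.self_of_nhds x.2
  have key : ∃ d : HChart πE, (β x : E) ∈ 𝒮 d ∧ 𝒮 d ⊆ V ∩ ρ ⁻¹' 𝒮 c ∧ d.base = c.base ∧
      ∀ y ∈ 𝒮 d, d.ext y = c.ext (ρ y) + t y • 𝐮 := by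
    refine c'.exists_half_chart (t := t) (G := c'.ext ∘ Φ ∘ c.ext.symm) hx' (β x).2 hU hxU c.base_mem
      (fun y hy => ?_) (fun y hy => ?_) H.nonneg H.zero htd (fun y hy => ?_) ?_ ?_
    · refine ContMDiffAt.contMDiffWithinAt (ContMDiffAt.add ?_ ?_)
      · exact ContMDiffAt.comp y (c.total.contMDiffAt_extend c.total_mem hy.2)
          (H.smooth.contMDiffAt (H.isOpen.mem_nhds hy.1))
      · exact (H.smooth_height y).smul contMDiffAt_const
    · have h1 := c.proj_mem _ hy.2; have h2 := c.fst_eq _ hy.2; rw [H.proj y hy.1] at h1 h2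
      refine ⟨h1, ?_⟩; rw [← h2]; simp [e₀]
    · change (c.ext (ρ y)).2 0 + t y * _ = t y; rw [(c.ext_zero hy.2).1 (H.mem y hy.1)]; simp [e₀]
    · rw [hFx]
      have h1 : ContMDiffWithinAt 𝓘(ℝ, 𝕍) 𝓘(ℝ, 𝕍) ∞ (c'.ext ∘ Φ ∘ c.ext.symm) ℛ (c.ext x) := by
        refine ContMDiffAt.comp_contMDiffWithinAt_of_eq (y := Φ x)
          (c'.total.contMDiffAt_extend c'.total_mem (by rw [hΦx]; exact hx')) ?_ ?_
        · exact hΦ.comp_contMDiffWithinAt_of_eq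
            (smooth_extend_symm c.total_mem (c.ext_mem hx)) (c.symm_ext hx)
        · rw [comp_apply, c.symm_ext hx]
      exact (contMDiffWithinAt_iff_contDiffWithinAt.1 h1).differentiableWithinAt (by simp)
    · have h1 : Tendsto ρ (𝓝 (β x : E)) (𝓝 (x : E1)) := by
        have := (H.smooth.continuousOn.continuousAt (H.isOpen.mem_nhds hxU.1)).tendsto
        rwa [H.bdry] at this
      filter_upwards [hU.mem_nhds hxU, h1.eventually hΦβ] with y hy h2 hyb
      obtain ⟨z, rfl⟩ : ∃ z, (β z : E) = y := ⟨β.symm ⟨y, hyb⟩, by rw [β.apply_symm_apply]⟩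
      rw [H.zero _ hyb, zero_smul, add_zero, comp_apply, comp_apply,
        c.symm_ext hy.2, h2 (H.mem _ hy.1)]
      congr 3; exact Subtype.ext (H.bdry z)
  obtain ⟨d, h1, h2, h3, h4⟩ := key; exact ⟨d, h1, h3, fun y hy => ⟨(h2 hy).1, (h2 hy).2, h4 y hy⟩⟩

end CollarMaps

section GluedCharts

variable (φ)

/-- The charts `d₁` and `d₂` match at the boundary. -/
structure MatchingPair (d₁ : HChart π₁) (d₂ : HChart π₂) : Prop where
  base : d₂.base = d₁.base
  source_iff : ∀ x : 𝔅 E1, (φ.toEquiv x : E2) ∈ 𝒮 d₂ ↔ (x : E1) ∈ 𝒮 d₁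
  ext_eq : ∀ x : 𝔅 E1, (x : E1) ∈ 𝒮 d₁ → d₂.ext (φ.toEquiv x : E2) = d₁.ext x

/-- The chart `e` consists of `d₁` and the reflection of `d₂`. -/
structure UnionChart (e : OPHomeo (Glued φ) 𝔐)
    (d₁ : HChart π₁) (d₂ : HChart π₂) : Prop where
  base : d₂.base = d₁.base
  source₁ : ∀ p, ι₁ p ∈ e.source ↔ p ∈ 𝒮 d₁
  source₂ : ∀ p, ι₂ p ∈ e.source ↔ p ∈ 𝒮 d₂
  ext₁ : ∀ p ∈ 𝒮 d₁, e (ι₁ p) = d₁.ext p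
  ext₂ : ∀ p ∈ 𝒮 d₂, e (ι₂ p) = 𝐫 (d₂.ext p)

variable {φ}

lemma isOpen_glued {U : Set (Glued φ)} (h₁ : IsOpen (ι₁ ⁻¹' U)) (h₂ : IsOpen (ι₂ ⁻¹' U)) :
  IsOpen U := by
  have : IsOpen (Quot.mk (GlueRel φ) ⁻¹' U) := isOpen_sum_iff.2 ⟨h₁, h₂⟩; exact this

lemma MatchingPair.exists_chart {d₁ : HChart π₁} {d₂ : HChart π₂} (H : MatchingPair φ d₁ d₂) : ∃ e,
  UnionChart φ e d₁ d₂ := by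
  classical
  have hz : ∀ {x : 𝔅 E1}, (x : E1) ∈ 𝒮 d₁ → (d₁.ext x).2 0 = 0 := fun {x} hx =>
    (d₁.ext_zero hx).1 x.2
  have hnn₁ : ∀ p, 0 ≤ (d₁.ext p).2 0 := fun p => mem_half.1 (d₁.ext_mem_range p)
  have hnn₂ : ∀ p, 0 ≤ (d₂.ext p).2 0 := fun p => mem_half.1 (d₂.ext_mem_range p)
  have hR : ∀ {x : 𝔅 E1}, (x : E1) ∈ 𝒮 d₁ →
      𝐫 (d₂.ext (φ.toEquiv x : E2)) = d₁.ext x := fun {x} hx => by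
    rw [H.ext_eq x hx, HalfCharts.reflL_of_zero (hz hx)]
  have hsplit : ∀ p : E2, (∃ x : 𝔅 E1, p = φ.toEquiv x) ∨ p ∉ 𝔅 E2 := fun p => by
    by_cases hp : p ∈ 𝔅 E2
    · exact Or.inl ⟨φ.toEquiv.symm ⟨p, hp⟩, by rw [φ.toEquiv.apply_symm_apply]⟩
    · exact Or.inr hp
  have hf : ∀ w : Glued φ, ∃ v : 𝕍, (∀ p ∈ 𝒮 d₁, ι₁ p = w → v = d₁.ext p) ∧
      ∀ p ∈ 𝒮 d₂, ι₂ p = w → v = 𝐫 (d₂.ext p) := by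
    intro w; obtain ⟨p, rfl⟩ | ⟨p, rfl⟩ := glued_cases φ w
    · refine ⟨d₁.ext p, fun p' _ h => by rw [incl₁_injective φ h], fun p' hp' h => ?_⟩
      obtain ⟨hx, rfl⟩ := (incl_eq_iff φ p p').1 h.symm; exact (hR ((H.source_iff _).1 hp')).symm
    · refine ⟨𝐫 (d₂.ext p), fun p' hp' h => ?_, fun p' _ h => by rw [incl₂_injective φ h]⟩
      obtain ⟨hx, rfl⟩ := (incl_eq_iff φ p' p).1 h; exact hR (x := ⟨p', hx⟩) hp'
  choose f hf1 hf2 using hf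
  have hf1 : ∀ p ∈ 𝒮 d₁, f (ι₁ p) = d₁.ext p := fun p hp => hf1 _ p hp rfl
  have hf2 : ∀ p ∈ 𝒮 d₂, f (ι₂ p) = 𝐫 (d₂.ext p) := fun p hp => hf2 _ p hp rfl
  let U : Set (Glued φ) := {w | (∀ p, ι₁ p = w → p ∈ 𝒮 d₁) ∧
    ∀ p, ι₂ p = w → p ∈ 𝒮 d₂}
  have hU1 : ∀ p, ι₁ p ∈ U ↔ p ∈ 𝒮 d₁ := fun p => by
    refine ⟨fun h => h.1 p rfl, fun h => ⟨fun p' h' => by rwa [incl₁_injective φ h'], fun p' h' => ?_⟩⟩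
    obtain ⟨hx, rfl⟩ := (incl_eq_iff φ p p').1 h'.symm; exact (H.source_iff _).2 h
  have hU2 : ∀ p, ι₂ p ∈ U ↔ p ∈ 𝒮 d₂ := fun p => by
    refine ⟨fun h => h.2 p rfl, fun h => ⟨fun p' h' => ?_, fun p' h' => by rwa [incl₂_injective φ h']⟩⟩
    obtain ⟨hx, rfl⟩ := (incl_eq_iff φ p' p).1 h'; exact (H.source_iff ⟨p', hx⟩).1 h
  have hUc : ∀ w ∈ U, (∃ p ∈ 𝒮 d₁, w = ι₁ p) ∨
      ∃ p ∈ 𝒮 d₂, 0 < (d₂.ext p).2 0 ∧ w = ι₂ p := fun w hw => by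
    obtain ⟨p, rfl⟩ | ⟨p, rfl⟩ := glued_cases φ w
    · exact Or.inl ⟨p, (hU1 p).1 hw, rfl⟩
    · obtain ⟨x, rfl⟩ | hp := hsplit p
      · exact Or.inl ⟨x, (H.source_iff x).1 ((hU2 _).1 hw), (incl₁_bdry φ x).symm⟩
      · have hp2 := (hU2 p).1 hw
        exact Or.inr ⟨p, hp2, (hnn₂ p).lt_of_ne fun h => hp ((d₂.ext_zero hp2).2 h.symm), rfl⟩
  let T : Set 𝕍 := {q | (0 ≤ q.2 0 → q ∈ d₁.ext.target) ∧
    (q.2 0 ≤ 0 → 𝐫 q ∈ d₂.ext.target)}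
  let g : 𝕍 → Glued φ := fun q => if 0 ≤ q.2 0 then ι₁ (d₁.ext.symm q) else ι₂ (d₂.ext.symm (𝐫 q))
  have hg1 : ∀ q, 0 ≤ q.2 0 → g q = ι₁ (d₁.ext.symm q) := fun q hq => if_pos hq
  have hg2 : ∀ q ∈ T, q.2 0 ≤ 0 → g q = ι₂ (d₂.ext.symm (𝐫 q)) := fun q hq h0 => by
    obtain h | h := h0.lt_or_eq
    · exact if_neg (not_le.2 h)
    · have h1 := hq.1 h.ge; have hs := d₁.mem_source h1; have hr := d₁.ext.right_inv h1
      obtain ⟨x, hx⟩ : ∃ x : 𝔅 E1, (x : E1) = d₁.ext.symm q :=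
        ⟨⟨_, (d₁.ext_zero hs).2 (by rw [hr, h])⟩, rfl⟩
      rw [← hx] at hs hr
      rw [hg1 q h.ge, ← hx, HalfCharts.reflL_of_zero h, ← hr, ← H.ext_eq x hs,
        d₂.symm_ext ((H.source_iff x).2 hs), incl₁_bdry]
  have hfT : ∀ w ∈ U, f w ∈ T ∧ g (f w) = w := fun w hw => by
    obtain ⟨p, hp, rfl⟩ | ⟨p, hp, h0, rfl⟩ := hUc w hw
    · rw [hf1 p hp]
      refine ⟨⟨fun _ => d₁.ext_mem hp, fun h => ?_⟩, by rw [hg1 _ (hnn₁ p), d₁.symm_ext hp]⟩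
      have h1 := h.antisymm (hnn₁ p)
      obtain ⟨x, rfl⟩ : ∃ x : 𝔅 E1, (x : E1) = p := ⟨⟨p, (d₁.ext_zero hp).2 h1⟩, rfl⟩
      rw [HalfCharts.reflL_of_zero h1, ← H.ext_eq x hp]; exact d₂.ext_mem ((H.source_iff x).2 hp)
    · have h1 : (𝐫 (d₂.ext p)).2 0 < 0 := by rw [reflL_height]; linarith
      have h2 : 𝐫 (d₂.ext p) ∈ T := ⟨fun h => absurd h1 (not_lt.2 h), fun _ => by
        rw [reflL_reflL]; exact d₂.ext_mem hp⟩
      rw [hf2 p hp, hg2 _ h2 h1.le, reflL_reflL, d₂.symm_ext hp]; exact ⟨h2, rfl⟩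
  have hgU : ∀ q ∈ T, g q ∈ U ∧ f (g q) = q := fun q hq => by
    obtain h | h := le_total 0 (q.2 0)
    · have h1 := d₁.mem_source (hq.1 h); rw [hg1 q h, hf1 _ h1, d₁.ext.right_inv (hq.1 h)]
      exact ⟨(hU1 _).2 h1, rfl⟩
    · have h1 := d₂.mem_source (hq.2 h)
      rw [hg2 q hq h, hf2 _ h1, d₂.ext.right_inv (hq.2 h), reflL_reflL]; exact ⟨(hU2 _).2 h1, rfl⟩
  have hUo : ∀ O : Set 𝕍, IsOpen O → IsOpen (U ∩ f ⁻¹' O) := fun O hO => by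
    refine isOpen_glued ?_ ?_
    · have : ι₁ ⁻¹' (U ∩ f ⁻¹' O) = 𝒮 d₁ ∩ d₁.ext ⁻¹' O := by
        ext p
        exact (and_congr_left' (hU1 p)).trans (and_congr_right fun hp => by
          rw [mem_preimage, hf1 p hp]; rfl)
      rw [this]; exact d₁.total.isOpen_extend_preimage hO
    · have : ι₂ ⁻¹' (U ∩ f ⁻¹' O) = 𝒮 d₂ ∩ d₂.ext ⁻¹' (𝐫 ⁻¹' O) := by
        ext p
        exact (and_congr_left' (hU2 p)).trans (and_congr_right fun hp => by
          rw [mem_preimage, hf2 p hp]; rfl)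
      rw [this]; exact d₂.total.isOpen_extend_preimage (hO.preimage (𝐫).continuous)
  have hUop : IsOpen U := by simpa using hUo univ isOpen_univ
  obtain ⟨O1, hO1, e1⟩ := d₁.exists_open_target; obtain ⟨O2, hO2, e2⟩ := d₂.exists_open_target
  have hh : Continuous fun q : 𝕍 => q.2 0 := (𝐡).continuous
  have hTop : IsOpen T := by
    have : T = ({q | q.2 0 < 0} ∪ O1) ∩ ({q | 0 < q.2 0} ∪ 𝐫 ⁻¹' O2) := by
      ext q; refine and_congr ?_ ?_
      · rw [e1, mem_inter_iff, mem_half, mem_union, mem_ofPred_eq, ← not_le]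
        tauto
      · rw [e2, mem_inter_iff, mem_half, reflL_height, mem_union, mem_ofPred_eq, ← not_le,
          neg_nonneg, mem_preimage]
        tauto
    rw [this]
    exact ((isOpen_lt hh continuous_const).union hO1).inter
      ((isOpen_lt continuous_const hh).union (hO2.preimage (𝐫).continuous))
  have hgc : ContinuousOn g T := by
    have c₁ : ContinuousOn g (T ∩ {q | 0 ≤ q.2 0}) :=
      ((continuous_incl₁ φ).comp_continuousOn (d₁.total.continuousOn_extend_symm.mono
        fun q hq => hq.1.1 hq.2)).congr fun q hq => hg1 q hq.2
    have c₂ : ContinuousOn g (T ∩ {q | q.2 0 ≤ 0}) :=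
      ((continuous_incl₂ φ).comp_continuousOn (d₂.total.continuousOn_extend_symm.comp
        (𝐫).continuous.continuousOn fun q hq => hq.1.2 hq.2)).congr
        fun q hq => hg2 q hq.1 hq.2
    have hcl : ∀ {S : Set 𝕍}, IsClosed S → ContinuousOn g (T ∩ S) →
        ∀ q ∈ T, ContinuousWithinAt g (T ∩ S) q := fun {S} hS hc q hq => by
      by_cases h : q ∈ S
      · exact hc q ⟨hq, h⟩
      · exact continuousWithinAt_of_notMem_closure fun h' =>
          h (hS.closure_subset (closure_mono inter_subset_right h'))
    intro q hq
    refine ((hcl (isClosed_le continuous_const hh) c₁ q hq).union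
      (hcl (isClosed_le hh continuous_const) c₂ q hq)).mono fun q' hq' => ?_
    exact (le_total 0 (q'.2 0)).imp (fun h => ⟨hq', h⟩) fun h => ⟨hq', h⟩
  exact ⟨{  toFun := f
            invFun := g
            source := U
            target := T
            map_source' := fun w hw => (hfT w hw).1
            map_target' := fun q hq => (hgU q hq).1
            left_inv' := fun w hw => (hfT w hw).2
            right_inv' := fun q hq => (hgU q hq).2
            open_source := hUop
            open_target := hTop
            continuousOn_toFun := (continuousOn_open_iff hUop).2 hUo
            continuousOn_invFun := hgc }, H.base, hU1, hU2, hf1, hf2⟩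

end GluedCharts

section Atlas

variable {e e' : OpenPartialHomeomorph (Glued φ) (ModelProd (𝔼 k) (𝔼 n))}
  {d₁ d₁' : FibredChart k (𝓡∂ n) π₁} {d₂ d₂' : FibredChart k (𝓡∂ n) π₂}

lemma FibredChart.height_nonneg (c : HChart πE) (x : E) : 0 ≤ (c.ext x).2 0 :=
  mem_half.1 (c.ext_mem_range x)

lemma FibredChart.contDiffWithinAt_transition (c c' : HChart πE) {p : 𝕍} (hp : p ∈ c.ext.target)
  (hp' : c.ext.symm p ∈ 𝒮 c') : SmoothWithinAt (c'.ext ∘ c.ext.symm) ℛ p := by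
  rw [← contMDiffWithinAt_iff_contDiffWithinAt]
  exact (c'.total.contMDiffAt_extend c'.total_mem hp').comp_contMDiffWithinAt_of_eq
    (smooth_extend_symm c.total_mem hp) rfl

namespace UnionChart

lemma symm₁ (H : UnionChart φ e d₁ d₂) {q : 𝕍} (hq : q ∈ e.target) (h0 : 0 < q.2 0) :
  q ∈ d₁.ext.target ∧ e.symm q = ι₁ (d₁.ext.symm q) := by
  have hs := e.map_target hq; have hr := e.right_inv hq
  obtain ⟨p, hp⟩ | ⟨p, hp⟩ := glued_cases φ (e.symm q)
  · rw [hp] at hs hr; have hs := (H.source₁ p).1 hs; rw [H.ext₁ p hs] at hr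
    rw [hp, ← hr, d₁.symm_ext hs]; exact ⟨d₁.ext_mem hs, rfl⟩
  · rw [hp] at hs hr; have hs := (H.source₂ p).1 hs; rw [H.ext₂ p hs] at hr
    rw [← hr, reflL_height] at h0; linarith [d₂.height_nonneg p]

lemma symm₂ (H : UnionChart φ e d₁ d₂) {q : 𝕍} (hq : q ∈ e.target) (h0 : q.2 0 < 0) :
  𝐫 q ∈ d₂.ext.target ∧ e.symm q = ι₂ (d₂.ext.symm (𝐫 q)) := by
  have hs := e.map_target hq; have hr := e.right_inv hq
  obtain ⟨p, hp⟩ | ⟨p, hp⟩ := glued_cases φ (e.symm q)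
  · rw [hp] at hs hr; have hs := (H.source₁ p).1 hs; rw [H.ext₁ p hs] at hr; rw [← hr] at h0
    linarith [d₁.height_nonneg p]
  · rw [hp] at hs hr; have hs := (H.source₂ p).1 hs; rw [H.ext₂ p hs] at hr
    rw [hp, ← hr, reflL_reflL, d₂.symm_ext hs]; exact ⟨d₂.ext_mem hs, rfl⟩

lemma mem_seam_iff (H : UnionChart φ e d₁ d₂) {w : Glued φ} (hw : w ∈ e.source) : w ∈ seam φ ↔
  (e w).2 0 = 0 := by
  obtain ⟨p, rfl⟩ | ⟨p, rfl⟩ := glued_cases φ w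
  · have hs := (H.source₁ p).1 hw; rw [H.ext₁ p hs, mem_seam_iff₁, d₁.ext_zero hs]
  · have hs := (H.source₂ p).1 hw
    rw [H.ext₂ p hs, mem_seam_iff₂, d₂.ext_zero hs, reflL_height, neg_eq_zero]

end UnionChart

/-- The charts obtained from charts of `E1` and `E2` off the seam, and product charts with respect
to the collar `(R, S)` at the seam. -/
def IsAdapted (R : Glued φ → E1) (S : Glued φ → ℝ) (e : OPHomeo (Glued φ) 𝔐) : Prop :=
  (∃ d₁ d₂, UnionChart φ e d₁ d₂) ∧ ((∀ w ∈ e.source, w ∉ seam φ) ∨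
    ∃ c : HChart π₁, ∀ w ∈ e.source, R w ∈ 𝒮 c ∧ R w ∈ 𝔅 E1 ∧ e w = c.ext (R w) + S w • 𝐮)

variable {R : Glued φ → E1} {S : Glued φ → ℝ}

lemma IsAdapted.contDiffAt (H : IsAdapted R S e) (H' : IsAdapted R S e') {q : 𝕍} (hq : q ∈ e.target)
  (hq' : e.symm q ∈ e'.source) : ContDiffAt ℝ ∞ (E := 𝕍) (F := 𝕍) (fun p => e' (e.symm p)) q := by
  obtain ⟨⟨d₁, d₂, hU⟩, hP⟩ := H; obtain ⟨⟨d₁', d₂', hU'⟩, hP'⟩ := H'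
  have hh : Continuous fun q : 𝕍 => q.2 0 := (𝐡).continuous
  have hev : ∀ᶠ p in 𝓝 q, p ∈ e.target ∧ e.symm p ∈ e'.source :=
    (e.open_target.eventually_mem hq).and ((e.continuousAt_symm hq).eventually
      (e'.open_source.eventually_mem hq'))
  obtain h0 | h0 | h0 := lt_trichotomy (q.2 0) 0
  · have key : ∀ {p : 𝕍}, p ∈ e.target → e.symm p ∈ e'.source → p.2 0 < 0 →
        𝐫 p ∈ d₂.ext.target ∧ d₂.ext.symm (𝐫 p) ∈ 𝒮 d₂' ∧
        e' (e.symm p) = 𝐫 (d₂'.ext (d₂.ext.symm (𝐫 p))) := fun {p} hp hp' h => by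
      obtain ⟨h1, h2⟩ := hU.symm₂ hp h; rw [h2] at hp' ⊢; have h3 := (hU'.source₂ _).1 hp'
      exact ⟨h1, h3, hU'.ext₂ _ h3⟩
    obtain ⟨h1, h2, -⟩ := key hq hq' h0
    have h3 := (d₂.contDiffWithinAt_transition d₂' h1 h2).contDiffAt (mem_of_superset
      ((isOpen_lt continuous_const hh).mem_nhds (show 0 < (𝐫 q).2 0 by
        rw [reflL_height]; linarith)) fun p hp => mem_half.2 (le_of_lt hp))
    refine ((𝐫).contDiff.contDiffAt.comp q
      (h3.comp q (𝐫).contDiff.contDiffAt)).congr_of_eventuallyEq ?_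
    filter_upwards [hev, (isOpen_lt hh continuous_const).mem_nhds h0] with p hp hp0
    exact (key hp.1 hp.2 hp0).2.2
  · have hs : e.symm q ∈ seam φ := (hU.mem_seam_iff (e.map_target hq)).2 (by
      rw [e.right_inv hq]; exact h0)
    obtain ⟨c, hc⟩ := hP.resolve_left fun h => h _ (e.map_target hq) hs
    obtain ⟨c', hc'⟩ := hP'.resolve_left fun h => h _ hq' hs
    have key : ∀ {p : 𝕍}, p ∈ e.target → e.symm p ∈ e'.source →
        𝐟 p ∈ c.ext.target ∧ c.ext.symm (𝐟 p) ∈ 𝒮 c' ∧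
        e' (e.symm p) = c'.ext (c.ext.symm (𝐟 p)) + p.2 0 • 𝐮 := fun {p} hp hp' => by
      obtain ⟨h1, h2, h3⟩ := hc _ (e.map_target hp); obtain ⟨h1', -, h3'⟩ := hc' _ hp'
      rw [e.right_inv hp] at h3; have h4 := (c.ext_zero h1).1 h2
      have h5 : p.2 0 = S (e.symm p) := by
        refine (congrArg 𝐡 h3).trans ?_; rw [map_add, map_smul, heightL_apply, h4, heightL_apply]
        simp [e₀]
      have h6 : 𝐟 p = c.ext (R (e.symm p)) := by rw [flatL_apply, h5]; exact sub_eq_of_eq_add h3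
      rw [h6, c.symm_ext h1, h3', h5]; exact ⟨c.ext_mem h1, h1', rfl⟩
    obtain ⟨h1, h2, -⟩ := key hq hq'
    have h3 : ContDiffAt ℝ ∞ (fun p => c'.ext (c.ext.symm (𝐟 p))) q := by
      rw [← contDiffWithinAt_univ]
      exact (c.contDiffWithinAt_transition c' h1 h2).comp q (𝐟).contDiff.contDiffAt.contDiffWithinAt
        fun p _ => mem_half.2 (flatL_height p).ge
    refine (h3.add ((𝐡).contDiff.contDiffAt.smul (contDiffAt_const (c := 𝐮)))).congr_of_eventuallyEq ?_
    filter_upwards [hev] with p hp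
    exact (key hp.1 hp.2).2.2
  · have key : ∀ {p : 𝕍}, p ∈ e.target → e.symm p ∈ e'.source → 0 < p.2 0 →
        p ∈ d₁.ext.target ∧ d₁.ext.symm p ∈ 𝒮 d₁' ∧
        e' (e.symm p) = d₁'.ext (d₁.ext.symm p) := fun {p} hp hp' h => by
      obtain ⟨h1, h2⟩ := hU.symm₁ hp h; rw [h2] at hp' ⊢; have h3 := (hU'.source₁ _).1 hp'
      exact ⟨h1, h3, hU'.ext₁ _ h3⟩
    obtain ⟨h1, h2, -⟩ := key hq hq' h0
    have h3 := (d₁.contDiffWithinAt_transition d₁' h1 h2).contDiffAt (mem_of_superset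
      ((isOpen_lt continuous_const hh).mem_nhds h0) fun p hp => mem_half.2 (le_of_lt hp))
    refine h3.congr_of_eventuallyEq ?_
    filter_upwards [hev, (isOpen_lt continuous_const hh).mem_nhds h0] with p hp hp0
    exact (key hp.1 hp.2 hp0).2.2

section Cover

lemma exists_empty_chart [Nonempty E] {b : OPHomeo B (𝔼 k)} (hb : b ∈ maximalAtlas (𝓡 k) ∞ B) : ∃
  c : HChart πE, 𝒮 c = ∅ ∧ c.base = b := by
  obtain ⟨c, h1, h2, -⟩ : ∃ c : HChart πE, 𝒮 c = ∅ ∧ c.base = b ∧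
      ∀ x ∈ (∅ : Set E), c.ext x = (fun _ => 0) x := by
    refine exists_fibredChart (N := fun _ => Classical.arbitrary E) (T := ∅) isOpen_empty isOpen_empty
      hb ?_ ?_ ?_ ?_ ?_ <;> simp
  exact ⟨c, h1, h2⟩

lemma CollarMap.ext_bdry {β : 𝔅 E1 ≃ 𝔅 E} {ρ : E → E1} {t : E → ℝ} {V : Set E}
  (H : CollarMap π₁ πE β ρ t V) {c : HChart π₁} {d : HChart πE} (hd : ∀ y ∈ 𝒮 d, y ∈ V ∧ ρ y ∈ 𝒮 c ∧
  d.ext y = c.ext (ρ y) + t y • 𝐮) {x : 𝔅 E1} (hx : (β x : E) ∈ 𝒮 d) : (x : E1) ∈ 𝒮 c ∧ d.ext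
  (β x) = c.ext x := by
  obtain ⟨-, h1, h2⟩ := hd _ hx; rw [H.bdry] at h1 h2
  rw [H.zero _ (β x).2, zero_smul, add_zero] at h2; exact ⟨h1, h2⟩

lemma CollarMap.mem_source {β : 𝔅 E1 ≃ 𝔅 E} {ρ : E → E1} {t : E → ℝ} {V : Set E}
  (H : CollarMap π₁ πE β ρ t V) {c : HChart π₁} {d : HChart πE} (hd : ∀ y ∈ 𝒮 d, y ∈ V ∧ ρ y ∈ 𝒮 c ∧
  d.ext y = c.ext (ρ y) + t y • 𝐮) {x : 𝔅 E1} (hx : (x : E1) ∈ 𝒮 c) (hxd : c.ext x ∈ d.ext.target) :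
  (β x : E) ∈ 𝒮 d := by
  have hs := d.mem_source hxd; have hr := d.ext.right_inv hxd
  obtain ⟨y, hy⟩ : ∃ y, (β y : E) = d.ext.symm (c.ext x) := by
    refine ⟨β.symm ⟨_, (d.ext_zero hs).2 ?_⟩, by rw [β.apply_symm_apply]⟩
    rw [hr, (c.ext_zero hx).1 x.2]
  rw [← hy] at hs hr; obtain ⟨h1, h2⟩ := H.ext_bdry hd hs; rw [h2] at hr
  have h3 : y = x := Subtype.ext (by rw [← c.symm_ext h1, hr, c.symm_ext hx])
  rwa [← h3]

variable {ρ1 : E1 → E1} {t1 : E1 → ℝ} {V1 : Set E1} {ρ2 : E2 → E1} {t2 : E2 → ℝ} {V2 : Set E2}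

lemma exists_adapted [Nonempty E1] [Nonempty E2] (hc1 : HasCharts k n π₁) (hc2 : HasCharts k n π₂)
  (H1 : CollarMap π₁ π₁ (Equiv.refl (𝔅 E1)) ρ1 t1 V1) (H2 : CollarMap π₁ π₂ φ.toEquiv ρ2 t2 V2)
  (hR1 : ∀ p, R (ι₁ p) = ρ1 p) (hR2 : ∀ p, R (ι₂ p) = ρ2 p) (hS1 : ∀ p, S (ι₁ p) = t1 p)
  (hS2 : ∀ p, S (ι₂ p) = -t2 p) (w : Glued φ) : ∃ e, IsAdapted R S e ∧ w ∈ e.source := by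
  by_cases hw : w ∈ seam φ
  · obtain ⟨x, hx, rfl⟩ := hw; obtain ⟨c, hxc⟩ := hc1 x
    obtain ⟨d₁, hx1, hb1, hd1⟩ := H1.exists_chart (fun y => ⟨id, contMDiffAt_id, by simp⟩) c
      (x := ⟨x, hx⟩) hxc
    obtain ⟨d₂, hx2, hb2, hd2⟩ := H2.exists_chart φ.smooth c (x := ⟨x, hx⟩) hxc
    obtain ⟨O1, hO1, e₁⟩ := d₁.exists_open_target; obtain ⟨O2, hO2, e₂⟩ := d₂.exists_open_target
    have hU1 : IsOpen (𝒮 d₁ ∩ d₁.ext ⁻¹' (𝐫 ⁻¹' O2)) :=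
      d₁.total.isOpen_extend_preimage (hO2.preimage (𝐫).continuous)
    have hU2 : IsOpen (𝒮 d₂ ∩ d₂.ext ⁻¹' (𝐫 ⁻¹' O1)) :=
      d₂.total.isOpen_extend_preimage (hO1.preimage (𝐫).continuous)
    have hs1 : (d₁.restrict hU1).total.source = 𝒮 d₁ ∩ d₁.ext ⁻¹' (𝐫 ⁻¹' O2) := by
      rw [d₁.restrict_source]; exact inter_eq_right.2 inter_subset_left
    have hs2 : (d₂.restrict hU2).total.source = 𝒮 d₂ ∩ d₂.ext ⁻¹' (𝐫 ⁻¹' O1) := by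
      rw [d₂.restrict_source]; exact inter_eq_right.2 inter_subset_left
    have hz : ∀ {y : 𝔅 E1}, (y : E1) ∈ 𝒮 c → c.ext y ∈ ℛ ∧ 𝐫 (c.ext y) = c.ext y := fun {y} hy =>
      ⟨c.ext_mem_range _, HalfCharts.reflL_of_zero ((c.ext_zero hy).1 y.2)⟩
    have hm1 : ∀ y : 𝔅 E1, (y : E1) ∈ (d₁.restrict hU1).total.source ↔
        (y : E1) ∈ 𝒮 c ∧ c.ext y ∈ O1 ∧ c.ext y ∈ O2 := fun y => by
      rw [hs1]
      constructor
      · rintro ⟨h1, h2⟩; obtain ⟨h3, h4⟩ := H1.ext_bdry hd1 (x := y) h1; have h5 := d₁.ext_mem h1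
        rw [Equiv.refl_apply] at h4; rw [mem_preimage, mem_preimage, h4, (hz h3).2] at h2
        rw [h4, e₁] at h5; exact ⟨h3, h5.1, h2⟩
      · rintro ⟨h1, h2, h3⟩
        have h4 : (y : E1) ∈ 𝒮 d₁ := H1.mem_source hd1 h1 (by rw [e₁]; exact ⟨h2, (hz h1).1⟩)
        have h5 : d₁.ext y = c.ext y := (H1.ext_bdry hd1 (x := y) h4).2
        exact ⟨h4, by rwa [mem_preimage, mem_preimage, h5, (hz h1).2]⟩
    have hm2 : ∀ y : 𝔅 E1, (φ.toEquiv y : E2) ∈ (d₂.restrict hU2).total.source ↔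
        (y : E1) ∈ 𝒮 c ∧ c.ext y ∈ O1 ∧ c.ext y ∈ O2 := fun y => by
      rw [hs2]
      constructor
      · rintro ⟨h1, h2⟩; obtain ⟨h3, h4⟩ := H2.ext_bdry hd2 h1; have h5 := d₂.ext_mem h1
        rw [mem_preimage, mem_preimage, h4, (hz h3).2] at h2; rw [h4, e₂] at h5
        exact ⟨h3, h2, h5.1⟩
      · rintro ⟨h1, h2, h3⟩; have h4 := H2.mem_source hd2 h1 (by rw [e₂]; exact ⟨h3, (hz h1).1⟩)
        exact ⟨h4, by rwa [mem_preimage, mem_preimage, (H2.ext_bdry hd2 h4).2, (hz h1).2]⟩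
    have hM : MatchingPair φ (d₁.restrict hU1) (d₂.restrict hU2) := by
      refine ⟨hb2.trans hb1.symm, fun y => (hm2 y).trans (hm1 y).symm, fun y hy => ?_⟩
      have h1 := (hm2 y).2 ((hm1 y).1 hy); rw [hs1] at hy; rw [hs2] at h1
      exact (H2.ext_bdry hd2 h1.1).2.trans (H1.ext_bdry hd1 (x := y) hy.1).2.symm
    obtain ⟨e, he⟩ := hM.exists_chart; refine ⟨e, ⟨⟨_, _, he⟩, Or.inr ⟨c, fun w hw => ?_⟩⟩, ?_⟩
    · obtain ⟨p, rfl⟩ | ⟨p, rfl⟩ := glued_cases φ w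
      · have hp := (he.source₁ p).1 hw; rw [he.ext₁ p hp, hR1, hS1]; rw [hs1] at hp
        obtain ⟨h1, h2, h3⟩ := hd1 p hp.1; exact ⟨h2, H1.mem p h1, h3⟩
      · have hp := (he.source₂ p).1 hw; rw [he.ext₂ p hp, hR2, hS2]; rw [hs2] at hp
        obtain ⟨h1, h2, h3⟩ := hd2 p hp.1; refine ⟨h2, H2.mem p h1, ?_⟩
        have h4 := (c.ext_zero h2).1 (H2.mem p h1)
        have h5 : (d₂.restrict hU2).ext p = c.ext (ρ2 p) + t2 p • 𝐮 := h3
        have h6 : 𝐫 𝐮 = -𝐮 := by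
          have : (𝐮).2 0 = 1 := by simp [e₀]
          rw [reflL_apply, this]; module
        rw [h5, map_add, map_smul, HalfCharts.reflL_of_zero h4, h6, neg_smul, smul_neg]
    · rw [he.source₁]; refine (hm1 ⟨x, hx⟩).2 ⟨hxc, ?_, ?_⟩
      · have := d₁.ext_mem hx1; rw [(H1.ext_bdry hd1 hx1).2, e₁] at this; exact this.1
      · have := d₂.ext_mem hx2; rw [(H2.ext_bdry hd2 hx2).2, e₂] at this; exact this.1
  · obtain ⟨p, rfl⟩ | ⟨p, rfl⟩ := glued_cases φ w
    · obtain ⟨c, hc⟩ := hc1 p; have ho : IsOpen (𝔅 E1)ᶜ := isClosed_bdry.isOpen_compl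
      obtain ⟨d, hd, hdb⟩ := exists_empty_chart (n := n) (πE := π₂) c.base_mem
      have hs : ∀ x : 𝔅 E1, (x : E1) ∉ (c.restrict ho).total.source := fun x hx => by
        rw [c.restrict_source] at hx; exact hx.2 x.2
      have hM : MatchingPair φ (c.restrict ho) d :=
        ⟨hdb, fun x => by simp [hs x, hd], fun x hx => absurd hx (hs x)⟩
      obtain ⟨e, he⟩ := hM.exists_chart; refine ⟨e, ⟨⟨_, _, he⟩, Or.inl ?_⟩, ?_⟩
      · rintro _ hx ⟨x, hxb, rfl⟩; exact hs ⟨x, hxb⟩ ((he.source₁ x).1 hx)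
      · rw [he.source₁, c.restrict_source]; exact ⟨hc, fun h => hw ((mem_seam_iff₁ φ p).2 h)⟩
    · obtain ⟨c, hc⟩ := hc2 p; have ho : IsOpen (𝔅 E2)ᶜ := isClosed_bdry.isOpen_compl
      obtain ⟨d, hd, hdb⟩ := exists_empty_chart (n := n) (πE := π₁) c.base_mem
      have hs : ∀ x : 𝔅 E1, (φ.toEquiv x : E2) ∉ (c.restrict ho).total.source := fun x hx => by
        rw [c.restrict_source] at hx; exact hx.2 (φ.toEquiv x).2
      have hM : MatchingPair φ d (c.restrict ho) :=
        ⟨hdb.symm, fun x => by simp [hs x, hd], fun x hx => by simp [hd] at hx⟩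
      obtain ⟨e, he⟩ := hM.exists_chart; refine ⟨e, ⟨⟨_, _, he⟩, Or.inl ?_⟩, ?_⟩
      · rintro _ hx ⟨x, hxb, rfl⟩; have := (he.source₁ x).1 hx; rw [hd] at this; exact this
      · rw [he.source₂, c.restrict_source]; exact ⟨hc, fun h => hw ((mem_seam_iff₂ φ p).2 h)⟩

end Cover

end Atlas

lemma UnionChart.exists_isHalfCharts [ChartedSpace 𝔐 (Glued φ)] {e : OPHomeo (Glued φ) 𝔐}
  {d₁ : HChart π₁} {d₂ : HChart π₂} (H : UnionChart φ e d₁ d₂) (he : e ∈ maximalAtlas 𝓕 ∞ (Glued φ))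
  : ∃ c : FChart (gluedProj φ), c.total = e ∧ HalfCharts φ c d₁ d₂ := by
  have hfst : ∀ w ∈ e.source, gluedProj φ w ∈ d₁.base.source ∧
      (e w).1 = d₁.base (gluedProj φ w) := fun w hw => by
    obtain ⟨p, rfl⟩ | ⟨p, rfl⟩ := glued_cases φ w
    · have hp := (H.source₁ p).1 hw; rw [H.ext₁ p hp]; exact ⟨d₁.proj_mem p hp, d₁.fst_eq p hp⟩
    · have hp := (H.source₂ p).1 hw; rw [H.ext₂ p hp, reflL_fst, ← H.base]
      exact ⟨d₂.proj_mem p hp, d₂.fst_eq p hp⟩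
  refine ⟨⟨e, d₁.base, he, d₁.base_mem, fun w hw => (hfst w hw).1, fun w hw => (hfst w hw).2⟩, rfl,
    ⟨fun w hw => ⟨?_, fun h => ?_⟩, fun w hw => ⟨?_, fun h => ?_⟩⟩,
    ext fun p => (H.source₁ p).symm, ext fun p => (H.source₂ p).symm,
    fun p hp => (H.ext₁ p hp).symm, fun p hp => ?_⟩
  · rintro ⟨p, rfl⟩; change 0 ≤ (e (ι₁ p)).2 0; rw [H.ext₁ p ((H.source₁ p).1 hw)]
    exact d₁.height_nonneg p
  · change 0 ≤ (e w).2 0 at h; obtain ⟨p, rfl⟩ | ⟨p, rfl⟩ := glued_cases φ w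
    · exact mem_range_self p
    · have hp := (H.source₂ p).1 hw; rw [H.ext₂ p hp, reflL_height] at h
      have h1 : ι₂ p ∈ seam φ := (mem_seam_iff₂ φ p).2
        ((d₂.ext_zero hp).2 (by linarith [d₂.height_nonneg p]))
      rw [seam_eq_inter] at h1; exact h1.1
  · rintro ⟨p, rfl⟩; change (e (ι₂ p)).2 0 ≤ 0; rw [H.ext₂ p ((H.source₂ p).1 hw), reflL_height]
    exact neg_nonpos.2 (d₂.height_nonneg p)
  · change (e w).2 0 ≤ 0 at h; obtain ⟨p, rfl⟩ | ⟨p, rfl⟩ := glued_cases φ w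
    · have hp := (H.source₁ p).1 hw; rw [H.ext₁ p hp] at h
      have h1 : ι₁ p ∈ seam φ := (mem_seam_iff₁ φ p).2
        ((d₁.ext_zero hp).2 (h.antisymm (d₁.height_nonneg p)))
      rw [seam_eq_inter] at h1; exact h1.2
    · exact mem_range_self p
  · change _ = 𝐫 (e (ι₂ p)); rw [H.ext₂ p hp, reflL_reflL]

lemma isCompatible_of_unionCharts [ChartedSpace 𝔐 (Glued φ)] [IsManifold 𝓕 ∞ (Glued φ)]
  (h : ∀ w : Glued φ, ∃ e ∈ maximalAtlas 𝓕 ∞ (Glued φ), w ∈ e.source ∧ ∃ d₁ d₂,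
  UnionChart φ e d₁ d₂) : IsCompatible φ := by
  have h : ∀ w : Glued φ, ∃ (c : FChart (gluedProj φ)) (d₁ : HChart π₁)
      (d₂ : HChart π₂), w ∈ 𝒮 c ∧ HalfCharts φ c d₁ d₂ := fun w => by
    obtain ⟨e, he, hw, d₁, d₂, H⟩ := h w; obtain ⟨c, rfl, hc⟩ := H.exists_isHalfCharts he
    exact ⟨c, d₁, d₂, hw, hc⟩
  have h₁ : ContMDiff 𝓗 𝓕 ∞ ι₁ := fun p => by
    obtain ⟨c, d₁, d₂, hw, H⟩ := h (ι₁ p); have hp := H.mem₁.2 hw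
    have h2 := (c.contMDiffOn_ext_symm).contMDiffAt (c.isOpen_target.mem_nhds (c.ext_mem hw))
    refine (h2.comp_of_eq (d₁.total.contMDiffAt_extend d₁.total_mem hp)
      (H.ext₁ p hp)).congr_of_eventuallyEq ?_
    filter_upwards [d₁.total.open_source.mem_nhds hp] with y hy
    exact ((congrArg c.ext.symm (H.ext₁ y hy)).trans (c.symm_ext (H.mem₁.1 hy))).symm
  have h₂ : ContMDiff 𝓗 𝓕 ∞ ι₂ := fun p => by
    obtain ⟨c, d₁, d₂, hw, H⟩ := h (ι₂ p); have hp := H.mem₂.2 hw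
    have e2 : ∀ y ∈ 𝒮 d₂, 𝐫 (d₂.ext y) = c.ext (ι₂ y) := fun y hy => by
      rw [H.ext₂ y hy, reflL_reflL]
    have h2 := (c.contMDiffOn_ext_symm).contMDiffAt (c.isOpen_target.mem_nhds (c.ext_mem hw))
    refine (h2.comp_of_eq ((𝐫).contMDiff.contMDiffAt.comp p
      (d₂.total.contMDiffAt_extend d₂.total_mem hp)) (e2 p hp)).congr_of_eventuallyEq ?_
    filter_upwards [d₂.total.open_source.mem_nhds hp] with y hy
    exact ((congrArg c.ext.symm (e2 y hy)).trans (c.symm_ext (H.mem₂.1 hy))).symm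
  refine ⟨h₁, h₂, fun p => ?_, fun p => ?_, fun w => ?_, fun w => ?_⟩
  · obtain ⟨c, d₁, d₂, hw, H⟩ := h (ι₁ p)
    rw [← bijective_transit d₁ c (H.mem₁.2 hw) hw (h₁ p), H.fderiv_transit₁ (H.mem₁.2 hw)]
    exact Function.bijective_id
  · obtain ⟨c, d₁, d₂, hw, H⟩ := h (ι₂ p)
    rw [← bijective_transit d₂ c (H.mem₂.2 hw) hw (h₂ p), H.fderiv_transit₂ (H.mem₂.2 hw)]
    exact Function.Involutive.bijective reflL_reflL
  · obtain ⟨c, -, -, hw, -⟩ := h w; exact c.contMDiffAt_proj hw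
  · obtain ⟨c, -, -, hw, -⟩ := h w; exact ⟨c, hw⟩

lemma exists_isCompatible [Nonempty E1] [Nonempty E2] (hc1 : HasCharts k n π₁)
  (hc2 : HasCharts k n π₂) : ∃ _ : ChartedSpace 𝔐 (Glued φ), IsManifold 𝓕 ∞ (Glued φ) ∧
  IsCompatible φ := by
  obtain ⟨ρ1, t1, V1, H1⟩ := exists_collarMap (π₁ := π₁) (β := Equiv.refl (𝔅 E1)) hc1
    (fun y => ⟨id, contMDiffAt_id, by simp⟩) fun _ => rfl
  obtain ⟨ρ2, t2, V2, H2⟩ := exists_collarMap hc2 φ.smooth_symm φ.proj_eq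
  let R : Glued φ → E1 := Quot.lift (Sum.elim ρ1 ρ2) (by
    rintro _ _ ⟨x⟩; exact (H1.bdry x).trans (H2.bdry x).symm)
  let S : Glued φ → ℝ := Quot.lift (Sum.elim t1 (-t2)) (by
    rintro _ _ ⟨x⟩; exact (H1.zero x x.2).trans (by simp [H2.zero _ (φ.toEquiv x).2]))
  have key := exists_adapted (R := R) (S := S) hc1 hc2 H1 H2 (fun _ => rfl) (fun _ => rfl)
    (fun _ => rfl) fun _ => rfl
  let C : ChartedSpace 𝔐 (Glued φ) :=
    { atlas := {e | IsAdapted R S e}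
      chartAt := fun w => (key w).choose
      mem_chart_source := fun w => (key w).choose_spec.2
      chart_mem_atlas := fun w => (key w).choose_spec.1 }
  have hM : IsManifold 𝓕 ∞ (Glued φ) := by
    refine isManifold_of_contDiffOn _ _ _ fun e e' he he' q hq => ?_
    exact (IsAdapted.contDiffAt he he' hq.1.1 hq.1.2).contDiffWithinAt
  refine ⟨C, hM, isCompatible_of_unionCharts fun w => ?_⟩
  obtain ⟨e, he, hw⟩ := key w; exact ⟨e, IsManifold.subset_maximalAtlas he, hw, he.1⟩

end FibreGluing

end

open FibreGluing

theorem theorem2p4 {k n : ℕ} [NeZero n]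
    {B E₁ E₂ M₁ M₂ : Type*}
    -- the base
    [TopologicalSpace B] [T2Space B] [CompactSpace B]
    [ChartedSpace (EuclideanSpace ℝ (Fin k)) B] [IsManifold (𝓡 k) ∞ B]
    -- the fibres
    [TopologicalSpace M₁] [ChartedSpace (EuclideanHalfSpace n) M₁] [IsManifold (𝓡∂ n) ∞ M₁]
    [TopologicalSpace M₂] [ChartedSpace (EuclideanHalfSpace n) M₂] [IsManifold (𝓡∂ n) ∞ M₂]
    -- the total spaces
    [TopologicalSpace E₁] [T2Space E₁] [CompactSpace E₁]
    [ChartedSpace (ModelProd (EuclideanSpace ℝ (Fin k)) (EuclideanHalfSpace n)) E₁]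
    [IsManifold ((𝓡 k).prod (𝓡∂ n)) ∞ E₁]
    [TopologicalSpace E₂] [T2Space E₂] [CompactSpace E₂]
    [ChartedSpace (ModelProd (EuclideanSpace ℝ (Fin k)) (EuclideanHalfSpace n)) E₂]
    [IsManifold ((𝓡 k).prod (𝓡∂ n)) ∞ E₂]
    -- the bundles
    (π₁ : E₁ → B) (π₂ : E₂ → B)
    (hπ₁ : IsSmoothFibreBundle k (𝓡∂ n) π₁ M₁) (hπ₂ : IsSmoothFibreBundle k (𝓡∂ n) π₂ M₂)
    (hM₁ : ((𝓡∂ n).boundary M₁).Nonempty) (hM₂ : ((𝓡∂ n).boundary M₂).Nonempty)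
    -- the fibrewise metrics
    (h₁ : FibreForm k (𝓡∂ n) π₁) (hh₁ : IsFibreMetric h₁) (hric₁ : RicciPositive h₁)
    (h₂ : FibreForm k (𝓡∂ n) π₂) (hh₂ : IsFibreMetric h₂) (hric₂ : RicciPositive h₂)
    -- the gluing map
    (φ : FibrewiseBdryDiffeo (k := k) (n := n) π₁ π₂) (hφ : IsFibrewiseIsometry φ h₁ h₂)
    (hcurv : NormalCurvatureCondition φ h₁ h₂) :
    (∃ (_ : ChartedSpace (ModelProd (EuclideanSpace ℝ (Fin k)) (EuclideanSpace ℝ (Fin n)))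
        (Glued φ)), IsManifold ((𝓡 k).prod (𝓡 n)) ∞ (Glued φ) ∧ IsCompatible φ) ∧
    ∀ [ChartedSpace (ModelProd (EuclideanSpace ℝ (Fin k)) (EuclideanSpace ℝ (Fin n))) (Glued φ)]
      [IsManifold ((𝓡 k).prod (𝓡 n)) ∞ (Glued φ)], IsCompatible φ →
      ∀ N : Set (Glued φ), IsOpen N → seam φ ⊆ N →
        ∃ g : FibreForm k (𝓡 n) (gluedProj φ),
          IsFibreMetric g ∧ RicciPositive g ∧ AgreesOutside φ g h₁ h₂ N := by
  have hc₁ := hπ₁.exists_fibredChart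
  have hc₂ := hπ₂.exists_fibredChart
  obtain hB | hB := isEmpty_or_nonempty B
  · have hE : ∀ w : Glued φ, False := fun w => hB.elim (gluedProj φ w)
    let C : ChartedSpace (ModelProd (EuclideanSpace ℝ (Fin k)) (EuclideanSpace ℝ (Fin n)))
        (Glued φ) :=
      { atlas := ∅
        chartAt := fun w => (hE w).elim
        mem_chart_source := fun w => (hE w).elim
        chart_mem_atlas := fun w => (hE w).elim }
    refine ⟨⟨C, ?_, ?_⟩, ?_⟩
    · exact isManifold_of_contDiffOn _ _ _ fun e _ he => absurd he (Set.notMem_empty e)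
    · exact ⟨fun x => (hE (incl₁ φ x)).elim, fun x => (hE (incl₂ φ x)).elim,
        fun x => (hE (incl₁ φ x)).elim, fun x => (hE (incl₂ φ x)).elim, fun w => (hE w).elim,
        fun w => (hE w).elim⟩
    · intro _ _ _ N _ _
      refine ⟨0, ⟨fun w => (hE w).elim, fun w => (hE w).elim,
        fun c i j p => (hE (c.ext.symm p)).elim⟩, fun c w => (hE w).elim,
        fun x => (hE (incl₁ φ x)).elim, fun x => (hE (incl₂ φ x)).elim⟩
  · have : Nonempty M₁ := hM₁.to_type
    have : Nonempty M₂ := hM₂.to_type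
    have : Nonempty E₁ := hπ₁.surjective.nonempty
    have : Nonempty E₂ := hπ₂.surjective.nonempty
    exact ⟨exists_isCompatible hc₁ hc₂, fun hW N hN hNs =>
      exists_glued_metric hW hc₁ hc₂ hh₁ hric₁ hh₂ hric₂ hφ hcurv hN hNs⟩
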